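/- **The game.** Let $N\ge 1$. The $N$-bit Two Counters game has, for each player $\alpha\in\{\text{Even},\text{Odd}\}$ (opponent $\overline\alpha$) and each bit $k\in\{0,\dots,N-1\}$ (bit $0$ is the highest), the vertices $l_\alpha(k),h_\alpha(k),t_\alpha(k),z_\alpha(k)$ and, for each $i<k$, the vertices $s_\alpha(k,i),a_\alpha(k,i),b_\alpha(k,i)$; put $s_\alpha(k,k):=z_\alpha(k)$. The vertices $z$ and $s$ with index $\alpha$ belong to $\alpha$, all others with index $\alpha$ to $\overline\alpha$. The edges are $l_\alpha(k)\to t_\alpha(k)$; $t_\alpha(k)\to h_\alpha(k)$ and $t_\alpha(k)\to s_\alpha(k,0)$; $h_\alpha(k)\to l_\alpha(k-1)$ for $k>0$ and $h_\alpha(0)\to l_\alpha(N-1)$; $s_\alpha(k,i)\to a_\alpha(k,i)$ and $s_\alpha(k,i)\to b_\alpha(k,i)$ for $i<k$; $a_\alpha(k,i)\to s_\alpha(k,i+1)$ and $a_\alpha(k,i)\to l_\alpha(i)$; $b_\alpha(k,i)\to s_\alpha(k,i+1)$ and $b_\alpha(k,i)\to l_{\overline\alpha}(i)$; $z_\alpha(k)\to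 t_\alpha(k)$; $z_{\text{Even}}(k)\to l_{\text{Odd}}(j)$ for $j>k$; and $z_{\text{Odd}}(k)\to l_{\text{Even}}(j)$ for $j\ge k$. The priorities are $2(N-1-k)+3$ for $l_{\text{Even}}(k)$, $2(N-1-k)+4$ for $l_{\text{Odd}}(k)$, $2N+2(N-1-k)+4$ for $h_{\text{Even}}(k)$, $2N+2(N-1-k)+5$ for $h_{\text{Odd}}(k)$, $2$ for $t_{\text{Even}}(k)$, $1$ for $t_{\text{Odd}}(k)$, $1$ for the $z,s,a,b$ vertices of Even's counter and $0$ for those of Odd's counter. **The algorithms.** Priority promotion repeatedly searches for a dominion. A search starts with no regions. Going down through the priorities $p$, with $\alpha$ the player of $p$'s parity, it considers the subgame of all vertices that are not in a region above $p$ and computes the $\alpha$-attractor $Z$ in this subgame of the vertices of priority $p$ together with the recorded region of $p$. If $Z$ is open in the subgame (some $\alpha$-vertex of $Z$ has no successor in $Z$, or some $\overline\alpha$-vertex of $Z$ has a successor in the subgame outside $Z$), then $Z$ is recorded as region $p$ and the search goes on with the next lower priority. Otherwise, if $\overline\alpha$ can leave $Z$ only to higher regions, $Z$ is promoted to (merged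 with) the lowest such region $q$, lower regions are reset, and the search goes on from $q$. Otherwise $\overline\alpha$ cannot leave $Z$; then the $\alpha$-attractor of $Z$ is removed from the game as won by $\alpha$. The variants differ in what a promotion resets. PP resets all lower regions. PP+ resets the lower regions of the opponent. RR (region recovery) resets a lower region only when the search gets to it again and the attractor strategy recorded for some vertex that is still in the region now leaves to a higher region or to the solved part. DP is PP+, and RRDP is RR, with delayed promotions: a promotion to $q$ is delayed when the opponent has a region below $q$ that is the result of a promotion and is on record; a delayed promotion is performed only in a copy of the decomposition, and when no normal promotion is available, the delayed promotions of the player who wins the highest delayed promotion are applied, the others are discarded, and the record is emptied. After a dominion has been removed, the next search may start afresh or may keep the recorded regions of the remaining vertices, where the removal is then treated like a promotion above all regions. The choice among the possible attractor strategies is arbitrary. **The progression.** Bit $k$ of $\alpha$ is *set* if $l_\alpha(k)$ lies in a region of $\alpha$ that is the result of a promotion (and has not been reset since), or is already won by $\alpha$. The binary progression $s_0,\dots,s_M$, $M=2(2^N-1)$, is the following sequence of states of the two counters: in $s_{2j}$ both counters show the binary representation of $j$; if $k$ is the bit that is $0$ in $j$ and $1$ in $j+1$, then $s_{2j+1}$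 arises from $s_{2j}$ by setting bit $k$ of Even and resetting all bits of Odd lower than $k$, and $s_{2j+2}$ arises from $s_{2j+1}$ by setting bit $k$ of Odd and resetting all bits of Even lower than $k$. **Lemma.** Each of PP, PP+, RR, DP and RRDP, with either way to start the next search, follows this progression when it solves the $N$-bit Two Counters game: it has a run, and every run (that is, for every choice of attractor strategies) ends with all vertices solved, and the sequence of states of the counters, taken before each promotion and at the end, splits into consecutive blocks $B_0,\dots,B_M$ such that for every $i$ the last state of $B_i$ is $s_i$, and every state in $B_i$ contains only bits of $s_i$ and contains all bits of $s_i$ that are not in $s_{i-1}$ (so a higher bit resets the lower bits of the opponent and is set only when the counters have reached the state $s_{i-1}$; all other promotions only recover bits of $s_i$). For RR and RRDP each block consists of $s_i$ only, except possibly $B_{M-1}$ if the second search starts afresh. In particular at least $2(2^N-1)$ promotions are performed, and exactly $2(2^N-1)$ by RR and RRDP if the regions are kept. -/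

import Mathlib

/-! ### Parity games and attractors -/

/-- The two players of a parity game. -/
inductive Player
  | even
  | odd
  deriving DecidableEq

namespace Player

instance : Fintype Player := ⟨{even, odd}, fun α => by cases α <;> simp⟩

/-- The opponent of a player. -/
def opp : Player → Player
  | even => odd
  | odd => even

/-- The player that wins a given priority. -/
def ofPriority (p : ℕ) : Player := if p % 2 = 0 then even else odd

end Player

/-- A parity game with vertex set `V`: every vertex has an owner, a priority and at least one
successor. -/
structure ParityGame (V : Type) where
  owner : V → Player
  succ : V → Finset V
  pr : V → ℕ
  total : ∀ v, (succ v).Nonempty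

/-- Least fixpoint: `Attracted G S α A v` says that player `α` attracts `v` to `A` in the game `G`
restricted to the vertices in `S`. -/
inductive Attracted {V : Type} (G : ParityGame V) (S : Finset V) (α : Player) (A : Finset V) :
    V → Prop
  | base {v : V} : v ∈ A → Attracted G S α A v
  | own {v w : V} : v ∈ S → G.owner v = α → w ∈ G.succ v → Attracted G S α A w →
      Attracted G S α A v
  | opp {v : V} : v ∈ S → G.owner v ≠ α → (∀ w ∈ G.succ v, w ∈ S → Attracted G S α A w) →
      Attracted G S α A v

open Classical in
/-- The attractor of `A` for player `α` in the subgame `S`. -/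
noncomputable def attr {V : Type} [Fintype V] (G : ParityGame V) (S : Finset V) (α : Player)
    (A : Finset V) : Finset V :=
  Finset.univ.filter fun v => Attracted G S α A v

/-! ### Priority promotion -/

/-- The variants of priority promotion: the original algorithm, PP+, region recovery, delayed
promotion (on top of PP+), and delayed promotion on top of region recovery. -/
inductive Variant
  | pp
  | ppPlus
  | rr
  | dp
  | rrdp
  deriving DecidableEq

namespace Variant

/-- The variants that recover lower regions instead of resetting them after a promotion. -/
def Recovers : Variant → Prop
  | rr => True
  | rrdp => True
  | _ => False

/-- The variants with the delayed promotion policy. -/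
def Delays : Variant → Prop
  | dp => True
  | rrdp => True
  | _ => False

/-- Does a promotion won by player `α` at once reset a lower region of priority `q`?  The original
algorithm resets all lower regions, PP+ resets the lower regions of the opponent, and with region
recovery no region is reset until it is inspected again. -/
def Resets : Variant → Player → ℕ → Prop
  | pp, _, _ => True
  | ppPlus, α, q => Player.ofPriority q ≠ α
  | dp, α, q => Player.ofPriority q ≠ α
  | rr, _, _ => False
  | rrdp, _, _ => False

instance : DecidablePred Recovers := fun v => by cases v <;> unfold Recovers <;> infer_instance

instance : DecidablePred Delays := fun v => by cases v <;> unfold Delays <;> infer_instance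

instance (v : Variant) (α : Player) (q : ℕ) : Decidable (Resets v α q) := by
  cases v <;> unfold Resets <;> infer_instance

end Variant

/-- A configuration of the priority promotion solver. -/
structure Config (V : Type) where
  /-- the vertices of the remaining game -/
  alive : Finset V
  /-- the part of the winning regions computed so far -/
  won : Player → Finset V
  /-- the priority of the current region of each vertex, `⊥` if it has none -/
  r : V → WithBot ℕ
  /-- the attractor strategies recorded for the current regions -/
  strat : V → Option V
  /-- the current priority -/
  p : ℕ
  /-- the regions (given by their priorities) that are currently the result of a promotion -/
  merged : Finset ℕ
  /-- the record of merged regions used by the delayed promotion policy, which is emptied whenever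
  delayed promotions are applied -/
  record : Finset ℕ
  /-- the copy of the decomposition with delayed promotions, stored as its difference from `r`:
  the priority to which the region of a vertex is promoted in the copy, if this is delayed -/
  delayed : V → Option ℕ

namespace Config

variable {V : Type} [Fintype V] [DecidableEq V]

/-- The current player. -/
def player (c : Config V) : Player := Player.ofPriority c.p

/-- The current subgame: all vertices that are not in a higher region. -/
def sub (c : Config V) : Finset V := c.alive.filter fun v => c.r v ≤ (c.p : WithBot ℕ)

/-- The attractor target: the current region and the vertices of the current priority. -/
def target (G : ParityGame V) (c : Config V) : Finset V :=
  c.sub.filter fun v => c.r v = (c.p : WithBot ℕ) ∨ G.pr v = c.p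

/-- The current region after attracting. -/
noncomputable def region (G : ParityGame V) (c : Config V) : Finset V :=
  attr G c.sub c.player (c.target G)

/-- Escape targets of the opponent from a set `Z`. -/
def esc (G : ParityGame V) (c : Config V) (Z : Finset V) : Finset V :=
  ((Z.filter fun v => G.owner v ≠ c.player).biUnion G.succ ∩ c.alive) \ Z

/-- The region `Z` is open in the current subgame. -/
def IsOpenRegion (G : ParityGame V) (c : Config V) (Z : Finset V) : Prop :=
  (∃ v ∈ Z, G.owner v = c.player ∧ ∀ w ∈ G.succ v, w ∉ Z) ∨ (c.esc G Z ∩ c.sub).Nonempty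

instance (G : ParityGame V) (c : Config V) (Z : Finset V) : Decidable (c.IsOpenRegion G Z) := by
  unfold IsOpenRegion; infer_instance

/-- The lowest region to which the opponent can escape from `Z`. -/
def lowestEscape (G : ParityGame V) (c : Config V) (Z : Finset V) : ℕ :=
  if h : (c.esc G Z).Nonempty then (c.esc G Z).inf' h fun v => (c.r v).unbotD 0 else 0

/-- The highest priority of the vertices and of the recorded regions in a set `S`. -/
def top (G : ParityGame V) (r : V → WithBot ℕ) (S : Finset V) : ℕ :=
  S.sup fun v => max (G.pr v) ((r v).unbotD 0)

/-- Region recovery fails: some vertex of the current region has an attractor strategy that now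
leaves to a higher region, or to the solved part of the game. -/
def Unrecoverable (G : ParityGame V) (c : Config V) : Prop :=
  ∃ v ∈ c.alive, c.r v = (c.p : WithBot ℕ) ∧ G.owner v = c.player ∧
    ∃ w, c.strat v = some w ∧ (w ∉ c.alive ∨ (c.p : WithBot ℕ) < c.r w)

open Classical in
/-- `c.discard R` resets all regions whose priority satisfies `R`. -/
noncomputable def discard (c : Config V) (R : ℕ → Prop) : Config V :=
  { c with
    r := fun v => if ∃ q : ℕ, c.r v = (q : WithBot ℕ) ∧ R q then ⊥ else c.r v
    strat := fun v => if ∃ q : ℕ, c.r v = (q : WithBot ℕ) ∧ R q then none else c.strat v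
    merged := c.merged.filter fun q => ¬ R q
    record := c.record.filter fun q => ¬ R q }

/-- Forget that the region of the current priority is the result of a promotion if no such region
is recorded any more, so that it is now formed anew. -/
def refresh (c : Config V) : Config V :=
  if ∃ v ∈ c.alive, c.r v = (c.p : WithBot ℕ) then c
  else { c with merged := c.merged.erase c.p, record := c.record.erase c.p }

/-- Record the region `Z` in the decomposition, at priority `q`. -/
def assign (c : Config V) (Z : Finset V) (q : ℕ) : Config V :=
  { c with r := fun v => if v ∈ Z then (q : WithBot ℕ) else c.r v }

/-- Promote the region `Z` of the current priority to priority `q`. -/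
noncomputable def promote (v : Variant) (c : Config V) (Z : Finset V) (q : ℕ) : Config V :=
  let c₁ : Config V :=
    { (c.assign Z q) with
      merged := c.merged.erase c.p
      record := c.record.erase c.p
      delayed := fun u => if u ∉ Z ∧ (q : WithBot ℕ) < c.r u then c.delayed u else none }
  let c₂ := c₁.discard fun x => x < q ∧ v.Resets c.player x
  { c₂ with p := q, merged := insert q c₂.merged, record := insert q c₂.record }

/-- Apply the delayed promotions of the player that wins the highest delayed promotion, discard
those of the other player, and continue with an empty record of merged regions. -/
noncomputable def applyDelayed (v : Variant) (c : Config V) : Config V :=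
  let m : ℕ := Finset.univ.sup fun u => (c.delayed u).getD 0
  let α := Player.ofPriority m
  let c₁ : Config V :=
    { c with
      r := fun u => match c.delayed u with
        | some q => if Player.ofPriority q = α then (q : WithBot ℕ) else c.r u
        | none => c.r u }
  let c₂ := c₁.discard fun x => x < m ∧ v.Resets α x
  { c₂ with
    p := m
    merged := c₂.merged ∪
      (Finset.univ.biUnion fun u => (c.delayed u).toFinset).filter fun q => Player.ofPriority q = α
    record := ∅
    delayed := fun _ => none }

/-- Continue with the next highest priority after the region `Z` has been recorded.  If nothing is
left, then no normal promotion is available and the delayed promotions are applied.  The Boolean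
tells whether promotions are applied. -/
noncomputable def descend (v : Variant) (G : ParityGame V) (c : Config V) (Z : Finset V) :
    Config V × Bool :=
  if (c.sub \ Z).Nonempty then ({ c with p := top G c.r (c.sub \ Z) }, false)
  else if ∃ u, c.delayed u ≠ none then (c.applyDelayed v, true)
  else (c, false)

/-- Remove the dominion `D` won by the current player and start the next search for a dominion.
The next search starts either with an empty decomposition, or (if `keep` holds) with the recorded
regions of the remaining vertices; in the latter case the removal of a dominion is treated like a
promotion to a region above all others. -/
noncomputable def removeDominion (v : Variant) (keep : Bool) (G : ParityGame V) (c : Config V)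
    (D : Finset V) : Config V :=
  let c₁ : Config V := c.discard fun x => keep = false ∨ v.Resets c.player x
  { c₁ with
    alive := c.alive \ D
    won := fun α => if α = c.player then c.won α ∪ D else c.won α
    p := top G c₁.r (c.alive \ D)
    record := ∅
    delayed := fun _ => none }

/-- `c.IsStrategyUpdate G Z σ`: the strategies `σ` may result from attracting `Z` in configuration
`c`.  Every added vertex of the current player plays to a vertex that was added before it, where
`rank` describes the order in which vertices are added; every vertex of the current player in the
attractor target that has no strategy yet plays to some vertex of `Z` if it can. -/
def IsStrategyUpdate (G : ParityGame V) (c : Config V) (Z : Finset V) (σ : V → Option V) : Prop :=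
  (∀ v, v ∉ Z → σ v = c.strat v) ∧
  (∀ v ∈ Z, G.owner v ≠ c.player → σ v = none) ∧
  (∀ v ∈ c.target G, G.owner v = c.player → c.strat v ≠ none → σ v = c.strat v) ∧
  (∀ v ∈ c.target G, G.owner v = c.player → c.strat v = none →
    (∃ w ∈ G.succ v ∩ Z, σ v = some w) ∨ (G.succ v ∩ Z = ∅ ∧ σ v = none)) ∧
  ∃ rank : V → ℕ, ∀ v ∈ Z \ c.target G,
    (G.owner v = c.player → ∃ w ∈ G.succ v ∩ Z, σ v = some w ∧ rank w < rank v) ∧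
    (G.owner v ≠ c.player → ∀ w ∈ G.succ v ∩ c.sub, rank w < rank v)

open Classical in
/-- One iteration of the solver, where `σ` are the strategies obtained by attracting.  The Boolean
tells whether a promotion is performed.  Once all vertices are solved, nothing changes. -/
noncomputable def step (v : Variant) (keep : Bool) (G : ParityGame V) (c : Config V)
    (σ : V → Option V) : Config V × Bool :=
  if c.alive = ∅ then (c, false)
  else if v.Recovers ∧ c.Unrecoverable G then
    ({ (c.discard fun x => x = c.p) with
        p := top G (c.discard fun x => x = c.p).r c.sub }, false)
  else
    let Z := c.region G
    let q := c.lowestEscape G Z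
    let c' : Config V := { c.refresh with strat := σ }
    if c.IsOpenRegion G Z then
      (c'.assign Z c.p).descend v G Z
    else if c.esc G Z = ∅ then
      ((c'.assign Z c.p).removeDominion v keep G (attr G c.alive c.player Z), false)
    else if v.Delays ∧ ∃ x ∈ c'.record, Player.ofPriority x ≠ c.player ∧ x < q then
      ({ (c'.assign Z c.p) with
          delayed := fun u => if u ∈ Z then some q else c.delayed u }).descend v G Z
    else (c'.promote v Z q, true)

/-- The initial configuration: nothing is solved, all vertices are mapped to `⊥`, and the search
starts at the highest priority. -/
def initial (G : ParityGame V) : Config V where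
  alive := Finset.univ
  won := fun _ => ∅
  r := fun _ => ⊥
  strat := fun _ => none
  p := top G (fun _ => ⊥) Finset.univ
  merged := ∅
  record := ∅
  delayed := fun _ => none

end Config

/-- A run of the solver on `G`: `c i` is the configuration before iteration `i`, and `b i` tells
whether iteration `i` performs a promotion.  The choice among the possible attractor strategies is
arbitrary in each iteration. -/
def IsRun {V : Type} [Fintype V] [DecidableEq V] (G : ParityGame V) (v : Variant) (keep : Bool)
    (c : ℕ → Config V) (b : ℕ → Bool) : Prop :=
  c 0 = Config.initial G ∧
  ∀ i, ∃ σ, (c i).IsStrategyUpdate G ((c i).region G) σ ∧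
    (c i).step v keep G σ = (c (i + 1), b i)

/-- The number of promotions performed in the first `T` iterations. -/
def promotions (b : ℕ → Bool) (T : ℕ) : ℕ := ((List.range T).filter b).length

/-! ### The Two Counters games -/

/-- The vertices of the `N`-bit Two Counters game.  Bit `k` of the counter of player `α` consists
of the low vertex `l α k`, the high vertex `h α k`, the tangle vertex `t α k`, and a chain that
leads from `t α k` to `z α k` via a choice between `a α k i` and `b α k i` at `s α k i`, for each
higher bit `i < k`.  Bit `0` is the highest bit. -/
inductive TCVertex (N : ℕ)
  | l (α : Player) (k : Fin N)
  | h (α : Player) (k : Fin N)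
  | t (α : Player) (k : Fin N)
  | z (α : Player) (k : Fin N)
  | s (α : Player) (k : Fin N) (i : Fin k)
  | a (α : Player) (k : Fin N) (i : Fin k)
  | b (α : Player) (k : Fin N) (i : Fin k)
  deriving DecidableEq, Fintype

namespace TCVertex

variable {N : ℕ}

/-- The `i`-th choice vertex of bit `k`, which is `z α k` after the choices for all higher bits. -/
def chain (α : Player) (k : Fin N) (i : ℕ) : TCVertex N :=
  if hi : i < k then s α k ⟨i, hi⟩ else z α k

/-- The bit above bit `k`; for the highest bit, the lowest bit. -/
def next (k : Fin N) : Fin N :=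
  ⟨if (k : ℕ) = 0 then N - 1 else k - 1, by have := k.isLt; split <;> omega⟩

/-- A higher bit `i < k`, as a bit. -/
def up {k : Fin N} (i : Fin k) : Fin N := ⟨i, i.isLt.trans k.isLt⟩

/-- The vertices `s` and `z` belong to the player whose counter they are in, all other vertices
to the opponent. -/
def owner : TCVertex N → Player
  | l α _ | h α _ | t α _ | a α _ _ | b α _ _ => α.opp
  | z α _ | s α _ _ => α

/-- The priorities.  The lowest are at the chains, then at the tangle vertices, followed by the low
vertices and finally the high vertices, each with higher priorities for higher bits, where the
counter of Even has the lower one of two adjacent priorities of equal bits. -/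
def pr : TCVertex N → ℕ
  | l .even k => 2 * (N - 1 - k) + 3
  | l .odd k => 2 * (N - 1 - k) + 4
  | h .even k => 2 * N + 2 * (N - 1 - k) + 4
  | h .odd k => 2 * N + 2 * (N - 1 - k) + 5
  | t .even _ => 2
  | t .odd _ => 1
  | z .even _ | s .even _ _ | a .even _ _ | b .even _ _ => 1
  | z .odd _ | s .odd _ _ | a .odd _ _ | b .odd _ _ => 0

/-- The edges.  From `z`, the player can be distracted by the low vertices of the lower bits of the
opponent's counter and, for the second player Odd, of the equal bit. -/
def succ : TCVertex N → Finset (TCVertex N)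
  | l α k => {t α k}
  | h α k => {l α (next k)}
  | t α k => {h α k, chain α k 0}
  | z .even k => insert (t .even k) ((Finset.univ.filter fun j => k < j).image (l .odd))
  | z .odd k => insert (t .odd k) ((Finset.univ.filter fun j => k ≤ j).image (l .even))
  | s α k i => {a α k i, b α k i}
  | a α k i => {chain α k (i + 1), l α (up i)}
  | b α k i => {chain α k (i + 1), l α.opp (up i)}

end TCVertex

/-- The `N`-bit Two Counters game, where player Even starts. -/
def twoCounters (N : ℕ) : ParityGame (TCVertex N) where
  owner := TCVertex.owner
  succ := TCVertex.succ
  pr := TCVertex.pr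
  total := by
    intro v
    cases v with
    | z α k => cases α <;> simp [TCVertex.succ]
    | _ => simp [TCVertex.succ]

/-! ### Counters -/

/-- The bits that are set in a configuration: a bit of player `α` is set if its low vertex, a
distraction for the opponent, is attracted to a region of player `α` that is the result of a
promotion, or is already won by player `α`. -/
def bits {N : ℕ} (c : Config (TCVertex N)) : Finset (Player × Fin N) :=
  Finset.univ.filter fun x =>
    TCVertex.l x.1 x.2 ∈ c.won x.1 ∨
      (TCVertex.l x.1 x.2 ∈ c.alive ∧
        ∃ q ∈ c.merged, Player.ofPriority q = x.1 ∧ c.r (TCVertex.l x.1 x.2) = (q : WithBot ℕ))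

/-- The states of the counters that are met in the first `T` iterations of a run: the bits that are
set when a promotion is about to be performed, and finally the bits set after `T` iterations. -/
def counterTrace {N : ℕ} (c : ℕ → Config (TCVertex N)) (b : ℕ → Bool) (T : ℕ) :
    List (Finset (Player × Fin N)) :=
  ((List.range T).filter b).map (fun i => bits (c i)) ++ [bits (c T)]

/-- Bit `k` of the binary representation of `j` with `N` bits, bit `0` being the highest. -/
def binBit (N j : ℕ) (k : Fin N) : Bool := j.testBit (N - 1 - k)

/-- The progression of the two counters.  After `2 * j` steps both counters have value `j`.  One
step later, Even has set the bit that `j + 1` newly sets while keeping its lower bits, and the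
lower bits of Odd are reset.  Then Odd sets this bit and the lower bits of Even are reset. -/
def progression (N i : ℕ) : Finset (Player × Fin N) :=
  Finset.univ.filter fun x =>
    if i % 2 = 0 then binBit N (i / 2) x.2 = true
    else if x.1 = .even then binBit N (i / 2) x.2 = true ∨ binBit N (i / 2 + 1) x.2 = true
    else binBit N (i / 2) x.2 = true ∧ binBit N (i / 2 + 1) x.2 = true

/-- The number of steps in which two `N`-bit counters are counted up from zero to the top. -/
def progressionLength (N : ℕ) : ℕ := 2 * (2 ^ N - 1)

/-!
Between two promotions, a search goes down through regions that depend only on the state of the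
counters.  These regions are written down for every state that is met; then it remains to see that
a search computes them, and that the promotion at the end of the search leads to the regions of the
next state.

The general part concerns an arbitrary parity game.  A `Layout` assigns a region to every vertex,
and if it satisfies `IsDecomposition`, then its regions are the attractors that a search computes,
whatever attractor strategies are chosen.  The invariant `Follows` says that the regions above the
current priority are those of the layout, while the regions that are still on record below cannot
obstruct the search: a vertex is recorded too high only in a region that region recovery is going to
reset.  By `Follows.reach`, the search gets to a region that is not open.  If `IsPromotion` holds
there, this region is promoted (`Follows.exists_promoted`), and the search goes on to compute the
next layout (`Follows.of_promoted`).  The promotions that can be delayed here occur only when nothing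
is left below, so they are applied in the same iteration.  The removal of a dominion is described in
the same way by `Follows.of_dominion`.

For the Two Counters games, a layout is given by a `Labelling` of the bits, and the local conditions
`Labelling.Valid` imply `IsDecomposition`.  While both counters show the bits in `J`, the labels are
`counting`: the lowest region contains the tangle vertex of the lowest unset bit `k` of Even, and the
opponent can leave it only to the region of the low vertex of the next higher unset bit of Odd, or
to that of the highest vertex of Even.  The promotion to that region sets bit `k` of Even.  Now the
vertex `l` of this bit is no longer a distraction for Odd, whose bit `k` becomes the lowest region
and is promoted in turn, and then both counters show the next number.

With region recovery nothing else changes, except that one region is reset because a strategy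
recorded in it now leaves it.  That such a strategy is recorded whatever choices are made is the
point of `Ranked.strat_z`: a vertex `z` that is the only entrance of a chain to a region cannot play
back to the tangle vertex, which is attracted later, so it plays to the distraction.  The other
variants also lose bits of the state that is being reached.  Odd recovers them from higher to lower
bits (`recovering`), and if Odd's promotion goes to its highest region, then so does Even (`raising`).
In the meantime only bits of the new state are set, and the bit that made the step remains set.

When Even sets its lowest bit as well, its whole counter is in one region, a dominion.  After its
removal (`remaining`), Odd sets the bits that were not kept, without distractions, and wins the rest
with the last one.
-/

set_option linter.unusedSectionVars false
set_option linter.unusedSimpArgs false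

/-! ### Attractors -/

section Attractors

variable {V : Type} {G : ParityGame V} {S A B : Finset V} {α : Player} {v : V}

theorem mem_attr [Fintype V] : v ∈ attr G S α A ↔ Attracted G S α A v := by
  simp [attr]

/-- The vertices that are attracted in at most `n` rounds. -/
def AttractedIn (G : ParityGame V) (S : Finset V) (α : Player) (A : Finset V) : ℕ → V → Prop
  | 0, v => v ∈ A
  | n + 1, v => AttractedIn G S α A n v ∨ v ∈ S ∧
      ((G.owner v = α ∧ ∃ w ∈ G.succ v, AttractedIn G S α A n w) ∨
        (G.owner v ≠ α ∧ ∀ w ∈ G.succ v, w ∈ S → AttractedIn G S α A n w))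

theorem AttractedIn.mono {m n : ℕ} (hmn : m ≤ n) (h : AttractedIn G S α A m v) :
    AttractedIn G S α A n v := by
  induction hmn with
  | refl => exact h
  | step _ ih => exact .inl ih

theorem Attracted.exists_attractedIn (h : Attracted G S α A v) :
    ∃ n, AttractedIn G S α A n v := by
  induction h with
  | base h => exact ⟨0, h⟩
  | own h₁ h₂ h₃ _ ih =>
    obtain ⟨n, hn⟩ := ih
    exact ⟨n + 1, .inr ⟨h₁, .inl ⟨h₂, _, h₃, hn⟩⟩⟩
  | @opp v h₁ h₂ _ ih =>
    choose! f hf using ih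
    refine ⟨(G.succ v).sup f + 1, .inr ⟨h₁, .inr ⟨h₂, fun w hw hwS => ?_⟩⟩⟩
    exact (hf w hw hwS).mono (Finset.le_sup hw)

theorem AttractedIn.attracted {n : ℕ} (h : AttractedIn G S α A n v) : Attracted G S α A v := by
  induction n generalizing v with
  | zero => exact .base h
  | succ n ih =>
    rcases h with h | ⟨h₁, ⟨h₂, w, hw, h₃⟩ | ⟨h₂, h₃⟩⟩
    · exact ih h
    · exact .own h₁ h₂ hw (ih h₃)
    · exact .opp h₁ h₂ fun w hw hwS => ih (h₃ w hw hwS)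

/-- The rounds in which vertices are attracted rank an attractor. -/
theorem exists_attractor_rank (G : ParityGame V) (S : Finset V) (α : Player) (A : Finset V) :
    ∃ rank : V → ℕ, ∀ v, Attracted G S α A v → v ∉ A →
      (G.owner v = α → ∃ w ∈ G.succ v, Attracted G S α A w ∧ rank w < rank v) ∧
      (G.owner v ≠ α → ∀ w ∈ G.succ v, w ∈ S → rank w < rank v) := by
  classical
  refine ⟨fun v => if h : ∃ n, AttractedIn G S α A n v then Nat.find h else 0, fun v hv hA => ?_⟩
  have hlt : ∀ {w n}, AttractedIn G S α A n w →
      (if h : ∃ n, AttractedIn G S α A n w then Nat.find h else 0) < n + 1 := by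
    intro w n hw
    rw [dif_pos ⟨n, hw⟩]
    exact Nat.lt_succ_of_le (Nat.find_min' _ hw)
  have hex := hv.exists_attractedIn
  simp only [dif_pos hex]
  have hspec := Nat.find_spec hex
  have hmin := fun m => @Nat.find_min _ _ hex m
  generalize Nat.find hex = n at hspec hmin
  cases n with
  | zero => exact absurd hspec hA
  | succ n =>
    rcases hspec with h | ⟨h₁, ⟨h₂, w, hw, h₃⟩ | ⟨h₂, h₃⟩⟩
    · exact absurd h (hmin n (Nat.lt_succ_self n))
    · exact ⟨fun _ => ⟨w, hw, h₃.attracted, hlt h₃⟩, fun h => absurd h₂ h⟩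
    · exact ⟨fun h => absurd h h₂, fun _ w hw hwS => hlt (h₃ w hw hwS)⟩

end Attractors

/-! ### Existence of runs -/

section Runs

variable {V : Type} [Fintype V] [DecidableEq V]

theorem Config.exists_isStrategyUpdate (G : ParityGame V) (c : Config V) :
    ∃ σ, c.IsStrategyUpdate G (c.region G) σ := by
  classical
  obtain ⟨rank, hrank⟩ := exists_attractor_rank G c.sub c.player (c.target G)
  set Z := c.region G with hZ
  have hmem : ∀ v, v ∈ Z ↔ Attracted G c.sub c.player (c.target G) v := fun v => mem_attr
  have hown : ∀ v, ∃ w, (v ∈ Z \ c.target G → G.owner v = c.player →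
      w ∈ G.succ v ∩ Z ∧ rank w < rank v) := by
    intro v
    by_cases h : v ∈ Z \ c.target G ∧ G.owner v = c.player
    · rw [Finset.mem_sdiff] at h
      obtain ⟨w, hw, hwZ, hlt⟩ := (hrank v ((hmem v).1 h.1.1) h.1.2).1 h.2
      exact ⟨w, fun _ _ => ⟨Finset.mem_inter.2 ⟨hw, (hmem w).2 hwZ⟩, hlt⟩⟩
    · exact ⟨v, fun h₁ h₂ => absurd ⟨h₁, h₂⟩ h⟩
  choose f hf using hown
  have htZ : ∀ v ∈ c.target G, v ∈ Z := fun v hv => (hmem v).2 (.base hv)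
  refine ⟨fun v => if v ∉ Z then c.strat v else if G.owner v ≠ c.player then none else
    if v ∈ c.target G then
      if c.strat v ≠ none then c.strat v
      else if h : (G.succ v ∩ Z).Nonempty then some h.choose else none
    else some (f v), ?_, ?_, ?_, ?_, rank, ?_⟩
  · intro v hv
    simp [hv]
  · intro v hv ho
    simp [hv, ho]
  · intro v hv ho hs
    simp [htZ v hv, ho, hv, hs]
  · intro v hv ho hs
    simp only [htZ v hv, ho, hv, hs, not_true_eq_false, if_false, if_true, ne_eq]
    by_cases h : (G.succ v ∩ Z).Nonempty
    · left
      exact ⟨h.choose, h.choose_spec, by rw [dif_pos h]⟩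
    · right
      exact ⟨Finset.not_nonempty_iff_eq_empty.1 h, by rw [dif_neg h]⟩
  · intro v hv
    have hv' := Finset.mem_sdiff.1 hv
    refine ⟨fun ho => ⟨f v, (hf v hv ho).1, ?_, (hf v hv ho).2⟩, fun ho w hw => ?_⟩
    · simp [hv'.1, hv'.2, ho]
    · rw [Finset.mem_inter] at hw
      exact (hrank v ((hmem v).1 hv'.1) hv'.2).2 ho w hw.1 hw.2

/-- Attracting always yields a strategy update, so the solver can be run forever. -/
theorem exists_isRun (G : ParityGame V) (v : Variant) (keep : Bool) :
    ∃ c b, IsRun G v keep c b := by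
  choose σ hσ using fun c : Config V => c.exists_isStrategyUpdate G
  let c : ℕ → Config V := fun n =>
    Nat.rec (Config.initial G) (fun _ c => (c.step v keep G (σ c)).1) n
  exact ⟨c, fun n => ((c n).step v keep G (σ (c n))).2, rfl, fun i => ⟨σ (c i), hσ _, rfl⟩⟩

end Runs

/-! ### Decompositions into regions -/

section Decompositions

variable {V : Type}

/-- `IsDecomposition G S D core` says that a search for a dominion in the subgame `S` puts every
vertex `u` into the region `D u`, when vertices in `core` are known to belong to their regions from
earlier promotions: no vertex is attracted to a higher region than its own, and every vertex is
attracted to its own region. -/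
structure IsDecomposition (G : ParityGame V) (S : Finset V) (D : V → ℕ) (core : V → Prop) :
    Prop where
  pr_le : ∀ u ∈ S, G.pr u ≤ D u
  low : ∀ u ∈ S, ∃ w ∈ G.succ u, w ∈ S ∧ D w ≤ D u
  up : ∀ u ∈ S, ∀ w ∈ G.succ u, w ∈ S → D u < D w → Player.ofPriority (D w) ≠ G.owner u
  attracted : ∀ u ∈ S, ∀ B : Finset V, (∀ w ∈ S, D w = D u → G.pr w = D w ∨ core w → w ∈ B) →
    Attracted G (S.filter fun w => D w ≤ D u) (Player.ofPriority (D u)) B u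

variable {G : ParityGame V} {S : Finset V} {D : V → ℕ} {core : V → Prop}

/-- Every region has a vertex from which it is attracted. -/
theorem IsDecomposition.exists_base (h : IsDecomposition G S D core) {u : V} (hu : u ∈ S) :
    ∃ w ∈ S, D w = D u ∧ (G.pr w = D w ∨ core w) := by
  classical
  have key := h.attracted u hu (S.filter fun w => D w = D u ∧ (G.pr w = D w ∨ core w))
    (fun w h₁ h₂ h₃ => Finset.mem_filter.2 ⟨h₁, h₂, h₃⟩)
  have : ∀ x, Attracted G (S.filter fun w => D w ≤ D u) (Player.ofPriority (D u))
      (S.filter fun w => D w = D u ∧ (G.pr w = D w ∨ core w)) x →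
      ∃ w ∈ S, D w = D u ∧ (G.pr w = D w ∨ core w) := by
    intro x hx
    induction hx with
    | base h => exact ⟨_, (Finset.mem_filter.1 h).1, (Finset.mem_filter.1 h).2⟩
    | own _ _ _ _ ih => exact ih
    | @opp x h₁ _ _ ih =>
      have hx := Finset.mem_filter.1 h₁
      obtain ⟨w, hw, hwS, hle⟩ := h.low x hx.1
      exact ih w hw (Finset.mem_filter.2 ⟨hwS, hle.trans hx.2⟩)
  exact this u key

/-- The attractor that a search computes at priority `p` is the region `p` of a decomposition. -/
theorem IsDecomposition.attr_eq [Fintype V] [DecidableEq V] (h : IsDecomposition G S D core)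
    {p : ℕ} {T : Finset V} (hT : ∀ u ∈ T, u ∈ S ∧ D u = p)
    (hB : ∀ u ∈ S, D u = p → G.pr u = D u ∨ core u → u ∈ T) :
    attr G (S.filter fun u => D u ≤ p) (Player.ofPriority p) T = S.filter fun u => D u = p := by
  ext u
  rw [mem_attr, Finset.mem_filter]
  constructor
  · intro hu
    induction hu with
    | base hu => exact hT _ hu
    | @own u w h₁ h₂ h₃ _ ih =>
      have hu := Finset.mem_filter.1 h₁
      refine ⟨hu.1, ?_⟩
      by_contra hne
      refine h.up u hu.1 w h₃ ih.1 (by have := hu.2; omega) ?_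
      rw [ih.2, h₂]
    | @opp u h₁ h₂ _ ih =>
      have hu := Finset.mem_filter.1 h₁
      obtain ⟨w, hw, hwS, hle⟩ := h.low u hu.1
      have := ih w hw (Finset.mem_filter.2 ⟨hwS, hle.trans hu.2⟩)
      exact ⟨hu.1, by omega⟩
  · rintro ⟨huS, rfl⟩
    exact h.attracted u huS T hB

end Decompositions

/-! ### Searches that follow a decomposition -/

/-- A decomposition of the remaining game into regions that a search is expected to compute,
together with the vertices that are already won. -/
structure Layout (V : Type) where
  /-- the vertices of the remaining game -/
  alive : Finset V
  /-- the vertices won by each player -/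
  won : Player → Finset V
  /-- the priority of the region of each vertex -/
  reg : V → ℕ
  /-- vertices that are in their regions because of promotions -/
  core : V → Prop

/-- What is known about recorded strategies, promoted regions and the record of the delayed
promotion policy while a layout is being computed. -/
structure Memo (V : Type) where
  /-- `kept u w`: with region recovery, the strategy at `u` is known to be `w` -/
  kept : V → V → Prop
  /-- with region recovery, these regions are computed from scratch -/
  fresh : ℕ → Prop
  /-- these regions are not the result of promotions -/
  avoid : ℕ → Prop
  /-- a property of all priorities on record -/
  record : ℕ → Prop

section Search

variable {V : Type} [Fintype V] [DecidableEq V]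

/-- The strategies `σ` in the region `d` make progress with respect to some rank towards the
vertices of priority `d`. -/
def Ranked (G : ParityGame V) (X : Layout V) (σ : V → Option V) (d : ℕ) : Prop :=
  ∃ rank : V → ℕ, ∀ u ∈ X.alive, X.reg u = d → G.pr u ≠ d →
    (G.owner u = Player.ofPriority d → ∃ w ∈ G.succ u, X.reg w = d ∧ σ u = some w ∧
      rank w < rank u) ∧
    (G.owner u ≠ Player.ofPriority d → ∀ w ∈ G.succ u, w ∈ X.alive → X.reg w ≤ d →
      rank w < rank u)

/-- The invariant of a search that computes the layout `X`: regions above the current priority are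
those of `X`, and the regions recorded below do not obstruct the search.  A vertex may be recorded
in a region that is higher than its region in `X` only if that region satisfies `bad`, that is, if
a recorded strategy makes region recovery reset it. -/
structure Follows (G : ParityGame V) (v : Variant) (X : Layout V) (Y : Memo V) (bad : ℕ → Prop)
    (c : Config V) : Prop where
  alive : c.alive = X.alive
  won : c.won = X.won
  above : ∀ u ∈ X.alive, c.p < X.reg u → c.r u = (X.reg u : WithBot ℕ)
  below : ∀ u ∈ X.alive, c.r u ≤ (X.reg u : WithBot ℕ) ∨
    ∃ x : ℕ, bad x ∧ c.r u = (x : WithBot ℕ)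
  core_eq : ∀ u ∈ X.alive, X.core u → c.r u = (X.reg u : WithBot ℕ)
  core_bad : ∀ u ∈ X.alive, X.core u → ¬ bad (X.reg u)
  core_merged : ∀ u ∈ X.alive, X.core u → X.reg u ∈ c.merged
  kept : v.Recovers → ∀ u w, Y.kept u w → u ∈ X.alive ∧ G.owner u = Player.ofPriority (X.reg u) ∧
    c.r u = (X.reg u : WithBot ℕ) ∧ c.strat u = some w ∧ ¬ bad (X.reg u)
  witness : ∀ x, bad x → x ≤ c.p ∧ v.Recovers ∧ ∃ u ∈ X.alive, c.r u = (x : WithBot ℕ) ∧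
    G.owner u = Player.ofPriority x ∧ X.reg u ≤ x ∧
    ∃ w, c.strat u = some w ∧ (w ∉ X.alive ∨ x < X.reg w)
  strat_mem : v.Recovers → ∀ u ∈ X.alive, c.r u = (X.reg u : WithBot ℕ) → ¬ bad (X.reg u) →
    G.owner u = Player.ofPriority (X.reg u) → ∀ w, c.strat u = some w →
    w ∈ G.succ u ∧ w ∈ X.alive ∧ X.reg w = X.reg u
  strat_some : v.Recovers → ∀ u ∈ X.alive, c.r u = (X.reg u : WithBot ℕ) → ¬ bad (X.reg u) →
    G.owner u = Player.ofPriority (X.reg u) → G.pr u ≠ X.reg u → c.strat u ≠ none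
  pr_le : v.Recovers → ∀ u ∈ X.alive, c.strat u ≠ none → (G.pr u : WithBot ℕ) ≤ c.r u
  delayed : ∀ u, c.delayed u = none
  avoid : ∀ d, Y.avoid d → d ∈ c.merged → ∀ u ∈ X.alive, c.r u ≠ (d : WithBot ℕ)
  record : ∀ d ∈ c.record, Y.record d
  fresh : v.Recovers → ∀ d, Y.fresh d →
    (d ≤ c.p → ∀ u ∈ X.alive, c.r u ≠ (d : WithBot ℕ)) ∧ (c.p < d → Ranked G X c.strat d)

variable {G : ParityGame V} {v : Variant} {keep : Bool} {X : Layout V} {Y : Memo V}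
  {bad : ℕ → Prop} {c : Config V} {σ : V → Option V}

/-- The vertices in a region of a layout. -/
def Layout.region (X : Layout V) (p : ℕ) : Finset V := X.alive.filter fun u => X.reg u = p

theorem Layout.mem_region {p : ℕ} {u : V} : u ∈ X.region p ↔ u ∈ X.alive ∧ X.reg u = p :=
  Finset.mem_filter

namespace Follows

theorem sub_eq (h : Follows G v X Y bad c) : c.sub = X.alive.filter fun u => X.reg u ≤ c.p := by
  ext u
  rw [Config.sub, Finset.mem_filter, Finset.mem_filter, h.alive]
  refine and_congr_right fun hu => ⟨fun hr => ?_, fun hr => ?_⟩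
  · by_contra hlt
    rw [h.above u hu (by omega)] at hr
    exact hlt (by exact_mod_cast hr)
  · rcases h.below u hu with h₁ | ⟨x, hx, h₁⟩
    · exact h₁.trans (by exact_mod_cast hr)
    · rw [h₁]
      exact_mod_cast (h.witness x hx).1

theorem mem_sub (h : Follows G v X Y bad c) {u : V} :
    u ∈ c.sub ↔ u ∈ X.alive ∧ X.reg u ≤ c.p := by
  rw [h.sub_eq, Finset.mem_filter]

theorem reg_eq_of_r_eq (h : Follows G v X Y bad c) (hp : ¬ bad c.p) {u : V} (hu : u ∈ X.alive)
    (hle : X.reg u ≤ c.p) (hr : c.r u = (c.p : WithBot ℕ)) : X.reg u = c.p := by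
  rcases h.below u hu with h₁ | ⟨x, hx, h₁⟩
  · rw [hr] at h₁
    have : c.p ≤ X.reg u := by exact_mod_cast h₁
    omega
  · rw [hr] at h₁
    have : c.p = x := by exact_mod_cast h₁
    exact absurd (this ▸ hx) hp

theorem mem_target (h : Follows G v X Y bad c) {u : V} :
    u ∈ c.target G ↔ (u ∈ X.alive ∧ X.reg u ≤ c.p) ∧
      (c.r u = (c.p : WithBot ℕ) ∨ G.pr u = c.p) := by
  rw [Config.target, Finset.mem_filter, h.mem_sub]

theorem reg_of_mem_target (h : Follows G v X Y bad c) (hp : ¬ bad c.p)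
    (hX : IsDecomposition G X.alive X.reg X.core) {u : V} (hu : u ∈ c.target G) :
    u ∈ X.alive ∧ X.reg u = c.p := by
  rw [h.mem_target] at hu
  refine ⟨hu.1.1, ?_⟩
  rcases hu.2 with hr | hr
  · exact h.reg_eq_of_r_eq hp hu.1.1 hu.1.2 hr
  · have := hX.pr_le u hu.1.1
    have := hu.1.2
    omega

theorem region_eq (h : Follows G v X Y bad c) (hp : ¬ bad c.p)
    (hX : IsDecomposition G X.alive X.reg X.core) : c.region G = X.region c.p := by
  rw [Config.region, h.sub_eq]
  refine hX.attr_eq (fun u hu => h.reg_of_mem_target hp hX hu) fun u hu he hb => ?_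
  rw [h.mem_target]
  refine ⟨⟨hu, he.le⟩, ?_⟩
  rcases hb with hb | hb
  · exact .inr (hb.trans he)
  · exact .inl (by rw [h.core_eq u hu hb, he])

theorem not_unrecoverable (h : Follows G v X Y bad c) (hp : ¬ bad c.p) :
    ¬ (v.Recovers ∧ c.Unrecoverable G) := by
  rintro ⟨hv, u, hu, hr, ho, w, hs, hw⟩
  rw [h.alive] at hu hw
  have hle : X.reg u ≤ c.p := by
    by_contra hlt
    rw [h.above u hu (by omega)] at hr
    exact hlt (by have : X.reg u = c.p := by exact_mod_cast hr
                  omega)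
  have he := h.reg_eq_of_r_eq hp hu hle hr
  rw [← he] at hr hp
  have ho' : G.owner u = Player.ofPriority (X.reg u) := by rw [ho, he]; rfl
  obtain ⟨_, hwa, hwr⟩ := h.strat_mem hv u hu hr hp ho' w hs
  rcases hw with hw | hw
  · exact hw hwa
  · have : w ∈ c.sub := h.mem_sub.2 ⟨hwa, by omega⟩
    rw [Config.sub, Finset.mem_filter] at this
    exact absurd this.2 (not_le_of_gt hw)

theorem unrecoverable (h : Follows G v X Y bad c) (hp : bad c.p) :
    v.Recovers ∧ c.Unrecoverable G := by
  obtain ⟨_, hv, u, hu, hr, ho, _, w, hs, hw⟩ := h.witness c.p hp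
  refine ⟨hv, u, h.alive ▸ hu, hr, ho, w, hs, ?_⟩
  by_cases hwa : w ∈ X.alive
  · right
    rcases hw with hw | hw
    · exact absurd hwa hw
    · rw [h.above w hwa hw]
      exact_mod_cast hw
  · left
    rwa [h.alive]

end Follows

theorem unbotD_natCast (n : ℕ) : (n : WithBot ℕ).unbotD 0 = n := rfl

/-- The priority at which a search continues is the highest region of the layout that is left, or
a region that has to be reset. -/
theorem top_spec (hX : IsDecomposition G X.alive X.reg X.core) {r : V → WithBot ℕ} {p : ℕ}
    {T : Finset V} (hT : ∀ u, u ∈ T ↔ u ∈ X.alive ∧ X.reg u ≤ p) (hne : T.Nonempty)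
    (hr : ∀ u ∈ T, r u ≤ (X.reg u : WithBot ℕ) ∨ ∃ x : ℕ, bad x ∧ r u = (x : WithBot ℕ))
    (hcore : ∀ u ∈ T, X.core u → r u = (X.reg u : WithBot ℕ)) :
    (∀ u ∈ T, X.reg u ≤ Config.top G r T) ∧
      (bad (Config.top G r T) ∨ ∃ u ∈ T, X.reg u = Config.top G r T) := by
  have hge : ∀ u ∈ T, X.reg u ≤ Config.top G r T := by
    intro u hu
    obtain ⟨w, hw, hwu, hb⟩ := hX.exists_base ((hT u).1 hu).1
    have hwT : w ∈ T := (hT w).2 ⟨hw, hwu ▸ ((hT u).1 hu).2⟩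
    refine le_trans ?_ (Finset.le_sup (f := fun v => max (G.pr v) ((r v).unbotD 0)) hwT)
    rcases hb with hb | hb
    · exact le_max_of_le_left (by omega)
    · refine le_max_of_le_right ?_
      rw [hcore w hwT hb, unbotD_natCast]
      omega
  refine ⟨hge, ?_⟩
  obtain ⟨u, hu, he⟩ := Finset.exists_mem_eq_sup T hne
    fun v => max (G.pr v) ((r v).unbotD 0)
  have hle := hX.pr_le u ((hT u).1 hu).1
  have hgu := hge u hu
  rw [Config.top] at hgu ⊢
  rw [he] at hgu ⊢
  rcases hr u hu with h | ⟨x, hx, h⟩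
  · right
    refine ⟨u, hu, le_antisymm hgu (max_le hle ?_)⟩
    exact WithBot.unbotD_le_iff (by simp) |>.2 h
  · rw [h, unbotD_natCast] at hgu ⊢
    by_cases hlt : G.pr u < x
    · left
      rwa [max_eq_right hlt.le]
    · right
      rw [max_eq_left (by omega)] at hgu ⊢
      exact ⟨u, hu, le_antisymm hgu hle⟩

namespace Config

@[simp] theorem refresh_alive (c : Config V) : c.refresh.alive = c.alive := by
  unfold refresh; split_ifs <;> rfl

@[simp] theorem refresh_won (c : Config V) : c.refresh.won = c.won := by
  unfold refresh; split_ifs <;> rfl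

@[simp] theorem refresh_r (c : Config V) : c.refresh.r = c.r := by
  unfold refresh; split_ifs <;> rfl

@[simp] theorem refresh_p (c : Config V) : c.refresh.p = c.p := by
  unfold refresh; split_ifs <;> rfl

@[simp] theorem refresh_delayed (c : Config V) : c.refresh.delayed = c.delayed := by
  unfold refresh; split_ifs <;> rfl

theorem mem_refresh_merged {c : Config V} {d : ℕ} : d ∈ c.refresh.merged ↔
    d ∈ c.merged ∧ (d = c.p → ∃ u ∈ c.alive, c.r u = (c.p : WithBot ℕ)) := by
  unfold refresh
  split_ifs with h
  · exact ⟨fun hd => ⟨hd, fun _ => h⟩, fun hd => hd.1⟩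
  · rw [Finset.mem_erase]
    exact ⟨fun hd => ⟨hd.2, fun he => absurd he hd.1⟩, fun hd => ⟨fun he => h (hd.2 he), hd.1⟩⟩

theorem refresh_record_subset (c : Config V) : c.refresh.record ⊆ c.record := by
  unfold refresh
  split_ifs
  · exact fun _ h => h
  · exact Finset.erase_subset _ _

/-- The configuration after the region `Z` has been recorded at the current priority. -/
def recorded (c : Config V) (σ : V → Option V) (Z : Finset V) : Config V :=
  ({ c.refresh with strat := σ } : Config V).assign Z c.p

theorem recorded_sub {Z : Finset V} (hZ : Z ⊆ c.sub) : (c.recorded σ Z).sub = c.sub := by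
  ext u
  simp only [recorded, assign, sub, refresh_alive, refresh_r, refresh_p, Finset.mem_filter]
  refine and_congr_right fun _ => ?_
  split_ifs with hu
  · exact ⟨fun _ => (Finset.mem_filter.1 (hZ hu)).2, fun _ => le_rfl⟩
  · rfl

end Config

/-! ### Recording regions -/

theorem r_le_top {r : V → WithBot ℕ} {T : Finset V} {u : V} (hu : u ∈ T) :
    r u ≤ (Config.top G r T : WithBot ℕ) := by
  have := Finset.le_sup (f := fun v => max (G.pr v) ((r v).unbotD 0)) hu
  have h2 : (r u).unbotD 0 ≤ Config.top G r T := (le_max_right _ _).trans this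
  exact (WithBot.unbotD_le_iff (by simp)).1 h2

theorem Config.mem_discard_merged {R : ℕ → Prop} {d : ℕ} :
    d ∈ (c.discard R).merged ↔ d ∈ c.merged ∧ ¬ R d := by
  simp [Config.discard]

theorem Config.mem_discard_record {R : ℕ → Prop} {d : ℕ} :
    d ∈ (c.discard R).record ↔ d ∈ c.record ∧ ¬ R d := by
  simp [Config.discard]

namespace Follows

/-- A region that region recovery cannot recover is reset, and the search goes on. -/
theorem step_discard (h : Follows G v X Y bad c) (hX : IsDecomposition G X.alive X.reg X.core)
    (hp : bad c.p) (σ : V → Option V) :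
    ∃ c', c.step v keep G σ = (c', false) ∧ c'.p ≤ c.p ∧
      (∀ u ∈ X.alive, X.reg u ≤ c.p → X.reg u ≤ c'.p) ∧
      ((bad c'.p ∧ c'.p ≠ c.p) ∨ ∃ u ∈ X.alive, X.reg u = c'.p) ∧
      Follows G v X Y (fun x => bad x ∧ x ≠ c.p) c' := by
  have hun := h.unrecoverable hp
  obtain ⟨-, hv, u₀, hu₀, hr₀, ho₀, hle₀, -⟩ := h.witness c.p hp
  have hne : c.alive ≠ ∅ := by
    rw [h.alive]
    exact Finset.ne_empty_of_mem hu₀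
  set r' := (c.discard fun x => x = c.p).r with hr'
  have hr'u : ∀ u, r' u = if c.r u = (c.p : WithBot ℕ) then ⊥ else c.r u := by
    intro u
    simp only [hr', Config.discard, exists_eq_right]
  have hs'u : ∀ u, (c.discard fun x => x = c.p).strat u =
      if c.r u = (c.p : WithBot ℕ) then none else c.strat u := by
    intro u
    simp only [Config.discard, exists_eq_right]
  have hcore : ∀ u ∈ X.alive, X.core u → r' u = (X.reg u : WithBot ℕ) := by
    intro u hu hc
    rw [hr'u, if_neg, h.core_eq u hu hc]
    rw [h.core_eq u hu hc]
    intro he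
    have : X.reg u = c.p := by exact_mod_cast he
    exact h.core_bad u hu hc (this ▸ hp)
  have hbelow : ∀ u ∈ X.alive, r' u ≤ (X.reg u : WithBot ℕ) ∨
      ∃ x : ℕ, ((bad x ∧ x ≠ c.p) ∧ x ≤ c.p) ∧ r' u = (x : WithBot ℕ) := by
    intro u hu
    rw [hr'u]
    split_ifs with he
    · exact .inl bot_le
    · rcases h.below u hu with h₁ | ⟨x, hx, h₁⟩
      · exact .inl h₁
      · exact .inr ⟨x, ⟨⟨hx, fun hxe => he (by rw [h₁, hxe])⟩, (h.witness x hx).1⟩, h₁⟩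
  have hsub := fun u => h.mem_sub (u := u)
  obtain ⟨hge, hhit⟩ := top_spec hX (r := r') (p := c.p) (T := c.sub) hsub
    ⟨u₀, (hsub u₀).2 ⟨hu₀, hle₀⟩⟩ (fun u hu => hbelow u ((hsub u).1 hu).1)
    (fun u hu => hcore u ((hsub u).1 hu).1)
  set p' := Config.top G r' c.sub with hp'
  have hp'le : p' ≤ c.p := by
    rcases hhit with hb | ⟨u, hu, he⟩
    · exact hb.2
    · exact he ▸ ((hsub u).1 hu).2
  have habove : ∀ u ∈ X.alive, p' < X.reg u → c.p < X.reg u := by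
    intro u hu hlt
    by_contra hle
    have := hge u ((hsub u).2 ⟨hu, by omega⟩)
    omega
  have hne_p : ∀ u, ∀ {d : ℕ}, c.r u = (d : WithBot ℕ) → d ≠ c.p → c.r u ≠ (c.p : WithBot ℕ) := by
    intro u d hd hne he
    rw [hd] at he
    exact hne (by exact_mod_cast he)
  refine ⟨{ (c.discard fun x => x = c.p) with p := p' }, ?_, hp'le, ?_, ?_, ?_⟩
  · rw [Config.step, if_neg hne, if_pos hun]
  · exact fun u hu hle => hge u ((hsub u).2 ⟨hu, hle⟩)
  · rcases hhit with hb | ⟨u, hu, he⟩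
    · exact .inl hb.1
    · exact .inr ⟨u, ((hsub u).1 hu).1, he⟩
  · refine ⟨h.alive, h.won, ?_, ?_, hcore, fun u hu hc hb => h.core_bad u hu hc hb.1, ?_, ?_, ?_,
      ?_, ?_, ?_, h.delayed, ?_, ?_, ?_⟩
    · intro u hu hlt
      have hlt' := habove u hu hlt
      show r' u = _
      rw [hr'u, if_neg (hne_p u (h.above u hu hlt') hlt'.ne'), h.above u hu hlt']
    · intro u hu
      show r' u ≤ _ ∨ _
      by_cases hle : X.reg u ≤ c.p
      · rcases hbelow u hu with h₁ | ⟨x, hx, h₁⟩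
        · exact .inl h₁
        · exact .inr ⟨x, hx.1, h₁⟩
      · left
        rw [hr'u, if_neg (hne_p u (h.above u hu (by omega)) (by omega)), h.above u hu (by omega)]
    · intro u hu hc
      refine Config.mem_discard_merged.2 ⟨h.core_merged u hu hc, fun he => h.core_bad u hu hc ?_⟩
      rw [he]
      exact hp
    · intro hv u w hk
      obtain ⟨h₁, h₂, h₃, h₄, h₅⟩ := h.kept hv u w hk
      have : c.r u ≠ (c.p : WithBot ℕ) := hne_p u h₃ fun he => h₅ (he ▸ hp)
      refine ⟨h₁, h₂, ?_, ?_, fun hb => h₅ hb.1⟩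
      · show r' u = _
        rw [hr'u, if_neg this, h₃]
      · rw [← h₄]
        exact (hs'u u).trans (if_neg this)
    · rintro x ⟨hx, hxp⟩
      obtain ⟨h₀, h₁, u, h₂, h₃, h₄, h₅, w, h₆, h₇⟩ := h.witness x hx
      have : c.r u ≠ (c.p : WithBot ℕ) := hne_p u h₃ hxp
      have hru : r' u = (x : WithBot ℕ) := by rw [hr'u, if_neg this, h₃]
      refine ⟨?_, h₁, u, h₂, hru, h₄, h₅, w, ?_, h₇⟩
      · have := r_le_top (G := G) (r := r') ((hsub u).2 ⟨h₂, h₅.trans h₀⟩)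
        rw [hru] at this
        exact_mod_cast this
      · exact ((hs'u u).trans (if_neg this)).trans h₆
    · intro hv u hu hr hb ho w hs
      have hr : r' u = _ := hr
      rw [hr'u] at hr
      have hs := (hs'u u).symm.trans hs
      split_ifs at hr hs with he
      exact h.strat_mem hv u hu hr (fun hb' => hb ⟨hb', fun hx => he (by rw [hr, hx])⟩) ho w hs
    · intro hv u hu hr hb ho hpr
      have hr : r' u = _ := hr
      rw [hr'u] at hr
      show (c.discard fun x => x = c.p).strat u ≠ none
      rw [hs'u]
      split_ifs at hr ⊢ with he
      · exact absurd hr (by simp)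
      · exact h.strat_some hv u hu hr (fun hb' => hb ⟨hb', fun hx => he (by rw [hr, hx])⟩) ho hpr
    · intro hv u hu hs
      have hs : (c.discard fun x => x = c.p).strat u ≠ none := hs
      rw [hs'u] at hs
      show _ ≤ r' u
      rw [hr'u]
      split_ifs at hs ⊢ with he
      · exact absurd rfl hs
      · exact h.pr_le hv u hu hs
    · intro d hd hm u hu
      have := h.avoid d hd (Config.mem_discard_merged.1 hm).1 u hu
      show r' u ≠ _
      rw [hr'u]
      split_ifs
      · simp
      · exact this
    · exact fun d hd => h.record d (Config.mem_discard_record.1 hd).1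
    · intro hv d hd
      obtain ⟨h₁, h₂⟩ := h.fresh hv d hd
      refine ⟨fun hle u hu => ?_, fun hlt => ?_⟩
      · show r' u ≠ _
        rw [hr'u]
        split_ifs
        · simp
        · exact h₁ (le_trans hle hp'le) u hu
      · by_cases hdp : c.p < d
        · obtain ⟨rank, hrank⟩ := h₂ hdp
          refine ⟨rank, fun u hu he hpr => ?_⟩
          have hru : c.r u ≠ (c.p : WithBot ℕ) :=
            hne_p u (h.above u hu (by omega)) (by omega)
          show (_ → ∃ w ∈ _, _ ∧ (c.discard fun x => x = c.p).strat u = _ ∧ _) ∧ _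
          rw [hs'u, if_neg hru]
          exact hrank u hu he hpr
        · refine ⟨fun _ => 0, fun u hu he _ => ?_⟩
          have := habove u hu (he ▸ hlt)
          omega

/-- The invariant is preserved when a region of the layout is recorded. -/
theorem recorded (h : Follows G v X Y bad c) (hX : IsDecomposition G X.alive X.reg X.core)
    (hp : ¬ bad c.p) (hσ : c.IsStrategyUpdate G (c.region G) σ) {p' : ℕ} (hlt : p' < c.p)
    (hge : ∀ u ∈ X.alive, X.reg u < c.p → X.reg u ≤ p')
    (hr : ∀ u ∈ X.alive, X.reg u < c.p → c.r u ≤ (p' : WithBot ℕ)) :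
    Follows G v X Y bad { (c.recorded σ (X.region c.p)) with p := p' } := by
  rw [h.region_eq hp hX] at hσ
  obtain ⟨hσ₁, hσ₂, hσ₃, hσ₄, rank, hσ₅⟩ := hσ
  have hZ : ∀ u ∈ X.alive, u ∈ X.region c.p ↔ X.reg u = c.p := fun u hu => by
    rw [Layout.mem_region]; tauto
  have hr' : ∀ u ∈ X.alive, (c.recorded σ (X.region c.p)).r u =
      if X.reg u = c.p then (c.p : WithBot ℕ) else c.r u := by
    intro u hu
    simp only [Config.recorded, Config.assign, Config.refresh_r, hZ u hu]
  have hmerged : ∀ d, d ∈ (c.recorded σ (X.region c.p)).merged ↔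
    d ∈ c.merged ∧ (d = c.p → ∃ u ∈ c.alive, c.r u = (c.p : WithBot ℕ)) := fun d =>
      Config.mem_refresh_merged
  have hstrat : ∀ u ∈ X.alive, X.reg u ≠ c.p → σ u = c.strat u := fun u hu hne =>
    hσ₁ u fun hm => hne ((hZ u hu).1 hm)
  -- a vertex of the current region that already has a strategy keeps it
  have hkeep : v.Recovers → ∀ u ∈ X.alive, X.reg u = c.p → u ∈ c.target G → c.strat u ≠ none →
      c.r u = (c.p : WithBot ℕ) := by
    intro hv u hu he ht hs
    rcases (h.mem_target.1 ht).2 with hr | hr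
    · exact hr
    · have hle := h.pr_le hv u hu hs
      rw [hr] at hle
      rcases h.below u hu with h₁ | ⟨x, hx, h₁⟩
      · exact le_antisymm (he ▸ h₁) hle
      · rw [h₁] at hle ⊢
        have : c.p ≤ x := by exact_mod_cast hle
        exact absurd (le_antisymm (h.witness x hx).1 this ▸ hx) hp
  refine ⟨?_, ?_, ?_, ?_, ?_, h.core_bad, ?_, ?_, ?_, ?_, ?_, ?_, ?_, ?_, ?_, ?_⟩
  · simpa [Config.recorded, Config.assign] using h.alive
  · simpa [Config.recorded, Config.assign] using h.won
  · intro u hu hlt'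
    refine (hr' u hu).trans ?_
    split_ifs with he
    · rw [he]
    · refine h.above u hu ?_
      by_contra hle
      have := hge u hu (by omega)
      have : p' < X.reg u := hlt'
      omega
  · intro u hu
    show (c.recorded σ (X.region c.p)).r u ≤ _ ∨ ∃ x, _ ∧ (c.recorded σ (X.region c.p)).r u = _
    rw [hr' u hu]
    split_ifs with he
    · exact .inl (by rw [he])
    · rcases h.below u hu with h₁ | ⟨x, hx, h₁⟩
      · exact .inl h₁
      · exact .inr ⟨x, hx, h₁⟩
  · intro u hu hc
    refine (hr' u hu).trans ?_
    split_ifs with he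
    · rw [he]
    · exact h.core_eq u hu hc
  · intro u hu hc
    refine (hmerged _).2 ⟨h.core_merged u hu hc, fun he => ⟨u, h.alive ▸ hu, ?_⟩⟩
    rw [h.core_eq u hu hc, he]
  · intro hv u w hk
    obtain ⟨h₁, h₂, h₃, h₄, h₅⟩ := h.kept hv u w hk
    refine ⟨h₁, h₂, (hr' u h₁).trans ?_, ?_, h₅⟩
    · split_ifs with he
      · rw [he]
      · exact h₃
    · show σ u = some w
      by_cases he : X.reg u = c.p
      · rw [hσ₃ u (h.mem_target.2 ⟨⟨h₁, he.le⟩, .inl (by rw [h₃, he])⟩) (by rw [h₂, he]; rfl)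
          (by rw [h₄]; simp), h₄]
      · rw [hstrat u h₁ he, h₄]
  · intro x hx
    obtain ⟨h₀, h₁, u, h₂, h₃, h₄, h₅, w, h₆, h₇⟩ := h.witness x hx
    have hxp : x ≠ c.p := fun he => hp (he ▸ hx)
    refine ⟨?_, h₁, u, h₂, ?_, h₄, h₅, w, (hstrat u h₂ (by omega)).trans h₆, h₇⟩
    · have := hr u h₂ (by omega)
      rw [h₃] at this
      exact_mod_cast this
    · exact (hr' u h₂).trans ((if_neg (by omega)).trans h₃)
  · intro hv u hu hr hb ho w hs
    have hr := (hr' u hu).symm.trans hr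
    have hs : σ u = some w := hs
    by_cases he : X.reg u = c.p
    · have ho' : G.owner u = c.player := by rw [ho, he]; rfl
      have huZ := (hZ u hu).2 he
      by_cases ht : u ∈ c.target G
      · by_cases hn : c.strat u = none
        · rcases hσ₄ u ht ho' hn with ⟨w', hw', hs'⟩ | ⟨_, hs'⟩
          · rw [hs] at hs'
            obtain rfl : w = w' := by simpa using hs'
            rw [Finset.mem_inter, Layout.mem_region] at hw'
            exact ⟨hw'.1, hw'.2.1, hw'.2.2.trans he.symm⟩
          · rw [hs] at hs'
            simp at hs'
        · rw [hσ₃ u ht ho' hn] at hs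
          exact h.strat_mem hv u hu (by rw [hkeep hv u hu he ht hn, he]) hb ho w hs
      · obtain ⟨w', hw', hs', _⟩ := (hσ₅ u (Finset.mem_sdiff.2 ⟨huZ, ht⟩)).1 ho'
        rw [hs] at hs'
        obtain rfl : w = w' := by simpa using hs'
        rw [Finset.mem_inter, Layout.mem_region] at hw'
        exact ⟨hw'.1, hw'.2.1, hw'.2.2.trans he.symm⟩
    · rw [if_neg he] at hr
      rw [hstrat u hu he] at hs
      exact h.strat_mem hv u hu hr hb ho w hs
  · intro hv u hu hr hb ho hpr
    have hr := (hr' u hu).symm.trans hr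
    show σ u ≠ none
    by_cases he : X.reg u = c.p
    · have ho' : G.owner u = c.player := by rw [ho, he]; rfl
      by_cases ht : u ∈ c.target G
      · have hru : c.r u = (X.reg u : WithBot ℕ) := by
          rcases (h.mem_target.1 ht).2 with hr | hr
          · rw [hr, he]
          · exact absurd (hr.trans he.symm) hpr
        have := h.strat_some hv u hu hru hb ho hpr
        rwa [hσ₃ u ht ho' this]
      · obtain ⟨w', _, hs', _⟩ := (hσ₅ u (Finset.mem_sdiff.2 ⟨(hZ u hu).2 he, ht⟩)).1 ho'
        rw [hs']
        simp
    · rw [if_neg he] at hr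
      rw [hstrat u hu he]
      exact h.strat_some hv u hu hr hb ho hpr
  · intro hv u hu hs
    refine le_of_le_of_eq ?_ (hr' u hu).symm
    split_ifs with he
    · have := hX.pr_le u hu
      rw [he] at this
      exact_mod_cast this
    · have hs : σ u ≠ none := hs
      rw [hstrat u hu he] at hs
      exact h.pr_le hv u hu hs
  · intro u
    simpa [Config.recorded, Config.assign] using h.delayed u
  · intro d hd hm u hu hr
    have hr := (hr' u hu).symm.trans hr
    obtain ⟨hm₁, hm₂⟩ := (hmerged d).1 hm
    have hav := h.avoid d hd hm₁
    by_cases hdp : d = c.p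
    · obtain ⟨w, hw, hrw⟩ := hm₂ hdp
      exact hav w (h.alive ▸ hw) (by rw [hrw, hdp])
    · split_ifs at hr with he
      · exact hdp (by exact_mod_cast hr.symm)
      · exact hav u hu hr
  · exact fun d hd => h.record d (Config.refresh_record_subset c hd)
  · intro hv d hd
    obtain ⟨h₁, h₂⟩ := h.fresh hv d hd
    refine ⟨fun hle u hu hr => ?_, fun hlt' => ?_⟩
    · have hle : d ≤ p' := hle
      have hr := (hr' u hu).symm.trans hr
      split_ifs at hr with he
      · have : c.p = d := by exact_mod_cast hr
        omega
      · exact h₁ (by omega) u hu hr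
    · rcases lt_trichotomy c.p d with hdp | hdp | hdp
      · obtain ⟨rank, hrank⟩ := h₂ hdp
        refine ⟨rank, fun u hu he hpr => ?_⟩
        show (_ → ∃ w ∈ _, _ ∧ σ u = _ ∧ _) ∧ _
        rw [hstrat u hu (by omega)]
        exact hrank u hu he hpr
      · refine ⟨rank, fun u hu he hpr => ?_⟩
        have ht : u ∉ c.target G := by
          intro ht
          rcases (h.mem_target.1 ht).2 with hr | hr
          · exact h₁ hdp.ge u hu (by rw [hr, hdp])
          · exact hpr (hr.trans hdp)
        obtain ⟨h₃, h₄⟩ := hσ₅ u (Finset.mem_sdiff.2 ⟨(hZ u hu).2 (he.trans hdp.symm), ht⟩)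
        refine ⟨fun ho => ?_, fun ho w hw hwa hwd => h₄ (by rwa [← hdp] at ho) w ?_⟩
        · obtain ⟨w, hw, hs, hrk⟩ := h₃ (by rw [ho, ← hdp]; rfl)
          rw [Finset.mem_inter, Layout.mem_region] at hw
          exact ⟨w, hw.1, hw.2.2.trans hdp, hs, hrk⟩
        · rw [Finset.mem_inter, h.mem_sub]
          exact ⟨hw, hwa, by omega⟩
      · refine ⟨fun _ => 0, fun u hu he _ => ?_⟩
        have : p' < d := hlt'
        have := hge u hu (by omega)
        omega

end Follows

/-! ### Open regions -/

/-- The region `p` of a layout is open in the subgame of all vertices in regions up to `p`. -/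
def Layout.IsOpen (X : Layout V) (G : ParityGame V) (p : ℕ) : Prop :=
  (∃ u ∈ X.alive, X.reg u = p ∧ G.owner u = Player.ofPriority p ∧
    ∀ w ∈ G.succ u, w ∈ X.alive → X.reg w ≠ p) ∨
  ∃ u ∈ X.alive, X.reg u = p ∧ G.owner u ≠ Player.ofPriority p ∧
    ∃ w ∈ G.succ u, w ∈ X.alive ∧ X.reg w < p

theorem Config.mem_esc {Z : Finset V} {w : V} : w ∈ c.esc G Z ↔
    (∃ u ∈ Z, G.owner u ≠ c.player ∧ w ∈ G.succ u) ∧ w ∈ c.alive ∧ w ∉ Z := by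
  simp only [Config.esc, Finset.mem_sdiff, Finset.mem_inter, Finset.mem_biUnion,
    Finset.mem_filter, and_assoc]

namespace Follows

theorem isOpenRegion_iff (h : Follows G v X Y bad c) :
    c.IsOpenRegion G (X.region c.p) ↔ X.IsOpen G c.p := by
  refine or_congr ⟨?_, ?_⟩ ⟨?_, ?_⟩
  · rintro ⟨u, hu, ho, hw⟩
    rw [Layout.mem_region] at hu
    exact ⟨u, hu.1, hu.2, ho, fun w hws hwa he => hw w hws (Layout.mem_region.2 ⟨hwa, he⟩)⟩
  · rintro ⟨u, hu, he, ho, hw⟩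
    refine ⟨u, Layout.mem_region.2 ⟨hu, he⟩, ho, fun w hws hwZ => ?_⟩
    rw [Layout.mem_region] at hwZ
    exact hw w hws hwZ.1 hwZ.2
  · rintro ⟨w, hw⟩
    rw [Finset.mem_inter, Config.mem_esc, h.mem_sub, Layout.mem_region] at hw
    obtain ⟨⟨⟨u, hu, ho, hws⟩, _, hwZ⟩, hwa, hle⟩ := hw
    rw [Layout.mem_region] at hu
    exact ⟨u, hu.1, hu.2, ho, w, hws, hwa, lt_of_le_of_ne hle fun he => hwZ ⟨hwa, he⟩⟩
  · rintro ⟨u, hu, he, ho, w, hws, hwa, hlt⟩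
    refine ⟨w, ?_⟩
    rw [Finset.mem_inter, Config.mem_esc, h.mem_sub, Layout.mem_region]
    exact ⟨⟨⟨u, Layout.mem_region.2 ⟨hu, he⟩, ho, hws⟩, h.alive ▸ hwa, fun hZ => hlt.ne hZ.2⟩,
      hwa, hlt.le⟩

theorem region_subset_sub (h : Follows G v X Y bad c) : X.region c.p ⊆ c.sub := fun u hu => by
  rw [Layout.mem_region] at hu
  exact h.mem_sub.2 ⟨hu.1, hu.2.le⟩

theorem mem_rest (h : Follows G v X Y bad c) {u : V} :
    u ∈ (c.recorded σ (X.region c.p)).sub \ X.region c.p ↔ u ∈ X.alive ∧ X.reg u < c.p := by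
  rw [Config.recorded_sub h.region_subset_sub, Finset.mem_sdiff, h.mem_sub, Layout.mem_region]
  constructor
  · rintro ⟨⟨h₁, h₂⟩, h₃⟩
    exact ⟨h₁, lt_of_le_of_ne h₂ fun he => h₃ ⟨h₁, he⟩⟩
  · rintro ⟨h₁, h₂⟩
    exact ⟨⟨h₁, h₂.le⟩, fun he => h₂.ne he.2⟩

/-- An open region is recorded, and the search goes on with the next lower region. -/
theorem step_open (h : Follows G v X Y bad c) (hX : IsDecomposition G X.alive X.reg X.core)
    (hp : ¬ bad c.p) (hopen : X.IsOpen G c.p) (hrest : ∃ u ∈ X.alive, X.reg u < c.p)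
    (hσ : c.IsStrategyUpdate G (c.region G) σ) :
    ∃ c', c.step v keep G σ = (c', false) ∧ c'.p < c.p ∧
      (∀ u ∈ X.alive, X.reg u < c.p → X.reg u ≤ c'.p) ∧
      (bad c'.p ∨ ∃ u ∈ X.alive, X.reg u = c'.p) ∧ Follows G v X Y bad c' := by
  obtain ⟨u₀, hu₀, hlt₀⟩ := hrest
  have hne : c.alive ≠ ∅ := by
    rw [h.alive]
    exact Finset.ne_empty_of_mem hu₀
  have hmem := fun u => h.mem_rest (σ := σ) (u := u)
  set c₁ := c.recorded σ (X.region c.p) with hc₁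
  have hr : ∀ u ∈ c₁.sub \ X.region c.p, c₁.r u = c.r u := by
    intro u hu
    simp only [hc₁, Config.recorded, Config.assign, Config.refresh_r]
    rw [if_neg (Finset.mem_sdiff.1 hu).2]
  obtain ⟨hge, hhit⟩ := top_spec hX (bad := fun x => bad x ∧ x ≠ c.p) (r := c₁.r) (p := c.p - 1)
    (T := c₁.sub \ X.region c.p)
    (fun u => by rw [hmem]; refine and_congr_right fun _ => ?_; omega) ⟨u₀, (hmem u₀).2 ⟨hu₀, hlt₀⟩⟩
    (fun u hu => by
      rw [hr u hu]
      rcases h.below u ((hmem u).1 hu).1 with h₁ | ⟨x, hx, h₁⟩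
      · exact .inl h₁
      · exact .inr ⟨x, ⟨hx, fun he => hp (he ▸ hx)⟩, h₁⟩)
    (fun u hu hc => by rw [hr u hu, h.core_eq u ((hmem u).1 hu).1 hc])
  set p' := Config.top G c₁.r (c₁.sub \ X.region c.p) with hp'
  have hlt : p' < c.p := by
    rcases hhit with ⟨hb, hne⟩ | ⟨u, hu, he⟩
    · exact lt_of_le_of_ne (h.witness _ hb).1 hne
    · exact he ▸ ((hmem u).1 hu).2
  have hge' : ∀ u ∈ X.alive, X.reg u < c.p → X.reg u ≤ p' := fun u hu hlt =>
    hge u ((hmem u).2 ⟨hu, hlt⟩)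
  refine ⟨{ c₁ with p := p' }, ?_, hlt, hge', ?_, ?_⟩
  · rw [Config.step, if_neg hne, if_neg (h.not_unrecoverable hp)]
    simp only [h.region_eq hp hX]
    rw [if_pos (h.isOpenRegion_iff.2 hopen)]
    show c₁.descend v G (X.region c.p) = _
    rw [Config.descend, if_pos ⟨u₀, (hmem u₀).2 ⟨hu₀, hlt₀⟩⟩]
  · rcases hhit with hb | ⟨u, hu, he⟩
    · exact .inl hb.1
    · exact .inr ⟨u, ((hmem u).1 hu).1, he⟩
  · refine h.recorded hX hp hσ hlt hge' fun u hu hlt => ?_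
    have hu' := (hmem u).2 ⟨hu, hlt⟩
    rw [← hr u hu']
    exact r_le_top hu'

/-- A search computes the layout until it reaches a region `f` such that all regions above `f` are
open. -/
theorem reach {cs : ℕ → Config V} {b : ℕ → Bool} (hrun : IsRun G v keep cs b)
    (hX : IsDecomposition G X.alive X.reg X.core) {f : ℕ} (hf : ∃ u ∈ X.alive, X.reg u = f)
    (hopen : ∀ u ∈ X.alive, f < X.reg u → X.IsOpen G (X.reg u))
    (hrest : (∀ u ∈ X.alive, f ≤ X.reg u) ∨ ¬ v.Recovers) {n : ℕ}
    (h : Follows G v X Y bad (cs n)) (hfn : f ≤ (cs n).p)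
    (hhit : bad (cs n).p ∨ ∃ u ∈ X.alive, X.reg u = (cs n).p) :
    ∃ m ≥ n, (∀ i, n ≤ i → i < m → b i = false) ∧ (cs m).p = f ∧
      Follows G v X Y (fun _ => False) (cs m) := by
  classical
  obtain ⟨u₀, hu₀, he₀⟩ := hf
  -- the reset of a region may leave the priority unchanged, but then the region is no longer `bad`
  induction hk : 2 * (cs n).p + (if bad (cs n).p then 1 else 0) using Nat.strong_induction_on
    generalizing n bad with
  | _ k ih =>
    obtain ⟨σ, hσ, hstep⟩ := hrun.2 n
    by_cases hb : bad (cs n).p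
    · obtain ⟨c', hc', h₁, h₂, h₃, h₄⟩ := h.step_discard (keep := keep) hX hb σ
      rw [hc', Prod.mk.injEq] at hstep
      obtain ⟨rfl, hbn⟩ := hstep
      obtain ⟨m, hm, hm₁, hm₂, hm₃⟩ := ih _
        (by rw [← hk, if_pos hb]; split_ifs with hb' <;> omega) h₄
        (he₀ ▸ h₂ u₀ hu₀ (by omega)) h₃ rfl
      refine ⟨m, by omega, fun i hi him => ?_, hm₂, hm₃⟩
      rcases Nat.eq_or_lt_of_le hi with rfl | hi
      · exact hbn.symm
      · exact hm₁ i hi him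
    · rcases hfn.eq_or_lt with he | hlt
      · refine ⟨n, le_rfl, fun i hi him => by omega, he.symm, ?_⟩
        have hF : bad = fun _ => False := by
          funext x
          rw [eq_iff_iff, iff_false]
          intro hx
          obtain ⟨hxp, hv, u, hu, _, _, hle, _⟩ := h.witness x hx
          have : x ≠ (cs n).p := fun he => hb (he ▸ hx)
          rcases hrest with hr | hr
          · have := hr u hu
            omega
          · exact hr hv
        exact hF ▸ h
      · obtain ⟨u₁, hu₁, he₁⟩ := hhit.resolve_left hb
        obtain ⟨c', hc', h₁, h₂, h₃, h₄⟩ := h.step_open (keep := keep) hX hb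
          (he₁ ▸ hopen u₁ hu₁ (he₁ ▸ hlt)) ⟨u₀, hu₀, he₀ ▸ hlt⟩ hσ
        rw [hc', Prod.mk.injEq] at hstep
        obtain ⟨rfl, hbn⟩ := hstep
        have hlt' : 2 * (cs (n + 1)).p + (if bad (cs (n + 1)).p then 1 else 0) < k := by
          rw [← hk, if_neg hb]
          split_ifs <;> omega
        obtain ⟨m, hm, hm₁, hm₂, hm₃⟩ := ih _ hlt' h₄ (he₀ ▸ h₂ u₀ hu₀ (by omega)) h₃ rfl
        refine ⟨m, by omega, fun i hi him => ?_, hm₂, hm₃⟩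
        rcases Nat.eq_or_lt_of_le hi with rfl | hi
        · exact hbn.symm
        · exact hm₁ i hi him

end Follows

/-! ### Promotions -/

variable {X' : Layout V} {Y' : Memo V} {bad' : ℕ → Prop} {f q : ℕ}

/-- What a normal promotion of the region `Z` of the current priority to `q` and the application of
a single delayed promotion of `Z` to `q` have in common. -/
structure Promoted (v : Variant) (c : Config V) (σ : V → Option V) (Z : Finset V) (q : ℕ)
    (c' : Config V) : Prop where
  alive : c'.alive = c.alive
  won : c'.won = c.won
  p : c'.p = q
  r_mem : ∀ u ∈ Z, c'.r u = (q : WithBot ℕ)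
  r_reset : ∀ u ∉ Z, ∀ x : ℕ, c.r u = (x : WithBot ℕ) → x < q → v.Resets c.player x → c'.r u = ⊥
  r_eq : ∀ u ∉ Z, (∀ x : ℕ, c.r u = (x : WithBot ℕ) → x < q → ¬ v.Resets c.player x) →
    c'.r u = c.r u
  strat : v.Recovers → ∀ u, c'.strat u = σ u
  merged : q ∈ c'.merged
  merged_of_mem : ∀ d ∈ c.merged, d ≠ c.p → (d < q → ¬ v.Resets c.player d) → d ∈ c'.merged
  record : ∀ d ∈ c'.record, d = q ∨ (d < q → ¬ v.Resets c.player d)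
  delayed : ∀ u, c'.delayed u = none

theorem Variant.Recovers.not_resets (hv : v.Recovers) (α : Player) (x : ℕ) :
    ¬ v.Resets α x := by
  cases v <;> simp_all [Variant.Recovers, Variant.Resets]

theorem mem_refresh_merged_of_ne {d : ℕ} (hd : d ∈ c.merged) (hne : d ≠ c.p) :
    d ∈ c.refresh.merged :=
  Config.mem_refresh_merged.2 ⟨hd, fun h => absurd h hne⟩

namespace Config

theorem discard_r_of_resets {R : ℕ → Prop} {u : V} {x : ℕ} (hx : c.r u = (x : WithBot ℕ))
    (hR : R x) : (c.discard R).r u = ⊥ :=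
  if_pos ⟨x, hx, hR⟩

theorem discard_r_of_not {R : ℕ → Prop} {u : V}
    (h : ∀ x : ℕ, c.r u = (x : WithBot ℕ) → ¬ R x) : (c.discard R).r u = c.r u :=
  if_neg fun ⟨x, hx, hR⟩ => h x hx hR

theorem discard_strat_of_not {R : ℕ → Prop} {u : V}
    (h : ∀ x : ℕ, c.r u = (x : WithBot ℕ) → ¬ R x) : (c.discard R).strat u = c.strat u :=
  if_neg fun ⟨x, hx, hR⟩ => h x hx hR

end Config

theorem promoted_of_discard {c₀ c' : Config V} {Z : Finset V} (halive : c'.alive = c.alive)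
    (hwon : c'.won = c.won) (hp : c'.p = q)
    (hr₀ : ∀ u, c₀.r u = if u ∈ Z then (q : WithBot ℕ) else c.r u) (hs₀ : c₀.strat = σ)
    (hr : c'.r = (c₀.discard fun x => x < q ∧ v.Resets c.player x).r)
    (hs : c'.strat = (c₀.discard fun x => x < q ∧ v.Resets c.player x).strat)
    (hq : q ∈ c'.merged)
    (hmerged : ∀ d ∈ c.merged, d ≠ c.p → (d < q → ¬ v.Resets c.player d) → d ∈ c'.merged)
    (hrecord : ∀ d ∈ c'.record, d = q ∨ (d < q → ¬ v.Resets c.player d))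
    (hdelayed : ∀ u, c'.delayed u = none) : Promoted v c σ Z q c' := by
  refine ⟨halive, hwon, hp, fun u hu => ?_, fun u hu x hx hlt hR => ?_, fun u hu hno => ?_,
    fun hv u => ?_, hq, hmerged, hrecord, hdelayed⟩
  · have h₀ : c₀.r u = (q : WithBot ℕ) := (hr₀ u).trans (if_pos hu)
    rw [hr, Config.discard_r_of_not, h₀]
    intro x hx hR
    rw [h₀] at hx
    have : q = x := by exact_mod_cast hx
    omega
  · have h₀ : c₀.r u = c.r u := (hr₀ u).trans (if_neg hu)
    rw [hr, Config.discard_r_of_resets (h₀.trans hx) ⟨hlt, hR⟩]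
  · have h₀ : c₀.r u = c.r u := (hr₀ u).trans (if_neg hu)
    rw [hr, Config.discard_r_of_not, h₀]
    intro x hx hR
    exact hno x (h₀.symm.trans hx) hR.1 hR.2
  · rw [hs, Config.discard_strat_of_not, hs₀]
    exact fun x _ hR => hv.not_resets _ _ hR.2

theorem promoted_promote (hdel : ∀ u, c.delayed u = none) (Z : Finset V) :
    Promoted v c σ Z q
      (Config.promote v ({ c.refresh with strat := σ } : Config V) Z q) := by
  have hpl : c.refresh.player = c.player := by simp [Config.player]
  set c₁ : Config V := { (({ c.refresh with strat := σ } : Config V).assign Z q) with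
      merged := c.refresh.merged.erase c.refresh.p
      record := c.refresh.record.erase c.refresh.p
      delayed := fun u => if u ∉ Z ∧ (q : WithBot ℕ) < c.refresh.r u then c.refresh.delayed u
        else none } with hc₁
  have hpro : Config.promote v ({ c.refresh with strat := σ } : Config V) Z q =
    { (c₁.discard fun x => x < q ∧ v.Resets c.refresh.player x) with
      p := q
      merged := insert q (c₁.discard fun x => x < q ∧ v.Resets c.refresh.player x).merged
      record := insert q (c₁.discard fun x => x < q ∧ v.Resets c.refresh.player x).record } := rfl
  rw [hpro, hpl]
  refine promoted_of_discard (c₀ := c₁) ?_ ?_ rfl ?_ rfl rfl rfl (Finset.mem_insert_self _ _)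
    ?_ ?_ ?_
  · exact Config.refresh_alive c
  · exact Config.refresh_won c
  · intro u
    simp [hc₁, Config.assign]
  · intro d hd hne hR
    refine Finset.mem_insert_of_mem (Config.mem_discard_merged.2 ⟨?_, fun h => hR h.1 h.2⟩)
    exact Finset.mem_erase.2 ⟨by simpa using hne, mem_refresh_merged_of_ne hd hne⟩
  · intro d hd
    rcases Finset.mem_insert.1 hd with hd | hd
    · exact .inl hd
    · exact .inr fun hlt hR => (Config.mem_discard_record.1 hd).2 ⟨hlt, hR⟩
  · intro u
    show c₁.delayed u = none
    simp [hc₁, hdel]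

/-- If only one promotion is delayed, then applying it has the same effect as the normal promotion,
except that the record is emptied. -/
theorem promoted_applyDelayed (hdel : ∀ u, c.delayed u = none) {Z : Finset V} (hZ : Z.Nonempty)
    (hq : Player.ofPriority q = c.player) :
    Promoted v c σ Z q
      (Config.applyDelayed v { (c.recorded σ Z) with
        delayed := fun u => if u ∈ Z then some q else c.delayed u }) := by
  set c₁ : Config V := { (c.recorded σ Z) with
    delayed := fun u => if u ∈ Z then some q else c.delayed u } with hc₁
  have hd₁ : ∀ u, c₁.delayed u = if u ∈ Z then some q else none := fun u => by
    simp [hc₁, hdel]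
  set m : ℕ := Finset.univ.sup fun u => (c₁.delayed u).getD 0 with hmdef
  have hm : m = q := by
    apply le_antisymm
    · refine Finset.sup_le fun u _ => ?_
      rw [hd₁]
      split_ifs <;> simp
    · obtain ⟨u, hu⟩ := hZ
      refine le_trans ?_ (Finset.le_sup (f := fun u => (c₁.delayed u).getD 0) (Finset.mem_univ u))
      simp [hd₁, hu]
  set c₂ : Config V := { c₁ with
      r := fun u => match c₁.delayed u with
        | some q' => if Player.ofPriority q' = Player.ofPriority m then (q' : WithBot ℕ)
          else c₁.r u
        | none => c₁.r u } with hc₂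
  set M : Finset ℕ := (Finset.univ.biUnion fun u => (c₁.delayed u).toFinset).filter
    fun q' => Player.ofPriority q' = Player.ofPriority m with hM
  have happ : Config.applyDelayed v c₁ =
    { (c₂.discard fun x => x < m ∧ v.Resets (Player.ofPriority m) x) with
      p := m
      merged := (c₂.discard fun x => x < m ∧ v.Resets (Player.ofPriority m) x).merged ∪ M
      record := ∅
      delayed := fun _ => none } := rfl
  rw [happ]
  clear_value m
  subst hm
  rw [hq]
  refine promoted_of_discard (c₀ := c₂) ?_ ?_ rfl ?_ rfl rfl rfl ?_ ?_ ?_ fun u => rfl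
  · exact Config.refresh_alive c
  · exact Config.refresh_won c
  · intro u
    simp only [hc₂]
    rw [hd₁]
    by_cases hu : u ∈ Z
    · simp [hu]
    · simp [hu, hc₁, Config.recorded, Config.assign]
  · refine Finset.mem_union_right _ (Finset.mem_filter.2 ⟨Finset.mem_biUnion.2 ?_, rfl⟩)
    obtain ⟨u, hu⟩ := hZ
    exact ⟨u, Finset.mem_univ u, by simp [hd₁, hu]⟩
  · intro d hd hne hR
    refine Finset.mem_union_left _ (Config.mem_discard_merged.2 ⟨?_, fun h => hR h.1 h.2⟩)
    exact mem_refresh_merged_of_ne hd hne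
  · intro d hd
    exact absurd hd (Finset.notMem_empty d)

/-- The region `f` of the layout `X` can be left by the opponent only to higher regions, of which
`q` is the lowest, and the promotion of `f` to `q` leads to the layout `X'`.  A region in between that is
neither reset nor `bad` loses no vertices to lower regions. -/
structure IsPromotion (G : ParityGame V) (v : Variant) (X X' : Layout V) (f q : ℕ)
    (bad : ℕ → Prop) : Prop where
  alive : X'.alive = X.alive
  won : X'.won = X.won
  lt : f < q
  parity : Player.ofPriority q = Player.ofPriority f
  own : ∀ u ∈ X.alive, X.reg u = f → G.owner u = Player.ofPriority f →
    ∃ w ∈ G.succ u, w ∈ X.alive ∧ X.reg w = f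
  opp : ∀ u ∈ X.alive, X.reg u = f → G.owner u ≠ Player.ofPriority f →
    ∀ w ∈ G.succ u, w ∈ X.alive → X.reg w = f ∨ q ≤ X.reg w
  escape : ∃ u ∈ X.alive, X.reg u = f ∧ G.owner u ≠ Player.ofPriority f ∧
    ∃ w ∈ G.succ u, w ∈ X.alive ∧ X.reg w = q
  base : ∀ u ∈ X.alive, X.reg u = f → X'.reg u = q
  high : ∀ u ∈ X.alive, q ≤ X.reg u → X'.reg u = X.reg u
  high' : ∀ u ∈ X.alive, q < X'.reg u → X.reg u = X'.reg u
  low : ∀ u ∈ X.alive, f < X.reg u → X.reg u < q →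
    v.Resets (Player.ofPriority f) (X.reg u) ∨ X.reg u ≤ X'.reg u ∨ bad (X.reg u)
  rest : ∀ u ∈ X.alive, X.reg u < f → X.reg u ≤ X'.reg u ∧ ¬ v.Recovers
  core : ∀ u ∈ X.alive, X'.core u → X.reg u = f ∨ (f < X.reg u ∧ X.core u ∧
    X'.reg u = X.reg u ∧ (X.reg u < q → ¬ v.Resets (Player.ofPriority f) (X.reg u)))
  core_bad : ∀ u ∈ X.alive, X'.core u → ¬ bad (X'.reg u)
  stay : v.Recovers → ∀ u ∈ X.alive, f < X.reg u → X'.reg u = X.reg u → ¬ bad (X.reg u) →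
    G.owner u = Player.ofPriority (X.reg u) → ∀ w ∈ G.succ u, w ∈ X.alive → X.reg w = X.reg u →
    X'.reg w = X.reg u

/-- If a search has computed all regions above `f`, then the region `f` is promoted to `q`. -/
theorem Follows.exists_promoted (h : Follows G v X Y bad c)
    (hX : IsDecomposition G X.alive X.reg X.core) (hp : ¬ bad c.p) (hf : c.p = f)
    (hP : IsPromotion G v X X' f q bad')
    (hrest : (∀ u ∈ X.alive, f ≤ X.reg u) ∨
      ∀ d, Y.record d → Player.ofPriority d ≠ Player.ofPriority f → q ≤ d) :
    ∃ c', c.step v keep G σ = (c', true) ∧ Promoted v c σ (X.region f) q c' := by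
  subst hf
  have hpl : c.player = Player.ofPriority c.p := rfl
  obtain ⟨u₀, hu₀, he₀, ho₀, w₀, hws₀, hwa₀, hw₀⟩ := hP.escape
  have hne : c.alive ≠ ∅ := by
    rw [h.alive]
    exact Finset.ne_empty_of_mem hu₀
  have hnopen : ¬ X.IsOpen G c.p := by
    rintro (⟨u, hu, he, ho, hw⟩ | ⟨u, hu, he, ho, w, hw, hwa, hlt⟩)
    · obtain ⟨w, hws, hwa, hwe⟩ := hP.own u hu he ho
      exact hw w hws hwa hwe
    · have := hP.opp u hu he ho w hw hwa
      have := hP.lt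
      omega
  have hqr : ∀ w ∈ X.alive, q ≤ X.reg w → c.r w = (X.reg w : WithBot ℕ) := fun w hw hle =>
    h.above w hw (lt_of_lt_of_le hP.lt hle)
  have hesc : ∀ w ∈ c.esc G (X.region c.p), w ∈ X.alive ∧ q ≤ X.reg w := by
    intro w hw
    obtain ⟨⟨u, hu, ho, hws⟩, hwa, hwZ⟩ := Config.mem_esc.1 hw
    rw [Layout.mem_region] at hu hwZ
    rw [h.alive] at hwa
    exact ⟨hwa, (hP.opp u hu.1 hu.2 ho w hws hwa).resolve_left fun he => hwZ ⟨hwa, he⟩⟩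
  have hw₀' : w₀ ∈ c.esc G (X.region c.p) := by
    refine Config.mem_esc.2 ⟨⟨u₀, Layout.mem_region.2 ⟨hu₀, he₀⟩, ho₀, hws₀⟩, h.alive ▸ hwa₀, ?_⟩
    rw [Layout.mem_region, hw₀]
    exact fun he => hP.lt.ne' he.2
  have hlow : c.lowestEscape G (X.region c.p) = q := by
    rw [Config.lowestEscape, dif_pos ⟨w₀, hw₀'⟩]
    apply le_antisymm
    · refine (Finset.inf'_le _ hw₀').trans ?_
      rw [hqr w₀ hwa₀ hw₀.ge, unbotD_natCast, hw₀]
    · refine Finset.le_inf' _ _ fun w hw => ?_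
      obtain ⟨hwa, hle⟩ := hesc w hw
      rwa [hqr w hwa hle, unbotD_natCast]
  rw [Config.step, if_neg hne, if_neg (h.not_unrecoverable hp)]
  simp only [h.region_eq hp hX]
  rw [if_neg (fun hh => hnopen (h.isOpenRegion_iff.1 hh)), if_neg (Finset.ne_empty_of_mem hw₀'),
    hlow]
  split_ifs with htrig
  -- a delayed promotion is applied at once, as no vertex is left in a lower region
  · obtain ⟨-, x, hx, hxp, hxq⟩ := htrig
    have hall : ∀ u ∈ X.alive, c.p ≤ X.reg u := by
      refine hrest.resolve_right fun hrec => ?_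
      have := hrec x (h.record x (Config.refresh_record_subset c hx)) hxp
      omega
    refine ⟨_, ?_, promoted_applyDelayed h.delayed ⟨u₀, Layout.mem_region.2 ⟨hu₀, he₀⟩⟩ hP.parity⟩
    show Config.descend v G { (c.recorded σ (X.region c.p)) with delayed := _ } _ = _
    rw [Config.descend, if_neg, if_pos]
    · exact ⟨u₀, by simp [Layout.mem_region.2 ⟨hu₀, he₀⟩]⟩
    · rintro ⟨u, hu⟩
      have := (h.mem_rest (σ := σ)).1 hu
      have := hall u this.1
      omega
  · exact ⟨_, rfl, promoted_promote h.delayed _⟩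

/-- After a promotion, the search computes the next layout. -/
theorem Follows.of_promoted (h : Follows G v X Y bad c)
    (hX : IsDecomposition G X.alive X.reg X.core) (hb : ∀ x, ¬ bad x) (hf : c.p = f)
    (hP : IsPromotion G v X X' f q bad') (hσ : c.IsStrategyUpdate G (c.region G) σ)
    {c' : Config V} (hc' : Promoted v c σ (X.region f) q c')
    (hbad : ∀ x, bad' x → x ≤ q ∧ v.Recovers ∧ ∃ u ∈ X.alive, f < X.reg u ∧ X.reg u = x ∧
      G.owner u = Player.ofPriority x ∧ X'.reg u ≤ x ∧ ∃ w, c.strat u = some w ∧ x < X'.reg w)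
    (hkept : v.Recovers → ∀ u w, Y'.kept u w → u ∈ X.alive ∧
      G.owner u = Player.ofPriority (X'.reg u) ∧ X'.reg u = X.reg u ∧ f < X.reg u ∧
      c.strat u = some w ∧ ¬ bad' (X'.reg u))
    (havoid : ∀ d, Y'.avoid d → d ≠ q ∧ f ≤ d ∧ ∀ u ∈ X.alive, f < X.reg u → X.reg u = d →
      d < q ∧ v.Resets (Player.ofPriority f) d)
    (hrecord : ∀ d, d = q ∨ (d < q → ¬ v.Resets (Player.ofPriority f) d) → Y'.record d)
    (hfresh : v.Recovers → ∀ d, Y'.fresh d → d < q ∧ f ≤ d ∧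
      ∀ u ∈ X.alive, f < X.reg u → X.reg u ≠ d) :
    Follows G v X' Y' bad' c' := by
  subst hf
  rw [h.region_eq (hb _) hX] at hσ
  obtain ⟨hσ₁, hσ₂, hσ₃, hσ₄, rank, hσ₅⟩ := hσ
  have hpl : c.player = Player.ofPriority c.p := rfl
  have hbelow : ∀ u ∈ X.alive, c.r u ≤ (X.reg u : WithBot ℕ) := fun u hu =>
    (h.below u hu).resolve_right fun ⟨x, hx, _⟩ => hb x hx
  have hZ : ∀ u ∈ X.alive, u ∈ X.region c.p ↔ X.reg u = c.p := fun u hu => by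
    rw [Layout.mem_region]; tauto
  have hlt := hP.lt
  have hq : ∀ u ∈ X.alive, X.reg u = c.p → c'.r u = (q : WithBot ℕ) := fun u hu he =>
    hc'.r_mem u ((hZ u hu).2 he)
  have hup : ∀ u ∈ X.alive, c.p < X.reg u →
      (X.reg u < q → ¬ v.Resets (Player.ofPriority c.p) (X.reg u)) →
      c'.r u = (X.reg u : WithBot ℕ) := by
    intro u hu hlt hR
    have hr := h.above u hu hlt
    rw [← hr]
    refine hc'.r_eq u (fun hz => hlt.ne' ((hZ u hu).1 hz)) fun x hx hxq => ?_
    have : x = X.reg u := by rw [hr] at hx; exact_mod_cast hx.symm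
    rw [this] at hxq ⊢
    exact hR hxq
  have hreset : ∀ u ∈ X.alive, c.p < X.reg u → X.reg u < q →
      v.Resets (Player.ofPriority c.p) (X.reg u) → c'.r u = ⊥ := fun u hu hlt hltq hR =>
    hc'.r_reset u (fun hz => hlt.ne' ((hZ u hu).1 hz)) _ (h.above u hu hlt) hltq hR
  have hdown : ∀ u ∈ X.alive, X.reg u < c.p → c'.r u ≤ c.r u := by
    intro u hu hlt
    have hz : u ∉ X.region c.p := fun hz => hlt.ne ((hZ u hu).1 hz)
    by_cases hex : ∃ x : ℕ, c.r u = (x : WithBot ℕ) ∧ x < q ∧ v.Resets c.player x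
    · obtain ⟨x, hx, hxq, hR⟩ := hex
      rw [hc'.r_reset u hz x hx hxq hR]
      exact bot_le
    · rw [hc'.r_eq u hz fun x hx hxq hR => hex ⟨x, hx, hxq, hR⟩]
  have hrec : v.Recovers → ∀ u ∈ X.alive, c.p < X.reg u → c'.r u = (X.reg u : WithBot ℕ) :=
    fun hv u hu hlt => hup u hu hlt fun _ => hv.not_resets _ _
  have hge : v.Recovers → ∀ u ∈ X.alive, X.reg u = c.p ∨ c.p < X.reg u := by
    intro hv u hu
    rcases lt_trichotomy (X.reg u) c.p with h₁ | h₁ | h₁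
    · exact absurd hv (hP.rest u hu h₁).2
    · exact .inl h₁
    · exact .inr h₁
  have hstrat : v.Recovers → ∀ u ∈ X.alive, c.p < X.reg u → c'.strat u = c.strat u :=
    fun hv u hu hlt => (hc'.strat hv u).trans (hσ₁ u fun hz => hlt.ne' ((hZ u hu).1 hz))
  have hcoreq : ∀ u ∈ X.alive, X'.core u → c'.r u = (X'.reg u : WithBot ℕ) := by
    intro u hu hc
    rcases hP.core u hu hc with h₁ | ⟨h₁, _, h₃, h₄⟩
    · rw [hq u hu h₁, hP.base u hu h₁]
    · rw [hup u hu h₁ h₄, h₃]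
  -- strategies in the promoted region lead to the promoted region
  have hown : ∀ u ∈ X.alive, X.reg u = c.p → G.owner u = Player.ofPriority c.p →
      v.Recovers → ∃ w ∈ G.succ u, w ∈ X.alive ∧ X.reg w = c.p ∧ σ u = some w := by
    intro u hu he ho hv
    by_cases ht : u ∈ c.target G
    · by_cases hs : c.strat u = none
      · rcases hσ₄ u ht ho hs with ⟨w, hw, hs'⟩ | ⟨he', _⟩
        · rw [Finset.mem_inter, Layout.mem_region] at hw
          exact ⟨w, hw.1, hw.2.1, hw.2.2, hs'⟩
        · obtain ⟨w, hws, hwa, hwe⟩ := hP.own u hu he ho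
          exact absurd he' (Finset.ne_empty_of_mem
            (Finset.mem_inter.2 ⟨hws, Layout.mem_region.2 ⟨hwa, hwe⟩⟩))
      · have hσu := hσ₃ u ht ho hs
        have hru : c.r u = (X.reg u : WithBot ℕ) := by
          rcases (h.mem_target.1 ht).2 with hr | hr
          · rw [hr, he]
          · have := h.pr_le hv u hu hs
            rw [hr, ← he] at this
            exact le_antisymm (hbelow u hu) this
        cases hsu : c.strat u with
        | none => exact absurd hsu hs
        | some w =>
          obtain ⟨h₁, h₂, h₃⟩ := h.strat_mem hv u hu hru (hb _) (he ▸ ho) w hsu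
          exact ⟨w, h₁, h₂, h₃.trans he, hσu.trans hsu⟩
    · obtain ⟨w, hw, hs', _⟩ := (hσ₅ u (Finset.mem_sdiff.2 ⟨(hZ u hu).2 he, ht⟩)).1 ho
      rw [Finset.mem_inter, Layout.mem_region] at hw
      exact ⟨w, hw.1, hw.2.1, hw.2.2, hs'⟩
  refine ⟨by rw [hc'.alive, h.alive, hP.alive], by rw [hc'.won, h.won, hP.won], ?_, ?_, ?_, ?_, ?_,
    ?_, ?_, ?_, ?_, ?_, hc'.delayed, ?_, ?_, ?_⟩
  · intro u hu hlt'
    rw [hP.alive] at hu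
    rw [hc'.p] at hlt'
    have he := hP.high' u hu hlt'
    rw [hup u hu (by omega) (by omega), he]
  · intro u hu
    rw [hP.alive] at hu
    rcases lt_trichotomy (X.reg u) c.p with h₁ | h₁ | h₁
    · left
      refine ((hdown u hu h₁).trans (hbelow u hu)).trans ?_
      exact_mod_cast (hP.rest u hu h₁).1
    · left
      rw [hq u hu h₁, hP.base u hu h₁]
    · by_cases hlt' : X.reg u < q
      · by_cases hR : v.Resets (Player.ofPriority c.p) (X.reg u)
        · left
          rw [hreset u hu h₁ hlt' hR]
          exact bot_le
        · rw [hup u hu h₁ fun _ => hR]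
          rcases hP.low u hu h₁ hlt' with h₂ | h₂ | h₂
          · exact absurd h₂ hR
          · left
            exact_mod_cast h₂
          · exact .inr ⟨_, h₂, rfl⟩
      · left
        rw [hup u hu h₁ (fun h => absurd h hlt'), hP.high u hu (by omega)]
  · intro u hu hc
    exact hcoreq u (hP.alive ▸ hu) hc
  · intro u hu hc
    exact hP.core_bad u (hP.alive ▸ hu) hc
  · intro u hu hc
    rw [hP.alive] at hu
    rcases hP.core u hu hc with h₁ | ⟨h₁, h₂, h₃, h₄⟩
    · rw [hP.base u hu h₁]
      exact hc'.merged
    · rw [h₃]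
      exact hc'.merged_of_mem _ (h.core_merged u hu h₂) h₁.ne' h₄
  · intro hv u w hk
    obtain ⟨h₁, h₂, h₃, h₄, h₅, h₆⟩ := hkept hv u w hk
    exact ⟨hP.alive ▸ h₁, h₂, by rw [hrec hv u h₁ h₄, h₃], by rw [hstrat hv u h₁ h₄, h₅], h₆⟩
  · intro x hx
    obtain ⟨h₀, h₁, u, h₂, h₃, h₄, h₅, h₆, w, h₇, h₈⟩ := hbad x hx
    exact ⟨hc'.p ▸ h₀, h₁, u, hP.alive ▸ h₂, by rw [hrec h₁ u h₂ h₃, h₄], h₅, h₆, w,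
      by rw [hstrat h₁ u h₂ h₃, h₇], .inr h₈⟩
  · intro hv u hu hr hb' ho w hs
    rw [hP.alive] at hu ⊢
    rcases hge hv u hu with he | hlt'
    · have hb₁ := hP.base u hu he
      rw [hb₁, hP.parity] at ho
      obtain ⟨w', h₁, h₂, h₃, h₄⟩ := hown u hu he ho hv
      rw [hc'.strat hv u, h₄] at hs
      obtain rfl : w' = w := by simpa using hs
      exact ⟨h₁, h₂, by rw [hP.base _ h₂ h₃, hb₁]⟩
    · rw [hrec hv u hu hlt'] at hr
      have hr' : X'.reg u = X.reg u := by exact_mod_cast hr.symm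
      rw [hr'] at hb' ho
      rw [hstrat hv u hu hlt'] at hs
      obtain ⟨h₁, h₂, h₃⟩ := h.strat_mem hv u hu (h.above u hu hlt') (hb _) ho w hs
      exact ⟨h₁, h₂, by rw [hP.stay hv u hu hlt' hr' hb' ho w h₁ h₂ h₃, hr']⟩
  · intro hv u hu hr hb' ho hpr
    rw [hP.alive] at hu
    rcases hge hv u hu with he | hlt'
    · rw [hP.base u hu he, hP.parity] at ho
      obtain ⟨w', h₁, h₂, h₃, h₄⟩ := hown u hu he ho hv
      rw [hc'.strat hv u, h₄]
      simp
    · rw [hrec hv u hu hlt'] at hr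
      have hr' : X'.reg u = X.reg u := by exact_mod_cast hr.symm
      rw [hr'] at ho hpr
      rw [hstrat hv u hu hlt']
      exact h.strat_some hv u hu (h.above u hu hlt') (hb _) ho hpr
  · intro hv u hu hs
    rw [hP.alive] at hu
    rcases hge hv u hu with he | hlt'
    · rw [hq u hu he]
      have := hX.pr_le u hu
      exact_mod_cast (by omega : G.pr u ≤ q)
    · rw [hrec hv u hu hlt']
      exact_mod_cast hX.pr_le u hu
  · intro d hd _ u hu hr
    rw [hP.alive] at hu
    obtain ⟨h₁, h₂, h₃⟩ := havoid d hd
    rcases lt_trichotomy (X.reg u) c.p with h₄ | h₄ | h₄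
    · have := (hdown u hu h₄).trans (hbelow u hu)
      rw [hr] at this
      have : d ≤ X.reg u := by exact_mod_cast this
      omega
    · rw [hq u hu h₄] at hr
      exact h₁ (by exact_mod_cast hr.symm)
    · by_cases hlt' : X.reg u < q ∧ v.Resets (Player.ofPriority c.p) (X.reg u)
      · rw [hreset u hu h₄ hlt'.1 hlt'.2] at hr
        simp at hr
      · rw [hup u hu h₄ fun h h' => hlt' ⟨h, h'⟩] at hr
        have he : X.reg u = d := by exact_mod_cast hr
        exact hlt' (he ▸ h₃ u hu h₄ he)
  · exact fun d hd => hrecord d (hc'.record d hd)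
  · intro hv d hd
    obtain ⟨h₁, h₂, h₃⟩ := hfresh hv d hd
    rw [hc'.p]
    refine ⟨fun _ u hu hr => ?_, fun h => by omega⟩
    rw [hP.alive] at hu
    rcases hge hv u hu with he | hlt'
    · rw [hq u hu he] at hr
      exact h₁.ne (by exact_mod_cast hr.symm)
    · rw [hrec hv u hu hlt'] at hr
      exact h₃ u hu hlt' (by exact_mod_cast hr)

/-! ### Removal of dominions -/

/-- The region `d` of the layout `X` is a dominion that attracts no other vertex. -/
structure IsDominion (G : ParityGame V) (X : Layout V) (d : ℕ) : Prop where
  nonempty : ∃ u ∈ X.alive, X.reg u = d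
  own : ∀ u ∈ X.alive, X.reg u = d → G.owner u = Player.ofPriority d →
    ∃ w ∈ G.succ u, w ∈ X.alive ∧ X.reg w = d
  opp : ∀ u ∈ X.alive, X.reg u = d → G.owner u ≠ Player.ofPriority d →
    ∀ w ∈ G.succ u, w ∈ X.alive → X.reg w = d
  own' : ∀ u ∈ X.alive, X.reg u ≠ d → G.owner u = Player.ofPriority d →
    ∀ w ∈ G.succ u, w ∈ X.alive → X.reg w ≠ d
  opp' : ∀ u ∈ X.alive, X.reg u ≠ d → G.owner u ≠ Player.ofPriority d →
    ∃ w ∈ G.succ u, w ∈ X.alive ∧ X.reg w ≠ d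

theorem IsDominion.attr_eq {d : ℕ} (h : IsDominion G X d) :
    attr G X.alive (Player.ofPriority d) (X.region d) = X.region d := by
  ext u
  rw [mem_attr]
  refine ⟨fun hu => ?_, fun hu => .base hu⟩
  induction hu with
  | base hu => exact hu
  | @own u w h₁ h₂ h₃ _ ih =>
    rw [Layout.mem_region] at ih ⊢
    by_contra hne
    exact h.own' u h₁ (fun he => hne ⟨h₁, he⟩) h₂ w h₃ ih.1 ih.2
  | @opp u h₁ h₂ _ ih =>
    rw [Layout.mem_region]
    by_contra hne
    obtain ⟨w, hw, hwa, hwe⟩ := h.opp' u h₁ (fun he => hne ⟨h₁, he⟩) h₂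
    exact hwe (Layout.mem_region.1 (ih w hw hwa)).2

namespace Follows

/-- A region that is a dominion is removed from the game. -/
theorem step_dominion (h : Follows G v X Y bad c) (hX : IsDecomposition G X.alive X.reg X.core)
    (hp : ¬ bad c.p) (hD : IsDominion G X c.p) :
    c.step v keep G σ =
      ((c.recorded σ (X.region c.p)).removeDominion v keep G (X.region c.p), false) := by
  obtain ⟨u₀, hu₀, he₀⟩ := hD.nonempty
  have hne : c.alive ≠ ∅ := by
    rw [h.alive]
    exact Finset.ne_empty_of_mem hu₀
  have hpl : c.player = Player.ofPriority c.p := rfl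
  have hnopen : ¬ X.IsOpen G c.p := by
    rintro (⟨u, hu, he, ho, hw⟩ | ⟨u, hu, he, ho, w, hw, hwa, hlt⟩)
    · obtain ⟨w, hws, hwa, hwe⟩ := hD.own u hu he ho
      exact hw w hws hwa hwe
    · have := hD.opp u hu he ho w hw hwa
      omega
  have hesc : c.esc G (X.region c.p) = ∅ := by
    rw [Finset.eq_empty_iff_forall_notMem]
    intro w hw
    obtain ⟨⟨u, hu, ho, hws⟩, hwa, hwZ⟩ := Config.mem_esc.1 hw
    rw [Layout.mem_region] at hu hwZ
    rw [h.alive] at hwa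
    exact hwZ ⟨hwa, hD.opp u hu.1 hu.2 ho w hws hwa⟩
  rw [Config.step, if_neg hne, if_neg (h.not_unrecoverable hp)]
  simp only [h.region_eq hp hX]
  rw [if_neg (fun hh => hnopen (h.isOpenRegion_iff.1 hh)), if_pos hesc, hpl, h.alive, hD.attr_eq]
  rfl

/-- After the removal of a dominion, the search computes the next layout. -/
theorem of_dominion (h : Follows G v X Y bad c) (hX : IsDecomposition G X.alive X.reg X.core)
    (hp : ¬ bad c.p) (hσ : c.IsStrategyUpdate G (c.region G) σ)
    (hX' : IsDecomposition G X'.alive X'.reg X'.core)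
    (halive : X'.alive = X.alive \ X.region c.p) (hne : X'.alive.Nonempty)
    (hwon : ∀ α, X'.won α =
      if α = Player.ofPriority c.p then X.won α ∪ X.region c.p else X.won α)
    (hlow : keep = true → ∀ u ∈ X'.alive, ∀ x : ℕ, ¬ v.Resets (Player.ofPriority c.p) x →
      c.r u = (x : WithBot ℕ) → x ≤ X'.reg u ∨ bad' x)
    (hcore : ∀ u ∈ X'.alive, X'.core u → keep = true ∧
      ¬ v.Resets (Player.ofPriority c.p) (X.reg u) ∧ X'.reg u = X.reg u ∧ X.core u ∧
      ¬ bad' (X.reg u))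
    (hreg : v.Recovers → keep = true → ∀ u ∈ X'.alive, X'.reg u = X.reg u)
    (hkept : ∀ u w, ¬ Y'.kept u w) (havoid : ∀ d, ¬ Y'.avoid d)
    (hrecord : ∀ d, Y'.record d)
    (hfresh : v.Recovers → ∀ d, Y'.fresh d → keep = false ∧ ∃ u ∈ X'.alive, X'.reg u = d)
    (hbad : keep = true → ∀ x, bad x → bad' x)
    (hbad' : ∀ x, bad' x → keep = true ∧ bad x ∧ x < c.p) :
    ∃ c', (c.recorded σ (X.region c.p)).removeDominion v keep G (X.region c.p) = c' ∧
      Follows G v X' Y' bad' c' ∧ (∀ u ∈ X'.alive, X'.reg u ≤ c'.p) ∧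
      (bad' c'.p ∨ ∃ u ∈ X'.alive, X'.reg u = c'.p) := by
  rw [h.region_eq hp hX] at hσ
  have hpl : c.player = Player.ofPriority c.p := rfl
  set R : ℕ → Prop := fun x => keep = false ∨ v.Resets (Player.ofPriority c.p) x with hR
  set c₀ := c.recorded σ (X.region c.p) with hc₀
  have hpl₀ : c₀.player = Player.ofPriority c.p := by
    simp [hc₀, Config.recorded, Config.assign, Config.player]
  have hmem : ∀ u, u ∈ X'.alive ↔ u ∈ X.alive ∧ X.reg u ≠ c.p := by
    intro u
    rw [halive, Finset.mem_sdiff, Layout.mem_region]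
    tauto
  set c' := c₀.removeDominion v keep G (X.region c.p) with hc'
  have halive' : c'.alive = X'.alive := by
    rw [halive, ← h.alive]
    show c₀.alive \ _ = _
    simp [hc₀, Config.recorded, Config.assign]
  have hr' : c'.r = (c₀.discard R).r := by
    show (c₀.discard fun x => keep = false ∨ v.Resets c₀.player x).r = _
    rw [hpl₀]
  have hs' : c'.strat = (c₀.discard R).strat := by
    show (c₀.discard fun x => keep = false ∨ v.Resets c₀.player x).strat = _
    rw [hpl₀]
  have hp' : c'.p = Config.top G c'.r X'.alive := by
    rw [← halive']
    rfl
  have hm' : ∀ d, d ∈ c.merged → d ≠ c.p → ¬ R d → d ∈ c'.merged := by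
    intro d hd hne hRd
    show d ∈ (c₀.discard fun x => keep = false ∨ v.Resets c₀.player x).merged
    rw [hpl₀, Config.mem_discard_merged]
    exact ⟨mem_refresh_merged_of_ne hd hne, hRd⟩
  have hr₀ : ∀ u ∈ X'.alive, c₀.r u = c.r u := by
    intro u hu
    have hz : u ∉ X.region c.p := fun hz => ((hmem u).1 hu).2 (Layout.mem_region.1 hz).2
    simp [hc₀, Config.recorded, Config.assign, hz]
  have hs₀ : ∀ u ∈ X'.alive, c₀.strat u = c.strat u := by
    intro u hu
    have hz : u ∉ X.region c.p := fun hz => ((hmem u).1 hu).2 (Layout.mem_region.1 hz).2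
    exact hσ.1 u hz
  have hreset : ∀ u ∈ X'.alive, ∀ x : ℕ, c.r u = (x : WithBot ℕ) → R x →
      c'.r u = ⊥ ∧ c'.strat u = none := by
    intro u hu x hx hRx
    rw [hr', hs']
    exact ⟨if_pos ⟨x, (hr₀ u hu).trans hx, hRx⟩, if_pos ⟨x, (hr₀ u hu).trans hx, hRx⟩⟩
  have hstay : ∀ u ∈ X'.alive, (∀ x : ℕ, c.r u = (x : WithBot ℕ) → ¬ R x) →
      c'.r u = c.r u ∧ c'.strat u = c.strat u := by
    intro u hu hno
    rw [← hr₀ u hu] at hno ⊢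
    rw [← hs₀ u hu, hr', hs']
    exact ⟨Config.discard_r_of_not hno, Config.discard_strat_of_not hno⟩
  have hcases : ∀ u ∈ X'.alive, (c'.r u = ⊥ ∧ (c.r u = ⊥ → c'.strat u = c.strat u) ∧
      (c.r u ≠ ⊥ → c'.strat u = none)) ∨
      ∃ x : ℕ, c.r u = (x : WithBot ℕ) ∧ ¬ R x ∧ c'.r u = (x : WithBot ℕ) ∧
        c'.strat u = c.strat u := by
    intro u hu
    by_cases hcr : c.r u = ⊥
    · left
      obtain ⟨h₁, h₂⟩ := hstay u hu fun x hx => by rw [hcr] at hx; cases hx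
      exact ⟨h₁.trans hcr, fun _ => h₂, fun h => absurd hcr h⟩
    · obtain ⟨x, hx⟩ := WithBot.ne_bot_iff_exists.1 hcr
      by_cases hRx : R x
      · left
        obtain ⟨h₁, h₂⟩ := hreset u hu x hx.symm hRx
        exact ⟨h₁, fun h => absurd h hcr, fun _ => h₂⟩
      · right
        obtain ⟨h₁, h₂⟩ := hstay u hu fun y hy => by
          have : x = y := by rw [← hx] at hy; exact WithBot.coe_injective hy
          exact this ▸ hRx
        exact ⟨x, hx.symm, hRx, h₁.trans hx.symm, h₂⟩
  have hbelow : ∀ u ∈ X'.alive, c'.r u ≤ (X'.reg u : WithBot ℕ) ∨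
      ∃ x : ℕ, bad' x ∧ c'.r u = (x : WithBot ℕ) := by
    intro u hu
    rcases hcases u hu with h₁ | ⟨x, hx, hRx, h₁, _⟩
    · left
      rw [h₁.1]
      exact bot_le
    · rw [h₁]
      simp only [hR, not_or, Bool.not_eq_false] at hRx
      rcases hlow hRx.1 u hu x hRx.2 hx with h₂ | h₂
      · left
        exact_mod_cast h₂
      · exact .inr ⟨x, h₂, rfl⟩
  have hcoreR : ∀ u ∈ X'.alive, X'.core u → ¬ R (X.reg u) := fun u hu hc => by
    obtain ⟨hk, hn, _⟩ := hcore u hu hc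
    simp [hR, hk, hn]
  have hcore_eq : ∀ u ∈ X'.alive, X'.core u → c'.r u = (X'.reg u : WithBot ℕ) := by
    intro u hu hc
    obtain ⟨_, _, he, hX₁, _⟩ := hcore u hu hc
    have hcr := h.core_eq u ((hmem u).1 hu).1 hX₁
    rw [he, ← hcr]
    refine (hstay u hu fun x hx => ?_).1
    have : X.reg u = x := by rw [hcr] at hx; exact_mod_cast hx
    exact this ▸ hcoreR u hu hc
  obtain ⟨htop, hhit⟩ := top_spec (G := G) (r := c'.r) (T := X'.alive) (bad := bad') hX'
    (p := X'.alive.sup X'.reg) (fun u => ⟨fun hu => ⟨hu, Finset.le_sup hu⟩, fun hu => hu.1⟩) hne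
    hbelow hcore_eq
  rw [← hp'] at htop hhit
  have hreg' : v.Recovers → ∀ u ∈ X'.alive, c'.r u = (X'.reg u : WithBot ℕ) →
      c.r u = (X.reg u : WithBot ℕ) ∧ c'.strat u = c.strat u ∧ X'.reg u = X.reg u ∧
        keep = true := by
    intro hv u hu hr
    rcases hcases u hu with h₁ | ⟨x, hx, hRx, h₁, h₂⟩
    · rw [h₁.1] at hr
      cases hr
    · simp only [hR, not_or, Bool.not_eq_false] at hRx
      have he := hreg hv hRx.1 u hu
      rw [h₁, he] at hr
      exact ⟨hx.trans hr, h₂, he, hRx.1⟩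
  refine ⟨c', rfl, ⟨halive', ?_, ?_, hbelow, hcore_eq, ?_, ?_, ?_, ?_, ?_, ?_, ?_, fun u => rfl,
    fun d hd => absurd hd (havoid d), fun d _ => hrecord d, ?_⟩, htop, hhit⟩
  · funext α
    rw [hwon, ← h.won]
    show (if α = c₀.player then c₀.won α ∪ _ else c₀.won α) = _
    rw [hpl₀]
    simp [hc₀, Config.recorded, Config.assign]
  · intro u hu hlt
    exact absurd (htop u hu) (by omega)
  · intro u hu hc
    obtain ⟨_, _, he, _, hb⟩ := hcore u hu hc
    rwa [he]
  · intro u hu hc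
    obtain ⟨_, _, he, hX₁, _⟩ := hcore u hu hc
    rw [he]
    exact hm' _ (h.core_merged u ((hmem u).1 hu).1 hX₁) ((hmem u).1 hu).2 (hcoreR u hu hc)
  · exact fun _ u w hk => absurd hk (hkept u w)
  · intro x hx
    obtain ⟨hk, hbx, hlt⟩ := hbad' x hx
    obtain ⟨_, hv, u, hu, hr, ho, hle, w, hs, hw⟩ := h.witness x hbx
    have hua : u ∈ X'.alive := (hmem u).2 ⟨hu, by omega⟩
    obtain ⟨h₁, h₂⟩ := hstay u hua fun y _ => by simp [hR, hk, hv.not_resets]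
    have hreg₁ := hreg hv hk
    refine ⟨?_, hv, u, hua, h₁.trans hr, ho, by rw [hreg₁ u hua]; exact hle, w, h₂.trans hs, ?_⟩
    · have := r_le_top (G := G) (r := c'.r) hua
      rw [← hp', h₁, hr] at this
      exact_mod_cast this
    · by_cases hwa : w ∈ X'.alive
      · right
        rw [hreg₁ w hwa]
        exact hw.resolve_left fun hh => hh ((hmem w).1 hwa).1
      · exact .inl hwa
  · intro hv u hu hr hb ho w hs
    obtain ⟨h₁, h₂, h₃, hk⟩ := hreg' hv u hu hr
    rw [h₂] at hs
    rw [h₃] at ho hb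
    obtain ⟨g₁, g₂, g₃⟩ := h.strat_mem hv u ((hmem u).1 hu).1 h₁ (fun hh => hb (hbad hk _ hh)) ho w hs
    have hwa : w ∈ X'.alive := (hmem w).2 ⟨g₂, g₃ ▸ ((hmem u).1 hu).2⟩
    exact ⟨g₁, hwa, by rw [hreg hv hk w hwa, h₃, g₃]⟩
  · intro hv u hu hr hb ho hpr
    obtain ⟨h₁, h₂, h₃, hk⟩ := hreg' hv u hu hr
    rw [h₂]
    rw [h₃] at ho hb hpr
    exact h.strat_some hv u ((hmem u).1 hu).1 h₁ (fun hh => hb (hbad hk _ hh)) ho hpr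
  · intro hv u hu hs
    rcases hcases u hu with ⟨h₁, h₂, h₃⟩ | ⟨x, hx, hRx, h₁, h₂⟩
    · by_cases hb : c.r u = ⊥
      · rw [h₂ hb] at hs
        rw [h₁, ← hb]
        exact h.pr_le hv u ((hmem u).1 hu).1 hs
      · exact absurd (h₃ hb) hs
    · rw [h₂] at hs
      rw [h₁, ← hx]
      exact h.pr_le hv u ((hmem u).1 hu).1 hs
  · intro hv d hd
    obtain ⟨hk, u, hu, he⟩ := hfresh hv d hd
    refine ⟨fun _ w hw hr => ?_, fun hlt => absurd (htop u hu) (by omega)⟩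
    rcases hcases w hw with h₁ | ⟨x, hx, hRx, h₁, h₂⟩
    · rw [h₁.1] at hr
      cases hr
    · exact hRx (.inl hk)

/-- The first search computes the layout of a decomposition without promotions. -/
theorem initial (hX : IsDecomposition G X.alive X.reg X.core) (halive : X.alive = Finset.univ)
    (hne : X.alive.Nonempty) (hwon : ∀ α, X.won α = ∅) (hcore : ∀ u, ¬ X.core u)
    (hkept : ∀ u w, ¬ Y.kept u w)
    (hfresh : ∀ d, Y.fresh d → ∃ u ∈ X.alive, X.reg u = d) :
    Follows G v X Y (fun _ => False) (Config.initial G) ∧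
      (∀ u ∈ X.alive, X.reg u ≤ (Config.initial G).p) ∧
      ∃ u ∈ X.alive, X.reg u = (Config.initial G).p := by
  have hp : (Config.initial G).p = Config.top G (fun _ => ⊥) X.alive := by
    rw [halive]
    rfl
  have hr : ∀ u, (Config.initial G).r u = ⊥ := fun u => rfl
  obtain ⟨htop, hhit⟩ := top_spec (G := G) (r := fun _ => ⊥) (T := X.alive)
    (bad := fun _ => False) hX
    (p := X.alive.sup X.reg) (fun u => ⟨fun hu => ⟨hu, Finset.le_sup hu⟩, fun hu => hu.1⟩) hne
    (fun u _ => .inl bot_le) (fun u _ hc => absurd hc (hcore u))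
  rw [← hp] at htop hhit
  refine ⟨⟨halive.symm, by funext α; rw [hwon]; rfl, ?_, fun u _ => .inl ?_, ?_, ?_, ?_, ?_, ?_, ?_,
    ?_, ?_, fun _ => rfl, ?_, ?_, ?_⟩, htop, hhit.resolve_left fun h => h⟩
  · intro u hu hlt
    exact absurd (htop u hu) (by omega)
  · rw [hr]
    exact bot_le
  · exact fun u _ hc => absurd hc (hcore u)
  · exact fun u _ hc => absurd hc (hcore u)
  · exact fun u _ hc => absurd hc (hcore u)
  · exact fun _ u w hk => absurd hk (hkept u w)
  · exact fun x hx => hx.elim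
  · intro _ u _ h
    rw [hr] at h
    cases h
  · intro _ u _ h
    rw [hr] at h
    cases h
  · exact fun _ u _ h => absurd rfl h
  · exact fun d _ h => absurd h (Finset.notMem_empty d)
  · exact fun d h => absurd h (Finset.notMem_empty d)
  · intro _ d hd
    obtain ⟨u, hu, he⟩ := hfresh d hd
    refine ⟨fun _ w _ h => ?_, fun hlt => absurd (htop u hu) (by omega)⟩
    rw [hr] at h
    cases h

end Follows

end Search

/-! ### Labellings of the Two Counters games -/

namespace Player

theorem ofPriority_eq_even {p : ℕ} : ofPriority p = even ↔ p % 2 = 0 := by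
  unfold ofPriority; split_ifs <;> simp_all

theorem ofPriority_eq_odd {p : ℕ} : ofPriority p = odd ↔ p % 2 = 1 := by
  unfold ofPriority; split_ifs <;> simp_all

@[simp] theorem opp_opp (α : Player) : α.opp.opp = α := by cases α <;> rfl

@[simp] theorem opp_ne (α : Player) : α.opp ≠ α := by cases α <;> simp [opp]

@[simp] theorem ne_opp (α : Player) : α ≠ α.opp := by cases α <;> simp [opp]

theorem ne_iff {α β : Player} : α ≠ β ↔ α = β.opp := by cases α <;> cases β <;> simp [opp]

end Player

open Player in
/-- The label of a vertex of player `ω` whose two successors are labelled `c` and `d`: a label of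
the parity of `ω` attracts the vertex, and the other player attracts it only if both labels have
the parity of this player. -/
def comb (ω : Player) (c d : ℕ) : ℕ :=
  if ofPriority c = ω then (if ofPriority d = ω then max c d else c)
  else if ofPriority d = ω then d else min c d

/-- The priority of the low vertex of bit `y` of player `α`. -/
def lowPr (N : ℕ) : Player → ℕ → ℕ
  | .even, y => 2 * (N - 1 - y) + 3
  | .odd, y => 2 * (N - 1 - y) + 4

/-- The priority of the high vertex of bit `y` of player `α`. -/
def highPr (N : ℕ) : Player → ℕ → ℕ
  | .even, y => 2 * N + 2 * (N - 1 - y) + 4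
  | .odd, y => 2 * N + 2 * (N - 1 - y) + 5

/-- The priority of the tangle vertices of player `α`. -/
def tanglePr : Player → ℕ
  | .even => 2
  | .odd => 1

/-- The priority of the chains of player `α`. -/
def chainPr : Player → ℕ
  | .even => 1
  | .odd => 0

/-- Bit `j` of the opponent can distract player `α` from bit `y`. -/
def Distracts (N : ℕ) : Player → ℕ → ℕ → Prop
  | .even, y, j => y < j ∧ j < N
  | .odd, y, j => y ≤ j ∧ j < N

/-- Regions for the Two Counters games, given by the regions of the vertices `l`, the common region
`g` of the vertices `t` and `s`, and the region of the vertices `z` of each bit.  Bits are natural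
numbers here, and only the labels of bits below `N` matter.  The vertices `t` of the bits that
satisfy `core` are in their region because of a promotion. -/
structure Labelling where
  l : Player → ℕ → ℕ
  g : Player → ℕ → ℕ
  z : Player → ℕ → ℕ
  core : Player → ℕ → Prop

namespace Labelling

/-- The region of the `i`-th vertex of the chain of a bit. -/
def c (A : Labelling) (α : Player) (y i : ℕ) : ℕ := if i < y then A.g α y else A.z α y

/-- The regions of all vertices. -/
def reg {N : ℕ} (A : Labelling) : TCVertex N → ℕ
  | .l α y => A.l α y
  | .h α y => max (highPr N α y) (A.l α (TCVertex.next y))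
  | .t α y => A.g α y
  | .z α y => A.z α y
  | .s α y _ => A.g α y
  | .a α y m => comb α.opp (A.c α y (m + 1)) (A.l α m)
  | .b α y m => comb α.opp (A.c α y (m + 1)) (A.l α.opp m)

/-- The layout of a labelling; the label `4 * N + 4` is given to vertices that are already won. -/
def layout (N : ℕ) (A : Labelling) (won : Player → Finset (TCVertex N)) :
    Layout (TCVertex N) where
  alive := Finset.univ.filter fun u => A.reg u < 4 * N + 4
  won := won
  reg := A.reg
  core := fun
    | .t α y => A.core α y
    | _ => False

open Player

/-- The vertex `l` of bit `y` is attracted to its region without the help of the opponent's bits, so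
that these can be attracted via this vertex. -/
def Early (N : ℕ) (A : Labelling) (α : Player) (y : ℕ) : Prop :=
  A.l α y = lowPr N α y ∨ (A.l α y = A.g α y ∧ ofPriority (A.g α y) ≠ α)

/-- The bit is attracted by its player, starting from its tangle vertex or from a distraction of
its player by a bit of the opponent. -/
structure Forward (N : ℕ) (A : Labelling) (α : Player) (y : ℕ) : Prop where
  parity : ofPriority (A.g α y) = α
  z_eq : A.z α y = A.g α y
  start : A.core α y ∨ A.g α y = tanglePr α ∨
    (A.g α y < 2 * N + 4 ∧ ∃ j, Distracts N α y j ∧ A.l α.opp j = A.g α y ∧ A.Early N α.opp j)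
  chain : ∀ m < y, (ofPriority (A.l α m) = α ∧ A.g α y ≤ A.l α m) ∨
    (ofPriority (A.l α.opp m) = α ∧ A.g α y ≤ A.l α.opp m ∧
      (A.l α.opp m = A.g α y → A.Early N α.opp m))

/-- The bit is attracted by the opponent via the low vertex of a higher bit `x`. -/
structure Crossed (N : ℕ) (A : Labelling) (α : Player) (y x : ℕ) : Prop where
  lt : x < y
  parity : ofPriority (A.g α y) ≠ α
  low : A.g α y = lowPr N α x
  own : ∀ m, x ≤ m → m < y → A.l α m = A.g α y
  opp : ∀ m, x ≤ m → m < y → A.g α y ≤ A.l α.opp m ∧ ofPriority (A.l α.opp m) ≠ α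
  high : A.g α y < A.l α.opp x

/-- Conditions under which the regions of a labelling are a decomposition.  A label is at least the
priority of the vertex, it is explained by the labels of successors, and no vertex has a successor
with a higher label of its owner's parity. -/
structure Valid (N : ℕ) (A : Labelling) : Prop where
  low_le : ∀ α, ∀ y < N, lowPr N α y ≤ A.l α y
  l_high : ∀ α, ∀ y < N, A.l α y < 2 * N + 4 ∨ (ofPriority (A.l α y) = α ∧ 4 * N + 2 ≤ A.l α y)
  g_le : ∀ α, ∀ y < N, A.g α y ≤ A.l α y
  tangle_le : ∀ α, ∀ y < N, tanglePr α ≤ A.g α y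
  z_le : ∀ α, ∀ y < N, A.z α y ≤ A.g α y
  chain_le : ∀ α, ∀ y < N, chainPr α ≤ A.z α y
  l_eq : ∀ α, ∀ y < N, A.l α y = lowPr N α y ∨ A.l α y = A.g α y
  low : ∀ α, ∀ y < N, ∀ m < y, ¬ (ofPriority (A.l α m) ≠ α ∧ A.g α y < A.l α m ∧
    ofPriority (A.l α.opp m) ≠ α ∧ A.g α y < A.l α.opp m)
  z_up : ∀ α, ∀ y < N, ∀ j, Distracts N α y j → A.z α y < A.l α.opp j →
    ofPriority (A.l α.opp j) ≠ α
  z_eq : ∀ α, ∀ y < N, A.z α y = A.g α y ∨ ∃ j, Distracts N α y j ∧ A.l α.opp j = A.z α y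
  z_min : ∀ α, ∀ y < N, ofPriority (A.z α y) ≠ α → ∀ j, Distracts N α y j →
    A.z α y ≤ A.l α.opp j
  kind : ∀ α, ∀ y < N, A.Forward N α y ∨ ∃ x, A.Crossed N α y x

end Labelling

/-! ### Labels along the edges -/

section Valid

open Player

variable {N : ℕ}

theorem pr_l (α : Player) (y : Fin N) : (twoCounters N).pr (.l α y) = lowPr N α y := by
  cases α <;> rfl

theorem pr_h (α : Player) (y : Fin N) : (twoCounters N).pr (.h α y) = highPr N α y := by
  cases α <;> rfl

theorem pr_t (α : Player) (y : Fin N) : (twoCounters N).pr (.t α y) = tanglePr α := by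
  cases α <;> rfl

theorem pr_z (α : Player) (y : Fin N) : (twoCounters N).pr (.z α y) = chainPr α := by
  cases α <;> rfl

theorem pr_s (α : Player) (y : Fin N) (i) : (twoCounters N).pr (.s α y i) = chainPr α := by
  cases α <;> rfl

theorem pr_a (α : Player) (y : Fin N) (i) : (twoCounters N).pr (.a α y i) = chainPr α := by
  cases α <;> rfl

theorem pr_b (α : Player) (y : Fin N) (i) : (twoCounters N).pr (.b α y i) = chainPr α := by
  cases α <;> rfl

theorem chainPr_le (α : Player) : chainPr α ≤ tanglePr α := by cases α <;> simp [chainPr, tanglePr]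

theorem le_highPr (α : Player) (y : ℕ) : 2 * N + 4 ≤ highPr N α y := by
  cases α <;> simp only [highPr] <;> omega

theorem ofPriority_highPr (α : Player) (y : ℕ) : ofPriority (highPr N α y) = α := by
  cases α <;> simp only [highPr, ofPriority_eq_even, ofPriority_eq_odd] <;> omega

theorem ofPriority_lowPr (α : Player) (y : ℕ) : ofPriority (lowPr N α y) = α.opp := by
  cases α <;> simp only [lowPr, opp, ofPriority_eq_even, ofPriority_eq_odd] <;> omega

theorem owner_l (α : Player) (y : Fin N) : (twoCounters N).owner (.l α y) = α.opp := rfl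
theorem owner_h (α : Player) (y : Fin N) : (twoCounters N).owner (.h α y) = α.opp := rfl
theorem owner_t (α : Player) (y : Fin N) : (twoCounters N).owner (.t α y) = α.opp := rfl
theorem owner_z (α : Player) (y : Fin N) : (twoCounters N).owner (.z α y) = α := rfl
theorem owner_s (α : Player) (y : Fin N) (i) : (twoCounters N).owner (.s α y i) = α := rfl
theorem owner_a (α : Player) (y : Fin N) (i) : (twoCounters N).owner (.a α y i) = α.opp := rfl
theorem owner_b (α : Player) (y : Fin N) (i) : (twoCounters N).owner (.b α y i) = α.opp := rfl

theorem mem_succ_l {α : Player} {y : Fin N} {w : TCVertex N} :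
    w ∈ (twoCounters N).succ (.l α y) ↔ w = .t α y := Finset.mem_singleton

theorem mem_succ_h {α : Player} {y : Fin N} {w : TCVertex N} :
    w ∈ (twoCounters N).succ (.h α y) ↔ w = .l α (TCVertex.next y) := Finset.mem_singleton

theorem mem_succ_t {α : Player} {y : Fin N} {w : TCVertex N} :
    w ∈ (twoCounters N).succ (.t α y) ↔ w = .h α y ∨ w = TCVertex.chain α y 0 := by
  simp [twoCounters, TCVertex.succ]

theorem mem_succ_s {α : Player} {y : Fin N} {i} {w : TCVertex N} :
    w ∈ (twoCounters N).succ (.s α y i) ↔ w = .a α y i ∨ w = .b α y i := by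
  simp [twoCounters, TCVertex.succ]

theorem mem_succ_a {α : Player} {y : Fin N} {i} {w : TCVertex N} :
    w ∈ (twoCounters N).succ (.a α y i) ↔
      w = TCVertex.chain α y (i + 1) ∨ w = .l α (TCVertex.up i) := by
  simp [twoCounters, TCVertex.succ]

theorem mem_succ_b {α : Player} {y : Fin N} {i} {w : TCVertex N} :
    w ∈ (twoCounters N).succ (.b α y i) ↔
      w = TCVertex.chain α y (i + 1) ∨ w = .l α.opp (TCVertex.up i) := by
  simp [twoCounters, TCVertex.succ]

theorem mem_succ_z {α : Player} {y : Fin N} {w : TCVertex N} :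
    w ∈ (twoCounters N).succ (.z α y) ↔
      w = .t α y ∨ ∃ j : Fin N, Distracts N α y j ∧ w = .l α.opp j := by
  cases α <;>
    simp [twoCounters, TCVertex.succ, Distracts, opp, eq_comm]

theorem Distracts.lt {α : Player} {y j : ℕ} (h : Distracts N α y j) : j < N := by
  cases α <;> exact h.2

theorem comb_cases (ω : Player) (c d : ℕ) :
    (comb ω c d = c ∧ (d = c ∨ (ofPriority c = ω ∧ (d < c ∨ ofPriority d ≠ ω)) ∨
      (ofPriority c ≠ ω ∧ ofPriority d ≠ ω ∧ c < d))) ∨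
    (comb ω c d = d ∧ (d = c ∨ (ofPriority d = ω ∧ (c < d ∨ ofPriority c ≠ ω)) ∨
      (ofPriority c ≠ ω ∧ ofPriority d ≠ ω ∧ d < c))) := by
  unfold comb
  rcases lt_trichotomy c d with h | h | h <;> split_ifs <;> simp_all [min_def, max_def] <;> omega

theorem comb_eq (ω : Player) (c d : ℕ) : comb ω c d = c ∨ comb ω c d = d :=
  (comb_cases ω c d).imp And.left And.left

theorem comb_comm (ω : Player) (c d : ℕ) : comb ω c d = comb ω d c := by
  unfold comb
  split_ifs <;> simp [max_comm, min_comm]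

theorem le_comb {ω : Player} {c d w : ℕ} (hw : w = c ∨ w = d) (h : ofPriority w = ω) :
    w ≤ comb ω c d := by
  unfold comb
  rcases hw with rfl | rfl <;> simp only [h, if_true] <;> split_ifs <;> simp

namespace Labelling

variable {A : Labelling}

theorem reg_chain (α : Player) (y : Fin N) (i : ℕ) :
    A.reg (TCVertex.chain α y i) = A.c α y i := by
  unfold TCVertex.chain c
  split_ifs <;> rfl

theorem Valid.c_le (h : A.Valid N) (α : Player) {y : ℕ} (hy : y < N) (i : ℕ) :
    A.c α y i ≤ A.g α y := by
  unfold c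
  split_ifs
  · exact le_rfl
  · exact h.z_le α y hy

theorem Valid.le_c (h : A.Valid N) (α : Player) {y : ℕ} (hy : y < N) (i : ℕ) :
    chainPr α ≤ A.c α y i := by
  unfold c
  split_ifs
  · exact (chainPr_le α).trans (h.tangle_le α y hy)
  · exact h.chain_le α y hy

theorem Valid.reg_h (h : A.Valid N) (α : Player) (y : Fin N) :
    ofPriority (A.reg (TCVertex.h α y : TCVertex N)) = α := by
  show ofPriority (max _ _) = α
  have h₁ := le_highPr (N := N) α y
  rcases h.l_high α _ (TCVertex.next y).isLt with h₂ | ⟨h₂, _⟩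
  · rw [max_eq_left (by omega)]
    exact ofPriority_highPr α y
  · rcases max_cases (highPr N α y) (A.l α (TCVertex.next y)) with h₃ | h₃ <;> rw [h₃.1]
    · exact ofPriority_highPr α y
    · exact h₂

theorem Valid.low_comb (h : A.Valid N) (α : Player) {y : ℕ} (hy : y < N) {m : ℕ} (hm : m < y) :
    comb α.opp (A.c α y (m + 1)) (A.l α m) ≤ A.g α y ∨
      comb α.opp (A.c α y (m + 1)) (A.l α.opp m) ≤ A.g α y := by
  have hc := h.c_le α hy (m + 1)
  have := h.low α y hy m hm
  rcases comb_cases α.opp (A.c α y (m + 1)) (A.l α m) with h₁ | h₁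
  · left; omega
  rcases comb_cases α.opp (A.c α y (m + 1)) (A.l α.opp m) with h₂ | h₂
  · right; omega
  simp only [ne_iff, opp_opp] at *
  by_contra hne
  push Not at hne
  apply this
  refine ⟨?_, by omega, ?_, by omega⟩
  · rcases h₁.2 with h₃ | h₃ | h₃
    · omega
    · exact h₃.1
    · omega
  · rcases h₂.2 with h₃ | h₃ | h₃
    · omega
    · exact h₃.1
    · omega

theorem comb_up {ω : Player} {c d g : ℕ} (hc : c ≤ g) (h : g < comb ω c d) :
    ofPriority (comb ω c d) = ω := by
  rcases comb_cases ω c d with h₁ | h₁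
  · omega
  · rw [h₁.1] at h ⊢
    rcases h₁.2 with h₂ | h₂ | h₂
    · omega
    · exact h₂.1
    · omega

end Labelling
end Valid

/-! ### Valid labellings give decompositions -/

section Valid

open Player

variable {N : ℕ} {A : Labelling}

namespace Labelling

theorem Valid.pr_le (h : A.Valid N) (u : TCVertex N) : (twoCounters N).pr u ≤ A.reg u := by
  have hcomb : ∀ (α : Player) (y : Fin N) (m : Fin y) (β : Player),
      chainPr α ≤ comb α.opp (A.c α y (m + 1)) (A.l β m) := by
    intro α y m β
    have h₁ := h.le_c α y.isLt (m + 1)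
    have h₂ := h.low_le β m (by omega)
    have h₃ : 3 ≤ lowPr N β m := by cases β <;> simp only [lowPr] <;> omega
    have h₄ : chainPr α ≤ 1 := by cases α <;> simp [chainPr]
    rcases comb_cases α.opp (A.c α y (m + 1)) (A.l β m) with h₁ | h₁ <;> omega
  cases u with
  | l α y => exact (pr_l α y).trans_le (h.low_le α y y.isLt)
  | h α y => exact (pr_h α y).trans_le (le_max_left _ _)
  | t α y => exact (pr_t α y).trans_le (h.tangle_le α y y.isLt)
  | z α y => exact (pr_z α y).trans_le (h.chain_le α y y.isLt)
  | s α y i =>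
    exact (pr_s α y i).trans_le ((chainPr_le α).trans (h.tangle_le α y y.isLt))
  | a α y i => exact (pr_a α y i).trans_le (hcomb α y i α)
  | b α y i => exact (pr_b α y i).trans_le (hcomb α y i α.opp)

theorem Valid.exists_le (h : A.Valid N) (u : TCVertex N) :
    ∃ w ∈ (twoCounters N).succ u, A.reg w ≤ A.reg u := by
  have hcomb := comb_eq
  cases u with
  | l α y => exact ⟨_, mem_succ_l.2 rfl, h.g_le α y y.isLt⟩
  | h α y => exact ⟨_, mem_succ_h.2 rfl, le_max_right _ _⟩
  | t α y =>
    refine ⟨_, mem_succ_t.2 (.inr rfl), ?_⟩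
    rw [reg_chain]
    exact h.c_le α y.isLt 0
  | z α y =>
    rcases h.z_eq α y y.isLt with he | ⟨j, hj, he⟩
    · exact ⟨_, mem_succ_z.2 (.inl rfl), he.ge⟩
    · exact ⟨_, mem_succ_z.2 (.inr ⟨⟨j, hj.lt⟩, hj, rfl⟩), he.le⟩
  | s α y i =>
    rcases h.low_comb α y.isLt i.isLt with hle | hle
    · exact ⟨_, mem_succ_s.2 (.inl rfl), hle⟩
    · exact ⟨_, mem_succ_s.2 (.inr rfl), hle⟩
  | a α y i =>
    rcases hcomb α.opp (A.c α y (i + 1)) (A.l α i) with he | he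
    · exact ⟨_, mem_succ_a.2 (.inl rfl), (reg_chain α y (i + 1)).trans_le he.ge⟩
    · exact ⟨_, mem_succ_a.2 (.inr rfl), he.ge⟩
  | b α y i =>
    rcases hcomb α.opp (A.c α y (i + 1)) (A.l α.opp i) with he | he
    · exact ⟨_, mem_succ_b.2 (.inl rfl), (reg_chain α y (i + 1)).trans_le he.ge⟩
    · exact ⟨_, mem_succ_b.2 (.inr rfl), he.ge⟩

/-- No vertex is attracted to a region above its own. -/
theorem Valid.parity_ne (h : A.Valid N) (u : TCVertex N) {w : TCVertex N}
    (hw : w ∈ (twoCounters N).succ u) (hlt : A.reg u < A.reg w) :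
    ofPriority (A.reg w) ≠ (twoCounters N).owner u := by
  cases u with
  | l α y =>
    obtain rfl := mem_succ_l.1 hw
    exact absurd hlt (not_lt_of_ge (h.g_le α y y.isLt))
  | h α y =>
    obtain rfl := mem_succ_h.1 hw
    exact absurd hlt (not_lt_of_ge (le_max_right _ _))
  | t α y =>
    rcases mem_succ_t.1 hw with rfl | rfl
    · rw [owner_t, ne_iff, opp_opp]
      exact h.reg_h α y
    · rw [reg_chain] at hlt
      exact absurd hlt (not_lt_of_ge (h.c_le α y.isLt 0))
  | z α y =>
    rcases mem_succ_z.1 hw with rfl | ⟨j, hj, rfl⟩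
    · rcases h.kind α y y.isLt with hk | ⟨x, hk⟩
      · exact absurd hlt (by rw [show A.reg (.z α y : TCVertex N) = A.z α y from rfl, hk.z_eq]
                             exact lt_irrefl _)
      · exact hk.parity
    · exact h.z_up α y y.isLt j hj hlt
  | s α y i =>
    rw [owner_s, ne_iff]
    rcases mem_succ_s.1 hw with rfl | rfl <;> exact comb_up (h.c_le α y.isLt _) hlt
  | a α y i =>
    rw [owner_a]
    refine fun hp => hlt.not_ge (le_comb ?_ hp)
    rcases mem_succ_a.1 hw with rfl | rfl
    · exact .inl (reg_chain _ _ _)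
    · exact .inr rfl
  | b α y i =>
    rw [owner_b]
    refine fun hp => hlt.not_ge (le_comb ?_ hp)
    rcases mem_succ_b.1 hw with rfl | rfl
    · exact .inl (reg_chain _ _ _)
    · exact .inr rfl

/-- A vertex is attracted to its region if its player has a successor that is attracted, or if all
successors that are not in higher regions are attracted. -/
theorem attracted_of_succ {S B : Finset (TCVertex N)} {ω : Player} {p : ℕ}
    (hS : ∀ u : TCVertex N, A.reg u ≤ p → u ∈ S) {u : TCVertex N} (hu : A.reg u ≤ p)
    (hex : (twoCounters N).owner u = ω →
      ∃ w ∈ (twoCounters N).succ u, Attracted (twoCounters N) S ω B w)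
    (hall : (twoCounters N).owner u ≠ ω → ∀ w ∈ (twoCounters N).succ u, w ∈ S →
      Attracted (twoCounters N) S ω B w) :
    Attracted (twoCounters N) S ω B u := by
  by_cases ho : (twoCounters N).owner u = ω
  · obtain ⟨w, hw, ha⟩ := hex ho
    exact .own (hS u hu) ho hw ha
  · exact .opp (hS u hu) ho (hall ho)

section Attracted

variable {S B : Finset (TCVertex N)} {p : ℕ} (hS : ∀ u : TCVertex N, u ∈ S ↔ A.reg u ≤ p)
  (hB : ∀ u : TCVertex N, A.reg u = p → (twoCounters N).pr u = p ∨
    (A.layout N fun _ => ∅).core u → u ∈ B)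

include hS

theorem attracted_comb {α β : Player} {y : Fin N} {m : ℕ} {u w : TCVertex N}
    (hs : ∀ x, x ∈ (twoCounters N).succ u ↔ x = TCVertex.chain α y (m + 1) ∨ x = w)
    (ho : (twoCounters N).owner u = β)
    (hu : A.reg u = comb β (A.c α y (m + 1)) (A.reg w)) (hp : A.reg u = p)
    (h₁ : A.c α y (m + 1) = p →
      Attracted (twoCounters N) S (ofPriority p) B (TCVertex.chain α y (m + 1)))
    (h₂ : A.reg w = p → Attracted (twoCounters N) S (ofPriority p) B w) :
    Attracted (twoCounters N) S (ofPriority p) B u := by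
  have hcomb := comb_cases β (A.c α y (m + 1)) (A.reg w)
  rw [← hu, hp] at hcomb
  refine attracted_of_succ (A := A) (fun u => (hS u).2) hp.le (fun _ => ?_) fun hne x hx hxS => ?_
  · rcases hcomb with h | h
    · exact ⟨_, (hs _).2 (.inl rfl), h₁ h.1.symm⟩
    · exact ⟨_, (hs _).2 (.inr rfl), h₂ h.1.symm⟩
  · have hle := (hS x).1 hxS
    rw [ho] at hne
    rcases (hs x).1 hx with rfl | rfl
    · apply h₁
      rw [reg_chain] at hle
      rcases hcomb with h | h
      · exact h.1.symm
      · rcases h.2 with h₃ | h₃ | h₃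
        · rw [← h₃]
          exact h.1.symm
        · exact absurd (h.1 ▸ h₃.1).symm hne
        · omega
    · apply h₂
      rcases hcomb with h | h
      · rcases h.2 with h₃ | h₃ | h₃
        · rw [h₃]
          exact h.1.symm
        · exact absurd (h.1 ▸ h₃.1).symm hne
        · omega
      · exact h.1.symm

theorem attracted_a {α : Player} {y : Fin N} {i : Fin y}
    (hp : A.reg (.a α y i : TCVertex N) = p)
    (h₁ : A.c α y (i + 1) = p →
      Attracted (twoCounters N) S (ofPriority p) B (TCVertex.chain α y (i + 1)))
    (h₂ : A.l α i = p →
      Attracted (twoCounters N) S (ofPriority p) B (.l α (TCVertex.up i))) :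
    Attracted (twoCounters N) S (ofPriority p) B (.a α y i) :=
  attracted_comb hS (fun _ => mem_succ_a) rfl rfl hp h₁ h₂

theorem attracted_b {α : Player} {y : Fin N} {i : Fin y}
    (hp : A.reg (.b α y i : TCVertex N) = p)
    (h₁ : A.c α y (i + 1) = p →
      Attracted (twoCounters N) S (ofPriority p) B (TCVertex.chain α y (i + 1)))
    (h₂ : A.l α.opp i = p →
      Attracted (twoCounters N) S (ofPriority p) B (.l α.opp (TCVertex.up i))) :
    Attracted (twoCounters N) S (ofPriority p) B (.b α y i) :=
  attracted_comb hS (fun _ => mem_succ_b) rfl rfl hp h₁ h₂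

theorem attracted_l_of_t {α : Player} {y : Fin N} (hl : A.l α y = p)
    (ht : Attracted (twoCounters N) S (ofPriority p) B (.t α y)) :
    Attracted (twoCounters N) S (ofPriority p) B (.l α y) := by
  refine attracted_of_succ (A := A) (fun u => (hS u).2) hl.le
    (fun _ => ⟨_, mem_succ_l.2 rfl, ht⟩) fun _ w hw _ => ?_
  rw [mem_succ_l.1 hw]
  exact ht

theorem Valid.attracted_s_of_opp (h : A.Valid N) {α : Player} {y : Fin N} {i : Fin y}
    (hp : A.g α y = p) (hpar : ofPriority p ≠ α)
    (h₁ : A.c α y (i + 1) = p →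
      Attracted (twoCounters N) S (ofPriority p) B (TCVertex.chain α y (i + 1)))
    (h₁' : A.c α y (i + 1) ≠ p → p ≤ A.l α i ∧ p ≤ A.l α.opp i ∧ ofPriority (A.l α i) ≠ α ∧
      ofPriority (A.l α.opp i) ≠ α)
    (h₂ : A.l α i = p →
      Attracted (twoCounters N) S (ofPriority p) B (.l α (TCVertex.up i)))
    (h₃ : A.l α.opp i = p →
      Attracted (twoCounters N) S (ofPriority p) B (.l α.opp (TCVertex.up i))) :
    Attracted (twoCounters N) S (ofPriority p) B (.s α y i) := by
  have hcl := h.c_le α y.isLt (i + 1)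
  have key : ∀ d, (A.c α y (i + 1) ≠ p → p ≤ d ∧ ofPriority d ≠ α) →
      p ≤ comb α.opp (A.c α y (i + 1)) d := by
    intro d hd
    by_cases hc : A.c α y (i + 1) = p
    · exact hc.ge.trans (le_comb (.inl rfl) (hc ▸ ne_iff.1 hpar))
    · exact (hd hc).1.trans (le_comb (.inr rfl) (ne_iff.1 (hd hc).2))
  refine attracted_of_succ (A := A) (fun u => (hS u).2) hp.le
    (fun ho => absurd ho.symm hpar) fun _ w hw hwS => ?_
  have hle := (hS w).1 hwS
  rcases mem_succ_s.1 hw with rfl | rfl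
  · refine attracted_a hS (le_antisymm hle ?_) h₁ h₂
    exact key _ fun hc => ⟨(h₁' hc).1, (h₁' hc).2.2.1⟩
  · refine attracted_b hS (le_antisymm hle ?_) h₁ h₃
    exact key _ fun hc => ⟨(h₁' hc).2.1, (h₁' hc).2.2.2⟩

include hB

theorem attracted_l_of_eq_lowPr {α : Player} {y : Fin N} (hl : A.l α y = lowPr N α y)
    (hp : A.l α y = p) : Attracted (twoCounters N) S (ofPriority p) B (.l α y) :=
  .base (hB _ hp (.inl (by rw [pr_l, ← hl, hp])))

/-- The tangle vertex of a crossed bit is attracted via the low vertex of the higher bit. -/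
theorem Valid.attracted_t_of_crossed (h : A.Valid N) {α : Player} {y : Fin N} {x : ℕ}
    (hk : A.Crossed N α y x) (hp : A.g α y = p) :
    Attracted (twoCounters N) S (ofPriority p) B (.t α y) := by
  have hpar : ofPriority p ≠ α := hp ▸ hk.parity
  have hxN : x < N := hk.lt.trans y.isLt
  have hlx := hk.own x le_rfl hk.lt
  have hx : Attracted (twoCounters N) S (ofPriority p) B (.l α ⟨x, hxN⟩) :=
    attracted_l_of_eq_lowPr (y := ⟨x, hxN⟩) hS hB (hlx.trans hk.low) (hlx.trans hp)
  have hs : ∀ i, i ≤ x →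
      Attracted (twoCounters N) S (ofPriority p) B (TCVertex.chain α y i) := by
    intro i hi
    induction hd : x - i generalizing i with
    | zero =>
      -- here `a` leads to the low vertex of bit `x`, while `b` is in a higher region
      obtain rfl : i = x := by omega
      rw [TCVertex.chain, dif_pos hk.lt]
      have hhigh := hk.high
      have hopp := (hk.opp i le_rfl hk.lt).2
      have hcl := h.c_le α y.isLt (i + 1)
      refine attracted_of_succ (A := A) (fun u => (hS u).2) hp.le
        (fun ho => absurd ho.symm hpar) fun _ w hw hwS => ?_
      have hle := (hS w).1 hwS
      rcases mem_succ_s.1 hw with rfl | rfl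
      · refine attracted_of_succ (A := A) (fun u => (hS u).2) hle
          (fun _ => ⟨_, mem_succ_a.2 (.inr rfl), hx⟩) fun ho => ?_
        rw [owner_a, ne_comm, ne_iff, opp_opp] at ho
        exact absurd ho hpar
      · change comb α.opp (A.c α y (i + 1)) (A.l α.opp i) ≤ p at hle
        have := le_comb (c := A.c α y (i + 1)) (.inr rfl) (ne_iff.1 hopp)
        omega
    | succ d ih =>
      have hlt : i < y := by have := hk.lt; omega
      have hc : A.c α y (i + 1) = p := by
        rw [c, if_pos (by have := hk.lt; omega), hp]
      have hch := ih (i + 1) (by omega) (by omega)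
      rw [TCVertex.chain, dif_pos hlt]
      rw [ne_iff] at hpar
      have hown : ∀ u : TCVertex N, (twoCounters N).owner u = α.opp → A.reg u ≤ p →
          TCVertex.chain α y (i + 1) ∈ (twoCounters N).succ u →
          Attracted (twoCounters N) S (ofPriority p) B u := fun u ho hle hs =>
        .own ((hS u).2 hle) (ho.trans hpar.symm) hs hch
      refine attracted_of_succ (A := A) (fun u => (hS u).2) hp.le
        (fun ho => absurd ho.symm (ne_iff.2 hpar)) fun _ w hw hwS => ?_
      have hle := (hS w).1 hwS
      rcases mem_succ_s.1 hw with rfl | rfl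
      · exact hown _ rfl hle (mem_succ_a.2 (.inl rfl))
      · exact hown _ rfl hle (mem_succ_b.2 (.inl rfl))
  refine attracted_of_succ (A := A) (fun u => (hS u).2) hp.le
    (fun _ => ⟨_, mem_succ_t.2 (.inr rfl), hs 0 (by omega)⟩) fun ho => ?_
  rw [owner_t, ne_comm, ne_iff, opp_opp] at ho
  exact absurd ho hpar

theorem Valid.attracted_l_of_early (h : A.Valid N) {α : Player} {y : Fin N}
    (he : A.Early N α y) (hp : A.l α y = p) :
    Attracted (twoCounters N) S (ofPriority p) B (.l α y) := by
  rcases he with he | ⟨he, hpar⟩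
  · exact attracted_l_of_eq_lowPr hS hB he hp
  · rcases h.kind α y y.isLt with hk | ⟨x, hk⟩
    · exact absurd hk.parity hpar
    · exact attracted_l_of_t hS hp (h.attracted_t_of_crossed hS hB hk (he.symm.trans hp))

theorem Valid.attracted_l_of (h : A.Valid N) {α : Player} {y : Fin N} (hp : A.l α y = p)
    (ht : A.g α y = p → Attracted (twoCounters N) S (ofPriority p) B (.t α y)) :
    Attracted (twoCounters N) S (ofPriority p) B (.l α y) := by
  rcases h.l_eq α y y.isLt with he | he
  · exact attracted_l_of_eq_lowPr hS hB he hp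
  · exact attracted_l_of_t hS hp (ht (he.symm.trans hp))

/-- The tangle vertex and the chain of a bit that is attracted by its player. -/
theorem Valid.attracted_of_forward (h : A.Valid N) {α : Player} {y : Fin N}
    (hk : A.Forward N α y) (hp : A.g α y = p) :
    Attracted (twoCounters N) S (ofPriority p) B (.t α y) ∧
      ∀ i, Attracted (twoCounters N) S (ofPriority p) B (TCVertex.chain α y i) := by
  obtain ⟨y, hy⟩ := y
  induction y using Nat.strong_induction_on with
  | _ y ih =>
  have hpar : ofPriority p = α := hp ▸ hk.parity
  have hz : ofPriority p = α →
      Attracted (twoCounters N) S (ofPriority p) B (.z α ⟨y, hy⟩) →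
      ∀ i, Attracted (twoCounters N) S (ofPriority p) B (TCVertex.chain α ⟨y, hy⟩ i) := by
    intro _ hz i
    induction hd : y - i generalizing i with
    | zero =>
      rw [TCVertex.chain, dif_neg (by simp only; omega)]
      exact hz
    | succ d ihd =>
      have hlt : i < y := by omega
      have hch := ihd (i + 1) (by omega)
      have hc : A.c α y (i + 1) = p := by
        rw [c]
        split_ifs
        · exact hp
        · exact hk.z_eq.trans hp
      rw [TCVertex.chain, dif_pos (by simpa using hlt)]
      have key : ∀ d', ofPriority d' = α → p ≤ d' → comb α.opp p d' = p := by
        intro d' h₁ h₂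
        rw [comb, if_neg (by simp [hpar]), if_neg (by simp [h₁]), min_eq_left h₂]
      rcases hk.chain i hlt with ⟨h₁, h₂⟩ | ⟨h₁, h₂, h₃⟩
      · refine .own (w := .a α ⟨y, hy⟩ ⟨i, hlt⟩) ((hS _).2 hp.le) hpar.symm
          (mem_succ_s.2 (.inl rfl)) (attracted_a hS ?_ (fun _ => hch) fun hl => ?_)
        · show comb α.opp (A.c α y (i + 1)) (A.l α i) = p
          rw [hc, key _ h₁ (hp ▸ h₂)]
        · refine h.attracted_l_of (y := ⟨i, hlt.trans hy⟩) hS hB hl fun hg => ?_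
          have hk' : A.Forward N α i := by
            rcases h.kind α i (hlt.trans hy) with hk' | ⟨x, hk'⟩
            · exact hk'
            · exact absurd (hg ▸ hpar) hk'.parity
          exact (ih i hlt (hlt.trans hy) hk' hg).1
      · refine .own (w := .b α ⟨y, hy⟩ ⟨i, hlt⟩) ((hS _).2 hp.le) hpar.symm
          (mem_succ_s.2 (.inr rfl)) (attracted_b hS ?_ (fun _ => hch) fun hl => ?_)
        · show comb α.opp (A.c α y (i + 1)) (A.l α.opp i) = p
          rw [hc, key _ h₁ (hp ▸ h₂)]
        · exact h.attracted_l_of_early (y := ⟨i, hlt.trans hy⟩) hS hB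
            (h₃ (hl.trans hp.symm)) hl
  have hzt : ∀ w, w ∈ (twoCounters N).succ (.z α ⟨y, hy⟩) →
      Attracted (twoCounters N) S (ofPriority p) B w →
      Attracted (twoCounters N) S (ofPriority p) B (.z α ⟨y, hy⟩) := fun w hw ha =>
    .own ((hS _).2 (hk.z_eq.trans hp).le) hpar.symm hw ha
  have hbase : ∀ {u : TCVertex N}, u ∈ B → Attracted (twoCounters N) S (ofPriority p) B u :=
    fun hu => .base hu
  have hcore : A.core α y ∨ A.g α y = tanglePr α →
      Attracted (twoCounters N) S (ofPriority p) B (.t α ⟨y, hy⟩) := by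
    rintro (hc | hc)
    · exact hbase (hB _ hp (.inr hc))
    · exact hbase (hB _ hp (.inl (by rw [pr_t, ← hc, hp])))
  rcases hk.start with hc | hc | ⟨hb, j, hj, hl, he⟩
  · have ht := hcore (.inl hc)
    exact ⟨ht, hz hpar (hzt _ (mem_succ_z.2 (.inl rfl)) ht)⟩
  · have ht := hcore (.inr hc)
    exact ⟨ht, hz hpar (hzt _ (mem_succ_z.2 (.inl rfl)) ht)⟩
  -- the chain is entered at `z`, and `t` is attracted last, as its vertex `h` is in a higher region
  · have hlj := h.attracted_l_of_early (y := ⟨j, hj.lt⟩) hS hB he (hl.trans hp)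
    have hch := hz hpar (hzt _ (mem_succ_z.2 (.inr ⟨⟨j, hj.lt⟩, hj, rfl⟩)) hlj)
    refine ⟨attracted_of_succ (A := A) (fun u => (hS u).2) hp.le
      (fun ho => ⟨_, mem_succ_t.2 (.inr rfl), hch 0⟩) fun _ w hw hwS => ?_, hch⟩
    have hle := (hS w).1 hwS
    rcases mem_succ_t.1 hw with rfl | rfl
    · have := le_highPr (N := N) α y
      have : highPr N α y ≤ A.reg (.h α ⟨y, hy⟩ : TCVertex N) := le_max_left _ _
      omega
    · exact hch 0

theorem Valid.attracted_t (h : A.Valid N) {α : Player} {y : Fin N} (hp : A.g α y = p) :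
    Attracted (twoCounters N) S (ofPriority p) B (.t α y) := by
  rcases h.kind α y y.isLt with hk | ⟨x, hk⟩
  · exact (h.attracted_of_forward hS hB hk hp).1
  · exact h.attracted_t_of_crossed hS hB hk hp

theorem Valid.attracted_l (h : A.Valid N) {α : Player} {y : Fin N} (hp : A.l α y = p) :
    Attracted (twoCounters N) S (ofPriority p) B (.l α y) :=
  h.attracted_l_of hS hB hp (h.attracted_t hS hB)

theorem Valid.attracted_z (h : A.Valid N) {α : Player} {y : Fin N} (hp : A.z α y = p) :
    Attracted (twoCounters N) S (ofPriority p) B (.z α y) := by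
  refine attracted_of_succ (A := A) (fun u => (hS u).2) hp.le (fun ho => ?_) fun ho w hw hwS => ?_
  · rcases h.z_eq α y y.isLt with he | ⟨j, hj, he⟩
    · exact ⟨_, mem_succ_z.2 (.inl rfl), h.attracted_t hS hB (he.symm.trans hp)⟩
    · exact ⟨_, mem_succ_z.2 (.inr ⟨⟨j, hj.lt⟩, hj, rfl⟩),
        h.attracted_l hS hB (y := ⟨j, hj.lt⟩) (he.trans hp)⟩
  · have hle := (hS w).1 hwS
    rw [owner_z, ne_comm] at ho
    rcases mem_succ_z.1 hw with rfl | ⟨j, hj, rfl⟩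
    · exact h.attracted_t hS hB (le_antisymm hle (hp ▸ h.z_le α y y.isLt))
    · exact h.attracted_l hS hB (le_antisymm hle (hp ▸ h.z_min α y y.isLt (hp ▸ ho) j hj))

theorem Valid.attracted_chain (h : A.Valid N) {α : Player} {y : Fin N} {i : ℕ}
    (hp : A.c α y i = p) :
    Attracted (twoCounters N) S (ofPriority p) B (TCVertex.chain α y i) := by
  induction hd : (y : ℕ) - i generalizing i with
  | zero =>
    rw [TCVertex.chain, dif_neg (by omega)]
    rw [c, if_neg (by omega)] at hp
    exact h.attracted_z hS hB hp
  | succ d ih =>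
    have hlt : i < y := by omega
    rw [c, if_pos hlt] at hp
    rcases h.kind α y y.isLt with hk | ⟨x, hk⟩
    · exact (h.attracted_of_forward hS hB hk hp).2 i
    · rw [TCVertex.chain, dif_pos hlt]
      refine h.attracted_s_of_opp hS (i := ⟨i, hlt⟩) hp (hp ▸ hk.parity)
        (fun hc => ih hc (by simp only at *; omega)) (fun hc => ?_)
        (h.attracted_l hS hB (y := TCVertex.up ⟨i, hlt⟩))
        (h.attracted_l hS hB (y := TCVertex.up ⟨i, hlt⟩))
      have hy : i + 1 = y := by
        by_contra hne
        rw [c, if_pos (by simp only; omega)] at hc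
        exact hc hp
      have hx : x ≤ i := by have := hk.lt; omega
      have h₁ := hk.own i hx hlt
      have h₂ := hk.opp i hx hlt
      exact ⟨by simp only; omega, by simp only; omega, h₁ ▸ hk.parity, h₂.2⟩

theorem Valid.attracted (h : A.Valid N) (u : TCVertex N) (hp : A.reg u = p) :
    Attracted (twoCounters N) S (ofPriority p) B u := by
  cases u with
  | l α y => exact h.attracted_l hS hB hp
  | h α y =>
    rcases max_cases (highPr N α y) (A.l α (TCVertex.next y)) with h₁ | h₁
    · exact .base (hB _ hp (.inl (by rw [pr_h, ← hp, ← h₁.1]; rfl)))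
    · have hl := h.attracted_l hS hB (y := TCVertex.next y) (h₁.1.symm.trans hp)
      refine attracted_of_succ (A := A) (fun u => (hS u).2) hp.le
        (fun _ => ⟨_, mem_succ_h.2 rfl, hl⟩) fun _ w hw _ => ?_
      rw [mem_succ_h.1 hw]
      exact hl
  | t α y => exact h.attracted_t hS hB hp
  | z α y => exact h.attracted_z hS hB hp
  | s α y i =>
    have := h.attracted_chain hS hB (α := α) (y := y) (i := i) (by rw [c, if_pos i.isLt]; exact hp)
    rwa [TCVertex.chain, dif_pos i.isLt] at this
  | a α y i =>
    exact attracted_a hS hp (h.attracted_chain hS hB)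
      (h.attracted_l hS hB (y := TCVertex.up i))
  | b α y i =>
    exact attracted_b hS hp (h.attracted_chain hS hB)
      (h.attracted_l hS hB (y := TCVertex.up i))

end Attracted

theorem mem_alive {won : Player → Finset (TCVertex N)} {u : TCVertex N} :
    u ∈ (A.layout N won).alive ↔ A.reg u < 4 * N + 4 := by
  simp [layout]

/-- The regions of a valid labelling are the regions that a search computes. -/
theorem Valid.isDecomposition (h : A.Valid N) (won : Player → Finset (TCVertex N)) :
    IsDecomposition (twoCounters N) (A.layout N won).alive (A.layout N won).reg
      (A.layout N won).core := by
  refine ⟨fun u _ => h.pr_le u, fun u hu => ?_, fun u _ w hw _ hlt => h.parity_ne u hw hlt,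
    fun u hu B hB => ?_⟩
  · obtain ⟨w, hw, hle⟩ := h.exists_le u
    exact ⟨w, hw, mem_alive.2 (hle.trans_lt (mem_alive.1 hu)), hle⟩
  · have hu' := mem_alive.1 hu
    refine h.attracted (fun w => ?_) (fun w hw hb => ?_) u rfl
    · rw [Finset.mem_filter, mem_alive]
      exact ⟨fun hw => hw.2, fun hw => ⟨hw.trans_lt hu', hw⟩⟩
    · exact hB w (mem_alive.2 (hw ▸ hu')) hw (hb.imp (fun hb => hb.trans hw.symm) id)

end Labelling

end Valid

/-! ### Open regions and promotions of labellings -/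

section Moves

open Player

variable {N : ℕ} {A A' : Labelling} {f q b : ℕ} {won won' : Player → Finset (TCVertex N)}

namespace Labelling

/-- All regions above `f` are open: the low vertex or the high vertex from which the region is
attracted leaves the region. -/
def OpenAbove (N f : ℕ) (A : Labelling) : Prop :=
  ∀ α, ∀ y < N, ∀ d, d = A.l α y ∨ d = A.g α y ∨ d = A.z α y → f < d → d < 4 * N + 4 →
    (∃ β, ∃ y' < N, A.l β y' = d ∧ lowPr N β y' = d ∧ A.g β y' < d) ∨
      ∃ β, highPr N β 0 = d ∧ A.l β (N - 1) < d

theorem reg_eq_label (A : Labelling) (u : TCVertex N) :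
    (∃ α, ∃ y < N, A.reg u = A.l α y ∨ A.reg u = A.g α y ∨ A.reg u = A.z α y) ∨
      ∃ α y, u = .h α y ∧ A.reg u = highPr N α y ∧ A.l α (TCVertex.next y) < highPr N α y := by
  have hcomb : ∀ (α : Player) (y : Fin N) (m : Fin y) (β : Player),
      ∃ γ, ∃ y' < N, comb α.opp (A.c α y (m + 1)) (A.l β m) = A.l γ y' ∨
        comb α.opp (A.c α y (m + 1)) (A.l β m) = A.g γ y' ∨
        comb α.opp (A.c α y (m + 1)) (A.l β m) = A.z γ y' := by
    intro α y m β
    rcases comb_cases α.opp (A.c α y (m + 1)) (A.l β m) with h | h <;> rw [h.1]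
    · refine ⟨α, y, y.isLt, .inr ?_⟩
      unfold c
      split_ifs
      · exact .inl rfl
      · exact .inr rfl
    · exact ⟨β, m, m.isLt.trans y.isLt, .inl rfl⟩
  cases u with
  | l α y => exact .inl ⟨α, y, y.isLt, .inl rfl⟩
  | h α y =>
    by_cases hlt : A.l α (TCVertex.next y) < highPr N α y
    · exact .inr ⟨α, y, rfl, max_eq_left hlt.le, hlt⟩
    · exact .inl ⟨α, _, (TCVertex.next y).isLt, .inl (max_eq_right (not_lt.1 hlt))⟩
  | t α y => exact .inl ⟨α, y, y.isLt, .inr (.inl rfl)⟩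
  | z α y => exact .inl ⟨α, y, y.isLt, .inr (.inr rfl)⟩
  | s α y _ => exact .inl ⟨α, y, y.isLt, .inr (.inl rfl)⟩
  | a α y m => exact .inl (hcomb α y m α)
  | b α y m => exact .inl (hcomb α y m α.opp)

theorem OpenAbove.isOpen (h : A.OpenAbove N f) (hN : 1 ≤ N) (u : TCVertex N)
    (hu : u ∈ (A.layout N won).alive) (hlt : f < (A.layout N won).reg u) :
    (A.layout N won).IsOpen (twoCounters N) ((A.layout N won).reg u) := by
  rw [mem_alive] at hu
  change f < A.reg u at hlt
  show (A.layout N won).IsOpen (twoCounters N) (A.reg u)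
  have high : ∀ β (y : Fin N), A.l β (TCVertex.next y) < highPr N β y → highPr N β y < 4 * N + 4 →
      (A.layout N won).IsOpen (twoCounters N) (highPr N β y) := by
    intro β y h₁ h₂
    have he : A.reg (.h β y : TCVertex N) = highPr N β y := max_eq_left h₁.le
    refine .inr ⟨.h β y, mem_alive.2 (he ▸ h₂), he, ?_, _, mem_succ_h.2 rfl,
      mem_alive.2 (h₁.trans h₂), h₁⟩
    rw [owner_h, ofPriority_highPr]
    exact opp_ne β
  rcases reg_eq_label A u with ⟨α, y, hy, hd⟩ | ⟨α, y, -, hd, hl⟩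
  · rcases h α y hy _ hd hlt hu with ⟨β, y', hy', h₁, h₂, h₃⟩ | ⟨β, h₁, h₂⟩
    · refine .inl ⟨.l β ⟨y', hy'⟩, mem_alive.2 (h₁.trans_lt hu), h₁, ?_, fun w hw _ => ?_⟩
      · rw [owner_l, ← h₂, ofPriority_lowPr]
      · rw [mem_succ_l.1 hw]
        exact h₃.ne
    · rw [← h₁] at h₂ hu ⊢
      exact high β ⟨0, hN⟩ h₂ hu
  · rw [hd] at hu ⊢
    exact high α y hl hu

/-- The region `f` is closed, and the opponent can leave it only to regions from `q` on. -/
structure Closed (N f q : ℕ) (A : Labelling) : Prop where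
  lt : f < q
  bound : f < 2 * N + 4
  l_eq : ∀ α, ∀ y < N, A.l α y = f → A.g α y = f ∧ y + 1 = N
  parity : ∀ α, ∀ y < N, A.g α y = f → ofPriority f = α
  high : ∀ α, ∀ y : Fin N, A.g α y = f → q ≤ A.l α (TCVertex.next y) ∨ q ≤ highPr N α y
  z_own : ∀ α, ∀ y < N, A.z α y = f → ofPriority f = α → A.g α y = f
  z_opp : ∀ α, ∀ y < N, A.z α y = f → ofPriority f ≠ α → (A.g α y = f ∨ q ≤ A.g α y) ∧
    ∀ j, Distracts N α y j → A.l α.opp j = f ∨ q ≤ A.l α.opp j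
  chain : ∀ α, ∀ y < N, A.g α y = f → ∀ m < y, ∀ γ, ofPriority (A.l γ m) = α → q ≤ A.l γ m

theorem Closed.own (h : A.Closed N f q) (hA : A.Valid N) (u : TCVertex N) (hu : A.reg u = f)
    (ho : (twoCounters N).owner u = ofPriority f) :
    ∃ w ∈ (twoCounters N).succ u, A.reg w = f := by
  have hcomb := comb_eq
  cases u with
  | l α y => exact ⟨_, mem_succ_l.2 rfl, (h.l_eq α y y.isLt hu).1⟩
  | h α y =>
    have h₁ : highPr N α y ≤ A.reg (.h α y : TCVertex N) := le_max_left _ _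
    have := le_highPr (N := N) α y
    have := h.bound
    omega
  | t α y =>
    have := h.parity α y y.isLt hu
    rw [owner_t, this] at ho
    exact absurd ho (opp_ne α)
  | z α y => exact ⟨_, mem_succ_z.2 (.inl rfl), h.z_own α y y.isLt hu ho.symm⟩
  | s α y i =>
    have hf : A.Forward N α y := by
      rcases hA.kind α y y.isLt with hk | ⟨x, hk⟩
      · exact hk
      · exact absurd (h.parity α y y.isLt hu) (hu ▸ hk.parity)
    have hc : A.c α y (i + 1) = f := by
      unfold c
      split_ifs
      · exact hu
      · exact hf.z_eq.trans hu
    have hg : A.g α y = f := hu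
    have key : ∀ d, ofPriority d = α → f ≤ d → comb α.opp f d = f := by
      intro d h₁ h₂
      rw [comb, if_neg (by simp [← ho, owner_s]), if_neg (by simp [h₁]), min_eq_left h₂]
    rcases hf.chain i i.isLt with ⟨h₁, h₂⟩ | ⟨h₁, h₂, _⟩
    · refine ⟨_, mem_succ_s.2 (.inl rfl), ?_⟩
      show comb α.opp (A.c α y (i + 1)) (A.l α i) = f
      rw [hc, key _ h₁ (hg ▸ h₂)]
    · refine ⟨_, mem_succ_s.2 (.inr rfl), ?_⟩
      show comb α.opp (A.c α y (i + 1)) (A.l α.opp i) = f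
      rw [hc, key _ h₁ (hg ▸ h₂)]
  | a α y i =>
    rcases hcomb α.opp (A.c α y (i + 1)) (A.l α i) with he | he
    · exact ⟨_, mem_succ_a.2 (.inl rfl), (reg_chain α y (i + 1)).trans (he.symm.trans hu)⟩
    · exact ⟨_, mem_succ_a.2 (.inr rfl), he.symm.trans hu⟩
  | b α y i =>
    rcases hcomb α.opp (A.c α y (i + 1)) (A.l α.opp i) with he | he
    · exact ⟨_, mem_succ_b.2 (.inl rfl), (reg_chain α y (i + 1)).trans (he.symm.trans hu)⟩
    · exact ⟨_, mem_succ_b.2 (.inr rfl), he.symm.trans hu⟩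

theorem Closed.escape (h : A.Closed N f q) (hA : A.Valid N) (u : TCVertex N) (hu : A.reg u = f)
    (ho : (twoCounters N).owner u ≠ ofPriority f) {w : TCVertex N}
    (hw : w ∈ (twoCounters N).succ u) : A.reg w = f ∨ q ≤ A.reg w := by
  have hcomb : ∀ (α : Player) (y : Fin N) (m : Fin y) (γ : Player),
      comb α.opp (A.c α y (m + 1)) (A.l γ m) = f → α.opp ≠ ofPriority f →
      A.c α y (m + 1) = f ∧ q ≤ A.l γ m := by
    intro α y m γ hc ho
    rw [ne_comm, ne_iff, opp_opp] at ho
    have hl : A.l γ m ≠ f := fun he => by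
      have := (h.l_eq γ m (m.isLt.trans y.isLt) he).2
      omega
    have hcf : A.c α y (m + 1) = f := by
      rcases comb_cases α.opp (A.c α y (m + 1)) (A.l γ m) with h₁ | h₁ <;> omega
    have hg : A.g α y = f := by
      unfold c at hcf
      split_ifs at hcf
      · exact hcf
      · exact h.z_own α y y.isLt hcf ho
    refine ⟨hcf, h.chain α y y.isLt hg m m.isLt γ ?_⟩
    by_contra hne
    rw [hcf, comb, if_neg (by simp [ho]), if_pos (ne_iff.1 hne)] at hc
    exact hl hc
  cases u with
  | l α y =>
    rw [mem_succ_l.1 hw]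
    exact .inl (h.l_eq α y y.isLt hu).1
  | h α y =>
    have h₁ : highPr N α y ≤ A.reg (.h α y : TCVertex N) := le_max_left _ _
    have := le_highPr (N := N) α y
    have := h.bound
    omega
  | t α y =>
    rcases mem_succ_t.1 hw with rfl | rfl
    · right
      rcases h.high α y hu with h₁ | h₁
      · exact h₁.trans (le_max_right _ _)
      · exact h₁.trans (le_max_left _ _)
    · left
      rw [reg_chain]
      unfold c
      split_ifs
      · exact hu
      · rcases hA.kind α y y.isLt with hk | ⟨x, hk⟩
        · exact hk.z_eq.trans hu
        · exact absurd (h.parity α y y.isLt hu) (hu ▸ hk.parity)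
  | z α y =>
    obtain ⟨h₁, h₂⟩ := h.z_opp α y y.isLt hu ho.symm
    rcases mem_succ_z.1 hw with rfl | ⟨j, hj, rfl⟩
    · exact h₁
    · exact h₂ j hj
  | s α y i =>
    exact absurd (h.parity α y y.isLt hu).symm ho
  | a α y i =>
    obtain ⟨h₁, h₂⟩ := hcomb α y i α hu ho
    rcases mem_succ_a.1 hw with rfl | rfl
    · exact .inl ((reg_chain _ _ _).trans h₁)
    · exact .inr h₂
  | b α y i =>
    obtain ⟨h₁, h₂⟩ := hcomb α y i α.opp hu ho
    rcases mem_succ_b.1 hw with rfl | rfl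
    · exact .inl ((reg_chain _ _ _).trans h₁)
    · exact .inr h₂

/-- The change of a label by a promotion from `f` to `q`: the label `f` becomes `q`, labels from `q`
on are kept, and no label gets above `q`. -/
def Shift (f q x y : ℕ) : Prop := (x = f → y = q) ∧ (q ≤ x → y = x) ∧ (q < y → x = y)

theorem Shift.comb {ω : Player} {c d c' d' : ℕ} (hlt : f < q)
    (hpar : ofPriority q = ofPriority f) (hc : Shift f q c c') (hd : Shift f q d d')
    (hesc : comb ω c d = f → ofPriority f ≠ ω → (c = f ∨ q ≤ c) ∧ (d = f ∨ q ≤ d)) :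
    Shift f q (comb ω c d) (comb ω c' d') := by
  obtain ⟨hc₁, hc₂, hc₃⟩ := hc
  obtain ⟨hd₁, hd₂, hd₃⟩ := hd
  have keyc : q ≤ c ∨ q < c' → c' = c := fun h => h.elim hc₂ fun h => (hc₃ h).symm
  have keyd : q ≤ d ∨ q < d' → d' = d := fun h => h.elim hd₂ fun h => (hd₃ h).symm
  -- how the larger label, or a label of the parity of `ω`, survives a change of the other label
  have key : ∀ {x y y' : ℕ}, _root_.comb ω x y = x → y' = y ∨ y < x ∧ y' ≤ x →
      _root_.comb ω x y' = x := by
    rintro x y y' h (rfl | ⟨h₁, h₂⟩)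
    · exact h
    · rcases comb_cases ω x y with ⟨-, h₃ | ⟨h₃, -⟩ | h₃⟩ | h₃
      · omega
      · rw [_root_.comb, if_pos h₃]
        split_ifs
        · exact max_eq_left h₂
        · rfl
      · omega
      · omega
  have key' : ∀ {y y' : ℕ}, ofPriority f = ω → _root_.comb ω f y = f → (q < y' → y' = y) →
      _root_.comb ω q y' = q := by
    intro y y' hf h₁ h₂
    rw [_root_.comb, if_pos hf] at h₁
    rw [_root_.comb, if_pos (hpar ▸ hf)]
    split_ifs with h₃
    · refine max_eq_left (not_lt.1 fun h₄ => ?_)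
      rw [← h₂ h₄, if_pos h₃] at h₁
      omega
    · rfl
  refine ⟨fun he => ?_, fun he => ?_, fun he => ?_⟩
  · by_cases hf : ofPriority f = ω
    · rcases comb_eq ω c d with h | h
      · obtain rfl : c = f := h.symm.trans he
        rw [hc₁ rfl]
        exact key' hf he fun h => keyd (.inr h)
      · obtain rfl : d = f := h.symm.trans he
        rw [hd₁ rfl, comb_comm]
        exact key' hf (comb_comm ω d c ▸ he) fun h => keyc (.inr h)
    · obtain ⟨h₁, h₂⟩ := hesc he hf
      have hq : ofPriority q ≠ ω := hpar ▸ hf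
      have hP : (ofPriority c ≠ ω ∧ ofPriority d ≠ ω) ∧ min c d = f := by
        rw [_root_.comb] at he
        split_ifs at he with h₃ h₄ h₄
        · rcases max_choice c d with h₅ | h₅ <;> rw [h₅] at he <;> subst he <;> tauto
        · subst he; tauto
        · subst he; tauto
        · exact ⟨⟨h₃, h₄⟩, he⟩
      have hP' : ofPriority c' ≠ ω ∧ ofPriority d' ≠ ω ∧ min c' d' = q := by
        rcases h₁ with h₁ | h₁ <;> rcases h₂ with h₂ | h₂
        · rw [hc₁ h₁, hd₁ h₂]; exact ⟨hq, hq, min_self q⟩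
        · rw [hc₁ h₁, hd₂ h₂]; exact ⟨hq, hP.1.2, min_eq_left h₂⟩
        · rw [hc₂ h₁, hd₁ h₂]; exact ⟨hP.1.1, hq, min_eq_right h₁⟩
        · have := hP.2
          omega
      rw [_root_.comb, if_neg hP'.1, if_neg hP'.2.1, hP'.2.2]
  · rcases comb_eq ω c d with h | h
    · rw [h] at he ⊢
      rw [hc₂ he]
      exact key h (by omega)
    · rw [h] at he ⊢
      rw [comb_comm] at h ⊢
      rw [hd₂ he]
      exact key h (by omega)
  · rcases comb_eq ω c' d' with h | h
    · rw [h] at he ⊢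
      rw [hc₃ he]
      exact key h (by omega)
    · rw [h] at he ⊢
      rw [comb_comm] at h ⊢
      rw [hd₃ he]
      exact key h (by omega)

/-- The labels of `A` are changed to those of `A'` by a promotion from `f` to `q`. -/
def Shifts (N f q : ℕ) (A A' : Labelling) : Prop :=
  ∀ α, ∀ y < N, Shift f q (A.l α y) (A'.l α y) ∧ Shift f q (A.g α y) (A'.g α y) ∧
    Shift f q (A.z α y) (A'.z α y)

theorem Shifts.reg (h : A.Shifts N f q A') (hA : A.Valid N) (hcl : A.Closed N f q)
    (hpar : ofPriority q = ofPriority f) (u : TCVertex N) : Shift f q (A.reg u) (A'.reg u) := by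
  have hc : ∀ α, ∀ y < N, ∀ i, Shift f q (A.c α y i) (A'.c α y i) := by
    intro α y hy i
    unfold c
    split_ifs
    · exact (h α y hy).2.1
    · exact (h α y hy).2.2
  cases u with
  | l α y => exact (h α y y.isLt).1
  | h α y =>
    obtain ⟨h₁, h₂, h₃⟩ := (h α _ (TCVertex.next y).isLt).1
    have := le_highPr (N := N) α y
    have := hcl.bound
    show Shift f q (max _ _) (max _ _)
    refine ⟨fun he => ?_, fun he => ?_, fun he => ?_⟩ <;> omega
  | t α y => exact (h α y y.isLt).2.1
  | z α y => exact (h α y y.isLt).2.2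
  | s α y _ => exact (h α y y.isLt).2.1
  | a α y m =>
    refine Shift.comb hcl.lt hpar (hc α y y.isLt _) (h α m (m.isLt.trans y.isLt)).1 fun he ho => ?_
    have h₁ := fun {w} => hcl.escape hA (.a α y m : TCVertex N) he ho.symm (w := w)
    have h₂ := h₁ (mem_succ_a.2 (.inl rfl))
    rw [reg_chain] at h₂
    exact ⟨h₂, h₁ (mem_succ_a.2 (.inr rfl))⟩
  | b α y m =>
    refine Shift.comb hcl.lt hpar (hc α y y.isLt _) (h α.opp m (m.isLt.trans y.isLt)).1
      fun he ho => ?_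
    have h₁ := fun {w} => hcl.escape hA (.b α y m : TCVertex N) he ho.symm (w := w)
    have h₂ := h₁ (mem_succ_b.2 (.inl rfl))
    rw [reg_chain] at h₂
    exact ⟨h₂, h₁ (mem_succ_b.2 (.inr rfl))⟩

/-- Only the regions `f` and `b` lose vertices, except for high vertices that get to higher
regions. -/
def Keeps (N f b : ℕ) (A A' : Labelling) : Prop :=
  ∀ u : TCVertex N, A.reg u < 4 * N + 4 → (∀ α y, u ≠ .h α y) →
    A'.reg u = A.reg u ∨ A.reg u = f ∨ A.reg u = b

/-- The region `f` of a valid labelling is promoted to `q`, and this leads to the labelling `A'`, if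
the region is closed, the labels change accordingly, the regions in between do not obstruct the
search, and the set bits of `A'` were set before unless they are in the promoted region. With region
recovery, only the region `b` is reset. -/
theorem isPromotion {v : Variant} (hA : A.Valid N) (hcl : A.Closed N f q)
    (hsh : A.Shifts N f q A') (hpar : ofPriority q = ofPriority f) (hq : q < 4 * N + 4)
    (hescape : ∃ u w : TCVertex N, A.reg u = f ∧ (twoCounters N).owner u ≠ ofPriority f ∧
      w ∈ (twoCounters N).succ u ∧ A.reg w = q)
    (hlow : ∀ u : TCVertex N, f < A.reg u → A.reg u < q →
      v.Resets (ofPriority f) (A.reg u) ∨ A.reg u ≤ A'.reg u ∨ (v.Recovers ∧ A.reg u = b))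
    (hrest : ∀ u : TCVertex N, A.reg u < f → A.reg u ≤ A'.reg u ∧ ¬ v.Recovers)
    (hcore : ∀ α, ∀ y < N, A'.core α y → A.g α y < 4 * N + 4 →
      A.g α y = f ∨ (f < A.g α y ∧ A.core α y ∧ A'.g α y = A.g α y ∧
      (A.g α y < q → ¬ v.Resets (ofPriority f) (A.g α y))))
    (hcore_bad : v.Recovers → ∀ α, ∀ y < N, A'.core α y → A'.g α y ≠ b)
    (hkeeps : v.Recovers → A.Keeps N f b A') :
    IsPromotion (twoCounters N) v (A.layout N won) (A'.layout N won) f q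
      (fun x => v.Recovers ∧ x = b) := by
  have hreg := hsh.reg hA hcl hpar
  have halive : (A'.layout N won).alive = (A.layout N won).alive := by
    ext u
    rw [mem_alive, mem_alive]
    obtain ⟨h₁, h₂, h₃⟩ := hreg u
    constructor
    · intro hu
      by_contra hne
      have := h₂ (by omega)
      omega
    · intro hu
      by_contra hne
      have := h₃ (by omega)
      omega
  have hfq := hcl.lt
  refine ⟨halive, rfl, hcl.lt, hpar, fun u hu he ho => ?_, fun u hu he ho w hw hwa => ?_, ?_,
    fun u _ => (hreg u).1, fun u _ => (hreg u).2.1, fun u _ => (hreg u).2.2,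
    fun u _ h₁ h₂ => hlow u h₁ h₂, fun u _ h => hrest u h, fun u hu hc => ?_, fun u hu hc => ?_,
    fun hv u hu hlt he hb ho w hw hwa hwr => ?_⟩
  · obtain ⟨w, hw, hwe⟩ := hcl.own hA u he ho
    exact ⟨w, hw, mem_alive.2 (by omega), hwe⟩
  · exact hcl.escape hA u he ho hw
  · obtain ⟨u, w, h₁, h₂, h₃, h₄⟩ := hescape
    exact ⟨u, mem_alive.2 (by omega), h₁, h₂, w, h₃, mem_alive.2 (by omega), h₄⟩
  · rw [mem_alive] at hu
    cases u with
    | t α y => exact hcore α y y.isLt hc hu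
    | _ => exact hc.elim
  · rintro ⟨hv, he⟩
    cases u with
    | t α y => exact hcore_bad hv α y y.isLt hc he
    | _ => exact hc.elim
  · change A.reg w = A.reg u at hwr
    show A'.reg w = A.reg u
    change f < A.reg u at hlt
    change ¬ (v.Recovers ∧ A.reg u = b) at hb
    change (twoCounters N).owner u = ofPriority (A.reg u) at ho
    by_cases hh : ∃ α y, w = .h α y
    · obtain ⟨α, y, rfl⟩ := hh
      exfalso
      rw [← hwr, hA.reg_h α y] at ho
      have : ∀ k i, (TCVertex.h α y : TCVertex N) ≠ TCVertex.chain α k i := by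
        intro k i
        unfold TCVertex.chain
        split_ifs <;> simp
      cases u with
      | l β k => simp [mem_succ_l] at hw
      | h β k => simp [mem_succ_h] at hw
      | t β k =>
        rcases mem_succ_t.1 hw with h₁ | h₁
        · simp only [TCVertex.h.injEq] at h₁
          rw [owner_t, ← h₁.1] at ho
          exact opp_ne α ho
        · unfold TCVertex.chain at h₁
          split_ifs at h₁
      | z β k => simp [mem_succ_z] at hw
      | s β k i => simp [mem_succ_s] at hw
      | a β k i =>
        rw [mem_succ_a] at hw
        unfold TCVertex.chain at hw
        split_ifs at hw <;> simp at hw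
      | b β k i =>
        rw [mem_succ_b] at hw
        unfold TCVertex.chain at hw
        split_ifs at hw <;> simp at hw
    · push Not at hh
      rcases hkeeps hv w (mem_alive.1 hwa) hh with h₁ | h₁ | h₁
      · rw [h₁, hwr]
      · omega
      · exact absurd ⟨hv, hwr ▸ h₁⟩ hb

end Labelling

end Moves

section Labels

open Player

variable {N : ℕ} {A A' : Labelling} {f q b : ℕ} {v : Variant}

namespace Labelling

theorem Keeps.low (h : A.Keeps N f b A') (hf : f < 2 * N + 4) (hb : b < 2 * N + 4)
    (hq : q < 4 * N + 4) (u : TCVertex N) (h₁ : f < A.reg u) (h₂ : A.reg u < q) :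
    A.reg u ≤ A'.reg u ∨ A.reg u = b := by
  by_cases hh : ∃ α y, u = .h α y
  · obtain ⟨α, y, rfl⟩ := hh
    left
    change max _ _ < q at h₂
    show max _ _ ≤ max _ _
    have h₃ := h (.l α (TCVertex.next y)) (lt_of_le_of_lt (le_max_right _ _) (h₂.trans hq))
      (by simp)
    change A'.l _ _ = A.l _ _ ∨ A.l _ _ = f ∨ A.l _ _ = b at h₃
    have := le_highPr (N := N) α y
    omega
  · push Not at hh
    rcases h u (h₂.trans hq) hh with h₃ | h₃ | h₃
    · exact .inl h₃.ge
    · omega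
    · exact .inr h₃

/-- Regions between `f` and `q` that are not reset by a promotion from `f` to `q` do not obstruct
the computation of the next labelling. -/
theorem low_of (hq : q < 4 * N + 4) (hf : f < 2 * N + 4) (hb : b < 2 * N + 4) {L : ℕ}
    (hno : ¬ v.Recovers → v ≠ .pp → ∀ α, ∀ y < N, ∀ d, d = A.l α y ∨ d = A.g α y ∨ d = A.z α y →
      f < d → d < q → ofPriority d = ofPriority f → d = L)
    (hL : ¬ v.Recovers → v ≠ .pp → f < L → L < q → ∀ u : TCVertex N, A.reg u = L → L ≤ A'.reg u)
    (hkeeps : v.Recovers → A.Keeps N f b A') (u : TCVertex N) (h₁ : f < A.reg u)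
    (h₂ : A.reg u < q) :
    v.Resets (ofPriority f) (A.reg u) ∨ A.reg u ≤ A'.reg u ∨ (v.Recovers ∧ A.reg u = b) := by
  have key : ¬ v.Recovers → v ≠ .pp → ofPriority (A.reg u) = ofPriority f →
      A.reg u ≤ A'.reg u := by
    intro hv hpp hp
    rcases reg_eq_label A u with ⟨α, y, hy, hd⟩ | ⟨α, y, rfl, hd, hl⟩
    · have := hno hv hpp α y hy _ hd h₁ h₂ hp
      rw [this]
      exact hL hv hpp (this ▸ h₁) (this ▸ h₂) u this
    · rw [hd]
      exact le_max_left _ _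
  cases v with
  | pp => exact .inl trivial
  | ppPlus =>
    by_cases hp : ofPriority (A.reg u) = ofPriority f
    · exact .inr (.inl (key (fun h => h) (by simp) hp))
    · exact .inl hp
  | dp =>
    by_cases hp : ofPriority (A.reg u) = ofPriority f
    · exact .inr (.inl (key (fun h => h) (by simp) hp))
    · exact .inl hp
  | rr =>
    rcases (hkeeps trivial).low hf hb hq u h₁ h₂ with h | h
    · exact .inr (.inl h)
    · exact .inr (.inr ⟨trivial, h⟩)
  | rrdp =>
    rcases (hkeeps trivial).low hf hb hq u h₁ h₂ with h | h
    · exact .inr (.inl h)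
    · exact .inr (.inr ⟨trivial, h⟩)

end Labelling

/-! ### The label of a set bit -/

/-- The label of bit `y` of player `α` when it is set, where the bits in `J` are set and `t` is the
highest label for Even: that of the low vertex of the lowest unset higher bit of the opponent, or
the highest label if all higher bits are set. -/
def above (N t : ℕ) (J : Finset ℕ) (α : Player) : ℕ → ℕ
  | 0 => match α with
    | .even => t
    | .odd => 4 * N + 3
  | y + 1 => if y ∈ J then above N t J α y else lowPr N α.opp y

section Above

variable {t : ℕ} {J J' : Finset ℕ}

theorem above_spec (α : Player) (y : ℕ) :
    (above N t J α y = above N t J α 0 ∧ ∀ m < y, m ∈ J) ∨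
    ∃ i < y, i ∉ J ∧ above N t J α y = lowPr N α.opp i ∧ ∀ m, i < m → m < y → m ∈ J := by
  induction y with
  | zero => exact .inl ⟨rfl, fun m hm => absurd hm (by omega)⟩
  | succ y ih =>
    by_cases hy : y ∈ J
    · have he : above N t J α (y + 1) = above N t J α y := if_pos hy
      rw [he]
      rcases ih with ⟨h₁, h₂⟩ | ⟨i, h₁, h₂, h₃, h₄⟩
      · refine .inl ⟨h₁, fun m hm => ?_⟩
        rcases Nat.lt_succ_iff_lt_or_eq.1 hm with h | rfl
        · exact h₂ m h
        · exact hy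
      · refine .inr ⟨i, by omega, h₂, h₃, fun m hm hmy => ?_⟩
        rcases Nat.lt_succ_iff_lt_or_eq.1 hmy with h | rfl
        · exact h₄ m hm h
        · exact hy
    · exact .inr ⟨y, by omega, hy, if_neg hy, fun m h₁ h₂ => by omega⟩

theorem above_congr {α : Player} {y : ℕ} (h : ∀ m < y, m ∈ J ↔ m ∈ J') :
    above N t J α y = above N t J' α y := by
  induction y with
  | zero => rfl
  | succ y ih =>
    have hy := h y (by omega)
    have := ih fun m hm => h m (by omega)
    simp only [above, hy, this]

theorem above_eq {α : Player} {m y : ℕ} (hmy : m ≤ y) (h : ∀ i, m ≤ i → i < y → i ∈ J) :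
    above N t J α y = above N t J α m := by
  induction y, hmy using Nat.le_induction with
  | base => rfl
  | succ y hy ih =>
    rw [above, if_pos (h y hy (by omega)), ih fun i h₁ h₂ => h i h₁ (by omega)]

theorem above_even_zero : above N t J .even 0 = t := rfl
theorem above_odd_zero : above N t J .odd 0 = 4 * N + 3 := rfl

theorem above_facts (ht : t % 2 = 0) (ht' : 4 * N + 2 ≤ t) (J : Finset ℕ) {y : ℕ} (hy : y < N) :
    above N t J .even y % 2 = 0 ∧ 2 * (N - y) + 4 ≤ above N t J .even y ∧
      (above N t J .even y < 2 * N + 4 ∨ above N t J .even y = t) ∧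
      above N t J .odd y % 2 = 1 ∧ 2 * (N - y) + 3 ≤ above N t J .odd y ∧
      (above N t J .odd y < 2 * N + 4 ∨ above N t J .odd y = 4 * N + 3) := by
  rcases above_spec (N := N) (t := t) (J := J) .even y with ⟨h₁, -⟩ | ⟨i, h, -, h₁, -⟩ <;>
  rcases above_spec (N := N) (t := t) (J := J) .odd y with ⟨h₂, -⟩ | ⟨i', h', -, h₂, -⟩ <;>
  simp only [h₁, h₂, above_even_zero, above_odd_zero, opp, lowPr] <;>
  refine ⟨?_, ?_, ?_, ?_, ?_, ?_⟩ <;> first | omega | simp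

theorem above_le (ht : 4 * N + 2 ≤ t) (α : Player) {m y : ℕ} (hy : y ≤ N) (hmy : m ≤ y) :
    above N t J α y ≤ above N t J α m := by
  induction y, hmy using Nat.le_induction with
  | base => exact le_rfl
  | succ y h ih =>
    refine le_trans ?_ (ih (by omega))
    rw [above]
    split_ifs
    · exact le_rfl
    · rcases above_spec (N := N) (t := t) (J := J) α y with ⟨h₁, -⟩ | ⟨i, h₁, -, h₃, -⟩ <;>
      cases α <;> simp only [*, above_even_zero, above_odd_zero, opp, lowPr] <;> omega

theorem above_le_lowPr (ht : 4 * N + 2 ≤ t) (α : Player) {m y : ℕ} (hy : y ≤ N) (hmy : m < y)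
    (hm : m ∉ J) : above N t J α y ≤ lowPr N α.opp m := by
  refine (above_le ht α hy (show m + 1 ≤ y from hmy)).trans ?_
  rw [above, if_neg hm]

end Above

open Classical in
/-- The label of an unset bit `y` of Even: that of the low vertex of the next lower unset bit of Odd,
or the priority of its own tangle vertex if there is none. -/
noncomputable def nextLow (N : ℕ) (J : Finset ℕ) (y : ℕ) : ℕ :=
  if h : ∃ m, y < m ∧ m < N ∧ m ∉ J then lowPr N .odd (Nat.find h) else 2

theorem nextLow_spec (N : ℕ) (J : Finset ℕ) (y : ℕ) :
    (nextLow N J y = 2 ∧ ∀ m, y < m → m < N → m ∈ J) ∨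
    ∃ m, y < m ∧ m < N ∧ m ∉ J ∧ nextLow N J y = 2 * (N - 1 - m) + 4 ∧
      ∀ m', y < m' → m' < m → m' ∈ J := by
  unfold nextLow
  split_ifs with h
  · right
    obtain ⟨h₁, h₂, h₃⟩ := Nat.find_spec h
    refine ⟨_, h₁, h₂, h₃, rfl, fun m' h₄ h₅ => ?_⟩
    by_contra h₆
    exact Nat.find_min h h₅ ⟨h₄, by omega, h₆⟩
  · left
    refine ⟨rfl, fun m h₁ h₂ => ?_⟩
    by_contra h₃
    exact h ⟨m, h₁, h₂, h₃⟩

namespace Labelling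

/-- The labels when both counters show the bits in `J`. -/
noncomputable def counting (N t : ℕ) (J : Finset ℕ) : Labelling where
  l α y := if y ∈ J then above N t J α y else lowPr N α y
  g α y := if y ∈ J then above N t J α y else match α with
    | .even => nextLow N J y
    | .odd => lowPr N .even y
  z α y := if y ∈ J then above N t J α y else match α with
    | .even => nextLow N J y
    | .odd => lowPr N .even y
  core _ y := y ∈ J

theorem above_facts₂ {t : ℕ} (ht' : 4 * N + 2 ≤ t) (J : Finset ℕ) {m y : ℕ}
    (hm : m < y) (hy : y < N) : above N t J .even y ≤ above N t J .even m ∧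
      above N t J .odd y ≤ above N t J .odd m ∧
      (m ∉ J → above N t J .even y ≤ 2 * (N - 1 - m) + 4 ∧
        above N t J .odd y ≤ 2 * (N - 1 - m) + 3) :=
  ⟨above_le ht' _ hy.le hm.le, above_le ht' _ hy.le hm.le, fun h =>
    ⟨above_le_lowPr ht' .even hy.le hm h, above_le_lowPr ht' .odd hy.le hm h⟩⟩

theorem valid_counting {t : ℕ} (ht : t % 2 = 0) (ht' : 4 * N + 2 ≤ t) (J : Finset ℕ) :
    (counting N t J).Valid N := by
  have nl := nextLow_spec N J
  have fs := fun y hy => above_facts (N := N) ht ht' J (y := y) hy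
  have fp := fun m y => above_facts₂ (N := N) ht' J (m := m) (y := y)
  constructor
  · intro α y hy
    have h₁ := fs y hy
    clear nl fs fp
    cases α <;> simp only [counting, lowPr] <;> grind
  · intro α y hy
    have h₁ := fs y hy
    clear nl fs fp
    cases α <;> simp only [counting, lowPr, ofPriority_eq_even, ofPriority_eq_odd] <;> grind
  · intro α y hy
    have h₁ := nl y
    clear nl fs fp
    cases α <;> simp only [counting, lowPr] <;> grind
  · intro α y hy
    have h₁ := nl y
    have h₂ := fs y hy
    clear nl fs fp
    cases α <;> simp only [counting, lowPr, tanglePr] <;> grind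
  · intro α y hy
    cases α <;> simp only [counting, le_refl]
  · intro α y hy
    have h₁ := nl y
    have h₂ := fs y hy
    clear nl fs fp
    cases α <;> simp only [counting, lowPr, chainPr] <;> grind
  · intro α y hy
    clear nl fs fp
    cases α <;> simp only [counting, lowPr] <;> grind
  · intro α y hy m hm
    have h₁ := fs m (hm.trans hy)
    clear nl fs fp
    cases α <;> simp only [counting, lowPr, opp, ofPriority_eq_even, ofPriority_eq_odd, ne_eq] <;>
      grind
  · intro α y hy j hj
    have h₁ := nl y
    have h₂ := fs y hy
    have h₃ := fs j hj.lt
    clear nl fs fp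
    cases α <;> simp only [counting, Distracts, lowPr, opp, ofPriority_eq_even,
      ofPriority_eq_odd, ne_eq] at hj ⊢ <;> grind
  · intro α y hy
    exact .inl (by cases α <;> rfl)
  · intro α y hy
    have h₁ := nl y
    have h₂ := fs y hy
    clear nl fs fp
    cases α <;> simp only [counting, Distracts, lowPr, opp, ofPriority_eq_even,
      ofPriority_eq_odd, ne_eq] <;> grind
  · intro α y hy
    left
    have h₁ := nl y
    have h₂ := fs y hy
    constructor
    · clear nl fs fp
      cases α <;> simp only [counting, lowPr, opp, ofPriority_eq_even, ofPriority_eq_odd] <;>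
        grind
    · cases α <;> rfl
    · clear nl fs fp h₂
      cases α <;> simp only [counting, Early, tanglePr, Distracts, lowPr, opp,
        ofPriority_eq_even, ofPriority_eq_odd, ne_eq]
      · by_cases hJ : y ∈ J
        · exact .inl hJ
        · right
          simp only [hJ, if_false]
          rcases h₁ with h₁ | ⟨m, h₁, h₂, h₃, h₄, _⟩
          · exact .inl h₁.1
          · refine .inr ⟨by omega, m, ⟨h₁, h₂⟩, ?_⟩
            simp only [h₃, if_false, h₄, true_and, true_or]
      · by_cases hJ : y ∈ J
        · exact .inl hJ
        · right
          right
          simp only [hJ, if_false]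
          refine ⟨by omega, y, ⟨le_rfl, hy⟩, ?_⟩
          simp only [hJ, if_false, true_and, true_or]
    · intro m hm
      have h₃ := fs m (hm.trans hy)
      have h₄ := fp m y hm hy
      clear nl fs fp
      cases α <;> simp only [counting, Early, lowPr, opp, ofPriority_eq_even, ofPriority_eq_odd,
        ne_eq] <;> grind

end Labelling

end Labels

/-! ### Promotions while both counters show the same bits -/

section Counting

open Player

variable {N k : ℕ} {J : Finset ℕ}

namespace Labelling

theorem counting_openAbove (hk : k < N) (hkJ : k ∉ J) :
    (counting N (4 * N + 2) J).OpenAbove N 2 := by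
  have key : ∀ α, ∀ y < N, ∀ d, d = above N (4 * N + 2) J α y → y ∈ J →
    (∃ β, ∃ y' < N, (counting N (4 * N + 2) J).l β y' = d ∧ lowPr N β y' = d ∧
      (counting N (4 * N + 2) J).g β y' < d) ∨
      ∃ β, highPr N β 0 = d ∧ (counting N (4 * N + 2) J).l β (N - 1) < d := by
    rintro α y hy d rfl hyJ
    rcases above_spec (N := N) (t := 4 * N + 2) (J := J) α y with ⟨h₁, -⟩ | ⟨i, h₁, h₂, h₃, -⟩
    · right
      refine ⟨α, ?_, ?_⟩
      · rw [h₁]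
        cases α <;> simp only [above, highPr] <;> omega
      · rw [h₁]
        have h₂ := above_facts (N := N) (t := 4 * N + 2) (by omega) le_rfl J (y := N - 1)
          (by omega)
        by_cases hm : N - 1 ∈ J
        · have h₃ := (above_facts₂ (N := N) (t := 4 * N + 2) le_rfl J (m := k) (y := N - 1)
            (lt_of_le_of_ne (by omega) fun h => hkJ (h ▸ hm)) (by omega)).2.2 hkJ
          cases α <;> simp only [counting, hm, if_true, above] <;> omega
        · cases α <;> simp only [counting, hm, if_false, above, lowPr] <;> omega
    · left
      refine ⟨α.opp, i, h₁.trans hy, ?_, h₃.symm, ?_⟩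
      · rw [h₃]
        simp [counting, h₂]
      · rw [h₃]
        have h₄ := nextLow_spec N J i
        clear h₃
        cases α <;> simp only [counting, h₂, if_false, opp, lowPr] <;> grind
  intro α y hy d hd hlt hlt'
  by_cases hyJ : y ∈ J
  · refine key α y hy d ?_ hyJ
    simp only [counting, hyJ, if_true] at hd
    tauto
  · left
    have h₁ := nextLow_spec N J y
    clear key
    simp only [counting, hyJ, if_false] at hd
    have hself : ∀ β, ∀ y' < N, y' ∉ J → d = lowPr N β y' → ∃ β, ∃ y' < N,
        (counting N (4 * N + 2) J).l β y' = d ∧ lowPr N β y' = d ∧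
          (counting N (4 * N + 2) J).g β y' < d := by
      rintro β y' h₂ h₃ rfl
      have h₄ := nextLow_spec N J y'
      refine ⟨β, y', h₂, ?_, rfl, ?_⟩
      · simp [counting, h₃]
      · cases β <;> simp only [counting, h₃, if_false, opp, lowPr] <;> grind
    cases α
    · simp only at hd
      by_cases hd' : d = lowPr N .even y
      · exact hself .even y hy hyJ hd'
      · have hd'' : d = nextLow N J y := by tauto
        rcases h₁ with h₁ | ⟨m, h₁, h₂, h₃, h₄, _⟩
        · omega
        · exact hself .odd m h₂ h₃ (hd''.trans h₄)
    · simp only at hd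
      by_cases hd' : d = lowPr N .even y
      · exact hself .even y hy hyJ hd'
      · exact hself .odd y hy hyJ (by tauto)

theorem nextLow_of_forall (h : ∀ m, k < m → m < N → m ∈ J) : nextLow N J k = 2 := by
  rcases nextLow_spec N J k with h₁ | ⟨m, h₁, h₂, h₃, _⟩
  · exact h₁.1
  · exact absurd (h m h₁ h₂) h₃

/-- In the labelling for the bits in `J`, the lowest region is closed and can be promoted to the
region that sets the lowest unset bit `k` of Even. -/
theorem counting_closed (hk : k < N) (hkJ : k ∉ J) (h : ∀ m, k < m → m < N → m ∈ J) :
    (counting N (4 * N + 2) J).Closed N 2 (above N (4 * N + 2) J .even k) := by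
  have fs := fun y hy => above_facts (N := N) (t := 4 * N + 2) (by omega) le_rfl J (y := y) hy
  have fp := fun m y => above_facts₂ (N := N) (t := 4 * N + 2) le_rfl J (m := m) (y := y)
  have hg : ∀ α, ∀ y < N, (counting N (4 * N + 2) J).g α y = 2 → α = .even ∧ y = k := by
    intro α y hy hg
    have h₁ := fs y hy
    have h₂ := nextLow_spec N J y
    by_cases hyJ : y ∈ J
    · cases α <;> simp only [counting, hyJ, if_true] at hg <;> omega
    · cases α <;> simp only [counting, hyJ, if_false, lowPr] at hg
      · refine ⟨rfl, ?_⟩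
        rcases lt_trichotomy y k with h₃ | h₃ | h₃
        · clear fs fp
          grind
        · exact h₃
        · exact absurd (h y h₃ hy) hyJ
      · omega
  have hz : ∀ α, ∀ y, (counting N (4 * N + 2) J).z α y = (counting N (4 * N + 2) J).g α y := by
    intro α y
    cases α <;> rfl
  refine ⟨by have := fs k hk; omega, by omega, fun α y hy he => ?_, fun α y hy he => ?_,
    fun α y he => ?_, fun α y hy he _ => (hz α y).symm.trans he, fun α y hy he hp => ?_,
    fun α y hy he m hm γ hp => ?_⟩
  · have h₁ := fs y hy
    exfalso
    cases α <;> simp only [counting, lowPr] at he <;> split_ifs at he <;> omega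
  · rw [(hg α y hy he).1]
    rfl
  · obtain ⟨rfl, hyk⟩ := hg α y y.isLt he
    have h₁ : (TCVertex.next y : ℕ) = if k = 0 then N - 1 else k - 1 := by rw [← hyk]; rfl
    rw [h₁, hyk]
    clear he hyk h₁ y
    by_cases hk0 : k = 0
    · right
      subst hk0
      simp only [above, highPr]
      omega
    · obtain ⟨k, rfl⟩ := Nat.exists_eq_succ_of_ne_zero hk0
      simp only [Nat.succ_eq_add_one, Nat.add_one_ne_zero, if_false, Nat.add_sub_cancel, above,
        counting, highPr, lowPr, opp]
      split_ifs <;> omega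
  · rw [hz] at he
    rw [(hg α y hy he).1] at hp
    exact absurd rfl hp
  · obtain ⟨rfl, rfl⟩ := hg α y hy he
    have h₁ := fs m (hm.trans hy)
    have h₂ := fp m y hm hy
    clear fs fp hg hz h
    cases γ <;> simp only [counting, lowPr, ofPriority_eq_even] at hp ⊢ <;> grind

theorem counting_escape (hk : k < N) (hkJ : k ∉ J) (h : ∀ m, k < m → m < N → m ∈ J) :
    ∃ u w : TCVertex N, (counting N (4 * N + 2) J).reg u = 2 ∧
      (twoCounters N).owner u ≠ ofPriority 2 ∧ w ∈ (twoCounters N).succ u ∧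
      (counting N (4 * N + 2) J).reg w = above N (4 * N + 2) J .even k := by
  have hg : (counting N (4 * N + 2) J).g .even k = 2 := by
    simp [counting, hkJ, nextLow_of_forall h]
  have hc : ∀ i, (counting N (4 * N + 2) J).c .even k i = 2 := by
    intro i
    unfold c
    split_ifs
    · exact hg
    · exact hg
  rcases above_spec (N := N) (t := 4 * N + 2) (J := J) .even k with ⟨h₁, h₂⟩ | ⟨i, h₁, h₂, h₃, -⟩
  · refine ⟨.t .even ⟨k, hk⟩, .h .even ⟨k, hk⟩, hg, by simp [owner_t, opp, ofPriority],
      mem_succ_t.2 (.inl rfl), ?_⟩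
    have h₃ : ((TCVertex.next ⟨k, hk⟩ : Fin N) : ℕ) = if k = 0 then N - 1 else k - 1 := rfl
    show max _ ((counting N (4 * N + 2) J).l .even _) = _
    rw [h₃, h₁]
    by_cases hk0 : k = 0
    · subst hk0
      have := above_facts (N := N) (t := 4 * N + 2) (by omega) le_rfl J (y := N - 1) (by omega)
      simp only [if_true, counting, highPr, lowPr, above]
      split_ifs <;> omega
    · have h₄ := above_eq (N := N) (t := 4 * N + 2) (J := J) (α := .even) (m := 0) (y := k - 1)
        (by omega) fun i _ hi => h₂ i (by omega)
      simp only [hk0, if_false, counting, h₂ (k - 1) (by omega), if_true, h₄, above, highPr]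
      omega
  · refine ⟨.b .even ⟨k, hk⟩ ⟨i, h₁⟩, .l .odd ⟨i, h₁.trans hk⟩, ?_, by simp [owner_b, opp,
      ofPriority], mem_succ_b.2 (.inr rfl), ?_⟩
    · show comb _ ((counting N (4 * N + 2) J).c .even k _) _ = 2
      rw [hc]
      simp only [counting, h₂, if_false, opp, lowPr, comb]
      rw [if_neg (by simp [ofPriority]), if_neg (by rw [ofPriority_eq_odd]; omega)]
      exact min_eq_left (by omega)
    · rw [h₃]
      show (counting N (4 * N + 2) J).l .odd i = _
      simp only [counting, h₂, if_false, opp]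

end Labelling

end Counting

/-! ### Labels after Even has set a bit -/

/-- What has become of the lowest bit of Even, if it is lower than the bit `k` that Even sets: it is
in the region of the current low bit of Odd, it is still in the region of bit `k` of Odd, or it has
been reset. -/
inductive Tail
  | settled
  | stale
  | lost
  deriving DecidableEq

section Recovering

open Player

variable {N t x k : ℕ} {J : Finset ℕ} {T : Tail}

namespace Labelling

/-- The labels after Even has set bit `k`, when Odd has recovered its bits above `x`.  These bits are
labelled as in `counting`, the bits of Even from `x` to `k` are in one region, and the other bits
are attracted via the low vertex of bit `x` of Odd. -/
noncomputable def recovering (N t : ℕ) (J : Finset ℕ) (x k : ℕ) (T : Tail) : Labelling where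
  l α y := if y < x then (counting N t J).l α y else match α with
    | .even => if y ≤ k then above N t J .even x else
        if y + 1 = N then match T with
          | .settled => lowPr N .odd x
          | .stale => lowPr N .odd k
          | .lost => 3
        else lowPr N .odd x
    | .odd => lowPr N .odd x
  g α y := if y < x then (counting N t J).g α y else match α with
    | .even => if y ≤ k then above N t J .even x else
        if y + 1 = N then match T with
          | .settled => lowPr N .odd x
          | .stale => lowPr N .odd k
          | .lost => 2
        else lowPr N .odd x
    | .odd => if y = x then match T with
          | .settled => 1
          | .stale => 1
          | .lost => 3
        else lowPr N .odd x
  z α y := if y < x then (counting N t J).z α y else match α with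
    | .even => if y ≤ k then above N t J .even x else
        if y + 1 = N then match T with
          | .settled => lowPr N .odd x
          | .stale => lowPr N .odd k
          | .lost => 2
        else lowPr N .odd x
    | .odd => if y = x then match T with
          | .settled => 1
          | .stale => 1
          | .lost => 3
        else match T with
          | .settled => lowPr N .odd x
          | .stale => lowPr N .odd k
          | .lost => 3
  core α y := y ∈ J ∨ α = .even ∧ x ≤ y ∧ (y ≤ k ∨ (y + 1 = N ∧ T ≠ .lost))

theorem valid_recovering (ht : t % 2 = 0) (ht' : 4 * N + 2 ≤ t) (hJ : ∀ m ∈ J, m < x)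
    (hxk : x ≤ k) (hk : k < N) (hT : T = .stale → x < k) (hT' : T ≠ .settled → k + 1 < N) :
    (recovering N t J x k T).Valid N := by
  have nl := nextLow_spec N J
  have fs := fun y hy => above_facts (N := N) ht ht' J (y := y) hy
  have fp := fun m y => above_facts₂ (N := N) ht' J (m := m) (y := y)
  have hxJ : x ∉ J := fun h => lt_irrefl _ (hJ x h)
  have hc := valid_counting (N := N) ht ht' J
  have fx := fs x (by omega)
  constructor
  · intro α y hy
    have h₁ := hc.low_le α y hy
    clear nl fs fp hc hJ
    cases α <;> cases T <;> simp only [recovering, lowPr] at h₁ ⊢ <;> grind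
  · intro α y hy
    have h₁ := hc.l_high α y hy
    clear nl fs fp hc hJ
    cases α <;> cases T <;>
      simp only [recovering, lowPr, ofPriority_eq_even, ofPriority_eq_odd] at h₁ ⊢ <;> grind
  · intro α y hy
    have h₁ := hc.g_le α y hy
    clear nl fs fp hc hJ
    cases α <;> cases T <;> simp only [recovering, lowPr] at h₁ ⊢ <;> grind
  · intro α y hy
    have h₁ := hc.tangle_le α y hy
    clear nl fs fp hc hJ
    cases α <;> cases T <;> simp only [recovering, lowPr, tanglePr] at h₁ ⊢ <;> grind
  · intro α y hy
    have h₁ := hc.z_le α y hy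
    clear nl fs fp hc hJ
    cases α <;> cases T <;> simp only [recovering, lowPr] at h₁ ⊢ <;> grind
  · intro α y hy
    have h₁ := hc.chain_le α y hy
    clear nl fs fp hc hJ
    cases α <;> cases T <;> simp only [recovering, lowPr, chainPr] at h₁ ⊢ <;> grind
  · intro α y hy
    have h₁ := hc.l_eq α y hy
    clear nl fs fp hc hJ
    cases α <;> cases T <;> simp only [recovering, lowPr] at h₁ ⊢ <;> grind
  · intro α y hy m hm
    have h₁ := fs m (hm.trans hy)
    have h₂ := hc.low α y hy m hm
    clear nl fs fp hc hJ
    cases α <;> cases T <;> simp only [recovering, counting, lowPr, opp, ofPriority_eq_even,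
      ofPriority_eq_odd, ne_eq] at h₂ ⊢ <;> grind
  · intro α y hy j hj
    have h₁ := nl y
    have h₂ := fs y hy
    have h₃ := fs j hj.lt
    have h₄ := hc.z_up α y hy j hj
    clear nl fs fp hc hJ
    cases α <;> cases T <;> simp only [recovering, counting, Distracts, lowPr, opp,
      ofPriority_eq_even, ofPriority_eq_odd, ne_eq] at hj h₄ ⊢ <;> grind
  · intro α y hy
    have h₁ : (counting N t J).z α y = (counting N t J).g α y := by cases α <;> rfl
    clear nl fs fp hc hJ
    by_cases hT₁ : T = .settled ∨ α = .even
    · left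
      rcases hT₁ with rfl | rfl
      · cases α <;> simp only [recovering, lowPr] at h₁ ⊢ <;> grind
      · simp only [recovering] at h₁ ⊢
        grind
    · by_cases hy' : y ≤ x
      · left
        simp only [recovering] at h₁ ⊢
        cases α <;> grind
      · right
        have hα : α = .odd := by cases α <;> simp_all
        subst hα
        refine ⟨N - 1, ⟨by omega, by omega⟩, ?_⟩
        cases T <;> simp only [recovering, opp, lowPr] <;> grind
  · intro α y hy
    have hzc := hc.z_min α y hy
    have h₁ := nl y
    clear nl fp hc hJ
    intro h j hj
    have h₂ := fs y hy
    have h₃ := fs j hj.lt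
    clear fs
    have h₄ := fun h => hzc h j hj
    clear hzc
    cases α <;> cases T <;> simp only [recovering, counting, Distracts, lowPr, opp,
      ofPriority_eq_even, ofPriority_eq_odd, ne_eq] at hj h h₄ ⊢ <;> grind
  · intro α y hy
    have h₁ := nl y
    have h₂ := fs y hy
    by_cases hodd : α = .odd ∧ x < y
    · right
      obtain ⟨rfl, hxy⟩ := hodd
      clear nl fs fp hc hJ h₁ h₂
      refine ⟨x, hxy, ?_, ?_, fun m h₃ h₄ => ?_, fun m h₃ h₄ => ?_, ?_⟩
      · simp only [recovering, lowPr, opp, ofPriority_eq_odd, ne_eq]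
        grind
      · simp only [recovering, lowPr]
        grind
      · simp only [recovering, lowPr]
        grind
      · cases T <;> simp only [recovering, lowPr, opp, ofPriority_eq_odd, ne_eq] <;> grind
      · simp only [recovering, lowPr, opp]
        grind
    · left
      constructor
      · clear nl fs fp hc hJ
        cases α <;> cases T <;> simp only [recovering, counting, lowPr, opp, ofPriority_eq_even,
          ofPriority_eq_odd] <;> grind
      · clear nl fs fp hc hJ
        cases α <;> cases T <;> simp only [recovering, counting] <;> grind
      · by_cases hyx : y < x
        · by_cases hyJ : y ∈ J
          · exact .inl (.inl hyJ)
          right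
          right
          clear fs fp hc
          cases α
          · rcases h₁ with h₁ | ⟨m, h₁, h₃, h₄, h₅, h₆⟩
            · exact absurd (h₁.2 x hyx (by omega)) hxJ
            · have hmx : m ≤ x := by
                by_contra hlt
                exact hxJ (h₆ x hyx (by omega))
              have hg : (recovering N t J x k T).g .even y = lowPr N .odd m := by
                simp only [recovering, counting, hyx, hyJ, if_true, if_false, h₅, lowPr]
              have hl : (recovering N t J x k T).l .odd m = lowPr N .odd m := by
                simp only [recovering, counting, h₄, if_false]
                split_ifs with h₇
                · rfl
                · rw [show m = x by omega]
              exact ⟨by rw [hg]; simp only [lowPr]; omega, m, ⟨h₁, h₃⟩, hl.trans hg.symm, .inl hl⟩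
          · have hg : (recovering N t J x k T).g .odd y = lowPr N .even y := by
              simp only [recovering, counting, hyx, hyJ, if_true, if_false]
            have hl : (recovering N t J x k T).l .even y = lowPr N .even y := by
              simp only [recovering, counting, hyx, hyJ, if_true, if_false]
            exact ⟨by rw [hg]; simp only [lowPr]; omega, y, ⟨le_rfl, hy⟩, hl.trans hg.symm, .inl hl⟩
        · clear nl fs fp hc hJ h₁ h₂
          cases α
          · by_cases hyk : y ≤ k
            · exact .inl (.inr ⟨rfl, by omega, .inl hyk⟩)
            by_cases hyN : y + 1 = N
            · by_cases hTl : T = .lost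
              · right
                left
                subst hTl
                simp only [recovering, hyx, hyk, hyN, if_true, if_false, tanglePr]
              · exact .inl (.inr ⟨rfl, by omega, .inr ⟨hyN, hTl⟩⟩)
            · right
              right
              have h₃ : ¬ N - 1 < x := by omega
              have h₄ : N - 1 ≠ x := by omega
              refine ⟨?_, N - 1, ⟨by omega, by omega⟩, ?_, .inr ⟨?_, ?_⟩⟩ <;>
                simp only [recovering, hyx, hyk, hyN, h₃, h₄, if_true, if_false, opp, lowPr,
                  ne_eq, ofPriority_eq_odd] <;> omega
          · have hyx' : y = x := by
              by_contra hne
              exact hodd ⟨rfl, by omega⟩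
            subst hyx'
            right
            by_cases hTl : T = .lost
            · right
              subst hTl
              have h₃ : ¬ N - 1 ≤ k := by have := hT' (by simp); omega
              have h₄ : ¬ N - 1 < y := by omega
              have h₅ : N - 1 + 1 = N := by omega
              refine ⟨?_, N - 1, ⟨by omega, by omega⟩, ?_, .inl ?_⟩ <;>
                simp only [recovering, lt_irrefl, h₃, h₄, h₅, if_true, if_false, opp, lowPr] <;>
                omega
            · left
              cases T <;> simp_all [recovering, tanglePr]
      · intro m hm
        have h₃ := fs m (hm.trans hy)
        have h₄ := fp m y hm hy
        have h₅ := fp m x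
        clear nl fs fp hc hJ
        cases α <;> cases T <;> simp only [recovering, counting, Early, lowPr, opp,
          ofPriority_eq_even, ofPriority_eq_odd, ne_eq] <;> grind

end Labelling

/-- The region that is promoted, see `Labelling.recovering`. -/
def Tail.source (N k : ℕ) : Tail → ℕ
  | .settled => 1
  | .stale => lowPr N .odd k
  | .lost => 2

/-- The target of the promotion, see `Labelling.recovering`. -/
def Tail.target (N t : ℕ) (J : Finset ℕ) (x : ℕ) : Tail → ℕ
  | .settled => above N t J .odd x
  | .stale => lowPr N .odd x
  | .lost => lowPr N .odd x

theorem Tail.source_parity (hT : T ≠ .settled) : ofPriority (T.source N k) = .even := by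
  cases T
  · exact absurd rfl hT
  · exact ofPriority_lowPr .odd k
  · simp [Tail.source, ofPriority]

namespace Labelling

theorem recovering_openAbove (ht : t % 2 = 0) (ht' : 4 * N + 2 ≤ t) (hJ : ∀ m ∈ J, m < x)
    (hxk : x ≤ k) (hk : k < N)
    (hT' : T ≠ .settled → k + 1 < N) (hdom : 4 * N + 4 ≤ t ∨ k + 1 < N ∨ ∃ i < x, i ∉ J) :
    (recovering N t J x k T).OpenAbove N (T.source N k) := by
  have hxJ : x ∉ J := fun h => lt_irrefl _ (hJ x h)
  have fx := above_facts (N := N) ht ht' J (y := x) (by omega)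
  set A := recovering N t J x k T with hA
  have hl : ∀ α, ∀ y < x, A.l α y = (counting N t J).l α y := by
    intro α y hy
    simp only [hA, recovering, hy, if_true]
  have hg : ∀ α, ∀ y < x, A.g α y = (counting N t J).g α y := by
    intro α y hy
    simp only [hA, recovering, hy, if_true]
  have hz : ∀ α, ∀ y < x, A.z α y = (counting N t J).g α y := by
    intro α y hy
    simp only [hA, recovering, hy, if_true]
    cases α <;> rfl
  have hlow : ∀ β, ∀ y < x, y ∉ J → (∃ β', ∃ y' < N, A.l β' y' = lowPr N β y ∧
      lowPr N β' y' = lowPr N β y ∧ A.g β' y' < lowPr N β y) := by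
    intro β y hy hyJ
    refine ⟨β, y, by omega, ?_, rfl, ?_⟩
    · rw [hl β y hy]
      simp only [counting, hyJ, if_false]
    · rw [hg β y hy]
      have := nextLow_spec N J y
      cases β <;> simp only [counting, hyJ, if_false, lowPr] <;> grind
  have hlowx : ∃ β', ∃ y' < N, A.l β' y' = lowPr N .odd x ∧
      lowPr N β' y' = lowPr N .odd x ∧ A.g β' y' < lowPr N .odd x := by
    refine ⟨.odd, x, by omega, ?_, rfl, ?_⟩
    · simp only [hA, recovering, lt_irrefl, if_false]
    · cases T <;> simp only [hA, recovering, lt_irrefl, if_false, if_true, lowPr] <;> omega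
  have habove : ∀ α, ∀ y ≤ x, above N t J α y < 4 * N + 4 →
      (∃ β, ∃ y' < N, A.l β y' = above N t J α y ∧ lowPr N β y' = above N t J α y ∧
        A.g β y' < above N t J α y) ∨
      ∃ β, highPr N β 0 = above N t J α y ∧ A.l β (N - 1) < above N t J α y := by
    intro α y hy hlt
    rcases above_spec (N := N) (t := t) (J := J) α y with ⟨h₁, -⟩ | ⟨i, h₁, h₂, h₃, -⟩
    · right
      rw [h₁] at hlt ⊢
      refine ⟨α, ?_, ?_⟩
      · cases α <;> simp only [above, highPr] at hlt ⊢ <;> omega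
      · have h₂ : ¬ N - 1 < x := by omega
        have h₃ : N - 1 + 1 = N := by omega
        cases α
        · simp only [above] at hlt ⊢
          simp only [hA, recovering, h₂, h₃, if_false, if_true]
          by_cases h₄ : N - 1 ≤ k
          · rw [if_pos h₄]
            obtain ⟨i, hi, hiJ⟩ := (hdom.resolve_left (by omega)).resolve_left (by omega)
            have : _ ≤ 2 * _ + 4 := above_le_lowPr (N := N) ht' .even (by omega) hi hiJ
            omega
          · rw [if_neg h₄]
            cases T <;> simp only [lowPr] <;> omega
        · simp only [above, hA, recovering, h₂, if_false, lowPr]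
          omega
    · left
      rw [h₃]
      exact hlow α.opp i (by omega) h₂
  intro α y hy d hd hlt hlt'
  by_cases hyx : y < x
  · rw [hl α y hyx, hg α y hyx, hz α y hyx] at hd
    by_cases hyJ : y ∈ J
    · have hd' : d = above N t J α y := by
        simp only [counting, hyJ, if_true] at hd
        tauto
      rw [hd'] at hlt' ⊢
      exact habove α y hyx.le hlt'
    · left
      by_cases hd' : d = lowPr N .even y
      · rw [hd']
        exact hlow .even y hyx hyJ
      by_cases hd'' : d = lowPr N .odd y
      · rw [hd'']
        exact hlow .odd y hyx hyJ
      have hd₃ : d = nextLow N J y := by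
        clear hlow hlowx habove hl hg hz hdom fx hJ hT' hlt hlt'
        cases α <;> simp only [counting, hyJ, if_false] at hd
        · exact (hd.resolve_left hd').elim id id
        · exact absurd (hd.resolve_left hd'') (by simp [hd'])
      rcases nextLow_spec N J y with h₁ | ⟨m, h₁, h₂, h₃, h₄, h₅⟩
      · exact absurd (h₁.2 x hyx (by omega)) hxJ
      · have hd₄ : d = lowPr N .odd m := hd₃.trans h₄
        rcases lt_trichotomy m x with h₆ | h₆ | h₆
        · rw [hd₄]
          exact hlow .odd m h₆ h₃
        · rw [hd₄, h₆]
          exact hlowx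
        · exact absurd (h₅ x hyx h₆) hxJ
  · by_cases hd₁ : d = lowPr N .odd x
    · rw [hd₁]
      exact .inl hlowx
    by_cases hd₂ : d = above N t J .even x
    · rw [hd₂] at hlt' ⊢
      exact habove .even x le_rfl hlt'
    left
    have hd₃ : T = .lost ∧ d = 3 := by
      clear hlow hlowx habove hl hg hz hdom fx hJ
      cases α <;> cases T <;>
        simp only [hA, recovering, hyx, if_false, Tail.source, lowPr] at hd hlt hd₁ hd₂ ⊢ <;> grind
    obtain ⟨rfl, rfl⟩ := hd₃
    have h₂ : ¬ N - 1 < x := by omega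
    have h₃ : ¬ N - 1 ≤ k := by have := hT' (by simp); omega
    have h₄ : N - 1 + 1 = N := by omega
    refine ⟨.even, N - 1, by omega, ?_, ?_, ?_⟩ <;>
      simp only [hA, recovering, h₂, h₃, h₄, if_false, if_true, lowPr] <;> omega

theorem Tail.target_parity (ht : t % 2 = 0) (ht' : 4 * N + 2 ≤ t) (hx : x < N) :
    ofPriority (T.target N t J x) = ofPriority (T.source N k) := by
  have fx := above_facts (N := N) ht ht' J (y := x) hx
  cases T
  · rw [Tail.source, show ofPriority 1 = .odd from rfl, Tail.target, ofPriority_eq_odd]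
    omega
  · rw [Tail.source, Tail.target, ofPriority_lowPr, ofPriority_lowPr]
  · rw [Tail.source, Tail.target, ofPriority_lowPr]
    rfl

theorem Tail.target_lt (ht : t % 2 = 0) (ht' : 4 * N + 2 ≤ t) (hx : x < N) :
    T.target N t J x < 4 * N + 4 := by
  have fx := above_facts (N := N) ht ht' J (y := x) hx
  cases T <;> simp only [Tail.target, lowPr] <;> omega

/-- The lowest region of the labelling that is not obstructed is closed and can be promoted. -/
theorem recovering_closed (ht : t % 2 = 0) (ht' : 4 * N + 2 ≤ t) (hJ : ∀ m ∈ J, m < x)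
    (hxk : x ≤ k) (hk : k < N) (hT : T = .stale → x < k) (hT' : T ≠ .settled → k + 1 < N) :
    (recovering N t J x k T).Closed N (T.source N k) (T.target N t J x) := by
  have fs := fun y hy => above_facts (N := N) ht ht' J (y := y) hy
  have fp := fun m y => above_facts₂ (N := N) ht' J (m := m) (y := y)
  have nl := nextLow_spec N J
  have hxJ : x ∉ J := fun h => lt_irrefl _ (hJ x h)
  have fx := fs x (by omega)
  clear hJ
  have hsrc : T.source N k = 1 ∨ T.source N k = 2 ∨ T.source N k = 2 * (N - 1 - k) + 4 := by
    cases T <;> simp [Tail.source, lowPr]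
  have hgz : ∀ α, ∀ y < N, (recovering N t J x k T).g α y = T.source N k ∨
      (recovering N t J x k T).z α y = T.source N k → (T = .settled ∧ α = .odd ∧ y = x ∧
        (recovering N t J x k T).g α y = T.source N k) ∨
      (T ≠ .settled ∧ α = .even ∧ y + 1 = N ∧ (recovering N t J x k T).g α y = T.source N k) ∨
      (T = .stale ∧ α = .odd ∧ x < y ∧ (recovering N t J x k T).g α y = lowPr N .odd x) := by
    intro α y hy h
    have h₁ := fs y hy
    have h₂ := nl y
    clear fs fp nl
    cases α <;> cases T <;>
      simp only [recovering, counting, lowPr, Tail.source] at h ⊢ <;> grind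
  constructor
  · cases T <;> simp only [Tail.source, Tail.target, lowPr] <;> grind
  · omega
  · intro α y hy he
    have h₁ := fs y hy
    clear fs fp nl hgz
    cases α <;> cases T <;>
      simp only [recovering, counting, lowPr, Tail.source] at he ⊢ <;> grind
  · intro α y hy he
    rcases hgz α y hy (.inl he) with ⟨rfl, rfl, -⟩ | ⟨h₁, rfl, -⟩ | ⟨rfl, rfl, h₁, h₂⟩
    · rfl
    · exact Tail.source_parity h₁
    · rw [he] at h₂
      simp only [Tail.source, lowPr] at h₂
      have := hT rfl
      omega
  · intro α y he
    rcases hgz α y y.isLt (.inl he) with ⟨rfl, rfl, h₁, -⟩ | ⟨h₁, rfl, -⟩ | ⟨rfl, rfl, h₁, h₂⟩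
    · have h₂ : (TCVertex.next y : ℕ) = if x = 0 then N - 1 else x - 1 := by rw [← h₁]; rfl
      rw [h₂, h₁]
      clear he h₂ h₁ y hgz hsrc fs fp nl
      by_cases hx0 : x = 0
      · right
        subst hx0
        simp only [Tail.target, above, highPr]
        omega
      · obtain ⟨x, rfl⟩ := Nat.exists_eq_succ_of_ne_zero hx0
        simp only [Nat.succ_eq_add_one, Nat.add_one_ne_zero, if_false, Nat.add_sub_cancel, above,
          counting, recovering, highPr, lowPr, opp, Tail.target, Nat.lt_succ_self, if_true]
        split_ifs <;> omega
    · right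
      cases T
      · exact absurd rfl h₁
      · simp only [Tail.target, lowPr, highPr]; omega
      · simp only [Tail.target, lowPr, highPr]; omega
    · right
      simp only [Tail.target, lowPr, highPr]; omega
  · intro α y hy he hp
    rcases hgz α y hy (.inr he) with ⟨-, -, -, h⟩ | ⟨-, -, -, h⟩ | ⟨rfl, rfl, h₁, h₂⟩
    · exact h
    · exact h
    · rw [Tail.source, ofPriority_lowPr] at hp
      cases hp
  · intro α y hy he hp
    rcases hgz α y hy (.inr he) with ⟨rfl, rfl, -⟩ | ⟨h₁, rfl, -⟩ | ⟨rfl, rfl, h₁, h₂⟩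
    · exact absurd rfl hp
    · exact absurd (Tail.source_parity h₁) hp
    · refine ⟨.inr h₂.ge, fun j hj => ?_⟩
      clear fs fp nl hgz hsrc
      simp only [Distracts] at hj
      simp only [recovering, Tail.source, Tail.target, opp, lowPr]
      grind
  · intro α y hy he m hm γ hp
    have h₁ := fs m (hm.trans hy)
    have h₂ := fp m x
    rcases hgz α y hy (.inl he) with ⟨rfl, rfl, rfl, -⟩ | ⟨h₃, rfl, h₄, -⟩ | ⟨rfl, rfl, h₃, h₄⟩
    · clear fs fp nl hgz hsrc
      cases γ <;> simp only [recovering, counting, lowPr, Tail.target, ofPriority_eq_odd] at hp ⊢ <;>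
        grind
    · clear fs fp nl hgz hsrc he
      cases γ <;> cases T <;>
        simp only [recovering, counting, lowPr, Tail.target, ofPriority_eq_even] at hp ⊢ <;> grind
    · rw [he] at h₄
      simp only [Tail.source, lowPr] at h₄
      have := hT rfl
      omega

theorem recovering_escape (hJ : ∀ m ∈ J, m < x)
    (hxk : x ≤ k) (hk : k < N) (hT : T = .stale → x < k) (hT' : T ≠ .settled → k + 1 < N) :
    ∃ u w : TCVertex N, (recovering N t J x k T).reg u = T.source N k ∧
      (twoCounters N).owner u ≠ ofPriority (T.source N k) ∧ w ∈ (twoCounters N).succ u ∧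
      (recovering N t J x k T).reg w = T.target N t J x := by
  have hxJ : x ∉ J := fun h => lt_irrefl _ (hJ x h)
  have hxN : x < N := by omega
  by_cases hTs : T = .settled
  · subst hTs
    have hc : ∀ i, (recovering N t J x k .settled).c .odd x i = 1 := by
      intro i
      unfold c
      split_ifs <;> simp only [recovering, lt_irrefl, if_true, if_false]
    simp only [Tail.source, Tail.target]
    rcases above_spec (N := N) (t := t) (J := J) .odd x with ⟨h₁, h₂⟩ | ⟨i, h₁, h₂, h₃, -⟩
    · refine ⟨.t .odd ⟨x, hxN⟩, .h .odd ⟨x, hxN⟩, ?_, by simp [owner_t, opp, ofPriority],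
        mem_succ_t.2 (.inl rfl), ?_⟩
      · show (recovering N t J x k .settled).g .odd x = 1
        simp only [recovering, lt_irrefl, if_true, if_false]
      have h₃ : ((TCVertex.next ⟨x, hxN⟩ : Fin N) : ℕ) = if x = 0 then N - 1 else x - 1 := rfl
      show max _ ((recovering N t J x k .settled).l .odd _) = _
      rw [h₃, h₁]
      by_cases hx0 : x = 0
      · subst hx0
        simp only [if_true, recovering, counting, highPr, lowPr, above, Nat.not_lt_zero, if_false]
        omega
      · have h₄ := above_eq (N := N) (t := t) (J := J) (α := .odd) (m := 0) (y := x - 1)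
          (by omega) fun i _ hi => h₂ i (by omega)
        have h₅ : x - 1 < x := by omega
        simp only [hx0, if_false, recovering, counting, h₂ (x - 1) (by omega), if_true, h₄, above,
          highPr, h₅]
        omega
    · refine ⟨.b .odd ⟨x, hxN⟩ ⟨i, h₁⟩, .l .even ⟨i, h₁.trans hxN⟩, ?_, by simp [owner_b, opp,
        ofPriority], mem_succ_b.2 (.inr rfl), ?_⟩
      · show comb _ ((recovering N t J x k .settled).c .odd x _) _ = 1
        rw [hc]
        simp only [recovering, counting, h₁, h₂, if_true, if_false, opp, lowPr, comb]
        rw [if_neg (by simp [ofPriority]), if_neg (by rw [ofPriority_eq_even]; omega)]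
        exact min_eq_left (by omega)
      · rw [h₃]
        show (recovering N t J x k .settled).l .even i = _
        simp only [recovering, counting, h₁, h₂, if_true, if_false, opp]
  · have hkN := hT' hTs
    have h₁ : ¬ N - 1 < x := by omega
    have h₂ : ¬ N - 1 ≤ k := by omega
    have h₃ : N - 1 + 1 = N := by omega
    have hc : ∀ i, (recovering N t J x k T).c .even (N - 1) i = T.source N k := by
      intro i
      unfold c
      cases T
      · exact absurd rfl hTs
      · split_ifs <;> simp only [recovering, h₁, h₂, h₃, if_true, if_false, Tail.source]
      · split_ifs <;> simp only [recovering, h₁, h₂, h₃, if_true, if_false, Tail.source]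
    have hpar : ofPriority (T.source N k) = .even := Tail.source_parity hTs
    have hlt : T.source N k ≤ lowPr N .odd x := by
      cases T <;> simp only [Tail.source, lowPr] <;> omega
    refine ⟨.b .even ⟨N - 1, by omega⟩ ⟨x, by simp only; omega⟩, .l .odd ⟨x, hxN⟩, ?_, ?_,
      mem_succ_b.2 (.inr rfl), ?_⟩
    · show comb _ ((recovering N t J x k T).c .even (N - 1) _)
        ((recovering N t J x k T).l .odd x) = _
      rw [hc]
      simp only [recovering, lt_irrefl, if_false, comb, opp]
      rw [if_neg (by simp [hpar]), if_neg (by simp [ofPriority_lowPr, opp]), min_eq_left hlt]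
    · rw [hpar]
      simp [owner_b, opp]
    · show (recovering N t J x k T).l .odd x = _
      cases T
      · exact absurd rfl hTs
      · simp only [recovering, lt_irrefl, if_false, Tail.target]
      · simp only [recovering, lt_irrefl, if_false, Tail.target]

end Labelling

end Recovering

/-! ### Labels while Even recovers its highest region -/

section Raising

open Player

variable {N x k : ℕ}

theorem comb_even (c d : ℕ) : comb .even c d =
    if c % 2 = 0 then (if d % 2 = 0 then max c d else c) else if d % 2 = 0 then d else min c d := by
  simp only [comb, ofPriority_eq_even]

theorem comb_odd (c d : ℕ) : comb .odd c d =
    if c % 2 = 1 then (if d % 2 = 1 then max c d else c) else if d % 2 = 1 then d else min c d := by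
  simp only [comb, ofPriority_eq_odd]

namespace Labelling

/-- The labels after Odd has set bit `k` when all higher bits are set, so that the region of Even
for its set bits has been reset, and Even has recovered the bits above `x`. -/
def raising (N x k : ℕ) : Labelling where
  l
    | .even, y => if y < x then 4 * N + 2 else lowPr N .even x
    | .odd, y => if y ≤ k then 4 * N + 3 else lowPr N .even x
  g
    | .even, y => if y < x then 4 * N + 2 else if y = x then 2 else lowPr N .even x
    | .odd, y => if y ≤ k then 4 * N + 3 else lowPr N .even x
  z
    | .even, y => if y < x then 4 * N + 2 else if y = x then 2 else lowPr N .even x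
    | .odd, y => if y ≤ k then 4 * N + 3 else lowPr N .even x
  core
    | .even, y => y < x
    | .odd, y => y ≤ k

theorem valid_raising (hxk : x ≤ k) (hk : k + 1 < N) : (raising N x k).Valid N := by
  constructor
  · intro α y hy
    cases α <;> simp only [raising, lowPr] <;> grind
  · intro α y hy
    cases α <;> simp only [raising, lowPr, ofPriority_eq_even, ofPriority_eq_odd] <;> grind
  · intro α y hy
    cases α <;> simp only [raising, lowPr] <;> grind
  · intro α y hy
    cases α <;> simp only [raising, lowPr, tanglePr] <;> grind
  · intro α y hy
    cases α <;> exact le_rfl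
  · intro α y hy
    cases α <;> simp only [raising, lowPr, chainPr] <;> grind
  · intro α y hy
    cases α <;> simp only [raising, lowPr] <;> grind
  · intro α y hy m hm
    cases α <;> simp only [raising, lowPr, opp, ofPriority_eq_even, ofPriority_eq_odd, ne_eq] <;>
      grind
  · intro α y hy j hj
    cases α <;> simp only [raising, Distracts, lowPr, opp, ofPriority_eq_even,
      ofPriority_eq_odd, ne_eq] at hj ⊢ <;> grind
  · intro α y hy
    exact .inl (by cases α <;> rfl)
  · intro α y hy h j hj
    cases α <;> simp only [raising, Distracts, lowPr, opp, ofPriority_eq_even,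
      ofPriority_eq_odd, ne_eq] at hj h ⊢ <;> grind
  · intro α y hy
    by_cases heven : α = .even ∧ x < y
    · right
      obtain ⟨rfl, hxy⟩ := heven
      refine ⟨x, hxy, ?_, ?_, fun m h₃ h₄ => ?_, fun m h₃ h₄ => ?_, ?_⟩ <;>
        simp only [raising, lowPr, opp, ofPriority_eq_even, ne_eq] <;> grind
    · left
      constructor
      · cases α <;> simp only [raising, lowPr, ofPriority_eq_even, ofPriority_eq_odd] <;> grind
      · cases α <;> rfl
      · cases α
        · by_cases hyx : y < x
          · exact .inl hyx
          · right
            left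
            have : y = x := by
              by_contra hne
              exact heven ⟨rfl, by omega⟩
            simp only [raising, hyx, this, if_true, if_false, tanglePr, lt_irrefl]
        · by_cases hyk : y ≤ k
          · exact .inl hyk
          · right
            right
            have h₁ : ¬ y < x := by omega
            have h₂ : y ≠ x := by omega
            refine ⟨?_, y, ⟨le_rfl, hy⟩, ?_, .inr ⟨?_, ?_⟩⟩ <;>
              simp only [raising, hyk, h₁, h₂, if_false, opp, lowPr, ne_eq, ofPriority_eq_even] <;>
              omega
      · intro m hm
        cases α <;> simp only [raising, Early, lowPr, opp, ofPriority_eq_even, ofPriority_eq_odd,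
          ne_eq] <;> grind

theorem raising_openAbove (hxk : x ≤ k) (hk : k + 1 < N) : (raising N x k).OpenAbove N 2 := by
  intro α y hy d hd hlt hlt'
  have hd' : d = 4 * N + 2 ∨ d = 4 * N + 3 ∨ d = lowPr N .even x := by
    cases α <;> simp only [raising] at hd <;> grind
  rcases hd' with rfl | rfl | rfl
  · exact .inr ⟨.even, by simp only [highPr]; omega, by simp only [raising, lowPr]; grind⟩
  · exact .inr ⟨.odd, by simp only [highPr]; omega, by simp only [raising, lowPr]; grind⟩
  · refine .inl ⟨.even, x, by omega, ?_, rfl, ?_⟩ <;>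
      simp only [raising, lt_irrefl, if_true, if_false, lowPr]
    omega

theorem raising_closed (hxk : x ≤ k) (hk : k + 1 < N) :
    (raising N x k).Closed N 2 (4 * N + 2) := by
  have hg : ∀ α, ∀ y < N, (raising N x k).g α y = 2 → α = .even ∧ y = x := by
    intro α y hy hg
    cases α <;> simp only [raising, lowPr] at hg <;> grind
  have hz : ∀ α y, (raising N x k).z α y = (raising N x k).g α y := fun α y => by cases α <;> rfl
  refine ⟨by omega, by omega, fun α y hy he => ?_, fun α y hy he => ?_, fun α y he => ?_,
    fun α y hy he _ => (hz α y).symm.trans he, fun α y hy he hp => ?_, fun α y hy he m hm γ hp => ?_⟩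
  · exfalso
    cases α <;> simp only [raising, lowPr] at he <;> split_ifs at he <;> omega
  · rw [(hg α y hy he).1]
    rfl
  · obtain ⟨rfl, hyx⟩ := hg α y y.isLt he
    have h₁ : (TCVertex.next y : ℕ) = if x = 0 then N - 1 else x - 1 := by rw [← hyx]; rfl
    rw [h₁, hyx]
    simp only [raising, highPr, lowPr]
    grind
  · rw [hz] at he
    rw [(hg α y hy he).1] at hp
    exact absurd rfl hp
  · obtain ⟨rfl, rfl⟩ := hg α y hy he
    cases γ <;> simp only [raising, lowPr, ofPriority_eq_even] at hp ⊢ <;> grind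

theorem raising_escape (hxk : x ≤ k) (hk : k + 1 < N) :
    ∃ u w : TCVertex N, (raising N x k).reg u = 2 ∧
      (twoCounters N).owner u ≠ ofPriority 2 ∧ w ∈ (twoCounters N).succ u ∧
      (raising N x k).reg w = 4 * N + 2 := by
  refine ⟨.t .even ⟨x, by omega⟩, .h .even ⟨x, by omega⟩, ?_, by simp [owner_t, opp, ofPriority],
    mem_succ_t.2 (.inl rfl), ?_⟩
  · show (raising N x k).g .even x = 2
    simp only [raising, lt_irrefl, if_true, if_false]
  · have h₃ : ((TCVertex.next ⟨x, by omega⟩ : Fin N) : ℕ) = if x = 0 then N - 1 else x - 1 := rfl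
    show max _ ((raising N x k).l .even _) = _
    rw [h₃]
    simp only [raising, highPr, lowPr]
    grind

end Labelling

end Raising

/-! ### Changes of labels by promotions -/

section Transitions

open Player

variable {N t x k f q b d L : ℕ} {J : Finset ℕ} {T : Tail} {v : Variant} {A A' : Labelling}
  {won : Player → Finset (TCVertex N)}

namespace Labelling

theorem le_reg (h : ∀ α, ∀ y < N, d ≤ A.l α y ∧ d ≤ A.g α y ∧ d ≤ A.z α y) (hd : d ≤ 2 * N + 4)
    (u : TCVertex N) : d ≤ A.reg u := by
  rcases reg_eq_label A u with ⟨α, y, hy, h₁⟩ | ⟨α, y, -, h₁, -⟩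
  · have := h α y hy
    omega
  · have := le_highPr (N := N) α y
    omega

/-- If even labels from `L` on are only replaced by such labels, then the region `L` of Even does
not lose vertices to lower regions. -/
theorem le_reg_of_even (hL : L % 2 = 0) (h : ∀ α, ∀ y < N,
    (A.l α y % 2 = 0 → L ≤ A.l α y → A'.l α y % 2 = 0 ∧ L ≤ A'.l α y) ∧
    (A.g α y % 2 = 0 → L ≤ A.g α y → A'.g α y % 2 = 0 ∧ L ≤ A'.g α y) ∧
    (A.z α y % 2 = 0 → L ≤ A.z α y → A'.z α y % 2 = 0 ∧ L ≤ A'.z α y)) (u : TCVertex N)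
    (hu : A.reg u = L) : L ≤ A'.reg u := by
  have hc : ∀ α, ∀ y < N, ∀ i, A.c α y i % 2 = 0 → L ≤ A.c α y i →
      A'.c α y i % 2 = 0 ∧ L ≤ A'.c α y i := by
    intro α y hy i
    unfold c
    split_ifs
    · exact (h α y hy).2.1
    · exact (h α y hy).2.2
  have hcomb : ∀ ω c d c' d', comb ω c d = L → (c % 2 = 0 → L ≤ c → c' % 2 = 0 ∧ L ≤ c') →
      (d % 2 = 0 → L ≤ d → d' % 2 = 0 ∧ L ≤ d') → L ≤ comb ω c' d' := by
    intro ω c d c' d' h₁ h₂ h₃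
    clear h hc hu
    cases ω <;> simp only [comb_even, comb_odd] at h₁ ⊢ <;> grind
  cases u with
  | l α y => exact ((h α y y.isLt).1 (by rw [← hL]; exact congrArg (· % 2) hu) hu.ge).2
  | h α y =>
    have h₁ := (h α _ (TCVertex.next y).isLt).1
    change max _ _ = L at hu
    show L ≤ max _ _
    rcases max_choice (highPr N α y) (A.l α (TCVertex.next y)) with h₂ | h₂
    · exact le_max_of_le_left (by omega)
    · rw [h₂] at hu
      exact le_max_of_le_right (h₁ (by omega) hu.ge).2
  | t α y => exact ((h α y y.isLt).2.1 (by rw [← hL]; exact congrArg (· % 2) hu) hu.ge).2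
  | z α y => exact ((h α y y.isLt).2.2 (by rw [← hL]; exact congrArg (· % 2) hu) hu.ge).2
  | s α y _ => exact ((h α y y.isLt).2.1 (by rw [← hL]; exact congrArg (· % 2) hu) hu.ge).2
  | a α y m => exact hcomb _ _ _ _ _ hu (hc α y y.isLt _) (h α m (m.isLt.trans y.isLt)).1
  | b α y m => exact hcomb _ _ _ _ _ hu (hc α y y.isLt _) (h α.opp m (m.isLt.trans y.isLt)).1

theorem keeps_of (hz : ∀ α, ∀ y < N, A.z α y = A.g α y) (hz' : ∀ α, ∀ y < N, A'.z α y = A'.g α y)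
    (hl : ∀ α, ∀ y < N, A'.l α y = A.l α y ∨ A.l α y = f ∨ A.l α y = b)
    (hg : ∀ α, ∀ y < N, A'.g α y = A.g α y ∨ A.g α y = f ∨ A.g α y = b)
    (hcomb : ∀ α γ, ∀ y < N, ∀ m < y, comb α.opp (A.g α y) (A.l γ m) < 4 * N + 4 →
      comb α.opp (A'.g α y) (A'.l γ m) = comb α.opp (A.g α y) (A.l γ m) ∨
      comb α.opp (A.g α y) (A.l γ m) = f ∨ comb α.opp (A.g α y) (A.l γ m) = b) :
    A.Keeps N f b A' := by
  intro u hu hh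
  have hc : ∀ α, ∀ y < N, ∀ i, A.c α y i = A.g α y := by
    intro α y hy i
    unfold c
    split_ifs
    · rfl
    · exact hz α y hy
  have hc' : ∀ α, ∀ y < N, ∀ i, A'.c α y i = A'.g α y := by
    intro α y hy i
    unfold c
    split_ifs
    · rfl
    · exact hz' α y hy
  cases u with
  | l α y => exact hl α y y.isLt
  | h α y => exact absurd rfl (hh α y)
  | t α y => exact hg α y y.isLt
  | z α y =>
    show A'.z α y = A.z α y ∨ A.z α y = f ∨ A.z α y = b
    rw [hz α y y.isLt, hz' α y y.isLt]
    exact hg α y y.isLt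
  | s α y _ => exact hg α y y.isLt
  | a α y m =>
    have := hcomb α α y y.isLt m m.isLt
    rw [← hc α y y.isLt (m + 1), ← hc' α y y.isLt (m + 1)] at this
    exact this hu
  | b α y m =>
    have := hcomb α α.opp y y.isLt m m.isLt
    rw [← hc α y y.isLt (m + 1), ← hc' α y y.isLt (m + 1)] at this
    exact this hu

/-- A region that only moves up need not be reset. -/
theorem _root_.IsPromotion.of_lt {V : Type} [Fintype V] [DecidableEq V] {G : ParityGame V}
    {X X' : Layout V} {bad : ℕ → Prop} (h : IsPromotion G v X X' f q bad)
    (hlt : ∀ u ∈ X.alive, bad (X.reg u) → X.reg u < X'.reg u) :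
    IsPromotion G v X X' f q fun _ => False := by
  refine ⟨h.alive, h.won, h.lt, h.parity, h.own, h.opp, h.escape, h.base, h.high, h.high',
    fun u hu h₁ h₂ => ?_, h.rest, h.core, fun _ _ _ h => h, fun hv u hu h₁ h₂ _ ho => ?_⟩
  · rcases h.low u hu h₁ h₂ with h₃ | h₃ | h₃
    · exact .inl h₃
    · exact .inr (.inl h₃)
    · exact .inr (.inl (hlt u hu h₃).le)
  · refine h.stay hv u hu h₁ h₂ (fun hb => ?_) ho
    have := hlt u hu hb
    omega

end Labelling

/-! ### Even sets a bit -/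

/-- Even sets bit `k` from the state where both counters show the bits in `J`, and the bits of Odd
from `x` on do not get through this promotion.  With region recovery only bits from `k` on are
lost.  Otherwise `x` follows the next higher unset bit; if there is none, the set bits of Odd are in
its highest region and get through.  The lowest bit of Even is lost in PP and may be stale in
the variants that keep the lower regions of Even. -/
structure SetsEven (N : ℕ) (v : Variant) (J : Finset ℕ) (x k : ℕ) (T : Tail) : Prop where
  lt : k < N
  notMem : k ∉ J
  low : ∀ m, k < m → m < N → m ∈ J
  le : x ≤ k
  mid : ∀ m, x ≤ m → m < k → m ∈ J
  start : x = k ∨ (0 < x ∧ x - 1 ∉ J)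
  full : (0 < x ∧ x - 1 ∉ J) ∨ (∀ m < k, m ∈ J) ∨ v.Recovers
  recovers : v.Recovers → x = k ∧ T = .settled
  lost : T = .lost → v = .pp ∧ k + 1 < N
  stale : T = .stale → x < k ∧ k + 1 < N
  tail : T ≠ .lost → k + 1 < N → v ≠ .pp ∧ (T = .settled → x = k)

namespace SetsEven

theorem notMem' (h : SetsEven N v J x k T) : x ∉ J.filter (· < x) := by simp

theorem next_of_lt (h : SetsEven N v J x k T) {y : ℕ} (hy : y < x) :
    nextLow N (J.filter (· < x)) y =
      if nextLow N J y = 2 * (N - 1 - k) + 4 then 2 * (N - 1 - x) + 4 else nextLow N J y := by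
  have h₁ := nextLow_spec N J y
  have h₂ := nextLow_spec N (J.filter (· < x)) y
  have hN := h.lt
  have hxk := h.le
  rcases h₁ with ⟨h₁, h₃⟩ | ⟨m, h₁, h₃, h₄, h₅, h₆⟩
  · exact absurd (h₃ k (by omega) h.lt) h.notMem
  rcases h₂ with ⟨h₂, h₇⟩ | ⟨m', h₂, h₇, h₈, h₉, h₁₀⟩
  · exact absurd (h₇ x hy (by omega)) h.notMem'
  have hm'x : m' ≤ x := by
    by_contra hlt
    exact h.notMem' (h₁₀ x hy (by omega))
  have hmk : m ≤ k := by
    by_contra hlt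
    exact h.notMem (h₆ k (by omega) (by omega))
  rw [h₅, h₉]
  by_cases hmx : m < x
  · have hm : m = m' := by
      rcases lt_trichotomy m m' with h₁₁ | h₁₁ | h₁₁
      · have := h₁₀ m h₁ h₁₁
        exact absurd (Finset.mem_filter.1 this).1 h₄
      · exact h₁₁
      · exact absurd (Finset.mem_filter.2 ⟨h₆ m' h₂ h₁₁, by omega⟩) h₈
    rw [if_neg (by omega), hm]
  · have hm : m = k := by
      by_contra hne
      exact h₄ (h.mid m (by omega) (by omega))
    have hm' : m' = x := by
      by_contra hne
      exact h₈ (Finset.mem_filter.2 ⟨h₆ m' h₂ (by omega), by omega⟩)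
    rw [if_pos (by omega), hm']

theorem above_of_le (h : SetsEven N v J x k T) {α : Player} {y : ℕ} (hy : y ≤ x) :
    above N t (J.filter (· < x)) α y = above N t J α y :=
  above_congr fun m hm => by simp only [Finset.mem_filter]; exact ⟨fun h => h.1, fun h => ⟨h, by omega⟩⟩

theorem above_mid (h : SetsEven N v J x k T) {α : Player} {y : ℕ} (hy : x ≤ y) (hyk : y ≤ k) :
    above N t J α y = above N t J α x :=
  above_eq hy fun i h₁ h₂ => h.mid i h₁ (by omega)

theorem above_low (h : SetsEven N v J x k T) {α : Player} {y : ℕ} (hy : k < y) (hyN : y < N) :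
    above N t J α y = lowPr N α.opp k := by
  rw [above_eq (show k + 1 ≤ y from hy) fun i h₁ h₂ => h.low i h₁ (by omega), above,
    if_neg h.notMem]

/-- All values of the labels at a bit, before and after the promotion. -/
theorem facts (h : SetsEven N v J x k T) (y : ℕ) (hy : y < N) :
    (y < x → (y ∈ J.filter (· < x) ↔ y ∈ J) ∧
      above N (4 * N + 2) (J.filter (· < x)) .even y = above N (4 * N + 2) J .even y ∧
      above N (4 * N + 2) (J.filter (· < x)) .odd y = above N (4 * N + 2) J .odd y ∧
      above N (4 * N + 2) J .even x ≤ above N (4 * N + 2) J .even y ∧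
      above N (4 * N + 2) J .odd x ≤ above N (4 * N + 2) J .odd y ∧
      nextLow N (J.filter (· < x)) y = (if nextLow N J y = 2 * (N - 1 - k) + 4
        then 2 * (N - 1 - x) + 4 else nextLow N J y) ∧
      2 * (N - 1 - k) + 4 ≤ nextLow N J y ∧ nextLow N J y % 2 = 0 ∧
      (y ∉ J → above N (4 * N + 2) J .even x ≤ 2 * (N - 1 - y) + 4)) ∧
    (x ≤ y → y < k → y ∈ J ∧
      above N (4 * N + 2) J .even y = above N (4 * N + 2) J .even x ∧
      above N (4 * N + 2) J .odd y = above N (4 * N + 2) J .odd x) ∧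
    (k < y → y ∈ J ∧
      above N (4 * N + 2) J .even y = 2 * (N - 1 - k) + 4 ∧
      above N (4 * N + 2) J .odd y = 2 * (N - 1 - k) + 3) ∧
    (y = k → y ∉ J ∧ nextLow N J y = 2) ∧
    above N (4 * N + 2) J .even y % 2 = 0 ∧ above N (4 * N + 2) J .odd y % 2 = 1 ∧
    2 * (N - y) + 4 ≤ above N (4 * N + 2) J .even y ∧
    2 * (N - y) + 3 ≤ above N (4 * N + 2) J .odd y := by
  have hk := h.lt
  have hxk := h.le
  have f₁ := above_facts (N := N) (t := 4 * N + 2) (by omega) le_rfl J hy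
  refine ⟨fun hyx => ?_, fun h₁ h₂ => ?_, fun h₁ => ?_, ?_, by omega, by omega, by omega, by omega⟩
  · have f₂ := Labelling.above_facts₂ (N := N) (t := 4 * N + 2) le_rfl J hyx (by omega)
    refine ⟨by simp [hyx], h.above_of_le hyx.le, h.above_of_le hyx.le, f₂.1, f₂.2.1,
      h.next_of_lt hyx, ?_, ?_, fun h₃ => (f₂.2.2 h₃).1⟩ <;>
    · rcases nextLow_spec N J y with ⟨h₁, h₃⟩ | ⟨m, h₁, h₃, h₄, h₅, h₆⟩
      · exact absurd (h₃ k (by omega) h.lt) h.notMem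
      · have : m ≤ k := by
          by_contra hlt
          exact h.notMem (h₆ k (by omega) (by omega))
        omega
  · exact ⟨h.mid y h₁ h₂, h.above_mid h₁ h₂.le, h.above_mid h₁ h₂.le⟩
  · exact ⟨h.low y h₁ hy, h.above_low h₁ hy, h.above_low h₁ hy⟩
  · rintro rfl
    exact ⟨h.notMem, Labelling.nextLow_of_forall h.low⟩

theorem above_x (h : SetsEven N v J x k T) :
    above N (4 * N + 2) (J.filter (· < x)) .even x = above N (4 * N + 2) J .even x ∧
    above N (4 * N + 2) (J.filter (· < x)) .odd x = above N (4 * N + 2) J .odd x ∧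
    above N (4 * N + 2) J .even k = above N (4 * N + 2) J .even x ∧
    above N (4 * N + 2) J .even x % 2 = 0 ∧ above N (4 * N + 2) J .odd x % 2 = 1 ∧
    2 * (N - x) + 4 ≤ above N (4 * N + 2) J .even x ∧
    2 * (N - x) + 3 ≤ above N (4 * N + 2) J .odd x ∧
    above N (4 * N + 2) J .even x ≤ 4 * N + 2 ∧
    (0 < x ∧ x - 1 ∉ J → above N (4 * N + 2) J .even x = 2 * (N - x) + 4 ∧
      above N (4 * N + 2) J .odd x = 2 * (N - x) + 3) ∧
    ((∀ m < k, m ∈ J) → above N (4 * N + 2) J .odd x = 4 * N + 3 ∧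
      ∀ y ≤ k, above N (4 * N + 2) J .odd y = 4 * N + 3) := by
  have hk := h.lt
  have hxk := h.le
  have f₁ := above_facts (N := N) (t := 4 * N + 2) (by omega) le_rfl J (y := x) (by omega)
  refine ⟨h.above_of_le le_rfl, h.above_of_le le_rfl, h.above_mid h.le le_rfl, by omega, by omega,
    by omega, by omega, by omega, fun ⟨h₁, h₂⟩ => ?_, fun h₁ => ?_⟩
  · obtain ⟨x, rfl⟩ := Nat.exists_eq_succ_of_ne_zero h₁.ne'
    simp only [Nat.succ_eq_add_one, Nat.add_sub_cancel] at h₂ ⊢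
    simp only [above, if_neg h₂, lowPr, opp]
    omega
  · have : ∀ y ≤ k, above N (4 * N + 2) J .odd y = 4 * N + 3 := fun y hy =>
      above_eq (Nat.zero_le y) fun m _ hm => h₁ m (by omega)
    exact ⟨this x h.le, this⟩

end SetsEven

namespace Labelling

open SetsEven in
theorem counting_shifts (h : SetsEven N v J x k T) :
    (counting N (4 * N + 2) J).Shifts N 2 (above N (4 * N + 2) J .even k)
      (recovering N (4 * N + 2) (J.filter (· < x)) x k T) := by
  intro α y hy
  have f := h.facts y hy
  have g := h.above_x
  have hk := h.lt
  have hxk := h.le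
  have h₁ := h.start
  have h₂ := h.lost
  have h₃ := h.stale
  clear h
  obtain ⟨g₁, g₂, g₃, g₄, g₅, g₆, g₇, g₈, g₉, -⟩ := g
  rw [g₃]
  simp only [recovering, counting, lowPr, Shift, g₁]
  generalize above N (4 * N + 2) (J.filter (· < x)) = M' at *
  generalize above N (4 * N + 2) J = M at *
  generalize J.filter (· < x) = J' at *
  generalize nextLow N J y = n at *
  generalize nextLow N J' y = n' at *
  rcases lt_or_ge y x with hyx | hyx
  · obtain ⟨f, -, -, -, f'⟩ := f
    have f := f hyx
    cases α <;> simp only [hyx, if_true] <;> grind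
  rcases lt_trichotomy y k with hyk | hyk | hyk
  · have f₁ := f.2.1 hyx hyk
    clear f
    cases α <;> cases T <;> simp only [not_lt.2 hyx, f₁, hyk.le, if_true, if_false] <;> grind
  · have f₁ := f.2.2.2.1 hyk
    clear f
    cases α <;> cases T <;> simp only [not_lt.2 hyx, f₁, hyk.le, if_true, if_false] <;> grind
  · have f₁ := f.2.2.1 hyk
    clear f
    cases α <;> cases T <;> simp only [not_lt.2 hyx, f₁, not_le.2 hyk, if_true, if_false] <;> grind

theorem counting_le_reg (h : SetsEven N v J x k T) (u : TCVertex N) :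
    2 ≤ (counting N (4 * N + 2) J).reg u := by
  refine le_reg (fun α y hy => ?_) (by omega) u
  have f := h.facts y hy
  have n := nextLow_spec N J y
  clear h
  cases α <;> simp only [counting, lowPr] <;> grind

theorem counting_core (h : SetsEven N v J x k T) (α : Player) (y : ℕ) (hy : y < N)
    (hc : (recovering N (4 * N + 2) (J.filter (· < x)) x k T).core α y) :
    (counting N (4 * N + 2) J).g α y = 2 ∨ (2 < (counting N (4 * N + 2) J).g α y ∧
      (counting N (4 * N + 2) J).core α y ∧
      (recovering N (4 * N + 2) (J.filter (· < x)) x k T).g α y =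
        (counting N (4 * N + 2) J).g α y ∧
      ((counting N (4 * N + 2) J).g α y < above N (4 * N + 2) J .even k →
        ¬ v.Resets (ofPriority 2) ((counting N (4 * N + 2) J).g α y))) := by
  have f := h.facts y hy
  obtain ⟨g₁, g₂, g₃, g₄, g₅, g₆, g₇, g₈, g₉, g₁₀⟩ := h.above_x
  have hk := h.lt
  have hxk := h.le
  have htail := h.tail
  have hkeep : (counting N (4 * N + 2) J).g α y % 2 = 0 → v ≠ .pp →
      ¬ v.Resets (ofPriority 2) ((counting N (4 * N + 2) J).g α y) := by
    intro h₁ h₂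
    have h₃ : ofPriority ((counting N (4 * N + 2) J).g α y) = ofPriority 2 :=
      (ofPriority_eq_even.2 h₁).trans (ofPriority_eq_even.2 rfl).symm
    cases v <;> simp_all [Variant.Resets]
  have hodd : α = .odd → y < x → above N (4 * N + 2) J .odd y < above N (4 * N + 2) J .even k →
      v.Recovers := by
    intro h₁ h₂ h₃
    rcases h.full with h₄ | h₄ | h₄
    · have := g₉ h₄
      have := f.1 h₂
      omega
    · have := (g₁₀ h₄).2 y (by omega)
      omega
    · exact h₄
  rw [g₃] at hodd
  rw [g₃]
  rcases lt_or_ge y x with hyx | hyx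
  · have hyJ : y ∈ J := by
      rcases hc with hc | hc
      · exact (Finset.mem_filter.1 hc).1
      · omega
    have f₁ := f.1 hyx
    have hA : (counting N (4 * N + 2) J).g α y = above N (4 * N + 2) J α y := by
      simp only [counting, hyJ, if_true]
    right
    rw [hA]
    refine ⟨by cases α <;> omega, hyJ, ?_, ?_⟩
    · simp only [recovering, hyx, if_true, counting, f₁.1, hyJ]
      cases α
      · exact f₁.2.1
      · exact f₁.2.2.1
    · intro hlt
      cases α
      · omega
      · exact (hodd rfl hyx hlt).not_resets _ _
  · rcases hc with hc | ⟨rfl, -, hc⟩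
    · exact absurd (Finset.mem_filter.1 hc).2 (by omega)
    rcases lt_trichotomy y k with hyk | hyk | hyk
    · have f₁ := f.2.1 hyx hyk
      right
      have hA : (counting N (4 * N + 2) J).g .even y = above N (4 * N + 2) J .even x := by
        simp only [counting, f₁.1, if_true, f₁.2.1]
      rw [hA]
      refine ⟨by omega, f₁.1, ?_, fun hlt => absurd hlt (lt_irrefl _)⟩
      simp only [recovering, not_lt.2 hyx, hyk.le, if_true, if_false, g₁]
    · left
      have f₁ := f.2.2.2.1 hyk
      simp only [counting, f₁.1, f₁.2, if_false]
    · have f₁ := f.2.2.1 hyk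
      obtain ⟨hyN, hT⟩ := hc.resolve_left (by omega)
      obtain ⟨hpp, hx⟩ := htail hT (by omega)
      have hA : (counting N (4 * N + 2) J).g .even y = 2 * (N - 1 - k) + 4 := by
        simp only [counting, f₁.1, if_true, f₁.2.1]
      right
      refine ⟨by omega, f₁.1, ?_, fun _ => hkeep (by omega) hpp⟩
      rw [hA]
      cases T
      · simp only [recovering, not_lt.2 hyx, not_le.2 hyk, hyN, if_true, if_false, lowPr]
        rw [hx rfl]
      · simp only [recovering, not_lt.2 hyx, not_le.2 hyk, hyN, if_true, if_false, lowPr]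
      · exact absurd rfl hT

theorem counting_low_even (h : SetsEven N v J x k T) (hT : T ≠ .lost) (u : TCVertex N)
    (hu : (counting N (4 * N + 2) J).reg u = 2 * (N - 1 - k) + 4) :
    2 * (N - 1 - k) + 4 ≤ (recovering N (4 * N + 2) (J.filter (· < x)) x k T).reg u := by
  refine le_reg_of_even (by omega) (fun α y hy => ?_) u hu
  have f := h.facts y hy
  obtain ⟨g₁, g₂, g₃, g₄, g₅, g₆, g₇, g₈, g₉, g₁₀⟩ := h.above_x
  have hk := h.lt
  have hxk := h.le
  clear h hu g₉ g₁₀ u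
  simp only [recovering, counting, lowPr, g₁]
  generalize above N (4 * N + 2) (J.filter (· < x)) = M' at *
  generalize above N (4 * N + 2) J = M at *
  generalize J.filter (· < x) = J' at *
  generalize nextLow N J y = n at *
  generalize nextLow N J' y = n' at *
  rcases lt_or_ge y x with hyx | hyx
  · obtain ⟨f, -, -, -, f'⟩ := f
    have f := f hyx
    cases α <;> simp only [hyx, if_true] <;> grind
  rcases lt_trichotomy y k with hyk | hyk | hyk
  · have f₁ := f.2.1 hyx hyk
    clear f
    cases α <;> cases T <;> simp only [not_lt.2 hyx, f₁, hyk.le, if_true, if_false] <;> grind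
  · have f₁ := f.2.2.2.1 hyk
    clear f
    cases α <;> cases T <;> simp only [not_lt.2 hyx, f₁, hyk.le, if_true, if_false] <;> grind
  · have f₁ := f.2.2.1 hyk
    clear f
    cases α <;> cases T <;> simp only [not_lt.2 hyx, f₁, not_le.2 hyk, if_true, if_false] <;> grind

theorem counting_keeps (h : SetsEven N v J k k .settled) :
    (counting N (4 * N + 2) J).Keeps N 2 (lowPr N .even k)
      (recovering N (4 * N + 2) (J.filter (· < k)) k k .settled) := by
  obtain ⟨g₁, g₂, g₃, g₄, g₅, g₆, g₇, g₈, g₉, g₁₀⟩ := h.above_x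
  have hk := h.lt
  clear g₃ g₉ g₁₀
  have key : ∀ α, ∀ y < N,
      ((counting N (4 * N + 2) J).l α y = 2 * (N - 1 - k) + 3 ∧ k ≤ y ∧
        ((recovering N (4 * N + 2) (J.filter (· < k)) k k .settled).l α y % 2 = 0) ∧
        (k = y → α = .even) ∧ (k < y → α = .odd) ∨
      (recovering N (4 * N + 2) (J.filter (· < k)) k k .settled).l α y =
        (counting N (4 * N + 2) J).l α y ∧ (y ≤ k → 2 * (N - 1 - k) + 4 ≤
          (counting N (4 * N + 2) J).l α y) ∧ 2 * (N - 1 - k) + 4 ≤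
          (counting N (4 * N + 2) J).l α y) ∧
      ((counting N (4 * N + 2) J).g α y = 2 ∧ α = .even ∧ y = k ∧
          (recovering N (4 * N + 2) (J.filter (· < k)) k k .settled).g α y % 2 = 0 ∨
        (counting N (4 * N + 2) J).g α y = 2 * (N - 1 - k) + 3 ∧ α = .odd ∧ k ≤ y ∧
          ((recovering N (4 * N + 2) (J.filter (· < k)) k k .settled).g α y = 2 * (N - 1 - k) + 4
            ∧ k < y ∨ y = k ∧
          (recovering N (4 * N + 2) (J.filter (· < k)) k k .settled).g α y = 1) ∨
        (recovering N (4 * N + 2) (J.filter (· < k)) k k .settled).g α y =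
          (counting N (4 * N + 2) J).g α y ∧ 2 * (N - 1 - k) + 4 ≤
          (counting N (4 * N + 2) J).g α y) ∧
      (α = .even → (counting N (4 * N + 2) J).g α y % 2 = 0) ∧
      (α = .odd → (counting N (4 * N + 2) J).g α y % 2 = 1) := by
    intro α y hy
    have f := h.facts y hy
    clear h
    simp only [recovering, counting, lowPr, g₁]
    generalize above N (4 * N + 2) (J.filter (· < k)) = M' at *
    generalize above N (4 * N + 2) J = M at *
    generalize J.filter (· < k) = J' at *
    generalize nextLow N J y = n at *
    generalize nextLow N J' y = n' at *
    rcases lt_trichotomy y k with hyk | hyk | hyk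
    · obtain ⟨f, -, -, -, f'⟩ := f
      have f := f hyk
      cases α <;> simp only [hyk, if_true] <;> grind
    · have f₁ := f.2.2.2.1 hyk
      clear f
      cases α <;> simp only [lt_irrefl, hyk, f₁, le_refl, if_true, if_false] <;> grind
    · have f₁ := f.2.2.1 hyk
      clear f
      cases α <;> simp only [not_lt.2 hyk.le, f₁, not_le.2 hyk, if_true, if_false] <;> grind
  have hz : ∀ α y, (counting N (4 * N + 2) J).z α y = (counting N (4 * N + 2) J).g α y :=
    fun α y => by cases α <;> rfl
  refine keeps_of (fun α y _ => hz α y) (fun α y hy => ?_) (fun α y hy => ?_) (fun α y hy => ?_)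
    fun α γ y hy m hm _ => ?_
  · clear key h
    simp only [recovering]
    cases α <;> simp only [counting]
  · have := (key α y hy).1
    simp only [lowPr]
    omega
  · have := (key α y hy).2.1
    simp only [lowPr]
    omega
  · have h₁ := (key α y hy).2
    have h₂ := (key γ m (by omega)).1
    clear key h hz
    generalize (recovering N (4 * N + 2) (J.filter (· < k)) k k .settled).g α y = c' at *
    generalize (recovering N (4 * N + 2) (J.filter (· < k)) k k .settled).l γ m = d' at *
    generalize (counting N (4 * N + 2) J).g α y = c at *
    generalize (counting N (4 * N + 2) J).l γ m = d at *
    cases α <;> simp only [opp, comb_even, comb_odd, lowPr] <;> grind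

/-- Even sets the lowest unset bit. -/
theorem counting_isPromotion (h : SetsEven N v J x k T) :
    IsPromotion (twoCounters N) v ((counting N (4 * N + 2) J).layout N won)
      ((recovering N (4 * N + 2) (J.filter (· < x)) x k T).layout N won) 2
      (above N (4 * N + 2) J .even k) fun d => v.Recovers ∧ d = lowPr N .even k := by
  obtain ⟨g₁, g₂, g₃, g₄, g₅, g₆, g₇, g₈, g₉, g₁₀⟩ := h.above_x
  have hk := h.lt
  have hkeeps : v.Recovers → (counting N (4 * N + 2) J).Keeps N 2 (lowPr N .even k)
      (recovering N (4 * N + 2) (J.filter (· < x)) x k T) := by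
    intro hv
    obtain ⟨rfl, rfl⟩ := h.recovers hv
    exact counting_keeps h
  refine isPromotion (valid_counting (by omega) le_rfl J) (counting_closed h.lt h.notMem h.low)
    (counting_shifts h) ?_ (by omega) (counting_escape h.lt h.notMem h.low) ?_ (fun u hu => ?_)
    (fun α y hy hc _ => counting_core h α y hy hc) (fun hv α y hy hc => ?_) hkeeps
  · rw [g₃, ofPriority_eq_even.2 g₄]
    rfl
  · refine low_of (L := 2 * (N - 1 - k) + 4) (by omega) (by omega)
      (by simp only [lowPr]; omega) ?_ (fun _ hpp _ _ u hu => ?_) hkeeps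
    · intro _ _ α y hy d hd h₁ h₂ h₃
      have f := h.facts y hy
      have hxk := h.le
      have h₄ : d % 2 = 0 := ofPriority_eq_even.1 (h₃.trans rfl)
      rw [g₃] at h₂
      have n : y < x → above N (4 * N + 2) J .even x ≤ nextLow N J y ∨
          nextLow N J y = 2 * (N - 1 - k) + 4 := by
        intro hyx
        rcases nextLow_spec N J y with ⟨-, h₅⟩ | ⟨m, h₅, h₆, h₇, h₈, h₉⟩
        · exact absurd (h₅ k (by omega) hk) h.notMem
        rcases lt_or_ge m x with hmx | hmx
        · have := (above_facts₂ (N := N) (t := 4 * N + 2) le_rfl J hmx (by omega)).2.2 h₇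
          omega
        · have : m = k := by
            rcases lt_trichotomy m k with h₁₀ | h₁₀ | h₁₀
            · exact absurd (h.mid m hmx h₁₀) h₇
            · exact h₁₀
            · exact absurd (h₉ k (by omega) h₁₀) h.notMem
          omega
      clear h h₃ g₉ g₁₀ hkeeps
      cases α <;> simp only [counting, lowPr] at hd <;> grind
    · by_cases hT : T = .lost
      · exact absurd (h.lost hT).1 hpp
      · exact counting_low_even h hT u hu
  · have := counting_le_reg h u
    omega
  · have f := h.facts y hy
    obtain ⟨rfl, rfl⟩ := h.recovers hv
    clear hkeeps
    clear h
    cases α <;> simp only [recovering, counting, lowPr] <;> grind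

end Labelling

/-! ### The lowest bit of Even settles -/

variable {T' : Tail}

/-- The values of the labels at a bit if Odd sets bit `x` in addition to the higher bits in `J`. -/
theorem insert_facts (ht : t % 2 = 0) (ht' : 4 * N + 2 ≤ t) (hJ : ∀ m ∈ J, m < x) (hx : x < N)
    (y : ℕ) (hy : y < N) :
    (y < x → (y ∈ insert x J ↔ y ∈ J) ∧
      above N t (insert x J) .even y = above N t J .even y ∧
      above N t (insert x J) .odd y = above N t J .odd y ∧
      above N t J .even x ≤ above N t J .even y ∧ above N t J .odd x ≤ above N t J .odd y ∧
      (y ∉ J → above N t J .even x ≤ 2 * (N - 1 - y) + 4 ∧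
        above N t J .odd x ≤ 2 * (N - 1 - y) + 3) ∧
      ((nextLow N J y = 2 * (N - 1 - x) + 4 ∧ nextLow N (insert x J) y < 2 * (N - 1 - x) + 4 ∧
          (nextLow N (insert x J) y = 2 * (N - 1 - (x + 1)) + 4 ∨ x + 1 = N ∧
            nextLow N (insert x J) y = 2)) ∨
        nextLow N (insert x J) y = nextLow N J y ∧ 2 * (N - 1 - x) + 4 < nextLow N J y) ∧
      nextLow N J y % 2 = 0) ∧
    (y = x → y ∈ insert x J ∧ y ∉ J ∧
      above N t (insert x J) .even y = above N t J .even x ∧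
      above N t (insert x J) .odd y = above N t J .odd x) ∧
    (x < y → y ∉ J ∧ y ∉ insert x J ∧ (nextLow N (insert x J) y = 2 ∧ y + 1 = N ∨
      y + 1 < N ∧ nextLow N (insert x J) y = 2 * (N - 1 - (y + 1)) + 4)) ∧
    above N t J .even y % 2 = 0 ∧ above N t J .odd y % 2 = 1 ∧
    2 * (N - y) + 4 ≤ above N t J .even y ∧ 2 * (N - y) + 3 ≤ above N t J .odd y := by
  have hxJ : x ∉ J := fun h => lt_irrefl _ (hJ x h)
  have f₁ := above_facts (N := N) ht ht' J hy
  have hmem : ∀ m, m ∈ insert x J ↔ m = x ∨ m ∈ J := fun m => Finset.mem_insert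
  have hab : ∀ α, ∀ y ≤ x, above N t (insert x J) α y = above N t J α y := fun α y hy =>
    above_congr fun m hm => by rw [hmem]; exact or_iff_right (by omega)
  have n₁ := nextLow_spec N J y
  have n₂ := nextLow_spec N (insert x J) y
  refine ⟨fun hyx => ?_, ?_, fun h₁ => ?_, by omega, by omega, by omega, by omega⟩
  · have f₂ := Labelling.above_facts₂ (N := N) ht' J hyx (by omega)
    refine ⟨by rw [hmem]; exact or_iff_right (by omega), hab _ _ hyx.le, hab _ _ hyx.le, f₂.1,
      f₂.2.1, f₂.2.2, ?_, by clear hmem hab; grind⟩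
    rcases n₁ with ⟨h₁, h₂⟩ | ⟨m, h₁, h₂, h₃, h₄, h₅⟩
    · exact absurd (h₂ x hyx hx) hxJ
    have hm : m ≤ x := by
      by_contra hlt
      exact hxJ (h₅ x hyx (by omega))
    rcases hm.lt_or_eq with hm | rfl
    · right
      rcases n₂ with ⟨h₆, h₇⟩ | ⟨m', h₆, h₇, h₈, h₉, h₁₀⟩
      · rcases (hmem m).1 (h₇ m h₁ h₂) with h₁₁ | h₁₁
        · omega
        · exact absurd h₁₁ h₃
      have : m = m' := by
        rcases lt_trichotomy m m' with h₁₁ | h₁₁ | h₁₁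
        · rcases (hmem m).1 (h₁₀ m h₁ h₁₁) with h₁₂ | h₁₂
          · omega
          · exact absurd h₁₂ h₃
        · exact h₁₁
        · exact absurd ((hmem m').2 (.inr (h₅ m' h₆ h₁₁))) h₈
      omega
    · left
      refine ⟨h₄, ?_⟩
      rcases n₂ with ⟨h₆, h₇⟩ | ⟨m', h₆, h₇, h₈, h₉, h₁₀⟩
      · by_cases hN : m + 1 = N
        · omega
        · rcases (hmem _).1 (h₇ (m + 1) (by omega) (by omega)) with h₁₁ | h₁₁
          · omega
          · have := hJ _ h₁₁
            omega
      · have : m' = m + 1 := by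
          rcases lt_trichotomy m' (m + 1) with h₁₁ | h₁₁ | h₁₁
          · rcases (show m' < m ∨ m' = m by omega) with h₁₂ | h₁₂
            · exact absurd ((hmem _).2 (.inr (h₅ m' h₆ h₁₂))) h₈
            · exact absurd ((hmem _).2 (.inl h₁₂)) h₈
          · exact h₁₁
          · rcases (hmem _).1 (h₁₀ (m + 1) (by omega) h₁₁) with h₁₂ | h₁₂
            · omega
            · have := hJ _ h₁₂
              omega
        subst this
        omega
  · rintro rfl
    exact ⟨(hmem y).2 (.inl rfl), hxJ, hab _ _ le_rfl, hab _ _ le_rfl⟩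
  · have hyJ : ∀ m, x < m → m ∉ insert x J := fun m hm h₂ => by
      rcases (hmem _).1 h₂ with h₃ | h₃
      · omega
      · have := hJ _ h₃
        omega
    refine ⟨fun h₂ => ?_, hyJ y h₁, ?_⟩
    · have := hJ _ h₂
      omega
    rcases n₂ with ⟨h₆, h₇⟩ | ⟨m', h₆, h₇, h₈, h₉, h₁₀⟩
    · by_cases hN : y + 1 = N
      · omega
      · exact absurd (h₇ (y + 1) (by omega) (by omega)) (hyJ _ (by omega))
    · have : m' = y + 1 := by
        by_contra hne
        exact hyJ (y + 1) (by omega) (h₁₀ (y + 1) (by omega) (by omega))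
      omega

namespace Labelling

theorem recovering_pos (ht : t % 2 = 0) (ht' : 4 * N + 2 ≤ t) (hk : k < N) (u : TCVertex N) :
    1 ≤ (recovering N t J x k T).reg u := by
  refine le_reg (fun α y hy => ?_) (by omega) u
  have f := above_facts ht ht' J hy
  by_cases hxN : x < N
  · have fx := above_facts ht ht' J hxN
    have n := nextLow_spec N J y
    cases α <;> cases T <;> simp only [recovering, counting, lowPr] <;> grind
  · have n := nextLow_spec N J y
    cases α <;> cases T <;> simp only [recovering, counting, lowPr] <;> grind

/-- The region of the lowest bit of Even is promoted to that of the current low bit of Odd. -/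
theorem recovering_settle (ht : t % 2 = 0) (ht' : 4 * N + 2 ≤ t) (hJ : ∀ m ∈ J, m < x)
    (hxk : x ≤ k) (hT : T = .stale → x < k) (hk : k + 1 < N) (hTs : T ≠ .settled)
    (hv : ¬ v.Recovers) :
    IsPromotion (twoCounters N) v ((recovering N t J x k T).layout N won)
      ((recovering N t J x k .settled).layout N won) (T.source N k) (T.target N t J x)
      fun d => v.Recovers ∧ d = 0 := by
  have htar : T.target N t J x = 2 * (N - 1 - x) + 4 := by
    cases T
    · exact absurd rfl hTs
    · rfl
    · rfl
  have hsrc : T.source N k = if T = .stale then 2 * (N - 1 - k) + 4 else 2 := by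
    cases T
    · exact absurd rfl hTs
    · rfl
    · rfl
  have hxJ : x ∉ J := fun h => lt_irrefl _ (hJ x h)
  have fx := above_facts ht ht' J (show x < N by omega)
  have fs := fun y (hy : y < N) => insert_facts ht ht' hJ (show x < N by omega) y hy
  refine isPromotion (valid_recovering ht ht' hJ hxk (by omega) hT fun _ => hk)
    (recovering_closed ht ht' hJ hxk (by omega) hT fun _ => hk) ?_
    (Tail.target_parity ht ht' (by omega)) (Tail.target_lt ht ht' (by omega))
    (recovering_escape hJ hxk (by omega) hT fun _ => hk) ?_ (fun u hu => ⟨?_, hv⟩) ?_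
    (fun h => absurd h hv) fun h => absurd h hv
  · intro α y hy
    have f := fs y hy
    rw [htar, hsrc]
    clear fs hJ htar hsrc
    cases α <;> cases T <;> simp only [recovering, counting, lowPr, Shift] <;> grind
  · refine low_of (L := T.source N k) (Tail.target_lt ht ht' (by omega)) ?_ (by omega) ?_
      (fun _ _ h => absurd h (lt_irrefl _)) fun h => absurd h hv
    · rw [hsrc]
      split_ifs <;> omega
    · intro _ _ α y hy d hd h₁ h₂ h₃
      exfalso
      rw [Tail.source_parity hTs, ofPriority_eq_even] at h₃
      rw [htar] at h₂
      rw [hsrc] at h₁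
      have f := fs y hy
      clear fs hJ htar hsrc
      cases α <;> cases T <;> simp only [recovering, counting, lowPr] at hd <;> grind
  · refine le_trans ?_ (recovering_pos ht ht' (by omega) u)
    rcases reg_eq_label (recovering N t J x k T) u with ⟨α, y, hy, h₁⟩ | ⟨α, y, -, h₁, -⟩
    · rw [hsrc] at hu
      have f := fs y hy
      clear fs hJ htar hsrc
      generalize (recovering N t J x k T).reg u = d at *
      cases α <;> cases T <;> simp only [recovering, counting, lowPr] at h₁ <;> grind
    · have := le_highPr (N := N) α y
      rw [hsrc] at hu
      split_ifs at hu <;> omega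
  · intro α y hy hc _
    rw [htar, hsrc]
    have f := fs y hy
    have hc' : y ∈ J ∧ y < x ∨ α = .even ∧ x ≤ y ∧ (y ≤ k ∨ y + 1 = N) := by
      rcases hc with hc | ⟨h₁, h₂, h₃⟩
      · exact .inl ⟨hc, hJ y hc⟩
      · exact .inr ⟨h₁, h₂, h₃.imp_right And.left⟩
    clear fs hJ htar hsrc hc
    cases α <;> cases T <;> simp only [recovering, counting, lowPr] <;> grind

/-! ### Odd recovers or sets a bit -/

theorem recovering_odd_ge (ht : t % 2 = 0) (ht' : 4 * N + 2 ≤ t) (hJ : ∀ m ∈ J, m < x)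
    (hxk : x ≤ k) (hk : k < N) (α : Player) (y : ℕ) (hy : y < N) (d : ℕ)
    (hd : d = (recovering N t J x k .settled).l α y ∨ d = (recovering N t J x k .settled).g α y ∨
      d = (recovering N t J x k .settled).z α y) (h₁ : 1 < d) (h₂ : d < above N t J .odd x)
    (h₃ : ofPriority d = ofPriority 1) : False := by
  have h₄ : d % 2 = 1 := ofPriority_eq_odd.1 (h₃.trans rfl)
  have f := insert_facts ht ht' hJ (show x < N by omega) y hy
  have fx := above_facts ht ht' J (show x < N by omega)
  clear hJ h₃
  cases α <;> simp only [recovering, counting, lowPr] at hd <;> grind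

theorem recovering_core_odd (ht : t % 2 = 0) (ht' : 4 * N + 2 ≤ t) (hJ : ∀ m ∈ J, m < x)
    (hxk : x ≤ k) (hk : k < N) (hdom : 4 * N + 4 ≤ t ∨ (∃ i < x, i ∉ J) ∨ v.Recovers) {α : Player}
    {y : ℕ} (hy : y < N) (hg : (recovering N t J x k .settled).g α y < above N t J .odd x)
    (hg' : (recovering N t J x k .settled).g α y < 4 * N + 4)
    (hc : y ∈ J ∨ α = .even ∧ x ≤ y ∧ y ≤ k) : v.Recovers := by
  have f := insert_facts ht ht' hJ (show x < N by omega) y hy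
  have fx := above_facts ht ht' J (show x < N by omega)
  rcases hdom with h₁ | ⟨i, h₁, h₂⟩ | h₁
  · have h₃ := above_spec (N := N) (t := t) (J := J) .odd x
    have h₄ : above N t J .even x = 2 * (N - 1 - x) + 4 ∨ above N t J .odd x < above N t J .even x := by
      rcases above_spec (N := N) (t := t) (J := J) .even x with ⟨h₅, -⟩ | ⟨i, h₅, h₆, h₇, h₈⟩
      · rw [above_even_zero] at h₅
        omega
      · have := (above_facts₂ (N := N) ht' J h₅ (by omega)).2.2 h₆
        simp only [opp, lowPr] at h₇
        omega
    exfalso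
    have h₅ := hJ y
    clear hJ
    cases α <;> simp only [recovering, counting, lowPr] at hg hg' <;> grind
  · have h₃ := (above_facts₂ (N := N) ht' J h₁ (by omega)).2.2 h₂
    have h₄ : above N t J .odd x < above N t J .even x := by
      rcases above_spec (N := N) (t := t) (J := J) .even x with ⟨h₅, h₆⟩ | ⟨i, h₅, h₆, h₇, h₈⟩
      · exact absurd (h₆ i h₁) h₂
      · have := (above_facts₂ (N := N) ht' J h₅ (by omega)).2.2 h₆
        simp only [opp, lowPr] at h₇
        omega
    exfalso
    have h₅ := hJ y
    clear hJ
    cases α <;> simp only [recovering, counting, lowPr] at hg hg' <;> grind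
  · exact h₁

/-- Odd recovers bit `x`. -/
theorem recovering_recover (ht : t % 2 = 0) (ht' : 4 * N + 2 ≤ t) (hJ : ∀ m ∈ J, m < x)
    (hxk : x < k) (hk : k < N) (hT : T' = .lost ∧ k + 1 < N ∨ T' = .settled ∧ k + 1 = N)
    (hdom : 4 * N + 4 ≤ t ∨ ∃ i < x, i ∉ J)
    (hv : v.Recovers → 4 * N + 4 ≤ t ∧ k + 1 = N ∧ ∀ m < x, m ∈ J) :
    IsPromotion (twoCounters N) v ((recovering N t J x k .settled).layout N won)
      ((recovering N t (insert x J) (x + 1) k T').layout N won) 1 (above N t J .odd x)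
      fun d => v.Recovers ∧ d = lowPr N .odd x := by
  have hxJ : x ∉ J := fun h => lt_irrefl _ (hJ x h)
  have fx := above_facts ht ht' J (show x < N by omega)
  have fs := fun y (hy : y < N) => insert_facts ht ht' hJ (show x < N by omega) y hy
  have hx₁ : above N t (insert x J) .even (x + 1) = above N t J .even x := by
    rw [above, if_pos (Finset.mem_insert_self x J)]
    exact ((fs x (by omega)).2.1 rfl).2.2.1
  have hkeeps : v.Recovers → (recovering N t J x k .settled).Keeps N 1 (lowPr N .odd x)
      (recovering N t (insert x J) (x + 1) k T') := by
    intro h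
    obtain ⟨h₁, h₂, h₃⟩ := hv h
    obtain ⟨h₄, rfl⟩ : k + 1 = N ∧ T' = .settled := by
      rcases hT with hT | hT
      · omega
      · exact ⟨hT.2, hT.1⟩
    have ha : above N t J .even x = t := above_eq (Nat.zero_le x) fun m _ hm => h₃ m hm
    have ha' : ∀ y < x, above N t J .even y = t := fun y hy =>
      above_eq (Nat.zero_le y) fun m _ hm => h₃ m (by omega)
    have ho' : ∀ y < x, above N t J .odd y = 4 * N + 3 := fun y hy =>
      above_eq (Nat.zero_le y) fun m _ hm => h₃ m (by omega)
    have hA : ∀ y < N, (recovering N t J x k .settled).l .even y = t ∧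
        (recovering N t J x k .settled).g .even y = t ∧
        (recovering N t (insert x J) (x + 1) k .settled).l .even y = t ∧
        (recovering N t (insert x J) (x + 1) k .settled).g .even y = t := by
      intro y hy
      have f := fs y hy
      have h₅ := ha' y
      have h₆ := h₃ y
      clear fs hJ hv hdom hT h₃ ha' ho'
      simp only [recovering, counting]
      grind
    have hB : ∀ y < N, (y < x ∧ (recovering N t J x k .settled).l .odd y = 4 * N + 3 ∧
        (recovering N t J x k .settled).g .odd y = 4 * N + 3 ∧
        (recovering N t (insert x J) (x + 1) k .settled).l .odd y = 4 * N + 3 ∧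
        (recovering N t (insert x J) (x + 1) k .settled).g .odd y = 4 * N + 3) ∨
        ((recovering N t J x k .settled).l .odd y = lowPr N .odd x ∧
        ((recovering N t J x k .settled).g .odd y = 1 ∨
          (recovering N t J x k .settled).g .odd y = lowPr N .odd x)) := by
      intro y hy
      have f := fs y hy
      have h₅ := ho' y
      have h₆ := h₃ y
      clear fs hJ hv hdom hT h₃ ha' ho' hA
      simp only [recovering, counting, lowPr]
      grind
    refine keeps_of (fun α y _ => ?_) (fun α y _ => ?_) (fun α y hy => ?_) (fun α y hy => ?_)
      fun α γ y hy m hm => ?_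
    · simp only [recovering, counting]
    · simp only [recovering, counting]
    · have h₅ := hA y hy
      have h₆ := hB y hy
      cases α
      · omega
      · omega
    · have h₅ := hA y hy
      have h₆ := hB y hy
      cases α
      · omega
      · omega
    · have h₅ := hA y hy
      have h₆ := hB y hy
      have h₇ := hA m (by omega)
      have h₈ := hB m (by omega)
      clear fs hJ hv hdom hT h₃ ha' ho' hA hB
      cases α <;> cases γ <;> simp only [opp, comb_even, comb_odd, lowPr] at * <;> grind
  refine isPromotion (valid_recovering ht ht' hJ hxk.le hk (by simp) (by simp))
    (recovering_closed (T := .settled) ht ht' hJ hxk.le hk (by simp) (by simp)) ?_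
    (Tail.target_parity (T := .settled) (k := k) ht ht' (by omega))
    (Tail.target_lt (T := .settled) ht ht' (by omega))
    (recovering_escape (t := t) (T := .settled) hJ hxk.le hk (by simp) (by simp)) ?_ (fun u hu => ?_)
    ?_ ?_ hkeeps
  · intro α y hy
    have f := fs y hy
    clear fs hJ hdom hv hkeeps
    simp only [Tail.source, Tail.target, recovering, counting, lowPr, Shift, hx₁]
    generalize above N t (insert x J) = M' at *
    generalize above N t J = M at *
    generalize nextLow N J y = n at *
    generalize nextLow N (insert x J) y = n' at *
    rcases lt_trichotomy y x with hyx | hyx | hyx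
    · have f₁ := f.1 hyx
      obtain ⟨-, -, -, f₂⟩ := f
      cases α <;> simp only [hyx, Nat.lt_succ_of_lt hyx, if_true] <;> grind
    · have f₁ := f.2.1 hyx
      clear f
      rcases hT with ⟨rfl, -⟩ | ⟨rfl, -⟩ <;> cases α <;>
        simp only [hyx, lt_irrefl, Nat.lt_succ_self, if_true, if_false, hxk.le] <;> grind
    · have f₁ := f.2.2.1 hyx
      clear f
      have h₁ : ¬ y < x + 1 := by omega
      rcases hT with ⟨rfl, -⟩ | ⟨rfl, -⟩ <;> cases α <;>
        simp only [not_lt.2 hyx.le, h₁, hyx.ne', if_false] <;> split_ifs <;> omega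
  · refine low_of (L := 1) (f := 1) (b := lowPr N .odd x) (Tail.target_lt (T := .settled) ht ht' (by omega))
      (by omega) (by simp only [lowPr]; omega) ?_ (fun _ _ h => absurd h (lt_irrefl _)) hkeeps
    intro _ _ α y hy d hd h₁ h₂ h₃
    exact absurd h₃ fun h₃ => recovering_odd_ge ht ht' hJ hxk.le hk α y hy d hd h₁ h₂ h₃
  · have := recovering_pos (x := x) (J := J) (T := .settled) ht ht' hk u
    change _ < 1 at hu
    omega
  · intro α y hy hc hlt
    have f := fs y hy
    have hc' : y ∈ J ∧ y < x ∨ y = x ∨ α = .even ∧ x < y ∧ y ≤ k := by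
      rcases hc with hc | ⟨h₁, h₂, h₃⟩
      · rcases Finset.mem_insert.1 hc with rfl | hc
        · exact .inr (.inl rfl)
        · exact .inl ⟨hc, hJ y hc⟩
      · refine .inr (.inr ⟨h₁, h₂, ?_⟩)
        rcases h₃ with h₃ | ⟨h₃, h₄⟩
        · exact h₃
        · rcases hT with hT | hT
          · exact absurd hT.1 h₄
          · omega
    by_cases hox : y = x ∧ α = .odd
    · obtain ⟨rfl, rfl⟩ := hox
      left
      simp only [recovering, lt_irrefl, if_false, if_true, Tail.source]
    have hc₂ : y ∈ J ∨ α = .even ∧ x ≤ y ∧ y ≤ k := by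
      rcases hc' with h | h | h
      · exact .inl h.1
      · refine .inr ⟨?_, by omega, by omega⟩
        cases α
        · rfl
        · exact absurd ⟨h, rfl⟩ hox
      · exact .inr ⟨h.1, by omega, h.2.2⟩
    right
    refine ⟨?_, ?_, ?_, fun hq => (recovering_core_odd (v := v) ht ht' hJ hxk.le hk
      (hdom.imp_right .inl) hy hq hlt hc₂).not_resets _ _⟩
    · clear fs hJ hdom hv hkeeps hT hc hc'
      simp only [recovering, counting, lowPr, Tail.source] at *
      cases α <;> grind
    · exact hc₂.imp_right fun h => ⟨h.1, h.2.1, .inl h.2.2⟩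
    · clear fs hJ hdom hv hkeeps hT hc
      simp only [recovering, counting, lowPr, hx₁] at *
      cases α <;> grind
  · intro h α y hy hc
    have f := fs y hy
    obtain ⟨h₁, h₂, h₃⟩ := hv h
    obtain ⟨h₄, rfl⟩ : k + 1 = N ∧ T' = .settled := by
      rcases hT with hT | hT
      · omega
      · exact ⟨hT.2, hT.1⟩
    clear fs hJ hdom hv hkeeps hT hc h₃
    simp only [recovering, counting, lowPr, hx₁] at *
    cases α <;> grind

/-- Odd sets bit `k`, and then both counters show the same bits. -/
theorem recovering_complete (ht : t % 2 = 0) (ht' : 4 * N + 2 ≤ t) (hJ : ∀ m ∈ J, m < k)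
    (hk : k < N) (hdom : 4 * N + 4 ≤ t ∨ (∃ i < k, i ∉ J) ∨ v.Recovers) :
    IsPromotion (twoCounters N) v ((recovering N t J k k .settled).layout N won)
      ((counting N t (insert k J)).layout N won) 1 (above N t J .odd k)
      fun d => v.Recovers ∧ d = lowPr N .odd k := by
  have hkJ : k ∉ J := fun h => lt_irrefl _ (hJ k h)
  have fk := above_facts ht ht' J hk
  have fs := fun y (hy : y < N) => insert_facts ht ht' hJ hk y hy
  have hz : ∀ α y, (counting N t (insert k J)).z α y = (counting N t (insert k J)).g α y :=
    fun α y => by cases α <;> rfl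
  have hz' : ∀ α y, (recovering N t J k k .settled).z α y =
      (recovering N t J k k .settled).g α y := fun α y => by
    simp only [recovering, counting]
  have key : ∀ α, ∀ y < N,
      ((counting N t (insert k J)).l α y = (recovering N t J k k .settled).l α y ∨
        (recovering N t J k k .settled).l α y = 2 * (N - 1 - k) + 4) ∧
      2 * (N - 1 - k) + 4 ≤ (recovering N t J k k .settled).l α y ∧
      ((counting N t (insert k J)).g α y = (recovering N t J k k .settled).g α y ∨
        (recovering N t J k k .settled).g α y = 2 * (N - 1 - k) + 4 ∨
        (recovering N t J k k .settled).g α y = 1) ∧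
      ((recovering N t J k k .settled).g α y = 1 ∨
        2 * (N - 1 - k) + 4 ≤ (recovering N t J k k .settled).g α y) := by
    intro α y hy
    have f := fs y hy
    clear fs hJ hdom hz hz'
    simp only [recovering, counting, lowPr]
    cases α <;> grind
  have hpar : ∀ y < N, (recovering N t J k k .settled).g .even y % 2 = 0 ∧
      (counting N t (insert k J)).g .even y % 2 = 0 ∧
      (((recovering N t J k k .settled).g .odd y % 2 = 1 ∧ y ≤ k ∧
      (counting N t (insert k J)).g .odd y % 2 = 1) ∨
      k < y ∧ (counting N t (insert k J)).g .odd y % 2 = 1 ∧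
        (recovering N t J k k .settled).g .odd y = 2 * (N - 1 - k) + 4) := by
    intro y hy
    have f := fs y hy
    clear fs hJ hdom hz hz' key
    simp only [recovering, counting, lowPr]
    grind
  have hkeeps : (recovering N t J k k .settled).Keeps N 1 (lowPr N .odd k)
      (counting N t (insert k J)) := by
    refine keeps_of (fun α y _ => hz' α y) (fun α y _ => hz α y) (fun α y hy => ?_)
      (fun α y hy => ?_) fun α γ y hy m hm _ => ?_
    · have := key α y hy
      simp only [lowPr]
      omega
    · have := key α y hy
      simp only [lowPr]
      omega
    · have h₁ := key α y hy
      have h₂ := key γ m (by omega)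
      have h₃ := hpar y hy
      have f := fs m (by omega)
      have h₄ : m < k → (recovering N t J k k .settled).l γ m =
          (counting N t (insert k J)).l γ m := by
        intro h
        clear key hJ fs hdom hz hz' hpar h₁ h₂ h₃
        simp only [recovering, counting, h, if_true]
        cases γ <;> grind
      have h₅ : k ≤ m → (recovering N t J k k .settled).l γ m = 2 * (N - 1 - k) + 4 ∨
          m = k ∧ γ = .even ∧ (recovering N t J k k .settled).l γ m =
          (counting N t (insert k J)).l γ m := by
        intro h
        clear key hJ fs hdom hz hz' hpar h₁ h₂ h₃ h₄
        simp only [recovering, counting, lowPr]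
        cases γ <;> grind
      clear key hJ fs hdom hz hz' hpar f
      generalize (recovering N t J k k .settled).l γ m = d at *
      generalize (counting N t (insert k J)).l γ m = d' at *
      cases α
      · generalize (recovering N t J k k .settled).g .even y = c at *
        generalize (counting N t (insert k J)).g .even y = c' at *
        simp only [opp, comb_odd, lowPr]
        grind
      · generalize (recovering N t J k k .settled).g .odd y = c at *
        generalize (counting N t (insert k J)).g .odd y = c' at *
        simp only [opp, comb_even, lowPr]
        grind
  refine isPromotion (valid_recovering ht ht' hJ le_rfl hk (by simp) (by simp))
    (recovering_closed (T := .settled) ht ht' hJ le_rfl hk (by simp) (by simp)) ?_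
    (Tail.target_parity (T := .settled) (k := k) ht ht' hk)
    (Tail.target_lt (T := .settled) ht ht' hk)
    (recovering_escape (t := t) (T := .settled) hJ le_rfl hk (by simp) (by simp)) ?_ (fun u hu => ?_)
    ?_ ?_ fun _ => hkeeps
  · intro α y hy
    have f := fs y hy
    clear fs hJ hdom hkeeps key hpar hz hz'
    simp only [Tail.source, Tail.target, recovering, counting, lowPr, Shift]
    generalize above N t (insert k J) = M' at *
    generalize above N t J = M at *
    generalize nextLow N J y = n at *
    generalize nextLow N (insert k J) y = n' at *
    rcases lt_trichotomy y k with hyx | hyx | hyx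
    · have f₁ := f.1 hyx
      obtain ⟨-, -, -, f₂⟩ := f
      cases α <;> simp only [hyx, if_true] <;> grind
    · have f₁ := f.2.1 hyx
      clear f
      subst hyx
      cases α <;> simp only [f₁, lt_irrefl, le_refl, if_true, if_false] <;> grind
    · have f₁ := f.2.2.1 hyx
      clear f
      cases α <;> simp only [f₁, not_lt.2 hyx.le, not_le.2 hyx, hyx.ne', if_false] <;> grind
  · refine low_of (L := 1) (f := 1) (b := lowPr N .odd k) (Tail.target_lt (T := .settled) ht ht' hk)
      (by omega) (by simp only [lowPr]; omega) ?_ (fun _ _ h => absurd h (lt_irrefl _)) fun _ => hkeeps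
    intro _ _ α y hy d hd h₁ h₂ h₃
    exact absurd h₃ fun h₃ => recovering_odd_ge ht ht' hJ le_rfl hk α y hy d hd h₁ h₂ h₃
  · have := recovering_pos (x := k) (J := J) (T := .settled) ht ht' hk u
    change _ < 1 at hu
    omega
  · intro α y hy hc hlt
    have f := fs y hy
    have hc' : y ∈ J ∧ y < k ∨ y = k := by
      rcases Finset.mem_insert.1 hc with rfl | hc
      · exact .inr rfl
      · exact .inl ⟨hc, hJ y hc⟩
    by_cases hox : y = k ∧ α = .odd
    · obtain ⟨rfl, rfl⟩ := hox
      left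
      simp only [recovering, lt_irrefl, if_false, if_true, Tail.source]
    have hc₂ : y ∈ J ∨ α = .even ∧ k ≤ y ∧ y ≤ k := by
      rcases hc' with h | h
      · exact .inl h.1
      · refine .inr ⟨?_, by omega, by omega⟩
        cases α
        · rfl
        · exact absurd ⟨h, rfl⟩ hox
    right
    refine ⟨?_, ?_, ?_, fun hq => (recovering_core_odd (v := v) ht ht' hJ le_rfl hk
      hdom hy hq hlt hc₂).not_resets _ _⟩
    · clear fs hJ hdom hkeeps hc key hpar hz hz'
      simp only [recovering, counting, lowPr, Tail.source] at *
      cases α <;> grind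
    · exact hc₂.imp_right fun h => ⟨h.1, h.2.1, .inl h.2.2⟩
    · clear fs hJ hdom hkeeps hc key hpar hz hz'
      simp only [recovering, counting, lowPr] at *
      cases α <;> grind
  · intro h α y hy hc
    have f := fs y hy
    have hc' : y < k ∨ y = k := by
      rcases Finset.mem_insert.1 hc with rfl | hc
      · exact .inr rfl
      · exact .inl (hJ y hc)
    clear fs hJ hdom hkeeps key hpar hz hz'
    change y ∈ insert k J at hc
    simp only [recovering, counting, lowPr] at *
    cases α <;> grind

/-! ### Promotions to the highest regions -/

theorem above_range (t : ℕ) (α : Player) {y : ℕ} (hy : y ≤ x) :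
    above N t (Finset.range x) α y = above N t (Finset.range x) α 0 :=
  above_eq (Nat.zero_le y) fun m _ hm => Finset.mem_range.2 (by omega)

theorem recovering_range_facts (t : ℕ) (α : Player) (y : ℕ) :
    (recovering N t (Finset.range x) x k .settled).l α y = (match α with
      | .even => if y ≤ k ∨ y < x then t else lowPr N .odd x
      | .odd => if y < x then 4 * N + 3 else lowPr N .odd x) ∧
    (recovering N t (Finset.range x) x k .settled).g α y = (match α with
      | .even => if y ≤ k ∨ y < x then t else lowPr N .odd x
      | .odd => if y < x then 4 * N + 3 else if y = x then 1 else lowPr N .odd x) ∧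
    (recovering N t (Finset.range x) x k .settled).z α y = (match α with
      | .even => if y ≤ k ∨ y < x then t else lowPr N .odd x
      | .odd => if y < x then 4 * N + 3 else if y = x then 1 else lowPr N .odd x) := by
  have h₁ : y < x → above N t (Finset.range x) α y = above N t (Finset.range x) α 0 :=
    fun h => above_range t α h.le
  have h₂ := above_range (N := N) (x := x) t .even le_rfl
  have h₃ : y ∈ Finset.range x ↔ y < x := Finset.mem_range
  rw [above_even_zero] at h₂
  cases α
  · rw [above_even_zero] at h₁
    simp only [recovering, counting, h₂, h₃]
    grind
  · rw [above_odd_zero] at h₁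
    simp only [recovering, counting, h₂, h₃]
    grind

theorem counting_range_facts (t : ℕ) (α : Player) {y : ℕ} (hy : y < N) :
    ((counting N t (Finset.range x)).l α y = (match α with
      | .even => if y < x then t else lowPr N .even y
      | .odd => if y < x then 4 * N + 3 else lowPr N .odd y)) ∧
    ((counting N t (Finset.range x)).g α y = (match α with
      | .even => if y < x then t else if y + 1 = N then 2 else lowPr N .odd (y + 1)
      | .odd => if y < x then 4 * N + 3 else lowPr N .even y)) ∧
    ((counting N t (Finset.range x)).z α y = (counting N t (Finset.range x)).g α y) := by
  have h₁ : y < x → above N t (Finset.range x) α y = above N t (Finset.range x) α 0 :=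
    fun h => above_range t α h.le
  have h₃ : y ∈ Finset.range x ↔ y < x := Finset.mem_range
  have n : x ≤ y → nextLow N (Finset.range x) y =
      if y + 1 = N then 2 else lowPr N .odd (y + 1) := by
    intro hxy
    rcases nextLow_spec N (Finset.range x) y with ⟨h₂, h₄⟩ | ⟨m, h₂, h₄, h₅, h₆, h₇⟩
    · by_cases hN : y + 1 = N
      · rw [if_pos hN, h₂]
      · have := Finset.mem_range.1 (h₄ (y + 1) (by omega) (by omega))
        omega
    · have : m = y + 1 := by
        by_contra hne
        have := Finset.mem_range.1 (h₇ (y + 1) (by omega) (by omega))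
        omega
      subst this
      rw [if_neg (by omega), h₆]
      rfl
  refine ⟨?_, ?_, by cases α <;> rfl⟩ <;> simp only [counting, h₃] <;> cases α <;>
    simp only [above_even_zero, above_odd_zero] at h₁ ⊢ <;> grind

theorem raising_low {A' : Labelling} {f q : ℕ} (hq : q < 4 * N + 4) (hf : f < 2 * N + 4)
    (A : Labelling) (hv : ¬ v.Recovers)
    (h : ∀ α, ∀ y < N, ∀ d, d = A.l α y ∨ d = A.g α y ∨ d = A.z α y →
      f < d → d < q → d % 2 = f % 2 → False) (u : TCVertex N) (h₁ : f < A.reg u)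
    (h₂ : A.reg u < q) :
    v.Resets (ofPriority f) (A.reg u) ∨ A.reg u ≤ A'.reg u ∨ (v.Recovers ∧ A.reg u = 0) := by
  refine low_of (L := f) hq hf (by omega) (fun _ _ α y hy d hd h₁ h₂ h₃ => ?_)
    (fun _ _ h => absurd h (lt_irrefl _)) (fun h => absurd h hv) u h₁ h₂
  refine (h α y hy d hd h₁ h₂ ?_).elim
  simp only [ofPriority] at h₃
  split_ifs at h₃ <;> omega

/-- If all bits above `k` are set, then Odd sets bit `k` by a promotion to its highest region,
and this resets the highest region of Even. -/
theorem recovering_raise (hk : k + 1 < N) (hv : ¬ v.Recovers) :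
    IsPromotion (twoCounters N) v
      ((recovering N (4 * N + 2) (Finset.range k) k k .settled).layout N won)
      ((raising N 0 k).layout N won) 1 (4 * N + 3) fun d => v.Recovers ∧ d = 0 := by
  have hJ : ∀ m ∈ Finset.range k, m < k := fun m hm => Finset.mem_range.1 hm
  have F := recovering_range_facts (N := N) (x := k) (k := k) (4 * N + 2)
  have hq : Tail.target N (4 * N + 2) (Finset.range k) k .settled = 4 * N + 3 :=
    above_range (4 * N + 2) .odd le_rfl
  have hcl := recovering_closed (t := 4 * N + 2) (T := .settled) (by omega) le_rfl hJ le_rfl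
    (show k < N by omega) (by simp) (by simp)
  have hesc := recovering_escape (t := 4 * N + 2) (T := .settled) hJ le_rfl
    (show k < N by omega) (by simp) (by simp)
  rw [hq] at hcl hesc
  refine isPromotion (valid_recovering (t := 4 * N + 2) (by omega) le_rfl hJ le_rfl
    (show k < N by omega) (by simp) (by simp)) hcl ?_ ?_ (by omega) hesc ?_ (fun u hu => ?_) ?_
    (fun h => absurd h hv) fun h => absurd h hv
  · intro α y hy
    obtain ⟨F₁, F₂, F₃⟩ := F α y
    rw [F₁, F₂, F₃]
    clear F F₁ F₂ F₃ hJ hq hcl hesc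
    cases α <;> simp only [raising, lowPr, Shift, Tail.source] <;> split_ifs <;> omega
  · rw [ofPriority_eq_odd.2 (show (4 * N + 3) % 2 = 1 by omega)]
    rfl
  · refine raising_low (f := 1) (by omega) (by omega) _ hv fun α y hy d hd h₁ h₂ h₃ => ?_
    obtain ⟨F₁, F₂, F₃⟩ := F α y
    rw [F₁, F₂, F₃] at hd
    clear F F₁ F₂ F₃ hJ hq hcl hesc
    cases α <;> simp only [lowPr] at hd <;> grind
  · have := recovering_pos (x := k) (J := Finset.range k) (T := .settled) (t := 4 * N + 2)
      (by omega) le_rfl (show k < N by omega) u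
    change _ < 1 at hu
    omega
  · intro α y hy hc hlt
    obtain ⟨F₁, F₂, F₃⟩ := F α y
    rw [F₂] at hlt ⊢
    clear F F₁ F₂ F₃ hJ hq hcl hesc
    simp only [raising, recovering, Tail.source, Finset.mem_range] at *
    cases α <;> grind

theorem raising_le_reg (hxk : x ≤ k) (hk : k + 1 < N) (u : TCVertex N) :
    2 ≤ (raising N x k).reg u := by
  refine le_reg (fun α y hy => ?_) (by omega) u
  cases α <;> simp only [raising, lowPr] <;> grind

/-- Even recovers bit `x`. -/
theorem raising_raise (hxk : x < k) (hk : k + 1 < N) (hv : ¬ v.Recovers) :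
    IsPromotion (twoCounters N) v ((raising N x k).layout N won)
      ((raising N (x + 1) k).layout N won) 2 (4 * N + 2) fun d => v.Recovers ∧ d = 0 := by
  refine isPromotion (valid_raising hxk.le hk) (raising_closed hxk.le hk) ?_ ?_ (by omega)
    (raising_escape hxk.le hk) ?_ (fun u hu => ?_) ?_ (fun h => absurd h hv) fun h => absurd h hv
  · intro α y hy
    cases α <;> simp only [raising, lowPr, Shift] <;> split_ifs <;> omega
  · rw [ofPriority_eq_even.2 (show (4 * N + 2) % 2 = 0 by omega)]
    rfl
  · refine raising_low (f := 2) (by omega) (by omega) _ hv fun α y hy d hd h₁ h₂ h₃ => ?_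
    cases α <;> simp only [raising, lowPr] at hd <;> grind
  · have := raising_le_reg hxk.le hk u
    omega
  · intro α y hy hc hlt
    cases α <;> simp only [raising] at * <;> grind

/-- Even recovers bit `k`, and then both counters show the same bits. -/
theorem raising_complete (hk : k + 1 < N) (hv : ¬ v.Recovers) :
    IsPromotion (twoCounters N) v ((raising N k k).layout N won)
      ((counting N (4 * N + 2) (Finset.range (k + 1))).layout N won) 2 (4 * N + 2)
      fun d => v.Recovers ∧ d = 0 := by
  have F := fun α y (hy : y < N) => counting_range_facts (N := N) (x := k + 1) (4 * N + 2) α hy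
  refine isPromotion (valid_raising le_rfl hk) (raising_closed le_rfl hk) ?_ ?_ (by omega)
    (raising_escape le_rfl hk) ?_ (fun u hu => ?_) ?_ (fun h => absurd h hv) fun h => absurd h hv
  · intro α y hy
    obtain ⟨F₁, F₂, F₃⟩ := F α y hy
    rw [F₃, F₁, F₂]
    clear F F₁ F₂ F₃
    cases α <;> simp only [raising, lowPr, Shift] <;> split_ifs <;> omega
  · rw [ofPriority_eq_even.2 (show (4 * N + 2) % 2 = 0 by omega)]
    rfl
  · refine raising_low (f := 2) (by omega) (by omega) _ hv fun α y hy d hd h₁ h₂ h₃ => ?_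
    cases α <;> simp only [raising, lowPr] at hd <;> grind
  · have := raising_le_reg le_rfl hk u
    omega
  · intro α y hy hc hlt
    obtain ⟨F₁, F₂, F₃⟩ := F α y hy
    rw [F₂]
    clear F F₁ F₂ F₃
    simp only [counting, Finset.mem_range] at hc
    cases α <;> simp only [raising] at * <;> grind

end Labelling

end Transitions

/-! ### The two dominions -/

section Dominions

open Player

variable {N x : ℕ} {won : Player → Finset (TCVertex N)}

/-- The vertices in the dominion of Even. -/
def TCVertex.EvenWins : TCVertex N → Prop
  | .l α _ | .h α _ | .t α _ | .z α _ | .s α _ _ | .a α _ _ => α = .even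
  | .b α _ _ => α = .odd

theorem TCVertex.evenWins_chain {α : Player} {y : Fin N} {i : ℕ} :
    (TCVertex.chain α y i).EvenWins ↔ α = .even := by
  unfold TCVertex.chain
  split_ifs <;> exact Iff.rfl

theorem TCVertex.exists_evenWins {u : TCVertex N} (hu : u.EvenWins)
    (ho : (twoCounters N).owner u = .even) : ∃ w ∈ (twoCounters N).succ u, w.EvenWins := by
  cases u with
  | b α y i => exact ⟨_, mem_succ_b.2 (.inr rfl), by cases hu; rfl⟩
  | z α y => exact ⟨_, mem_succ_z.2 (.inl rfl), hu⟩
  | s α y i => exact ⟨_, mem_succ_s.2 (.inl rfl), hu⟩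
  | _ => cases hu; cases ho

/-- The loser of a vertex cannot leave the winning region of the other player. -/
theorem TCVertex.evenWins_of_mem_succ {u w : TCVertex N}
    (h : u.EvenWins ∧ (twoCounters N).owner u ≠ .even ∨
      ¬ u.EvenWins ∧ (twoCounters N).owner u = .even)
    (hw : w ∈ (twoCounters N).succ u) : w.EvenWins ↔ u.EvenWins := by
  cases u with
  | l α y => rw [mem_succ_l.1 hw]; rfl
  | h α y => rw [mem_succ_h.1 hw]; rfl
  | t α y =>
    rcases mem_succ_t.1 hw with rfl | rfl <;> first | exact Iff.rfl | exact TCVertex.evenWins_chain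
  | a α y i =>
    rcases mem_succ_a.1 hw with rfl | rfl <;> first | exact Iff.rfl | exact TCVertex.evenWins_chain
  | b α y i => cases α <;> simp [TCVertex.EvenWins, owner_b, opp] at h
  | _ α y => exfalso; cases α <;> simp [TCVertex.EvenWins, owner_z, owner_s] at h

theorem TCVertex.exists_not_evenWins {u : TCVertex N} (hu : ¬ u.EvenWins)
    (ho : (twoCounters N).owner u ≠ .even) : ∃ w ∈ (twoCounters N).succ u, ¬ w.EvenWins := by
  cases u with
  | z α y => exact ⟨_, mem_succ_z.2 (.inl rfl), hu⟩
  | s α y i => exact ⟨_, mem_succ_s.2 (.inl rfl), hu⟩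
  | b α y i =>
    cases α
    · exact ⟨_, mem_succ_b.2 (.inr rfl), by simp [TCVertex.EvenWins, opp]⟩
    · exact absurd rfl hu
  | _ α => cases α <;> first | exact absurd rfl hu | exact absurd rfl ho

namespace Labelling

theorem recovering_last_facts (t x : ℕ) (y : ℕ) (hy : y < N) (i : ℕ) :
    (recovering N t (Finset.range x) x (N - 1) .settled).l .even y = t ∧
    (recovering N t (Finset.range x) x (N - 1) .settled).g .even y = t ∧
    (recovering N t (Finset.range x) x (N - 1) .settled).z .even y = t ∧
    (recovering N t (Finset.range x) x (N - 1) .settled).c .even y i = t ∧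
    (recovering N t (Finset.range x) x (N - 1) .settled).l .odd y =
      (if y < x then 4 * N + 3 else lowPr N .odd x) ∧
    (recovering N t (Finset.range x) x (N - 1) .settled).g .odd y =
      (if y < x then 4 * N + 3 else if y = x then 1 else lowPr N .odd x) ∧
    (recovering N t (Finset.range x) x (N - 1) .settled).z .odd y =
      (if y < x then 4 * N + 3 else if y = x then 1 else lowPr N .odd x) ∧
    (recovering N t (Finset.range x) x (N - 1) .settled).c .odd y i =
      (if y < x then 4 * N + 3 else if y = x then 1 else lowPr N .odd x) := by
  have h := fun α => recovering_range_facts (N := N) (x := x) (k := N - 1) t α y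
  have h₁ := h .even
  have h₂ := h .odd
  have hyN : y ≤ N - 1 := by omega
  simp only [hyN, true_or, if_true] at h₁
  simp only at h₂
  obtain ⟨h₁, h₃, h₄⟩ := h₁
  obtain ⟨h₂, h₅, h₆⟩ := h₂
  refine ⟨h₁, h₃, h₄, ?_, h₂, h₅, h₆, ?_⟩ <;> unfold c <;> split_ifs <;> simp_all

theorem recovering_last_reg (ht : t = 4 * N + 2 ∧ x + 1 = N ∨ t = 4 * N + 4) (hx : x < N)
    (u : TCVertex N) :
    ((recovering N t (Finset.range x) x (N - 1) .settled).reg u = t ↔ u.EvenWins) ∧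
    (¬ u.EvenWins → (recovering N t (Finset.range x) x (N - 1) .settled).reg u < 4 * N + 4) := by
  have F := recovering_last_facts (N := N) t x
  have ho : 3 ≤ lowPr N .odd x ∧ lowPr N .odd x ≤ 2 * N + 2 ∧ lowPr N .odd x % 2 = 0 := by
    simp only [lowPr]
    omega
  have hne : (Player.odd = Player.even) = False := by simp
  have hne' : (Player.even = Player.odd) = False := by simp
  cases u with
  | l α y =>
    have f := F y y.isLt 0
    cases α <;> simp only [reg, TCVertex.EvenWins, hne, f] <;> grind
  | h α y =>
    have f := F _ (TCVertex.next y).isLt 0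
    have := y.isLt
    cases α <;> simp only [reg, TCVertex.EvenWins, hne, f, highPr] <;> grind
  | t α y =>
    have f := F y y.isLt 0
    cases α <;> simp only [reg, TCVertex.EvenWins, hne, f] <;> grind
  | z α y =>
    have f := F y y.isLt 0
    cases α <;> simp only [reg, TCVertex.EvenWins, hne, f] <;> grind
  | s α y i =>
    have f := F y y.isLt 0
    cases α <;> simp only [reg, TCVertex.EvenWins, hne, f] <;> grind
  | a α y i =>
    have f := F y y.isLt (i + 1)
    have f' := F i (i.isLt.trans y.isLt) 0
    have := y.isLt
    have := i.isLt
    cases α <;> simp only [reg, TCVertex.EvenWins, hne, f, f', opp, comb_even, comb_odd] <;> grind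
  | b α y i =>
    have f := F y y.isLt (i + 1)
    have f' := F i (i.isLt.trans y.isLt) 0
    have := y.isLt
    have := i.isLt
    cases α <;> simp only [reg, TCVertex.EvenWins, hne, hne', f, f', opp, comb_even, comb_odd] <;>
      grind

/-- The labels after the dominion of Even has been removed, when Odd has recovered its bits above
`x`. -/
noncomputable def remaining (N x : ℕ) : Labelling :=
  recovering N (4 * N + 4) (Finset.range x) x (N - 1) .settled

theorem mem_alive_remaining (hx : x < N) {u : TCVertex N} :
    u ∈ ((remaining N x).layout N won).alive ↔ ¬ u.EvenWins := by
  obtain ⟨h₁, h₂⟩ := recovering_last_reg (t := 4 * N + 4) (.inr rfl) hx u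
  rw [mem_alive]
  change (recovering N _ _ x (N - 1) .settled).reg u < _ ↔ _
  by_cases hu : u.EvenWins
  · simp [h₁.2 hu, hu]
  · simp [hu, h₂ hu]

/-- The labels when Even has set all bits and Odd all bits but the lowest one. -/
noncomputable def dominating (N : ℕ) : Labelling :=
  recovering N (4 * N + 2) (Finset.range (N - 1)) (N - 1) (N - 1) .settled

theorem dominating_reg (hN : 1 ≤ N) (u : TCVertex N) :
    ((dominating N).reg u = 4 * N + 2 ↔ u.EvenWins) ∧ (dominating N).reg u < 4 * N + 4 := by
  obtain ⟨h₁, h₂⟩ := recovering_last_reg (N := N) (t := 4 * N + 2) (x := N - 1)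
    (.inl ⟨rfl, by omega⟩) (by omega) u
  refine ⟨h₁, ?_⟩
  by_cases hu : u.EvenWins
  · have := h₁.2 hu
    change (recovering N _ _ (N - 1) (N - 1) .settled).reg u < _
    omega
  · exact h₂ hu

theorem mem_alive_dominating (hN : 1 ≤ N) (u : TCVertex N) :
    u ∈ ((dominating N).layout N won).alive := mem_alive.2 (dominating_reg hN u).2

theorem dominating_isDominion (hN : 1 ≤ N) :
    IsDominion (twoCounters N) ((dominating N).layout N won) (4 * N + 2) := by
  have hreg : ∀ u : TCVertex N, ((dominating N).layout N won).reg u = 4 * N + 2 ↔ u.EvenWins :=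
    fun u => (dominating_reg hN u).1
  have hal := mem_alive_dominating (won := won) hN
  have hp : ofPriority (4 * N + 2) = .even := ofPriority_eq_even.2 (by omega)
  refine ⟨⟨.l .even ⟨0, hN⟩, hal _, (hreg _).2 rfl⟩, fun u _ hu ho => ?_,
    fun u _ hu ho w hw _ => ?_, fun u _ hu ho w hw _ => ?_, fun u _ hu ho => ?_⟩ <;>
  rw [hp] at ho <;> simp only [ne_eq, hreg, hal, true_and] at hu ⊢
  · exact TCVertex.exists_evenWins hu ho
  · exact (TCVertex.evenWins_of_mem_succ (.inl ⟨hu, ho⟩) hw).2 hu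
  · exact fun h => hu ((TCVertex.evenWins_of_mem_succ (.inr ⟨hu, ho⟩) hw).1 h)
  · exact TCVertex.exists_not_evenWins hu ho

/-- The labels when Odd has set all bits as well. -/
noncomputable def solved (N : ℕ) : Labelling := counting N (4 * N + 4) (Finset.range N)

theorem solved_facts (α : Player) {y : ℕ} (hy : y < N) (i : ℕ) :
    (solved N).l α y = (if α = .even then 4 * N + 4 else 4 * N + 3) ∧
    (solved N).g α y = (if α = .even then 4 * N + 4 else 4 * N + 3) ∧
    (solved N).z α y = (if α = .even then 4 * N + 4 else 4 * N + 3) ∧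
    (solved N).c α y i = (if α = .even then 4 * N + 4 else 4 * N + 3) := by
  obtain ⟨h₁, h₂, h₃⟩ := counting_range_facts (N := N) (x := N) (4 * N + 4) α hy
  rw [h₂] at h₃
  have h₄ : (solved N).l α y = (if α = .even then 4 * N + 4 else 4 * N + 3) := by
    refine h₁.trans ?_
    cases α <;> simp [hy]
  have h₅ : (solved N).g α y = (if α = .even then 4 * N + 4 else 4 * N + 3) := by
    refine h₂.trans ?_
    cases α <;> simp [hy]
  have h₆ : (solved N).z α y = (if α = .even then 4 * N + 4 else 4 * N + 3) := by
    refine h₃.trans ?_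
    cases α <;> simp [hy]
  refine ⟨h₄, h₅, h₆, ?_⟩
  unfold c
  split_ifs at * <;> assumption

theorem solved_reg (u : TCVertex N) (hu : (solved N).reg u < 4 * N + 4) :
    (solved N).reg u = 4 * N + 3 := by
  rcases reg_eq_label (solved N) u with ⟨α, y, hy, h₁⟩ | ⟨α, y, -, h₁, h₂⟩
  · obtain ⟨f₁, f₂, f₃, -⟩ := solved_facts α hy 0
    rw [f₁, f₂, f₃] at h₁
    split_ifs at h₁ <;> omega
  · obtain ⟨f₁, -⟩ := solved_facts α (TCVertex.next y).isLt 0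
    have := y.isLt
    rw [f₁] at h₂
    cases α <;> simp [highPr] at h₂ <;> omega

theorem solved_isDominion (hN : 1 ≤ N) :
    IsDominion (twoCounters N) ((solved N).layout N won) (4 * N + 3) := by
  have hv : (solved N).Valid N := valid_counting (by omega) (by omega) _
  have hreg : ∀ u ∈ ((solved N).layout N won).alive,
      ((solved N).layout N won).reg u = 4 * N + 3 := fun u hu => solved_reg u (mem_alive.1 hu)
  refine ⟨⟨.l .odd ⟨0, hN⟩, ?_, ?_⟩, fun u hu he _ => ?_, fun u hu he _ w _ hwa => hreg w hwa,
    fun u hu he => absurd (hreg u hu) he, fun u hu he => absurd (hreg u hu) he⟩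
  · rw [mem_alive]
    show (solved N).l .odd 0 < _
    rw [(solved_facts .odd hN 0).1]
    simp
  · show (solved N).l .odd 0 = _
    rw [(solved_facts .odd hN 0).1]
    simp
  · obtain ⟨w, hw, hle⟩ := hv.exists_le u
    have hwa : w ∈ ((solved N).layout N won).alive := mem_alive.2 (hle.trans_lt (mem_alive.1 hu))
    exact ⟨w, hw, hwa, hreg w hwa⟩

end Labelling

end Dominions

/-! ### Following the run -/

section Run

open Player Labelling

variable {N f q n m k x : ℕ} {v : Variant} {keep : Bool} {cs : ℕ → Config (TCVertex N)}
  {b : ℕ → Bool} {A A' : Labelling} {Y Y' : Memo (TCVertex N)} {bad : ℕ → Prop}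
  {won : Player → Finset (TCVertex N)} {c : Config (TCVertex N)}

/-- The states of the counters that are met before the promotions from iteration `n` to iteration
`m`. -/
def states (cs : ℕ → Config (TCVertex N)) (b : ℕ → Bool) (n m : ℕ) :
    List (Finset (Player × Fin N)) :=
  ((List.range' n (m - n)).filter b).map fun i => bits (cs i)

theorem states_append {l : ℕ} (h₁ : n ≤ m) (h₂ : m ≤ l) :
    states cs b n m ++ states cs b m l = states cs b n l := by
  have := List.range'_append_1 (s := n) (m := m - n) (n := l - m)
  rw [show n + (m - n) = m by omega, show m - n + (l - m) = l - n by omega] at this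
  rw [states, states, states, ← this, List.filter_append, List.map_append]

theorem states_eq_nil (h : ∀ i, n ≤ i → i < m → b i = false) : states cs b n m = [] := by
  rw [states, List.map_eq_nil_iff, List.filter_eq_nil_iff]
  intro i hi
  rw [List.mem_range'_1] at hi
  rw [h i hi.1 (by omega)]
  simp

theorem states_of_nil (hnm : n ≤ m) (h : states cs b n m = []) :
    states cs b n (m + 1) = states cs b m (m + 1) := by
  rw [← states_append hnm (Nat.le_succ m), h, List.nil_append]

theorem states_succ (h : b m = true) : states cs b m (m + 1) = [bits (cs m)] := by
  simp [states, h]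

theorem counterTrace_eq (T : ℕ) : counterTrace cs b T = states cs b 0 T ++ [bits (cs T)] := by
  rw [counterTrace, states, Nat.sub_zero, List.range_eq_range']

theorem promotions_eq (T : ℕ) : promotions b T = (states cs b 0 T).length := by
  rw [promotions, states, Nat.sub_zero, List.range_eq_range', List.length_map]

/-- The search at iteration `n` is on its way to the region `f` of the labelling `A`. -/
def Ready (v : Variant) (cs : ℕ → Config (TCVertex N)) (n : ℕ) (A : Labelling)
    (won : Player → Finset (TCVertex N)) (Y : Memo (TCVertex N)) (f : ℕ) : Prop :=
  ∃ bad, Follows (twoCounters N) v (A.layout N won) Y bad (cs n) ∧ f ≤ (cs n).p ∧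
    (bad (cs n).p ∨ ∃ u ∈ (A.layout N won).alive, (A.layout N won).reg u = (cs n).p)

/-- The search at iteration `n` has reached the region `f` of the labelling `A`. -/
def Arrived (v : Variant) (cs : ℕ → Config (TCVertex N)) (n : ℕ) (A : Labelling)
    (won : Player → Finset (TCVertex N)) (Y : Memo (TCVertex N)) (f : ℕ) : Prop :=
  Follows (twoCounters N) v (A.layout N won) Y (fun _ => False) (cs n) ∧ (cs n).p = f

/-- The search gets to the region `f` without a promotion. -/
theorem Ready.arrives (hrun : IsRun (twoCounters N) v keep cs b) (hN : 1 ≤ N) (hA : A.Valid N)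
    (hopen : A.OpenAbove N f) (hf : f < 4 * N + 4) (hex : ∃ u : TCVertex N, A.reg u = f)
    (hrest : (∀ u : TCVertex N, f ≤ A.reg u) ∨ ¬ v.Recovers) (h : Ready v cs n A won Y f) :
    ∃ m ≥ n, states cs b n m = [] ∧ Arrived v cs m A won Y f := by
  obtain ⟨bad, h, hfn, hhit⟩ := h
  obtain ⟨u, hu⟩ := hex
  obtain ⟨m, hnm, hb, hp, hF⟩ := Follows.reach hrun (hA.isDecomposition won)
    ⟨u, mem_alive.2 (hu ▸ hf), hu⟩ (fun u hu hlt => hopen.isOpen hN u hu hlt)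
    (hrest.imp_left fun h u _ => h u) h hfn hhit
  exact ⟨m, hnm, states_eq_nil hb, hF, hp⟩

/-- The search promotes the region `f` at which it has arrived and goes on to compute the next
labelling. -/
theorem Arrived.promotes (hrun : IsRun (twoCounters N) v keep cs b) (hA : A.Valid N)
    (h : Arrived v cs n A won Y f) {f' : ℕ} (hf' : f' ≤ q)
    (hP : IsPromotion (twoCounters N) v (A.layout N won) (A'.layout N won) f q bad)
    (hrest : (∀ u : TCVertex N, f ≤ A.reg u) ∨
      ∀ d, Y.record d → ofPriority d ≠ ofPriority f → q ≤ d)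
    (hbad : ∀ x, bad x → x ≤ q ∧ v.Recovers ∧ ∃ u : TCVertex N, A.reg u < 4 * N + 4 ∧
      f < A.reg u ∧ A.reg u = x ∧ (twoCounters N).owner u = ofPriority x ∧ A'.reg u ≤ x ∧
      ∃ w, (cs n).strat u = some w ∧ x < A'.reg w)
    (hkept : v.Recovers → ∀ u w, Y'.kept u w → A.reg u < 4 * N + 4 ∧
      (twoCounters N).owner u = ofPriority (A'.reg u) ∧ A'.reg u = A.reg u ∧ f < A.reg u ∧
      (cs n).strat u = some w ∧ ¬ bad (A'.reg u))
    (havoid : ∀ d, Y'.avoid d → d ≠ q ∧ f ≤ d ∧ ∀ u : TCVertex N, f < A.reg u → A.reg u ≠ d)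
    (hrecord : ∀ d, d = q ∨ (d < q → ¬ v.Resets (ofPriority f) d) → Y'.record d)
    (hfresh : v.Recovers → ∀ d, Y'.fresh d → d < q ∧ f ≤ d ∧
      ∀ u : TCVertex N, f < A.reg u → A.reg u ≠ d) :
    states cs b n (n + 1) = [bits (cs n)] ∧ Ready v cs (n + 1) A' won Y' f' ∧
      Follows (twoCounters N) v (A'.layout N won) Y' bad (cs (n + 1)) ∧ (cs (n + 1)).p = q := by
  obtain ⟨hF, hp⟩ := h
  have hX := hA.isDecomposition won
  obtain ⟨σ, hσ, hstep⟩ := hrun.2 n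
  obtain ⟨c', hc', hpr⟩ := hF.exists_promoted (keep := keep) (σ := σ) hX (fun h => h) hp hP
    (hrest.imp_left fun h u _ => h u)
  rw [hstep] at hc'
  obtain ⟨rfl, hb⟩ := Prod.mk.inj hc'
  have hF' := hF.of_promoted (Y' := Y') hX (fun _ h => h) hp hP hσ hpr
    (fun x hx => by
      obtain ⟨h₁, h₂, u, h₃, h₄⟩ := hbad x hx
      exact ⟨h₁, h₂, u, mem_alive.2 h₃, h₄⟩)
    (fun hv u w hk => by
      obtain ⟨h₁, h₂⟩ := hkept hv u w hk
      exact ⟨mem_alive.2 h₁, h₂⟩)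
    (fun d hd => by
      obtain ⟨h₁, h₂, h₃⟩ := havoid d hd
      exact ⟨h₁, h₂, fun u _ h₄ h₅ => absurd h₅ (h₃ u h₄)⟩)
    hrecord
    (fun hv d hd => by
      obtain ⟨h₁, h₂, h₃⟩ := hfresh hv d hd
      exact ⟨h₁, h₂, fun u _ => h₃ u⟩)
  refine ⟨states_succ hb, ⟨bad, hF', ?_, .inr ?_⟩, hF', hpr.p⟩
  · rw [hpr.p]
    exact hf'
  · obtain ⟨u, hu, he, -⟩ := hP.escape
    exact ⟨u, hP.alive ▸ hu, by rw [hpr.p]; exact hP.base u hu he⟩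

/-! ### The bits of a layout -/

theorem mem_bits {α : Player} {y : Fin N} : (α, y) ∈ bits c ↔ TCVertex.l α y ∈ c.won α ∨
    (TCVertex.l α y ∈ c.alive ∧ ∃ q ∈ c.merged, ofPriority q = α ∧
      c.r (TCVertex.l α y) = (q : WithBot ℕ)) := by
  simp [bits]

/-- A bit is set if its low vertex is in the region of a promoted tangle vertex. -/
theorem Arrived.mem_bits_of_core (h : Arrived v cs n A won Y f) {α β : Player} {y z : Fin N}
    (hc : A.core β z) (he : A.g β z = A.l α y) (hf : f < A.l α y) (hlt : A.l α y < 4 * N + 4)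
    (hp : ofPriority (A.l α y) = α) : (α, y) ∈ bits (cs n) := by
  obtain ⟨hF, hpf⟩ := h
  have hl : TCVertex.l α y ∈ (A.layout N won).alive := mem_alive.2 hlt
  have ht : TCVertex.t β z ∈ (A.layout N won).alive := mem_alive.2 (he.trans_lt hlt)
  refine mem_bits.2 (.inr ⟨hF.alive ▸ hl, A.l α y, ?_, hp, hF.above _ hl (hpf ▸ hf)⟩)
  exact he ▸ hF.core_merged _ ht hc

theorem Arrived.notMem_bits (h : Arrived v cs n A won Y f) {α : Player} {y : Fin N}
    (hw : TCVertex.l α y ∉ won α) (hf : f < A.l α y)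
    (hp : ofPriority (A.l α y) ≠ α ∨ Y.avoid (A.l α y)) : (α, y) ∉ bits (cs n) := by
  obtain ⟨hF, hpf⟩ := h
  rw [mem_bits, hF.won, hF.alive]
  rintro (h₁ | ⟨h₁, q, h₂, h₃, h₄⟩)
  · exact hw h₁
  · have h₅ := hF.above _ h₁ (hpf ▸ hf)
    have h₆ : A.l α y = q := by
      have h₇ := h₅.symm.trans h₄
      change ((A.l α y : ℕ) : WithBot ℕ) = q at h₇
      exact_mod_cast h₇
    rcases hp with hp | hp
    · exact hp (h₆ ▸ h₃)
    · exact hF.avoid _ hp (h₆ ▸ h₂) _ h₁ h₅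

theorem Arrived.mem_bits_of_won (h : Arrived v cs n A won Y f) {α : Player} {y : Fin N}
    (hw : TCVertex.l α y ∈ won α) : (α, y) ∈ bits (cs n) :=
  mem_bits.2 (.inl (h.1.won ▸ hw))

theorem bits_counting {J : Finset ℕ} (h : Arrived v cs n (counting N (4 * N + 2) J)
    (fun _ => ∅) Y 2) : bits (cs n) = Finset.univ.filter fun x => (x.2 : ℕ) ∈ J := by
  ext ⟨α, y⟩
  simp only [Finset.mem_filter, Finset.mem_univ, true_and]
  have f := above_facts (N := N) (t := 4 * N + 2) (by omega) le_rfl J y.isLt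
  have hN := y.isLt
  have hl : (counting N (4 * N + 2) J).l α y =
      if (y : ℕ) ∈ J then above N (4 * N + 2) J α y else lowPr N α y := rfl
  constructor
  · intro hb
    by_contra hy
    rw [if_neg hy] at hl
    refine h.notMem_bits (by simp) ?_ ?_ hb
    · rw [hl]
      cases α <;> simp only [lowPr] <;> omega
    · rw [hl, ofPriority_lowPr]
      exact .inl (opp_ne α)
  · intro hy
    rw [if_pos hy] at hl
    refine h.mem_bits_of_core (β := α) (z := y) hy ?_ ?_ ?_ ?_
    · rw [hl]
      simp only [counting, hy, if_true]
    all_goals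
      rw [hl]
      clear h hl hy
      cases α
      · first | omega | exact ofPriority_eq_even.2 (by omega)
      · first | omega | exact ofPriority_eq_odd.2 (by omega)

theorem recovering_source_lt {t : ℕ} {J : Finset ℕ} {T : Tail} (ht : t % 2 = 0)
    (ht' : 4 * N + 2 ≤ t) (hxk : x ≤ k) (hk : k < N) (hT : T = .stale → x < k) (α : Player) {y : ℕ}
    (hy : y < N) (h : y ≤ k ∨ α = .odd ∨ T ≠ .stale) :
    T.source N k < (recovering N t J x k T).l α y := by
  have f := above_facts (N := N) ht ht' J hy
  have f' := above_facts (N := N) ht ht' J (show x < N by omega)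
  cases α <;> cases T <;> simp only [recovering, counting, Tail.source, lowPr] <;> grind

theorem bits_recovering_subset {J : Finset ℕ} {T : Tail} (hxk : x ≤ k)
    (hk : k < N) (hT : T = .stale → x < k)
    (h : Arrived v cs n (recovering N (4 * N + 2) J x k T) (fun _ => ∅) Y (T.source N k)) :
    bits (cs n) ⊆ Finset.univ.filter fun y => (y.2 : ℕ) ∈ J ∨ y.1 = .even ∧ x ≤ (y.2 : ℕ) := by
  rintro ⟨α, y⟩ hb
  simp only [Finset.mem_filter, Finset.mem_univ, true_and]
  by_contra hy
  push Not at hy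
  have hlt := recovering_source_lt (t := 4 * N + 2) (J := J) (by omega) le_rfl hxk hk hT α y.isLt (by
    by_cases hα : α = .odd
    · exact .inr (.inl hα)
    · have := hy.2 (by cases α <;> simp_all)
      exact .inl (by omega))
  refine h.notMem_bits (by simp) hlt (.inl ?_) hb
  have hl : (recovering N (4 * N + 2) J x k T).l α y = lowPr N α y ∨
      (recovering N (4 * N + 2) J x k T).l α y = lowPr N α x := by
    have h₁ := hy.1
    have h₂ := hy.2
    cases α <;> simp only [recovering, counting] <;> grind
  rcases hl with hl | hl <;> rw [hl, ofPriority_lowPr] <;> exact opp_ne α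

theorem bits_recovering_mem {J : Finset ℕ} {T : Tail} (hxk : x ≤ k)
    (hk : k < N) (hT : T = .stale → x < k)
    (h : Arrived v cs n (recovering N (4 * N + 2) J x k T) (fun _ => ∅) Y (T.source N k)) :
    (.even, ⟨k, hk⟩) ∈ bits (cs n) := by
  have f := above_facts (N := N) (t := 4 * N + 2) (by omega) le_rfl J (show x < N by omega)
  have hlt := recovering_source_lt (t := 4 * N + 2) (J := J) (by omega) le_rfl hxk hk hT .even hk
    (.inl le_rfl)
  have hl : (recovering N (4 * N + 2) J x k T).l .even k = above N (4 * N + 2) J .even x := by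
    simp only [recovering, not_lt.2 hxk, if_false, le_refl, if_true]
  have hg : (recovering N (4 * N + 2) J x k T).g .even k = above N (4 * N + 2) J .even x := by
    simp only [recovering, not_lt.2 hxk, if_false, le_refl, if_true]
  refine h.mem_bits_of_core (β := .even) (z := ⟨k, hk⟩) (.inr ⟨rfl, hxk, .inl le_rfl⟩)
    (hg.trans hl.symm) hlt ?_ ?_
  · show (recovering N (4 * N + 2) J x k T).l .even k < _
    rw [hl]
    omega
  · show ofPriority ((recovering N (4 * N + 2) J x k T).l .even k) = _
    rw [hl, ofPriority_eq_even]
    omega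

theorem bits_recovering {J : Finset ℕ} (hJ : ∀ m ∈ J, m < k) (hk : k < N)
    (h : Arrived v cs n (recovering N (4 * N + 2) J k k .settled) (fun _ => ∅) Y 1) :
    bits (cs n) = Finset.univ.filter fun y => (y.2 : ℕ) ∈ J ∨ y.1 = .even ∧ k ≤ (y.2 : ℕ) := by
  refine (bits_recovering_subset le_rfl hk (by simp) h).antisymm ?_
  rintro ⟨α, y⟩ hb
  simp only [Finset.mem_filter, Finset.mem_univ, true_and] at hb
  have hlt := recovering_source_lt (t := 4 * N + 2) (J := J) (T := .settled) (by omega) le_rfl le_rfl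
    hk (by simp) α y.isLt (.inr (.inr (by simp)))
  change 1 < _ at hlt
  have f := above_facts (N := N) (t := 4 * N + 2) (by omega) le_rfl J y.isLt
  have f' := above_facts (N := N) (t := 4 * N + 2) (by omega) le_rfl J hk
  rcases lt_or_ge (y : ℕ) k with hyk | hyk
  · have hyJ : (y : ℕ) ∈ J := hb.resolve_right (by omega)
    have hl : (recovering N (4 * N + 2) J k k .settled).l α y = above N (4 * N + 2) J α y := by
      simp only [recovering, hyk, if_true, counting, hyJ]
    have hg : (recovering N (4 * N + 2) J k k .settled).g α y = above N (4 * N + 2) J α y := by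
      simp only [recovering, hyk, if_true, counting, hyJ]
    refine h.mem_bits_of_core (β := α) (z := y) (.inl hyJ) (hg.trans hl.symm) hlt ?_ ?_
    all_goals
      rw [hl]
      clear h hl hg hlt
      cases α
      · first | omega | exact ofPriority_eq_even.2 (by omega)
      · first | omega | exact ofPriority_eq_odd.2 (by omega)
  · obtain ⟨rfl, -⟩ := hb.resolve_left fun h => by have := hJ _ h; omega
    rcases hyk.lt_or_eq with hyk | hyk
    · have hl : (recovering N (4 * N + 2) J k k .settled).l .even y = lowPr N .odd k := by
        simp only [recovering, not_lt.2 hyk.le, if_false, not_le.2 hyk, ite_self]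
      have hg : (recovering N (4 * N + 2) J k k .settled).g .even (N - 1) = lowPr N .odd k := by
        have h₁ : ¬ N - 1 < k := by omega
        have h₂ : ¬ N - 1 ≤ k := by omega
        simp only [recovering, h₁, if_false, h₂, ite_self]
      refine h.mem_bits_of_core (β := .even) (z := ⟨N - 1, by omega⟩) (.inr ⟨rfl, ?_, .inr ⟨?_, by simp⟩⟩)
        (hg.trans hl.symm) hlt ?_ ?_
      · show k ≤ N - 1
        omega
      · show N - 1 + 1 = N
        omega
      · rw [hl]
        simp only [lowPr]
        omega
      · rw [hl, ofPriority_lowPr]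
        rfl
    · have := bits_recovering_mem le_rfl hk (by simp) h
      convert this using 2
      exact Fin.ext hyk.symm

theorem bits_raising (hxk : x ≤ k) (hk : k + 1 < N) (hY : Y.avoid (lowPr N .even x))
    (h : Arrived v cs n (raising N x k) (fun _ => ∅) Y 2) :
    (bits (cs n) ⊆ Finset.univ.filter fun y => (y.2 : ℕ) < k + 1) ∧
      (.odd, ⟨k, by omega⟩) ∈ bits (cs n) := by
  constructor
  · rintro ⟨α, y⟩ hb
    simp only [Finset.mem_filter, Finset.mem_univ, true_and]
    by_contra hy
    have hl : (raising N x k).l α y = lowPr N .even x := by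
      cases α <;> simp only [raising] <;> grind
    refine h.notMem_bits (by simp) ?_ (.inr (hl ▸ hY)) hb
    rw [hl]
    simp only [lowPr]
    omega
  · have hl : (raising N x k).l .odd k = 4 * N + 3 := by simp only [raising, le_refl, if_true]
    have hg : (raising N x k).g .odd k = 4 * N + 3 := by simp only [raising, le_refl, if_true]
    refine h.mem_bits_of_core (β := .odd) (z := ⟨k, by omega⟩) le_rfl (hg.trans hl.symm) ?_ ?_ ?_
    · show 2 < (raising N x k).l .odd k
      omega
    · show (raising N x k).l .odd k < _
      omega
    · show ofPriority ((raising N x k).l .odd k) = .odd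
      rw [hl, ofPriority_eq_odd]
      omega

theorem bits_remaining (hx : x < N) (hE : ∀ y, TCVertex.l .even y ∈ won .even) (hO : won .odd = ∅)
    (h : Arrived v cs n (remaining N x) won Y 1) :
    bits (cs n) = Finset.univ.filter fun y => y.1 = .even ∨ (y.2 : ℕ) < x := by
  ext ⟨α, y⟩
  simp only [Finset.mem_filter, Finset.mem_univ, true_and]
  cases α
  · simp [h.mem_bits_of_won (hE y)]
  · simp only [reduceCtorEq, false_or]
    obtain ⟨-, -, -, -, hl, hg, -⟩ := recovering_last_facts (N := N) (4 * N + 4) x y y.isLt 0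
    change (remaining N x).l .odd y = _ at hl
    change (remaining N x).g .odd y = _ at hg
    constructor
    · intro hb
      by_contra hy
      rw [if_neg hy] at hl
      refine h.notMem_bits (by rw [hO]; simp) ?_ (.inl ?_) hb
      · rw [hl]
        simp only [lowPr]
        omega
      · rw [hl, ofPriority_lowPr]
        exact opp_ne _
    · intro hy
      rw [if_pos hy] at hl hg
      refine h.mem_bits_of_core (β := .odd) (z := y) (.inl (Finset.mem_range.2 hy))
        (hg.trans hl.symm) ?_ ?_ ?_
      · rw [hl]
        omega
      · rw [hl]
        omega
      · rw [hl, ofPriority_eq_odd]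
        omega

end Run

/-! ### Recorded strategies -/

section Strategies

open Player Labelling

variable {N n k x y d : ℕ} {v : Variant} {cs : ℕ → Config (TCVertex N)} {J : Finset ℕ} {o : ℕ}
  {A : Labelling} {won : Player → Finset (TCVertex N)} {σ : TCVertex N → Option (TCVertex N)}

/-- What is known when both counters show the bits in `J`: the strategy at `z` of each unset bit of
Odd is to distract Even from this bit, as this is recorded for the bits above `o`, and the regions
of the low vertices of the other bits are computed from scratch. -/
def countingMemo (N : ℕ) (J : Finset ℕ) (o : ℕ) : Memo (TCVertex N) where
  kept u w := ∃ y : Fin N, (y : ℕ) ∉ J ∧ (y : ℕ) < o ∧ u = .z .odd y ∧ w = .l .even y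
  fresh d := (∃ y < N, y ∉ J ∧ o ≤ y ∧ d = lowPr N .even y) ∨ (N - 1 ∉ J ∧ d = lowPr N .odd (N - 1))
  avoid _ := False
  record _ := True

/-- What is known when Even has set bit `k`: besides the strategies at `z` of the unset bits of Odd,
one that leaves the region of bit `k` of Odd when Odd sets this bit; with a stale lowest bit of
Even, also that the record contains no low regions of Odd. -/
def recoveringMemo (N : ℕ) (J : Finset ℕ) (x k : ℕ) (T : Tail) : Memo (TCVertex N) where
  kept u w := (∃ y : Fin N, (y : ℕ) ∉ J ∧ (y : ℕ) < k ∧ u = .z .odd y ∧ w = .l .even y) ∨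
    (∃ (y : Fin N) (i : Fin y), (y : ℕ) + 1 = N ∧ (i : ℕ) = k ∧ u = .s .even y i ∧
      w = .b .even y i) ∨
    (∃ i j : Fin N, (j : ℕ) = k ∧ (j : ℕ) + 1 = N ∧ (i : ℕ) < k ∧ (i : ℕ) ∉ J ∧
      (∀ m, (i : ℕ) < m → m < k → m ∈ J) ∧ u = .z .even i ∧ w = .l .odd j)
  fresh _ := False
  avoid _ := False
  record d := T = .stale → ofPriority d = .odd → lowPr N .odd x ≤ d

/-- What is known while Even recovers its bits: the region of the low vertex of its current bit is
not the result of a promotion. -/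
def raisingMemo (N x : ℕ) : Memo (TCVertex N) where
  kept _ _ := False
  fresh _ := False
  avoid d := d = lowPr N .even x
  record _ := True

/-- What is known after the dominion of Even has been removed: the region of the current bit `x` of
Odd is computed from scratch. -/
def remainingMemo (N x : ℕ) : Memo (TCVertex N) where
  kept _ _ := False
  fresh d := x + 1 < N ∧ d = lowPr N .odd x
  avoid _ := False
  record _ := True

theorem c_eq_of {α : Player} (hg : A.g α y = d) (hz : A.z α y = d) (i : ℕ) : A.c α y i = d := by
  unfold Labelling.c
  split_ifs
  · exact hg
  · exact hz

/-- If the chain of a bit is attracted to a region of its player only through the vertex `z`, then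
`z` does not play back to the tangle vertex. -/
theorem Ranked.strat_z (h : Ranked (twoCounters N) (A.layout N won) σ d) {α : Player} {y : Fin N}
    (hg : A.g α y = d) (hz : A.z α y = d) (hp : ofPriority d = α) (h3 : 3 ≤ d) (hd : d < 4 * N + 4) :
    ∃ j : Fin N, Distracts N α y j ∧ A.l α.opp j = d ∧ σ (.z α y) = some (.l α.opp j) := by
  obtain ⟨rank, hr⟩ := h
  have hc : ∀ i, A.reg (TCVertex.chain α y i) = d := fun i => by
    rw [reg_chain]
    exact c_eq_of hg hz i
  have alive : ∀ u : TCVertex N, A.reg u = d → u ∈ (A.layout N won).alive := fun u hu =>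
    mem_alive.2 (hu ▸ hd)
  have low : ∀ p : ℕ, p ≤ 2 → p ≠ d := fun p hp => by omega
  have htp : tanglePr α ≤ 2 := by cases α <;> simp [tanglePr]
  have hcp : chainPr α ≤ 2 := (chainPr_le α).trans htp
  -- the opponent owns `t`, `a` and `b`, so that ranks decrease down the chain from `t` to `z`
  have hchain : ∀ i ≤ (y : ℕ), rank (TCVertex.chain α y i) < rank (.t α y) := by
    intro i hi
    induction i with
    | zero =>
      refine (hr (.t α y) (alive _ hg) hg (by rw [pr_t]; exact low _ htp)).2 ?_ _
        (mem_succ_t.2 (.inr rfl)) (alive _ (hc 0)) (hc 0).le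
      rw [owner_t, hp]
      exact opp_ne α
    | succ i ih =>
      refine lt_trans ?_ (ih (by omega))
      have hs : TCVertex.chain α y i = .s α y ⟨i, hi⟩ := dif_pos hi
      rw [hs]
      have step : ∀ u : TCVertex N, A.reg u = d → (twoCounters N).pr u = chainPr α →
          (twoCounters N).owner u = α.opp →
          TCVertex.chain α y (i + 1) ∈ (twoCounters N).succ u →
          rank (TCVertex.chain α y (i + 1)) < rank u := by
        intro u hu h₁ h₂ h₃
        refine (hr u (alive _ hu) hu (h₁ ▸ low _ hcp)).2 ?_ _ h₃ (alive _ (hc _)) (hc _).le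
        rw [h₂, hp]
        exact opp_ne α
      obtain ⟨w, hw, hwe, -, hlt⟩ := (hr (.s α y ⟨i, hi⟩) (alive _ hg) hg
        (by rw [pr_s]; exact low _ hcp)).1 (by rw [owner_s, hp])
      rcases mem_succ_s.1 hw with rfl | rfl
      · exact (step _ (by exact hwe) (pr_a _ _ _) (owner_a _ _ _) (mem_succ_a.2 (.inl rfl))).trans hlt
      · exact (step _ (by exact hwe) (pr_b _ _ _) (owner_b _ _ _) (mem_succ_b.2 (.inl rfl))).trans hlt
  obtain ⟨w, hw, hwe, hσ, hlt⟩ := (hr (.z α y) (alive _ hz) hz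
    (by rw [pr_z]; exact low _ hcp)).1 (by rw [owner_z, hp])
  rcases mem_succ_z.1 hw with rfl | ⟨j, hj, rfl⟩
  · have := hchain y le_rfl
    rw [show TCVertex.chain α y y = .z α y from dif_neg (lt_irrefl _)] at this
    omega
  · exact ⟨j, hj, hwe, hσ⟩

theorem Arrived.strat_z_odd
    (h : Arrived v cs n (counting N (4 * N + 2) J) won (countingMemo N J o) 2) (hv : v.Recovers)
    (y : Fin N) (hy : (y : ℕ) ∉ J) :
    (cs n).strat (.z .odd y) = some (.l .even y) := by
  obtain ⟨hF, hp⟩ := h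
  by_cases hyo : (y : ℕ) < o
  · exact (hF.kept hv _ _ ⟨y, hy, hyo, rfl, rfl⟩).2.2.2.1
  · have hN := y.isLt
    have hr := (hF.fresh hv (lowPr N .even y) (.inl ⟨y, hN, hy, by omega, rfl⟩)).2
      (by rw [hp]; simp only [lowPr]; omega)
    have hg : (counting N (4 * N + 2) J).g .odd y = lowPr N .even y := by
      simp only [counting, hy, if_false]
    obtain ⟨j, hj, hl, hσ⟩ := hr.strat_z hg hg (ofPriority_lowPr .even y)
      (by simp only [lowPr]; omega) (by simp only [lowPr]; omega)
    have hjN := j.isLt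
    have f := above_facts (N := N) (t := 4 * N + 2) (by omega) le_rfl J hjN
    have : j = y := by
      apply Fin.ext
      clear hF hr hσ
      simp only [counting, opp, lowPr] at hl
      split_ifs at hl <;> omega
    rw [hσ, this]
    rfl

theorem Arrived.strat_z_even
    (h : Arrived v cs n (counting N (4 * N + 2) J) won (countingMemo N J o) 2) (hv : v.Recovers)
    {i j : Fin N} (hj : (j : ℕ) + 1 = N) (hjJ : (j : ℕ) ∉ J)
    (hij : (i : ℕ) < j) (hi : (i : ℕ) ∉ J) (hm : ∀ m, (i : ℕ) < m → m < j → m ∈ J) :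
    (cs n).strat (.z .even i) = some (.l .odd j) := by
  obtain ⟨hF, hp⟩ := h
  have hjN : (j : ℕ) = N - 1 := by omega
  have hr := (hF.fresh hv (lowPr N .odd (N - 1)) (.inr ⟨hjN ▸ hjJ, rfl⟩)).2
    (by rw [hp]; simp only [lowPr]; omega)
  have hg : (counting N (4 * N + 2) J).g .even i = lowPr N .odd (N - 1) := by
    simp only [counting, hi, if_false]
    rcases nextLow_spec N J i with ⟨h₁, h₂⟩ | ⟨m, h₁, h₂, h₃, h₄, h₅⟩
    · exact absurd (h₂ j hij j.isLt) hjJ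
    · have : m = j := by
        rcases lt_trichotomy m j with h₆ | h₆ | h₆
        · exact absurd (hm m h₁ h₆) h₃
        · exact h₆
        · omega
      rw [h₄, this, hjN]
      rfl
  obtain ⟨j', hj', hl, hσ⟩ := hr.strat_z hg (by exact hg) (ofPriority_lowPr .odd _)
    (by simp only [lowPr]; omega) (by simp only [lowPr]; omega)
  have f := above_facts (N := N) (t := 4 * N + 2) (by omega) le_rfl J j'.isLt
  have : j' = j := by
    apply Fin.ext
    have := j'.isLt
    clear hF hr hσ
    simp only [counting, opp, lowPr] at hl
    split_ifs at hl <;> omega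
  rw [hσ, this]
  rfl

/-- The strategy in the region of bit `i` of Odd leads to the low vertex of this bit via `b`,
because `a` is not in this region. -/
theorem Arrived.strat_s_even
    (h : Arrived v cs n (counting N (4 * N + 2) J) won (countingMemo N J o) 2) (hv : v.Recovers)
    {y : Fin N} {i : Fin y} (hy : (y : ℕ) + 1 = N) (hi : (i : ℕ) ∉ J)
    (hm : ∀ m, (i : ℕ) < m → m < N → m ∈ J) :
    (cs n).strat (.s .even y i) = some (.b .even y i) := by
  obtain ⟨hF, hp⟩ := h
  have hyN := y.isLt
  have hiy := i.isLt
  have hyJ : (y : ℕ) ∈ J := hm y i.isLt y.isLt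
  have hg : (counting N (4 * N + 2) J).g .even y = lowPr N .odd i := by
    simp only [counting, hyJ, if_true]
    rw [above_eq (show (i : ℕ) + 1 ≤ y by omega) fun m h₁ h₂ => hm m h₁ (by omega), above,
      if_neg hi]
    rfl
  set u : TCVertex N := .s .even y i with hu
  have hreg : (counting N (4 * N + 2) J).reg u = lowPr N .odd i := hg
  have hlt : lowPr N .odd i < 4 * N + 4 := by simp only [lowPr]; omega
  have hlt' : 2 < lowPr N .odd i := by simp only [lowPr]; omega
  have hua : u ∈ ((counting N (4 * N + 2) J).layout N won).alive :=
    mem_alive.2 (hreg.trans_lt hlt)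
  have hr := hF.above u hua (by
    show (cs n).p < (counting N (4 * N + 2) J).reg u
    rw [hp, hreg]
    exact hlt')
  have ho : (twoCounters N).owner u =
      ofPriority (((counting N (4 * N + 2) J).layout N won).reg u) := by
    show _ = ofPriority ((counting N (4 * N + 2) J).reg u)
    rw [hreg, hu, owner_s, ofPriority_lowPr]
    rfl
  have hne := hF.strat_some hv u hua hr (fun h => h) ho (by
    show _ ≠ (counting N (4 * N + 2) J).reg u
    rw [hreg, hu, pr_s]
    simp only [chainPr, lowPr]
    omega)
  obtain ⟨w, hw⟩ := Option.ne_none_iff_exists'.1 hne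
  obtain ⟨h₁, -, h₂⟩ := hF.strat_mem hv u hua hr (fun h => h) ho w hw
  change (counting N (4 * N + 2) J).reg w = (counting N (4 * N + 2) J).reg u at h₂
  rcases mem_succ_s.1 h₁ with rfl | rfl
  · rw [hreg] at h₂
    change comb _ ((counting N (4 * N + 2) J).c .even y _) ((counting N (4 * N + 2) J).l .even i) = _
      at h₂
    have hc : (counting N (4 * N + 2) J).c .even y (i + 1) = lowPr N .odd i :=
      c_eq_of hg (by exact hg) _
    have hl : (counting N (4 * N + 2) J).l .even i = lowPr N .even i := by
      simp only [counting, hi, if_false]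
    rw [hc, hl] at h₂
    simp only [opp, comb_odd, lowPr] at h₂
    split_ifs at h₂ <;> omega
  · exact hw

/-- The strategy at `a` is to play to the low vertex of bit `x`, because the chain is attracted via
this vertex only. -/
theorem Arrived.strat_a_odd (h : Arrived v cs n (remaining N x) won (remainingMemo N x) 1)
    (hv : v.Recovers) {y : Fin N} {i : Fin y} (hy : (y : ℕ) = x + 1) (hi : (i : ℕ) = x) :
    (cs n).strat (.a .odd y i) = some (.l .odd (TCVertex.up i)) := by
  obtain ⟨hF, hp⟩ := h
  have hyN := y.isLt
  have hiy := i.isLt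
  have F := recovering_last_facts (N := N) (4 * N + 4) x
  set d := lowPr N .odd x with hd
  have hd' : d = 2 * (N - 1 - x) + 4 := rfl
  obtain ⟨rank, hr⟩ := (hF.fresh hv d ⟨by omega, rfl⟩).2 (by rw [hp]; omega)
  have alive : ∀ u : TCVertex N, (remaining N x).reg u = d →
      u ∈ ((remaining N x).layout N won).alive := fun u hu => mem_alive.2 (by omega)
  have hpar : ofPriority d = .even := ofPriority_lowPr .odd x
  have hgz : (remaining N x).g .odd y = d ∧ (remaining N x).z .odd y = d := by
    obtain ⟨-, -, -, -, -, h₁, h₂, -⟩ := F y hyN 0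
    rw [if_neg (by omega), if_neg (by omega)] at h₁ h₂
    exact ⟨h₁, h₂⟩
  have hc : ∀ i, (remaining N x).reg (TCVertex.chain .odd y i) = d := fun i => by
    rw [reg_chain]
    exact c_eq_of hgz.1 hgz.2 i
  have hl : ∀ m < x, (remaining N x).l .odd m = 4 * N + 3 := fun m hm => by
    obtain ⟨-, -, -, -, h₁, -⟩ := F m (by omega) 0
    rwa [if_pos hm] at h₁
  have hlx : (remaining N x).l .odd x = d := by
    obtain ⟨-, -, -, -, h₁, -⟩ := F x (by omega) 0
    rwa [if_neg (lt_irrefl _)] at h₁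
  have ha : ∀ m : Fin y, (remaining N x).reg (.a .odd y m : TCVertex N) = d := by
    intro m
    show comb _ ((remaining N x).c .odd y (m + 1)) ((remaining N x).l .odd m) = d
    rw [c_eq_of hgz.1 hgz.2]
    by_cases hm : (m : ℕ) < x
    · rw [hl m hm, opp, comb_even, if_pos (by omega), if_neg (by omega)]
    · rw [show (m : ℕ) = x by have := m.isLt; omega, hlx, opp, comb_even, if_pos (by omega),
        if_pos (by omega), max_self]
  have hs : ∀ m : Fin y, rank (.a .odd y m) < rank (TCVertex.chain .odd y m) := by
    intro m
    rw [show TCVertex.chain .odd y m = .s .odd y m from dif_pos m.isLt]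
    refine (hr (.s .odd y m) (alive _ hgz.1) hgz.1 (by rw [pr_s]; simp only [chainPr]; omega)).2 ?_ _
      (mem_succ_s.2 (.inl rfl)) (alive _ (ha m)) (ha m).le
    rw [owner_s, hpar]
    simp
  have hplay : ∀ m : Fin y, ∃ w ∈ (twoCounters N).succ (.a .odd y m),
      (remaining N x).reg w = d ∧ (cs n).strat (.a .odd y m) = some w ∧
      rank w < rank (.a .odd y m) := by
    intro m
    exact (hr (.a .odd y m) (alive _ (ha m)) (ha m)
      (by rw [pr_a]; simp only [chainPr]; omega)).1 (by rw [owner_a, hpar]; rfl)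
  have hchain : ∀ m ≤ x, rank (TCVertex.chain .odd y m) < rank (.t .odd y) := by
    intro m hm
    induction m with
    | zero =>
      obtain ⟨w, hw, hwe, -, hlt⟩ := (hr (.t .odd y) (alive _ hgz.1) hgz.1
        (by rw [pr_t]; simp only [tanglePr]; omega)).1 (by rw [owner_t, hpar]; rfl)
      rcases mem_succ_t.1 hw with rfl | rfl
      · have h₁ : highPr N .odd y ≤ (remaining N x).reg (.h .odd y : TCVertex N) :=
          le_max_left _ _
        have h₂ := le_highPr (N := N) .odd y
        change max _ _ = d at hwe
        change _ ≤ max _ _ at h₁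
        omega
      · exact hlt
    | succ m ih =>
      obtain ⟨w, hw, hwe, -, hlt⟩ := hplay ⟨m, by omega⟩
      rcases mem_succ_a.1 hw with rfl | rfl
      · exact hlt.trans ((hs ⟨m, by omega⟩).trans (ih (by omega)))
      · change (remaining N x).l .odd m = d at hwe
        have := hl m (by omega)
        omega
  obtain ⟨w, hw, hwe, hσ, hlt⟩ := hplay i
  rcases mem_succ_a.1 hw with rfl | rfl
  · have h₁ := (hs i).trans (hi ▸ hchain x le_rfl)
    have h₂ : TCVertex.chain .odd y (i + 1) = .z .odd y := dif_neg (by omega)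
    rw [h₂] at hlt
    have h₃ := (hr (.z .odd y) (alive _ hgz.2) hgz.2 (by rw [pr_z]; simp only [chainPr]; omega)).2
      (by rw [owner_z, hpar]; simp) _ (mem_succ_z.2 (.inl rfl)) (alive _ hgz.1) hgz.1.le
    omega
  · exact hσ

end Strategies

/-! ### The promotions of a run -/

section Steps

open Player Labelling

variable {N n k x o : ℕ} {v : Variant} {keep : Bool} {cs : ℕ → Config (TCVertex N)}
  {b : ℕ → Bool} {J : Finset ℕ} {T T' : Tail} {won : Player → Finset (TCVertex N)}

/-- Even sets bit `k`. -/
theorem Ready.counting_step (hrun : IsRun (twoCounters N) v keep cs b) (hs : SetsEven N v J x k T)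
    (h : Ready v cs n (counting N (4 * N + 2) J) (fun _ => ∅) (countingMemo N J o) 2) :
    ∃ m ≥ n, states cs b n m = [Finset.univ.filter fun x => (x.2 : ℕ) ∈ J] ∧
      Ready v cs m (recovering N (4 * N + 2) (J.filter (· < x)) x k T) (fun _ => ∅)
        (recoveringMemo N (J.filter (· < x)) x k T) (T.source N k) ∧
      Follows (twoCounters N) v
        ((recovering N (4 * N + 2) (J.filter (· < x)) x k T).layout N fun _ => ∅)
        (recoveringMemo N (J.filter (· < x)) x k T)
        (fun d => v.Recovers ∧ d = lowPr N .even k) (cs m) ∧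
      (cs m).p = above N (4 * N + 2) J .even k := by
  have hk := hs.lt
  have hA : (counting N (4 * N + 2) J).Valid N := valid_counting (by omega) le_rfl J
  have hle := counting_le_reg hs
  obtain ⟨m, hnm, hm, ha⟩ := h.arrives hrun (by omega) hA (counting_openAbove hk hs.notMem)
    (by omega) (by
      obtain ⟨u, -, hu, -⟩ := counting_escape hk hs.notMem hs.low
      exact ⟨u, hu⟩) (.inl hle)
  obtain ⟨g₁, g₂, g₃, g₄, g₅, g₆, -⟩ := hs.above_x
  have hxk := hs.le
  have hP := counting_isPromotion (won := fun _ => ∅) hs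
  have hf : T.source N k ≤ above N (4 * N + 2) J .even k := by
    cases T <;> simp only [Tail.source, lowPr] <;> omega
  have hlow : ∀ y ∉ J, (counting N (4 * N + 2) J).z .odd y = lowPr N .even y := fun y hy => by
    simp only [counting, hy, if_false]
  have key := ha.promotes hrun hA hf hP (Y' := recoveringMemo N (J.filter (· < x)) x k T) (.inl hle)
    (fun d hd => ?_) (fun hv u w hu => ?_) (fun d hd => hd.elim) (fun d hd hT hp => ?_)
    (fun _ d hd => hd.elim)
  · refine ⟨m + 1, by omega, ?_, key.2⟩
    rw [states_of_nil hnm hm, key.1, bits_counting ha]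
  -- the strategy of Odd to distract Even from bit `k` now leaves the region of this distraction
  · obtain ⟨hv, rfl⟩ := hd
    obtain ⟨rfl, rfl⟩ := hs.recovers hv
    have hz : (counting N (4 * N + 2) J).reg (.z .odd ⟨x, hk⟩ : TCVertex N) = lowPr N .even x :=
      hlow x hs.notMem
    refine ⟨?_, hv, .z .odd ⟨x, hk⟩, ?_, ?_, hz, ?_, ?_, _, ha.strat_z_odd hv ⟨x, hk⟩ hs.notMem, ?_⟩
    · simp only [lowPr]; omega
    · rw [hz]; simp only [lowPr]; omega
    · rw [hz]; simp only [lowPr]; omega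
    · rw [owner_z, ofPriority_lowPr]; rfl
    · show (recovering N (4 * N + 2) (J.filter (· < x)) x x .settled).z .odd x ≤ _
      simp only [recovering, lt_irrefl, if_false, if_true, lowPr]
      omega
    · show _ < (recovering N (4 * N + 2) (J.filter (· < x)) x x .settled).l .even x
      simp only [recovering, lt_irrefl, if_false, le_refl, if_true, g₁, lowPr]
      omega
  · obtain ⟨rfl, rfl⟩ := hs.recovers hv
    rcases hu with ⟨y, hy, hyk, rfl, rfl⟩ | ⟨y, i, hy, hi, rfl, rfl⟩ |
      ⟨i, j, hj, hj', hi, hiJ, hm, rfl, rfl⟩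
    · have hyJ : (y : ℕ) ∉ J := fun h => hy (Finset.mem_filter.2 ⟨h, hyk⟩)
      have hz : (counting N (4 * N + 2) J).reg (.z .odd y : TCVertex N) = lowPr N .even y :=
        hlow y hyJ
      have hz' : (recovering N (4 * N + 2) (J.filter (· < x)) x x .settled).reg
          (.z .odd y : TCVertex N) = lowPr N .even y := by
        show (recovering N (4 * N + 2) (J.filter (· < x)) x x .settled).z .odd y = _
        simp only [recovering, hyk, if_true, counting, hy, if_false]
      rw [hz', hz, owner_z, ofPriority_lowPr]
      refine ⟨?_, rfl, rfl, ?_, ha.strat_z_odd hv y hyJ, fun h => ?_⟩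
      · simp only [lowPr]; omega
      · simp only [lowPr]; omega
      · have := h.2
        simp only [lowPr] at this
        omega
    · have hiy := i.isLt
      have f := hs.facts y y.isLt
      have hz : (counting N (4 * N + 2) J).reg (.s .even y i : TCVertex N) = lowPr N .odd x := by
        show (counting N (4 * N + 2) J).g .even y = _
        have f₁ := f.2.2.1 (by omega)
        simp only [counting, f₁, if_true, lowPr]
      have hz' : (recovering N (4 * N + 2) (J.filter (· < x)) x x .settled).reg
          (.s .even y i : TCVertex N) = lowPr N .odd x := by
        show (recovering N (4 * N + 2) (J.filter (· < x)) x x .settled).g .even y = _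
        have h₁ : ¬ (y : ℕ) < x := by omega
        have h₂ : ¬ (y : ℕ) ≤ x := by omega
        simp only [recovering, h₁, h₂, if_false, ite_self]
      rw [hz', hz, owner_s, ofPriority_lowPr]
      refine ⟨?_, rfl, rfl, ?_, ha.strat_s_even hv hy (hi ▸ hs.notMem) (hi ▸ hs.low), fun h => ?_⟩
      · simp only [lowPr]; omega
      · simp only [lowPr]; omega
      · have := h.2
        simp only [lowPr] at this
        omega
    · have hiJ' : (i : ℕ) ∉ J := fun h => hiJ (Finset.mem_filter.2 ⟨h, hi⟩)
      have hm' : ∀ m, (i : ℕ) < m → m < j → m ∈ J := fun m h₁ h₂ =>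
        (Finset.mem_filter.1 (hm m h₁ (by omega))).1
      have f := (hs.facts i i.isLt).1 hi
      have hn : nextLow N J i = lowPr N .odd x := by
        rcases nextLow_spec N J i with ⟨h₁, h₂⟩ | ⟨m, h₁, h₂, h₃, h₄, h₅⟩
        · exact absurd (h₂ x hi hk) hs.notMem
        · have : m = x := by
            rcases lt_trichotomy m x with h₆ | h₆ | h₆
            · exact absurd (hm' m h₁ (by omega)) h₃
            · exact h₆
            · omega
          rw [h₄, this]
          rfl
      have hz : (counting N (4 * N + 2) J).reg (.z .even i : TCVertex N) = lowPr N .odd x := by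
        show (counting N (4 * N + 2) J).z .even i = _
        simp only [counting, hiJ', if_false, hn]
      have hz' : (recovering N (4 * N + 2) (J.filter (· < x)) x x .settled).reg
          (.z .even i : TCVertex N) = lowPr N .odd x := by
        show (recovering N (4 * N + 2) (J.filter (· < x)) x x .settled).z .even i = _
        have f' := f.2.2.2.2.2.1
        simp only [recovering, hi, if_true, counting, hiJ, if_false, f', hn, lowPr]
      rw [hz', hz, owner_z, ofPriority_lowPr]
      refine ⟨?_, rfl, rfl, ?_, ha.strat_z_even hv hj' (hj ▸ hs.notMem) (hj ▸ hi) hiJ' hm',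
        fun h => ?_⟩
      · simp only [lowPr]; omega
      · simp only [lowPr]; omega
      · have := h.2
        simp only [lowPr] at this
        omega
  · have hv : ¬ v.Recovers := fun hv => by
      rw [(hs.recovers hv).2] at hT
      cases hT
    have hpp := (hs.tail (by rw [hT]; simp) (hs.stale hT).2).1
    have hR : v.Resets (ofPriority 2) d := by
      have : ofPriority 2 = .even := rfl
      cases v <;> simp_all [Variant.Resets, Variant.Recovers]
    have hd' : above N (4 * N + 2) J .even k ≤ d := by
      rcases hd with hd | hd
      · exact hd.ge
      · by_contra hlt
        exact hd (by omega) hR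
    simp only [lowPr]
    omega

theorem recovering_lost_le (hxk : x ≤ k) (hk : k < N) (u : TCVertex N) :
    2 ≤ (recovering N (4 * N + 2) J x k .lost).reg u := by
  refine le_reg (fun α y hy => ?_) (by omega) u
  have f := above_facts (t := 4 * N + 2) (by omega) le_rfl J hy
  have fx := above_facts (t := 4 * N + 2) (by omega) le_rfl J (show x < N by omega)
  have n := nextLow_spec N J y
  cases α <;> simp only [recovering, counting, lowPr] <;> grind

theorem recovering_arrives {t : ℕ} {Y : Memo (TCVertex N)}
    (hrun : IsRun (twoCounters N) v keep cs b) (ht : t % 2 = 0)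
    (ht' : 4 * N + 2 ≤ t) (hJ : ∀ m ∈ J, m < x) (hxk : x ≤ k) (hk : k < N)
    (hT : T = .stale → x < k) (hT' : T ≠ .settled → k + 1 < N)
    (hdom : 4 * N + 4 ≤ t ∨ k + 1 < N ∨ ∃ i < x, i ∉ J) (hv : v.Recovers → T = .settled)
    (h : Ready v cs n (recovering N t J x k T) won Y (T.source N k)) :
    ∃ m ≥ n, states cs b n m = [] ∧ Arrived v cs m (recovering N t J x k T) won Y (T.source N k) := by
  refine h.arrives hrun (by omega) (valid_recovering ht ht' hJ hxk hk hT hT')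
    (recovering_openAbove ht ht' hJ hxk hk hT' hdom) ?_ ?_ ?_
  · cases T <;> simp only [Tail.source, lowPr] <;> omega
  · obtain ⟨u, -, hu, -⟩ := recovering_escape hJ hxk hk hT hT'
    exact ⟨u, hu⟩
  · by_cases hT₁ : T = .settled
    · subst hT₁
      exact .inl (recovering_pos ht ht' hk)
    · exact .inr fun h => hT₁ (hv h)

/-- The lowest bit of Even gets to the region of the current bit of Odd. -/
theorem Ready.settle_step (hrun : IsRun (twoCounters N) v keep cs b) (hJ : ∀ m ∈ J, m < x)
    (hxk : x ≤ k) (hT : T = .stale → x < k) (hk : k + 1 < N) (hTs : T ≠ .settled)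
    (hv : ¬ v.Recovers)
    (h : Ready v cs n (recovering N (4 * N + 2) J x k T) (fun _ => ∅) (recoveringMemo N J x k T)
      (T.source N k)) :
    ∃ m ≥ n, (∃ S, states cs b n m = [S] ∧
        S ⊆ (Finset.univ.filter fun y => (y.2 : ℕ) ∈ J ∨ y.1 = .even ∧ x ≤ (y.2 : ℕ)) ∧
        (.even, ⟨k, by omega⟩) ∈ S) ∧
      Ready v cs m (recovering N (4 * N + 2) J x k .settled) (fun _ => ∅)
        (recoveringMemo N J x k .settled) 1 := by
  have ht : (4 * N + 2) % 2 = 0 := by omega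
  obtain ⟨m, hnm, hm, ha⟩ := recovering_arrives hrun ht le_rfl hJ hxk (by omega) hT
    (fun _ => hk) (.inr (.inl hk)) (fun h => absurd h hv) h
  have hq : T.target N (4 * N + 2) J x = lowPr N .odd x := by
    cases T
    · exact absurd rfl hTs
    · rfl
    · rfl
  have key := ha.promotes (f' := 1) hrun (valid_recovering ht le_rfl hJ hxk (by omega) hT fun _ => hk)
    (by rw [hq]; simp only [lowPr]; omega)
    (recovering_settle (won := fun _ => ∅) ht le_rfl hJ hxk hT hk hTs hv)
    (Y' := recoveringMemo N J x k .settled) ?_ (fun d hd => absurd hd.1 hv)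
    (fun h => absurd h hv) (fun d hd => hd.elim) (fun d _ hd => by cases hd)
    (fun h => absurd h hv)
  · refine ⟨m + 1, by omega, ⟨bits (cs m), ?_, bits_recovering_subset hxk (by omega) hT ha,
      bits_recovering_mem hxk (by omega) hT ha⟩, key.2.1⟩
    rw [states_of_nil hnm hm, key.1]
  · by_cases hst : T = .stale
    · right
      intro d hd hp
      rw [hq]
      refine hd hst ?_
      rw [Tail.source_parity hTs] at hp
      exact ne_iff.1 hp
    · left
      have : T = .lost := by
        cases T
        · exact absurd rfl hTs
        · exact absurd rfl hst
        · rfl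
      subst this
      exact recovering_lost_le hxk (by omega)

/-- Odd recovers bit `x`, which is higher than the bit that has to be set. -/
theorem Ready.recover_step (hrun : IsRun (twoCounters N) v keep cs b) (hJ : ∀ m ∈ J, m < x)
    (hxk : x < k) (hk : k < N) (hT : T' = .lost ∧ k + 1 < N ∨ T' = .settled ∧ k + 1 = N)
    (hi : ∃ i < x, i ∉ J) (hv : ¬ v.Recovers)
    (h : Ready v cs n (recovering N (4 * N + 2) J x k .settled) (fun _ => ∅)
      (recoveringMemo N J x k .settled) 1) :
    ∃ m ≥ n, (∃ S, states cs b n m = [S] ∧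
        S ⊆ (Finset.univ.filter fun y => (y.2 : ℕ) ∈ J ∨ y.1 = .even ∧ x ≤ (y.2 : ℕ)) ∧
        (.even, ⟨k, hk⟩) ∈ S) ∧
      Ready v cs m (recovering N (4 * N + 2) (insert x J) (x + 1) k T') (fun _ => ∅)
        (recoveringMemo N (insert x J) (x + 1) k T') (T'.source N k) := by
  have ht : (4 * N + 2) % 2 = 0 := by omega
  have fx := above_facts ht le_rfl J (show x < N by omega)
  obtain ⟨m, hnm, hm, ha⟩ := recovering_arrives (T := .settled) hrun ht le_rfl hJ hxk.le hk (by simp)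
    (by simp) (.inr (.inr hi)) (fun h => absurd h hv) h
  have key := ha.promotes (f' := T'.source N k) hrun
    (valid_recovering ht le_rfl hJ hxk.le hk (by simp) (by simp))
    ?_ (recovering_recover (won := fun _ => ∅) ht le_rfl hJ hxk hk hT (.inr hi)
      fun h => absurd h hv)
    (Y' := recoveringMemo N (insert x J) (x + 1) k T') (.inl (recovering_pos ht le_rfl hk))
    (fun d hd => absurd hd.1 hv) (fun h => absurd h hv) (fun d hd => hd.elim) (fun d _ hd => ?_)
    (fun h => absurd h hv)
  · refine ⟨m + 1, by omega, ⟨bits (cs m), ?_, bits_recovering_subset (T := .settled) hxk.le hk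
      (by simp) ha, bits_recovering_mem (T := .settled) hxk.le hk (by simp) ha⟩, key.2.1⟩
    rw [states_of_nil hnm hm, key.1]
  · rcases hT with ⟨rfl, -⟩ | ⟨rfl, -⟩ <;> simp only [Tail.source] <;> omega
  · rcases hT with ⟨rfl, -⟩ | ⟨rfl, -⟩ <;> cases hd

/-- Odd sets bit `k` as well, and then both counters show the same bits. -/
theorem Ready.complete_step (hrun : IsRun (twoCounters N) v keep cs b) (hJ : ∀ m ∈ J, m < k)
    (hk : k < N) (hi : (∃ i < k, i ∉ J) ∨ v.Recovers ∧ k + 1 < N)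
    (h : Ready v cs n (recovering N (4 * N + 2) J k k .settled) (fun _ => ∅)
      (recoveringMemo N J k k .settled) 1) :
    ∃ m ≥ n, states cs b n m = [Finset.univ.filter fun y =>
        (y.2 : ℕ) ∈ J ∨ y.1 = .even ∧ k ≤ (y.2 : ℕ)] ∧
      Ready v cs m (counting N (4 * N + 2) (insert k J)) (fun _ => ∅)
        (countingMemo N (insert k J) (k + 1)) 2 := by
  have ht : (4 * N + 2) % 2 = 0 := by omega
  have hA : (recovering N (4 * N + 2) J k k .settled).Valid N :=
    valid_recovering ht le_rfl hJ le_rfl hk (by simp) (by simp)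
  have hkJ : k ∉ J := fun h => lt_irrefl _ (hJ k h)
  have fk := above_facts ht le_rfl J hk
  have F := insert_facts ht le_rfl hJ hk
  obtain ⟨m, hnm, hm, ha⟩ := recovering_arrives (T := .settled) hrun ht le_rfl hJ le_rfl hk (by simp)
    (by simp) (.inr (hi.symm.imp_left And.right)) (fun _ => rfl) h
  have key := ha.promotes (f' := 2) hrun hA (by omega)
    (recovering_complete (won := fun _ => ∅) ht le_rfl hJ hk (.inr (hi.imp_right And.left)))
    (Y' := countingMemo N (insert k J) (k + 1)) (.inl (recovering_pos ht le_rfl hk))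
    (fun d hd => ?_) (fun hv u w hu => ?_) (fun d hd => hd.elim) (fun d _ => trivial)
    (fun hv d hd => ?_)
  · refine ⟨m + 1, by omega, ?_, key.2.1⟩
    rw [states_of_nil hnm hm, key.1,
      bits_recovering hJ hk ha]
  · obtain ⟨hv, rfl⟩ := hd
    have hq : lowPr N .odd k ≤ above N (4 * N + 2) J .odd k := by simp only [lowPr]; omega
    have hlt : lowPr N .odd k < 4 * N + 4 := by simp only [lowPr]; omega
    have hlt' : 1 < lowPr N .odd k := by simp only [lowPr]; omega
    have hl : (counting N (4 * N + 2) (insert k J)).l .odd k = above N (4 * N + 2) J .odd k := by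
      have f := (F k hk).2.1 rfl
      simp only [counting, f, if_true]
    have hlt'' : lowPr N .odd k < above N (4 * N + 2) J .odd k := by simp only [lowPr]; omega
    have hlast : ∀ y, k ≤ y → y + 1 = N → (counting N (4 * N + 2) (insert k J)).g .even y = 2 ∨
        y = k := by
      intro y hy hyN
      rcases hy.lt_or_eq with hlt | rfl
      · have f := (F y (by omega)).2.2.1 hlt
        left
        simp only [counting, f, if_false]
        omega
      · exact .inr rfl
    by_cases hkN : k + 1 < N
    · have hlN : k < N - 1 := by omega
      have hg : (recovering N (4 * N + 2) J k k .settled).reg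
          (.s .even ⟨N - 1, by omega⟩ ⟨k, hlN⟩ : TCVertex N) = lowPr N .odd k := by
        show (recovering N (4 * N + 2) J k k .settled).g .even (N - 1) = _
        have h₁ : ¬ N - 1 < k := by omega
        have h₂ : ¬ N - 1 ≤ k := by omega
        simp only [recovering, h₁, h₂, if_false, ite_self]
      have hg' : (counting N (4 * N + 2) (insert k J)).g .even (N - 1) = 2 :=
        (hlast (N - 1) (by omega) (by omega)).resolve_right (by omega)
      refine ⟨hq, hv, .s .even ⟨N - 1, by omega⟩ ⟨k, hlN⟩, hg.trans_lt hlt, hlt'.trans_eq hg.symm,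
        hg, ?_, ?_, .b .even ⟨N - 1, by omega⟩ ⟨k, hlN⟩, ?_, ?_⟩
      · rw [owner_s, ofPriority_lowPr]
        rfl
      · show (counting N (4 * N + 2) (insert k J)).g .even (N - 1) ≤ _
        rw [hg']
        exact hlt'
      · exact (ha.1.kept hv _ _ (.inr (.inl ⟨⟨N - 1, by omega⟩, ⟨k, hlN⟩, by
          show N - 1 + 1 = N; omega, rfl, rfl, rfl⟩))).2.2.2.1
      · show _ < comb _ ((counting N (4 * N + 2) (insert k J)).c .even (N - 1) _)
          ((counting N (4 * N + 2) (insert k J)).l .odd k)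
        rw [c_eq_of hg' (by exact hg'), hl, opp, comb_odd, if_neg (by omega), if_pos (by omega)]
        exact hlt''
    · obtain ⟨i, hi₁, hi₂, hi₃⟩ : ∃ i < k, i ∉ J ∧ ∀ m, i < m → m < k → m ∈ J := by
        obtain ⟨i, hi₁, hi₂⟩ := hi.resolve_right (by omega)
        rcases above_spec (N := N) (t := 4 * N + 2) (J := J) .even k with ⟨-, h₁⟩ |
          ⟨j, h₁, h₂, -, h₃⟩
        · exact absurd (h₁ i hi₁) hi₂
        · exact ⟨j, h₁, h₂, h₃⟩
      have f := (F i (by omega)).1 hi₁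
      have hn := nextLow_spec N J i
      have hn₁ : nextLow N J i = lowPr N .odd k := by
        rcases hn with ⟨h₁, h₂⟩ | ⟨m, h₁, h₂, h₃, h₄, h₅⟩
        · exact absurd (h₂ k hi₁ hk) hkJ
        · have : m = k := by
            rcases lt_trichotomy m k with h₆ | h₆ | h₆
            · exact absurd (hi₃ m h₁ h₆) h₃
            · exact h₆
            · omega
          rw [h₄, this]
          rfl
      have hz : (recovering N (4 * N + 2) J k k .settled).reg
          (.z .even ⟨i, by omega⟩ : TCVertex N) = lowPr N .odd k := by
        show (recovering N (4 * N + 2) J k k .settled).z .even i = _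
        simp only [recovering, hi₁, if_true, counting, hi₂, if_false, hn₁]
      have hz' : (counting N (4 * N + 2) (insert k J)).z .even i < lowPr N .odd k := by
        have h₁ : i ∉ insert k J := fun h => hi₂ (f.1.1 h)
        have hlow : lowPr N .odd k = 2 * (N - 1 - k) + 4 := rfl
        simp only [counting, h₁, if_false]
        omega
      refine ⟨hq, hv, .z .even ⟨i, by omega⟩, hz.trans_lt hlt, hlt'.trans_eq hz.symm, hz, ?_,
        hz'.le, .l .odd ⟨k, hk⟩, ?_, ?_⟩
      · rw [owner_z, ofPriority_lowPr]
        rfl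
      · exact (ha.1.kept hv _ _ (.inr (.inr ⟨⟨i, by omega⟩, ⟨k, hk⟩, rfl, by
          show k + 1 = N; omega, hi₁, hi₂, hi₃, rfl, rfl⟩))).2.2.2.1
      · show _ < (counting N (4 * N + 2) (insert k J)).l .odd k
        rw [hl]
        exact hlt''
  · obtain ⟨y, hy, hyk, rfl, rfl⟩ := hu
    have hyk' : (y : ℕ) < k := by
      have : (y : ℕ) ≠ k := fun h => hy (h ▸ Finset.mem_insert_self k J)
      omega
    have hyJ : (y : ℕ) ∉ J := fun h => hy (Finset.mem_insert_of_mem h)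
    have hz : (recovering N (4 * N + 2) J k k .settled).reg (.z .odd y : TCVertex N) =
        lowPr N .even y := by
      show (recovering N (4 * N + 2) J k k .settled).z .odd y = _
      simp only [recovering, hyk', if_true, counting, hyJ, if_false]
    have hz' : (counting N (4 * N + 2) (insert k J)).reg (.z .odd y : TCVertex N) =
        lowPr N .even y := by
      show (counting N (4 * N + 2) (insert k J)).z .odd y = _
      simp only [counting, hy, if_false]
    rw [hz, hz', owner_z, ofPriority_lowPr]
    refine ⟨?_, rfl, rfl, ?_, (ha.1.kept hv _ _ (.inl ⟨y, hyJ, hyk', rfl, rfl⟩)).2.2.2.1, fun h => ?_⟩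
    · simp only [lowPr]; omega
    · simp only [Tail.source, lowPr]; omega
    · have := h.2
      simp only [lowPr] at this
      omega
  · have hd' : d < above N (4 * N + 2) J .odd k ∧ 1 ≤ d ∧ d < 2 * N + 4 ∧
        (∃ y < N, k < y ∧ (d = lowPr N .even y ∨ d = lowPr N .odd y)) := by
      rcases hd with ⟨y, h₁, h₂, h₃, rfl⟩ | ⟨h₁, rfl⟩
      · refine ⟨?_, ?_, ?_, y, h₁, h₃, .inl rfl⟩ <;> simp only [lowPr] <;> omega
      · have : k ≠ N - 1 := fun h => h₁ (h ▸ Finset.mem_insert_self k J)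
        refine ⟨?_, ?_, ?_, N - 1, by omega, by omega, .inr rfl⟩ <;> simp only [lowPr] <;> omega
    obtain ⟨h₁, h₂, h₃, y, hy, hky, h₄⟩ := hd'
    refine ⟨h₁, h₂, fun u hu he => ?_⟩
    rcases reg_eq_label (recovering N (4 * N + 2) J k k .settled) u with ⟨α, z, hz, h₅⟩ |
      ⟨α, z, -, h₅, -⟩
    · have f := F z hz
      rw [he] at h₅
      change 1 < _ at hu
      rw [he] at hu
      clear F hd hi
      simp only [recovering, counting, lowPr] at h₄ h₅
      cases α <;> grind
    · have := le_highPr (N := N) α z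
      omega

/-- Odd sets bit `k` by a promotion to its highest region, by which Even loses its bits. -/
theorem Ready.raise_step (hrun : IsRun (twoCounters N) v keep cs b) (hk : k + 1 < N)
    (hv : ¬ v.Recovers)
    (h : Ready v cs n (recovering N (4 * N + 2) (Finset.range k) k k .settled) (fun _ => ∅)
      (recoveringMemo N (Finset.range k) k k .settled) 1) :
    ∃ m ≥ n, states cs b n m = [Finset.univ.filter fun y =>
        (y.2 : ℕ) ∈ Finset.range k ∨ y.1 = .even ∧ k ≤ (y.2 : ℕ)] ∧
      Ready v cs m (raising N 0 k) (fun _ => ∅) (raisingMemo N 0) 2 := by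
  have ht : (4 * N + 2) % 2 = 0 := by omega
  have hJ : ∀ m ∈ Finset.range k, m < k := fun m hm => Finset.mem_range.1 hm
  obtain ⟨m, hnm, hm, ha⟩ := recovering_arrives (T := .settled) hrun ht le_rfl hJ le_rfl
    (show k < N by omega) (by simp) (by simp) (.inr (.inl hk)) (fun _ => rfl) h
  have key := ha.promotes (f' := 2) hrun
    (valid_recovering ht le_rfl hJ le_rfl (by omega) (by simp) (by simp)) (by omega)
    (recovering_raise (won := fun _ => ∅) hk hv) (Y' := raisingMemo N 0)
    (.inl (recovering_pos ht le_rfl (by omega)))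
    (fun d hd => absurd hd.1 hv) (fun h => absurd h hv) (fun d hd => ?_) (fun d _ => trivial)
    (fun h => absurd h hv)
  · refine ⟨m + 1, by omega, ?_, key.2.1⟩
    rw [states_of_nil hnm hm, key.1,
      bits_recovering hJ (by omega) ha]
  · have hd' : d = lowPr N .even 0 := hd
    have hd'' : d = 2 * (N - 1) + 3 := by rw [hd']; simp only [lowPr]; omega
    refine ⟨by omega, by simp only [Tail.source]; omega, fun u hu he => ?_⟩
    rcases reg_eq_label (recovering N (4 * N + 2) (Finset.range k) k k .settled) u with
      ⟨α, z, hz, h₅⟩ | ⟨α, z, -, h₅, -⟩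
    · obtain ⟨F₁, F₂, F₃⟩ := recovering_range_facts (N := N) (x := k) (k := k) (4 * N + 2) α z
      rw [F₁, F₂, F₃, he] at h₅
      clear hu he F₁ F₂ F₃ h ha
      cases α <;> simp only [lowPr] at h₅ <;> split_ifs at h₅ <;> omega
    · have := le_highPr (N := N) α z
      omega

theorem raising_arrives {Y : Memo (TCVertex N)} (hrun : IsRun (twoCounters N) v keep cs b)
    (hxk : x ≤ k) (hk : k + 1 < N) (h : Ready v cs n (raising N x k) won Y 2) :
    ∃ m ≥ n, states cs b n m = [] ∧ Arrived v cs m (raising N x k) won Y 2 := by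
  refine h.arrives hrun (by omega) (valid_raising hxk hk) (raising_openAbove hxk hk) (by omega) ?_
    (.inl (raising_le_reg hxk hk))
  obtain ⟨u, -, hu, -⟩ := raising_escape hxk hk
  exact ⟨u, hu⟩

/-- Even recovers bit `x`. -/
theorem Ready.raising_step (hrun : IsRun (twoCounters N) v keep cs b) (hxk : x < k)
    (hk : k + 1 < N) (hv : ¬ v.Recovers)
    (h : Ready v cs n (raising N x k) (fun _ => ∅) (raisingMemo N x) 2) :
    ∃ m ≥ n, (∃ S, states cs b n m = [S] ∧ S ⊆ (Finset.univ.filter fun y => (y.2 : ℕ) < k + 1) ∧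
        (.odd, ⟨k, by omega⟩) ∈ S) ∧
      Ready v cs m (raising N (x + 1) k) (fun _ => ∅) (raisingMemo N (x + 1)) 2 := by
  obtain ⟨m, hnm, hm, ha⟩ := raising_arrives hrun hxk.le hk h
  have key := ha.promotes (f' := 2) hrun (valid_raising hxk.le hk) (by omega)
    (raising_raise (won := fun _ => ∅) hxk hk hv) (Y' := raisingMemo N (x + 1))
    (.inl (raising_le_reg hxk.le hk))
    (fun d hd => absurd hd.1 hv) (fun h => absurd h hv) (fun d hd => ?_) (fun d _ => trivial)
    (fun h => absurd h hv)
  · obtain ⟨h₁, h₂⟩ := bits_raising hxk.le hk (by exact rfl) ha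
    refine ⟨m + 1, by omega, ⟨bits (cs m), ?_, h₁, h₂⟩, key.2.1⟩
    rw [states_of_nil hnm hm, key.1]
  · have hd' : d = lowPr N .even (x + 1) := hd
    simp only [lowPr] at hd'
    refine ⟨by omega, by omega, fun u hu he => ?_⟩
    rcases reg_eq_label (raising N x k) u with ⟨α, z, hz, h₅⟩ | ⟨α, z, -, h₅, -⟩
    · rw [he] at h₅
      clear hu he h ha hd
      cases α <;> simp only [raising, lowPr] at h₅ <;> split_ifs at h₅ <;> omega
    · have := le_highPr (N := N) α z
      omega

/-- Even recovers the last bit, and then both counters show the same bits. -/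
theorem Ready.raising_complete_step (hrun : IsRun (twoCounters N) v keep cs b)
    (hk : k + 1 < N) (hv : ¬ v.Recovers)
    (h : Ready v cs n (raising N k k) (fun _ => ∅) (raisingMemo N k) 2) :
    ∃ m ≥ n, (∃ S, states cs b n m = [S] ∧ S ⊆ (Finset.univ.filter fun y => (y.2 : ℕ) < k + 1) ∧
        (.odd, ⟨k, by omega⟩) ∈ S) ∧
      Ready v cs m (counting N (4 * N + 2) (Finset.range (k + 1))) (fun _ => ∅)
        (countingMemo N (Finset.range (k + 1)) (k + 1)) 2 := by
  obtain ⟨m, hnm, hm, ha⟩ := raising_arrives hrun le_rfl hk h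
  have key := ha.promotes (f' := 2) hrun (valid_raising le_rfl hk) (by omega)
    (raising_complete (won := fun _ => ∅) hk hv)
    (Y' := countingMemo N (Finset.range (k + 1)) (k + 1))
    (.inl (raising_le_reg le_rfl hk))
    (fun d hd => absurd hd.1 hv) (fun h => absurd h hv) (fun d hd => hd.elim) (fun d _ => trivial)
    (fun h => absurd h hv)
  obtain ⟨h₁, h₂⟩ := bits_raising le_rfl hk (by exact rfl) ha
  refine ⟨m + 1, by omega, ⟨bits (cs m), ?_, h₁, h₂⟩, key.2.1⟩
  rw [← states_append (by omega : n ≤ m) (by omega : m ≤ m + 1), hm, key.1]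
  rfl

/-! ### One round of counting -/

/-- The state in which both counters show the bits in `J`. -/
def evenState (N : ℕ) (J : Finset ℕ) : Finset (Player × Fin N) :=
  Finset.univ.filter fun y => (y.2 : ℕ) ∈ J

/-- The state after Even has set bit `k` of the counters that show `J`, where all bits lower
than `k` are in `J`, and those of Odd have been reset. -/
def oddState (N : ℕ) (J : Finset ℕ) (k : ℕ) : Finset (Player × Fin N) :=
  Finset.univ.filter fun y => (y.2 : ℕ) ∈ J.filter (· < k) ∨ y.1 = .even ∧ k ≤ (y.2 : ℕ)

/-- How many bits get through the promotion depends on the variant. -/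
theorem SetsEven.exists (v : Variant) (hk : k < N) (hkJ : k ∉ J)
    (hlow : ∀ m, k < m → m < N → m ∈ J) :
    ∃ x T, SetsEven N v J x k T ∧ (x < k → ∃ i < x, i ∉ J) := by
  have hv : v = .pp ∨ (v ≠ .pp ∧ (¬ v.Recovers)) ∨ (v ≠ .pp ∧ v.Recovers) := by
    cases v <;> simp [Variant.Recovers]
  by_cases hR : v.Recovers
  · exact ⟨k, .settled, ⟨hk, hkJ, hlow, le_rfl, by omega, .inl rfl, .inr (.inr hR), by simp, by simp,
      by simp, fun _ _ => ⟨fun h => by subst h; simp [Variant.Recovers] at hR, by simp⟩⟩, by omega⟩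
  -- the bits of Odd that are lower than the next unset bit above `k` do not get through
  obtain ⟨x, hxk, hmid, hx⟩ : ∃ x ≤ k, (∀ m, x ≤ m → m < k → m ∈ J) ∧
      (x = 0 ∨ 0 < x ∧ x - 1 ∉ J) := by
    clear hlow hkJ hk
    induction k with
    | zero => exact ⟨0, le_rfl, by omega, .inl rfl⟩
    | succ k ih =>
      by_cases hk : k ∈ J
      · obtain ⟨x, h₁, h₂, h₃⟩ := ih
        refine ⟨x, by omega, fun m hm hmk => ?_, h₃⟩
        rcases Nat.lt_succ_iff_lt_or_eq.1 hmk with h | rfl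
        · exact h₂ m hm h
        · exact hk
      · exact ⟨k + 1, le_rfl, by omega, .inr ⟨by omega, by simpa using hk⟩⟩
  have hlast : v = .pp ∨ v ≠ .pp := em _
  rcases hx with rfl | hx
  · have hm : ∀ m < k, m ∈ J := fun m hm => hmid m (by omega) hm
    by_cases hpp : v = .pp ∧ k + 1 < N
    · exact ⟨k, .lost, ⟨hk, hkJ, hlow, le_rfl, by omega, .inl rfl, .inr (.inl hm),
        fun h => absurd h hR, fun _ => hpp, by simp, by simp⟩, by omega⟩
    · exact ⟨k, .settled, ⟨hk, hkJ, hlow, le_rfl, by omega, .inl rfl, .inr (.inl hm),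
        fun h => absurd h hR, by simp, by simp, fun _ h => ⟨fun h' => hpp ⟨h', h⟩, by simp⟩⟩,
        by omega⟩
  · have hi : x < k → ∃ i < x, i ∉ J := fun _ => ⟨x - 1, by omega, hx.2⟩
    by_cases hpp : v = .pp ∧ k + 1 < N
    · exact ⟨x, .lost, ⟨hk, hkJ, hlow, hxk, hmid, .inr hx, .inl hx,
        fun h => absurd h hR, fun _ => hpp, by simp, by simp⟩, hi⟩
    · by_cases hst : x < k ∧ k + 1 < N
      · exact ⟨x, .stale, ⟨hk, hkJ, hlow, hxk, hmid, .inr hx, .inl hx,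
          fun h => absurd h hR, by simp, fun _ => hst, fun _ h => ⟨fun h' => hpp ⟨h', h⟩, by simp⟩⟩,
          hi⟩
      · exact ⟨x, .settled, ⟨hk, hkJ, hlow, hxk, hmid, .inr hx, .inl hx,
          fun h => absurd h hR, by simp, by simp,
          fun _ h => ⟨fun h' => hpp ⟨h', h⟩, fun _ => by omega⟩⟩, hi⟩

theorem subset_oddState (hxk : x ≤ k) (hmid : ∀ m, x ≤ m → m < k → m ∈ J) :
    (Finset.univ.filter fun y : Player × Fin N =>
      (y.2 : ℕ) ∈ J.filter (· < x) ∨ y.1 = .even ∧ x ≤ (y.2 : ℕ)) ⊆ oddState N J k := by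
  intro y hy
  simp only [oddState, Finset.mem_filter, Finset.mem_univ, true_and] at hy ⊢
  rcases hy with ⟨h₁, h₂⟩ | ⟨h₁, h₂⟩
  · exact .inl ⟨h₁, by omega⟩
  · rcases lt_or_ge (y.2 : ℕ) k with h | h
    · exact .inl ⟨hmid _ h₂ h, h⟩
    · exact .inr ⟨h₁, h⟩

/-- After Even has set bit `k`, the bits that this promotion did not let through are recovered. -/
theorem Ready.recover (hrun : IsRun (twoCounters N) v keep cs b) (hk : k < N) (hxk : x ≤ k)
    (hv : ¬ v.Recovers) (hmid : ∀ m, x ≤ m → m < k → m ∈ J) (hi : x < k → ∃ i < x, i ∉ J)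
    (hT : T = .stale → x < k) (hT' : T ≠ .settled → k + 1 < N)
    (h : Ready v cs n (recovering N (4 * N + 2) (J.filter (· < x)) x k T) (fun _ => ∅)
      (recoveringMemo N (J.filter (· < x)) x k T) (T.source N k)) :
    ∃ m ≥ n, (∀ S ∈ states cs b n m, S ⊆ oddState N J k ∧ (.even, ⟨k, hk⟩) ∈ S) ∧
      Ready v cs m (recovering N (4 * N + 2) (J.filter (· < k)) k k .settled) (fun _ => ∅)
        (recoveringMemo N (J.filter (· < k)) k k .settled) 1 := by
  induction hd : k - x generalizing x n T with
  | zero =>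
    obtain rfl : x = k := by omega
    by_cases hTs : T = .settled
    · subst hTs
      exact ⟨n, le_rfl, by simp [states], h⟩
    · obtain ⟨m, hnm, ⟨S, hS, hS₁, hS₂⟩, hm⟩ := h.settle_step hrun (by simp) hxk hT (hT' hTs) hTs hv
      refine ⟨m, hnm, ?_, hm⟩
      rw [hS]
      simp only [List.mem_singleton, forall_eq]
      exact ⟨hS₁.trans (subset_oddState hxk hmid), hS₂⟩
  | succ d ih =>
    have hx : x < k := by omega
    obtain ⟨i, hi₁, hi₂⟩ := hi hx
    have step : ∀ n, Ready v cs n (recovering N (4 * N + 2) (J.filter (· < x)) x k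
          .settled) (fun _ => ∅) (recoveringMemo N (J.filter (· < x)) x k .settled) 1 →
        ∃ m ≥ n, (∀ S ∈ states cs b n m, S ⊆ oddState N J k ∧
            (.even, ⟨k, hk⟩) ∈ S) ∧
          Ready v cs m (recovering N (4 * N + 2) (J.filter (· < k)) k
              k .settled) (fun _ => ∅)
            (recoveringMemo N (J.filter (· < k)) k k
              .settled) 1 := by
      intro n h
      obtain ⟨T', hT₁⟩ : ∃ T' : Tail, T' = .lost ∧ k + 1 < N ∨
          T' = .settled ∧ k + 1 = N := by
        rcases Nat.lt_or_eq_of_le (show k + 1 ≤ N by omega) with h | h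
        · exact ⟨.lost, .inl ⟨rfl, h⟩⟩
        · exact ⟨.settled, .inr ⟨rfl, h⟩⟩
      obtain ⟨m, hnm, ⟨S, hS, hS₁, hS₂⟩, hm⟩ := h.recover_step hrun (by simp) hx hk hT₁
        ⟨i, hi₁, by simp [hi₂]⟩ hv
      have hJ : insert x (J.filter (· < x)) = J.filter (· < x + 1) := by
        ext y
        simp only [Finset.mem_insert, Finset.mem_filter]
        have := hmid x le_rfl hx
        constructor
        · rintro (rfl | ⟨h₁, h₂⟩)
          · exact ⟨this, by omega⟩
          · exact ⟨h₁, by omega⟩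
        · rintro ⟨h₁, h₂⟩
          by_cases hy : y = x
          · exact .inl hy
          · exact .inr ⟨h₁, by omega⟩
      rw [hJ] at hm
      obtain ⟨m', hm', hL, hR⟩ := ih (by omega) (fun m h₁ h₂ => hmid m (by omega) h₂)
        (fun _ => ⟨i, by omega, hi₂⟩) (fun h => by rcases hT₁ with ⟨rfl, -⟩ | ⟨rfl, -⟩ <;> cases h)
        (fun h => by
          rcases hT₁ with ⟨-, h₁⟩ | ⟨h₁, -⟩
          · exact h₁
          · exact absurd h₁ h) hm (by omega)
      refine ⟨m', hnm.trans hm', fun S' hS' => ?_, hR⟩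
      rw [← states_append hnm hm', hS, List.mem_append, List.mem_singleton] at hS'
      rcases hS' with rfl | hS'
      · exact ⟨hS₁.trans (subset_oddState hxk hmid), hS₂⟩
      · exact hL S' hS'
    by_cases hTs : T = .settled
    · subst hTs
      exact step n h
    · obtain ⟨m, hnm, ⟨S, hS, hS₁, hS₂⟩, hm⟩ := h.settle_step hrun (by simp) hxk hT (hT' hTs) hTs hv
      obtain ⟨m', hm', hL, hR⟩ := step m hm
      refine ⟨m', hnm.trans hm', fun S' hS' => ?_, hR⟩
      rw [← states_append hnm hm', hS, List.mem_append, List.mem_singleton] at hS'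
      rcases hS' with rfl | hS'
      · exact ⟨hS₁.trans (subset_oddState hxk hmid), hS₂⟩
      · exact hL S' hS'

/-- If all bits above bit `k` of Odd are set, then Even recovers its bits one by one. -/
theorem Ready.raise (hrun : IsRun (twoCounters N) v keep cs b) (hk : k + 1 < N) (hxk : x ≤ k)
    (hv : ¬ v.Recovers)
    (h : Ready v cs n (raising N x k) (fun _ => ∅) (raisingMemo N x) 2) :
    ∃ m ≥ n, (∀ S ∈ states cs b n m, S ⊆ evenState N (Finset.range (k + 1)) ∧
        (.odd, ⟨k, by omega⟩) ∈ S) ∧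
      Ready v cs m (counting N (4 * N + 2) (Finset.range (k + 1))) (fun _ => ∅)
        (countingMemo N (Finset.range (k + 1)) (k + 1)) 2 := by
  have hsub : ∀ S : Finset (Player × Fin N),
      S ⊆ (Finset.univ.filter fun y => (y.2 : ℕ) < k + 1) →
      S ⊆ evenState N (Finset.range (k + 1)) := fun S hS y hy => by
    simpa [evenState] using hS hy
  induction hd : k - x generalizing x n with
  | zero =>
    obtain rfl : x = k := by omega
    obtain ⟨m, hnm, ⟨S, hS, hS₁, hS₂⟩, hm⟩ := h.raising_complete_step hrun hk hv
    refine ⟨m, hnm, ?_, hm⟩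
    rw [hS]
    simp only [List.mem_singleton, forall_eq]
    exact ⟨hsub S hS₁, hS₂⟩
  | succ d ih =>
    obtain ⟨m, hnm, ⟨S, hS, hS₁, hS₂⟩, hm⟩ := h.raising_step hrun (by omega) hk hv
    obtain ⟨m', hm', hL, hR⟩ := ih (by omega) hm (by omega)
    refine ⟨m', hnm.trans hm', fun S' hS' => ?_, hR⟩
    rw [← states_append hnm hm', hS, List.mem_append, List.mem_singleton] at hS'
    rcases hS' with rfl | hS'
    · exact ⟨hsub _ hS₁, hS₂⟩
    · exact hL S' hS'

/-- Both counters are increased by one. -/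
theorem Ready.count (hrun : IsRun (twoCounters N) v keep cs b) (hk : k < N) (hkJ : k ∉ J)
    (hlow : ∀ m, k < m → m < N → m ∈ J) (hi : k + 1 < N ∨ ∃ i < k, i ∉ J)
    (h : Ready v cs n (counting N (4 * N + 2) J) (fun _ => ∅) (countingMemo N J o) 2) :
    ∃ m ≥ n, ∃ L L' o',
      states cs b n m = evenState N J :: (L ++ oddState N J k :: L') ∧
      (∀ S ∈ L, S ⊆ oddState N J k ∧ (.even, ⟨k, hk⟩) ∈ S) ∧
      (∀ S ∈ L', S ⊆ evenState N (insert k (J.filter (· < k))) ∧ (.odd, ⟨k, hk⟩) ∈ S) ∧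
      (v.Recovers → L = [] ∧ L' = []) ∧
      Ready v cs m (counting N (4 * N + 2) (insert k (J.filter (· < k)))) (fun _ => ∅)
        (countingMemo N (insert k (J.filter (· < k))) o') 2 := by
  obtain ⟨x, T, hs, hx⟩ := SetsEven.exists v hk hkJ hlow
  obtain ⟨n₁, hn₁, hS₁, h₁, -⟩ := h.counting_step hrun hs
  obtain ⟨n₂, hn₂, hS₂, hr, h₂⟩ : ∃ m ≥ n₁, (∀ S ∈ states cs b n₁ m,
      S ⊆ oddState N J k ∧ (.even, ⟨k, hk⟩) ∈ S) ∧ (v.Recovers → states cs b n₁ m = []) ∧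
      Ready v cs m (recovering N (4 * N + 2) (J.filter (· < k)) k k .settled) (fun _ => ∅)
        (recoveringMemo N (J.filter (· < k)) k k .settled) 1 := by
    by_cases hv : v.Recovers
    · obtain ⟨rfl, rfl⟩ := hs.recovers hv
      exact ⟨n₁, le_rfl, by simp [states], fun _ => by simp [states], h₁⟩
    · obtain ⟨m, hm₁, hm₂, hm₃⟩ := h₁.recover hrun hk hs.le hv hs.mid hx (fun hT => (hs.stale hT).1)
        (fun hT => by
          cases T
          · exact absurd rfl hT
          · exact (hs.stale rfl).2
          · exact (hs.lost rfl).2)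
      exact ⟨m, hm₁, hm₂, fun h => absurd h hv, hm₃⟩
  by_cases hc : (∃ i < k, i ∉ J) ∨ v.Recovers ∧ k + 1 < N
  · obtain ⟨n₃, hn₃, hS₃, h₃⟩ := h₂.complete_step hrun (by simp) hk
      (hc.imp_left fun ⟨i, hi₁, hi₂⟩ => ⟨i, hi₁, by simp [hi₂]⟩)
    refine ⟨n₃, by omega, states cs b n₁ n₂, [], _, ?_, hS₂, by simp, fun hv => ⟨hr hv, rfl⟩, h₃⟩
    rw [← states_append (by omega : n ≤ n₁) (by omega : n₁ ≤ n₃), ← states_append hn₂ hn₃, hS₁, hS₃]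
    rfl
  · push Not at hc
    have hv : ¬ v.Recovers := fun hv => by
      have := hc.2 hv
      obtain ⟨i, hi₁, hi₂⟩ := hi.resolve_left (by omega)
      exact hi₂ (hc.1 i hi₁)
    have hkN : k + 1 < N := hi.resolve_right fun ⟨i, hi₁, hi₂⟩ => hi₂ (hc.1 i hi₁)
    have hJ : J.filter (· < k) = Finset.range k := by
      ext y
      rw [Finset.mem_filter, Finset.mem_range]
      exact ⟨fun h => h.2, fun h => ⟨hc.1 y h, h⟩⟩
    have hJ' : insert k (Finset.range k) = Finset.range (k + 1) := Finset.range_add_one.symm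
    rw [hJ] at h₂
    obtain ⟨n₃, hn₃, hS₃, h₃⟩ := h₂.raise_step hrun hkN hv
    obtain ⟨n₄, hn₄, hS₄, h₄⟩ := h₃.raise hrun hkN (Nat.zero_le k) hv
    rw [hJ, hJ']
    refine ⟨n₄, by omega, states cs b n₁ n₂, states cs b n₃ n₄, _, ?_, hS₂, hS₄,
      fun h => absurd h hv, h₄⟩
    rw [← states_append (by omega : n ≤ n₁) (by omega : n₁ ≤ n₄),
      ← states_append hn₂ (by omega : n₂ ≤ n₄), ← states_append hn₃ hn₄, hS₁, hS₃]
    simp only [oddState, evenState, hJ]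
    rfl

/-! ### Removing the dominions -/

/-- The search starts with both counters at zero. -/
theorem Ready.initial (hrun : IsRun (twoCounters N) v keep cs b) (hN : 1 ≤ N) :
    Ready v cs 0 (counting N (4 * N + 2) ∅) (fun _ => ∅) (countingMemo N ∅ 0) 2 := by
  have hA : (counting N (4 * N + 2) ∅).Valid N := valid_counting (by omega) le_rfl ∅
  have hreg : ∀ u : TCVertex N, (counting N (4 * N + 2) ∅).reg u < 4 * N + 4 := by
    intro u
    rcases reg_eq_label (counting N (4 * N + 2) ∅) u with ⟨α, y, hy, h⟩ | ⟨α, y, -, h, -⟩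
    · have f : nextLow N ∅ y ≤ 2 * N + 2 := by
        rcases nextLow_spec N ∅ y with ⟨h₁, -⟩ | ⟨m, -, -, -, h₁, -⟩ <;> omega
      generalize (counting N (4 * N + 2) ∅).reg u = r at h ⊢
      cases α <;> simp only [counting, Finset.notMem_empty, if_false, lowPr] at h <;> omega
    · have := y.isLt
      cases α <;> simp only [highPr] at h <;> omega
  have hl : ∀ α (y : Fin N), (counting N (4 * N + 2) ∅).reg (.l α y : TCVertex N) = lowPr N α y :=
    fun α y => rfl
  obtain ⟨h₁, h₂, h₃⟩ := Follows.initial (G := twoCounters N) (v := v)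
    (X := (counting N (4 * N + 2) ∅).layout N fun _ => ∅) (Y := countingMemo N ∅ 0)
    (hA.isDecomposition _) (by ext u; simp [mem_alive, hreg])
    ⟨.l .even ⟨0, hN⟩, mem_alive.2 (hreg _)⟩ (fun _ => rfl)
    (fun u => by cases u <;> simp [layout, counting])
    (fun u w => by simp [countingMemo])
    (fun d hd => by
      rcases hd with ⟨y, hy, -, -, rfl⟩ | ⟨-, rfl⟩
      · exact ⟨.l .even ⟨y, hy⟩, mem_alive.2 (hreg _), rfl⟩
      · exact ⟨.l .odd ⟨N - 1, by omega⟩, mem_alive.2 (hreg _), rfl⟩)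
  rw [← hrun.1] at h₁ h₂ h₃
  refine ⟨_, h₁, ?_, .inr h₃⟩
  refine le_trans ?_ (h₂ (.l .even ⟨0, hN⟩) (mem_alive.2 (hreg _)))
  show 2 ≤ (counting N (4 * N + 2) ∅).reg (.l .even ⟨0, hN⟩ : TCVertex N)
  rw [hl]
  simp only [lowPr]
  omega

theorem remaining_reg_last (hN : 1 ≤ N) {u : TCVertex N} (hu : ¬ u.EvenWins) :
    (remaining N (N - 1)).reg u = (dominating N).reg u := by
  have F := recovering_last_facts (N := N) (4 * N + 4) (N - 1)
  have F' := recovering_last_facts (N := N) (4 * N + 2) (N - 1)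
  have h₄ : ofPriority (4 * N + 4) = .even := ofPriority_eq_even.2 (by omega)
  have h₂ : ofPriority (4 * N + 2) = .even := ofPriority_eq_even.2 (by omega)
  have hne : (Player.odd = Player.even) = False := by simp
  have hne' : (Player.even = Player.odd) = False := by simp
  simp only [remaining, dominating]
  cases u with
  | h α y =>
    have f := F _ (TCVertex.next y).isLt 0
    have f' := F' _ (TCVertex.next y).isLt 0
    cases α <;> simp only [reg, TCVertex.EvenWins, hne, f, f', not_true_eq_false] at hu ⊢
  | a α y i =>
    have f := F y y.isLt (i + 1)
    have f' := F' y y.isLt (i + 1)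
    have g := F i (i.isLt.trans y.isLt) 0
    have g' := F' i (i.isLt.trans y.isLt) 0
    cases α <;> simp only [reg, TCVertex.EvenWins, hne, f, f', g, g', not_true_eq_false] at hu ⊢
  | b α y i =>
    have f := F y y.isLt (i + 1)
    have f' := F' y y.isLt (i + 1)
    have g := F i (i.isLt.trans y.isLt) 0
    have g' := F' i (i.isLt.trans y.isLt) 0
    have hi : (i : ℕ) < N - 1 := by have := y.isLt; have := i.isLt; omega
    have h₃ : ofPriority (4 * N + 3) = .odd := ofPriority_eq_odd.2 (by omega)
    cases α <;> simp only [reg, TCVertex.EvenWins, hne', opp, comb, f, f', g, g', h₂, h₃, h₄, hi,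
      not_true_eq_false, if_false, if_true] at hu ⊢
  | _ α y =>
    have f := F y y.isLt 0
    have f' := F' y y.isLt 0
    cases α <;> simp only [reg, TCVertex.EvenWins, hne, f, f', not_true_eq_false] at hu ⊢

theorem dominating_reg_le (hN : 1 ≤ N) {u : TCVertex N} (hu : ¬ u.EvenWins) :
    (dominating N).reg u = 4 * N + 3 ∨ (dominating N).reg u ≤ (remaining N 0).reg u := by
  have F := recovering_last_facts (N := N) (4 * N + 4) 0
  have F' := recovering_last_facts (N := N) (4 * N + 2) (N - 1)
  have hne : (Player.odd = Player.even) = False := by simp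
  have hne' : (Player.even = Player.odd) = False := by simp
  simp only [remaining, dominating, Finset.range_zero] at *
  cases u with
  | h α y =>
    have f := F _ (TCVertex.next y).isLt 0
    have f' := F' _ (TCVertex.next y).isLt 0
    have := y.isLt
    cases α <;> simp only [reg, TCVertex.EvenWins, hne, f, f', not_true_eq_false, highPr,
      lowPr] at hu ⊢ <;> grind
  | a α y i =>
    have f := F y y.isLt (i + 1)
    have f' := F' y y.isLt (i + 1)
    have g := F i (i.isLt.trans y.isLt) 0
    have g' := F' i (i.isLt.trans y.isLt) 0
    have := y.isLt
    have := i.isLt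
    cases α <;> simp only [reg, TCVertex.EvenWins, hne, f, f', g, g', not_true_eq_false, opp,
      comb_even, lowPr] at hu ⊢ <;> grind
  | b α y i =>
    have f := F y y.isLt (i + 1)
    have f' := F' y y.isLt (i + 1)
    have g := F i (i.isLt.trans y.isLt) 0
    have g' := F' i (i.isLt.trans y.isLt) 0
    have := y.isLt
    have := i.isLt
    cases α <;> simp only [reg, TCVertex.EvenWins, hne', f, f', g, g', not_true_eq_false, opp,
      comb_odd, lowPr] at hu ⊢ <;> grind
  | _ α y =>
    have f := F y y.isLt 0
    have f' := F' y y.isLt 0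
    have := y.isLt
    cases α <;> simp only [reg, TCVertex.EvenWins, hne, f, f', not_true_eq_false,
      lowPr] at hu ⊢ <;> grind

/-- When Even has set the lowest bit as well, its counter is a dominion and is removed; how many
bits of Odd are still set then depends on how the next search starts. -/
theorem Ready.remove_even (hrun : IsRun (twoCounters N) v keep cs b) (hN : 1 ≤ N)
    (hx : (v.Recovers ∧ keep = true) ∧ x = N - 1 ∨ ¬ (v.Recovers ∧ keep = true) ∧ x = 0)
    (h : Ready v cs n (counting N (4 * N + 2) (Finset.range (N - 1))) (fun _ => ∅)
      (countingMemo N (Finset.range (N - 1)) o) 2) :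
    ∃ m ≥ n, states cs b n m = [evenState N (Finset.range (N - 1))] ∧
      ∃ won : Player → Finset (TCVertex N), (∀ y, .l .even y ∈ won .even) ∧ won .odd = ∅ ∧
      Ready v cs m (remaining N x) won (remainingMemo N x) 1 := by
  have hs : SetsEven N v (Finset.range (N - 1)) (N - 1) (N - 1) .settled :=
    ⟨by omega, by simp, by omega, le_rfl, by omega, .inl rfl,
      .inr (.inl fun m hm => Finset.mem_range.2 hm), by simp, by simp, by simp, by omega⟩
  obtain ⟨m, hnm, hm, -, hF, hp⟩ := h.counting_step hrun hs
  have hJ : (Finset.range (N - 1)).filter (· < N - 1) = Finset.range (N - 1) :=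
    Finset.filter_true_of_mem fun y hy => Finset.mem_range.1 hy
  have hp' : (cs m).p = 4 * N + 2 := by
    rw [hp]
    rcases above_spec (N := N) (t := 4 * N + 2) (J := Finset.range (N - 1)) .even (N - 1) with
      ⟨h₁, -⟩ | ⟨j, h₁, h₂, -⟩
    · exact h₁
    · exact absurd (Finset.mem_range.2 h₁) h₂
  rw [hJ] at hF
  change Follows _ v ((dominating N).layout N _) _ _ _ at hF
  have hA : (dominating N).Valid N :=
    valid_recovering (by omega) le_rfl (by simp) le_rfl (by omega) (by simp) (by simp)
  have hX := hA.isDecomposition fun _ => ∅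
  have hxN : x < N := by omega
  have hA' : (remaining N x).Valid N :=
    valid_recovering (by omega) (by omega) (by simp) (by omega) (by omega) (by simp) (by simp)
  have hpar : ofPriority (cs m).p = .even := by rw [hp', ofPriority_eq_even]; omega
  have hlow : lowPr N .even (N - 1) = 3 := by simp only [lowPr]; omega
  have hnb : ¬ (v.Recovers ∧ (cs m).p = lowPr N .even (N - 1)) := fun h => by
    have := h.2
    omega
  obtain ⟨σ, hσ, hstep⟩ := hrun.2 m
  have hD := dominating_isDominion (won := fun _ => ∅) hN
  rw [← hp'] at hD
  set X := (dominating N).layout N (fun _ => (∅ : Finset (TCVertex N))) with hXdef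
  rw [hF.step_dominion hX hnb hD] at hstep
  set won : Player → Finset (TCVertex N) := fun α =>
    if α = ofPriority (cs m).p then X.won α ∪ X.region (cs m).p else X.won α with hwon
  have hal : ∀ u, u ∈ ((remaining N x).layout N won).alive ↔ ¬ u.EvenWins := fun u =>
    mem_alive_remaining hxN
  have hreg : v.Recovers → keep = true → ∀ u ∈ ((remaining N x).layout N won).alive,
      (remaining N x).reg u = (dominating N).reg u := by
    intro hv hk u hu
    obtain ⟨-, rfl⟩ := hx.resolve_right fun h => h.1 ⟨hv, hk⟩
    exact remaining_reg_last hN ((hal u).1 hu)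
  have key := hF.of_dominion (keep := keep) (σ := σ)
    (X' := (remaining N x).layout N won) (Y' := remainingMemo N x)
    (bad' := fun d => keep = true ∧ v.Recovers ∧ d = lowPr N .even (N - 1)) hX hnb hσ
    (hA'.isDecomposition won) ?_ ⟨.l .odd ⟨0, hN⟩, (hal _).2 (by simp [TCVertex.EvenWins])⟩
    (fun _ => rfl) ?_ ?_ hreg (fun _ _ h => h) (fun _ h => h) (fun _ => trivial) ?_
    (fun hk x hx => ⟨hk, hx⟩) (fun x hx => ⟨hx.1, hx.2, by rw [hx.2.2]; omega⟩)
  · obtain ⟨c', hc', hF', htop, hhit⟩ := key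
    rw [hc'] at hstep
    obtain ⟨hc, hb⟩ := Prod.mk.inj hstep
    rw [hc] at hF' htop hhit
    refine ⟨m + 1, by omega, ?_, won, fun y => ?_, ?_, _, hF', ?_, hhit⟩
    · rw [← states_append (by omega : n ≤ m) (by omega : m ≤ m + 1), hm,
        states_eq_nil (n := m) fun i h₁ h₂ => by
          obtain rfl : i = m := by omega
          exact hb.symm]
      rfl
    · rw [hwon]
      simp only [hpar, if_true]
      refine Finset.mem_union_right _ (Layout.mem_region.2 ⟨mem_alive_dominating hN _, ?_⟩)
      rw [hp']
      exact (dominating_reg hN (.l .even y)).1.2 rfl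
    · rw [hwon]
      simp [hpar, hXdef, layout]
    · have h₁ : 1 ≤ (remaining N x).reg (.l .odd ⟨0, hN⟩ : TCVertex N) :=
        recovering_pos (by omega) (by omega) (by omega) _
      exact h₁.trans (htop (.l .odd ⟨0, hN⟩) ((hal _).2 (by simp [TCVertex.EvenWins])))
  · ext u
    rw [hal, Finset.mem_sdiff, Layout.mem_region, hp', show X.reg u = (dominating N).reg u from rfl,
      (dominating_reg hN u).1]
    have hu : u ∈ X.alive := mem_alive_dominating hN u
    exact ⟨fun h => ⟨hu, fun h' => h h'.2⟩, fun h h' => h.2 ⟨hu, h'⟩⟩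
  · intro hk u hu d hR hr
    have hne := (hal u).1 hu
    by_cases hv : v.Recovers
    · rcases hF.below u (mem_alive_dominating hN u) with h₁ | ⟨d', h₁, h₂⟩
      · left
        change d ≤ (remaining N x).reg u
        rw [hreg hv hk u hu]
        rw [hr] at h₁
        exact_mod_cast h₁
      · right
        rw [hr] at h₂
        have : d = d' := by exact_mod_cast h₂
        exact this ▸ ⟨hk, h₁⟩
    · left
      obtain ⟨-, rfl⟩ := hx.resolve_left fun h => hv h.1.1
      have hd : ofPriority d = .even := by
        rw [hpar] at hR
        cases v <;> simp [Variant.Resets, Variant.Recovers] at hR hv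
        all_goals exact hR
      rcases dominating_reg_le hN hne with h₁ | h₁
      · have h₂ := hF.above u (mem_alive_dominating hN u) (by
          rw [hp', show X.reg u = (dominating N).reg u from rfl]
          omega)
        rw [hr, show X.reg u = (dominating N).reg u from rfl, h₁] at h₂
        have h₃ : d = 4 * N + 3 := by exact_mod_cast h₂
        rw [ofPriority_eq_even] at hd
        omega
      · refine le_trans ?_ h₁
        rcases hF.below u (mem_alive_dominating hN u) with h₁ | ⟨d', h₁, h₂⟩
        · rw [hr] at h₁
          exact_mod_cast h₁
        · exact absurd h₁.1 hv
  · intro u hu hc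
    have hne := (hal u).1 hu
    cases u with
    | t α y =>
      cases α
      · exact absurd rfl hne
      have hy : (y : ℕ) < x := by simpa [layout, remaining, recovering] using hc
      obtain ⟨hv, rfl⟩ := hx.resolve_right fun h => by omega
      have hg : (dominating N).g .odd y = 4 * N + 3 := by
        obtain ⟨-, -, -, -, -, h₁, -⟩ :=
          recovering_last_facts (N := N) (4 * N + 2) (N - 1) y y.isLt 0
        rw [if_pos hy] at h₁
        exact h₁
      refine ⟨hv.2, hv.1.not_resets _ _, hreg hv.1 hv.2 _ hu, .inl (Finset.mem_range.2 hy), ?_⟩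
      rintro ⟨-, -, h₁⟩
      change (dominating N).g .odd y = _ at h₁
      omega
    | _ => exact hc.elim
  · rintro hv d ⟨hd, rfl⟩
    have hk : keep = false := by
      by_contra hk
      rcases hx with h | h
      · omega
      · exact h.1 ⟨hv, by simpa using hk⟩
    refine ⟨hk, .l .odd ⟨x, hxN⟩, (hal _).2 (by simp [TCVertex.EvenWins]), ?_⟩
    obtain ⟨-, -, -, -, h₁, -⟩ :=
      recovering_last_facts (N := N) (4 * N + 4) x x hxN 0
    rw [if_neg (lt_irrefl _)] at h₁
    exact h₁

/-! ### The remaining game -/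

theorem remaining_arrives (hrun : IsRun (twoCounters N) v keep cs b) (hx : x < N)
    (h : Ready v cs n (remaining N x) won (remainingMemo N x) 1) :
    ∃ m ≥ n, states cs b n m = [] ∧ Arrived v cs m (remaining N x) won (remainingMemo N x) 1 :=
  recovering_arrives (T := .settled) hrun (by omega) (by omega) (by simp) (by omega) (by omega)
    (by simp) (by simp) (.inl le_rfl) (fun _ => rfl) h

theorem above_range_odd (N t x : ℕ) : above N t (Finset.range x) .odd x = 4 * N + 3 := by
  rcases above_spec (N := N) (t := t) (J := Finset.range x) .odd x with ⟨h₁, -⟩ | ⟨j, h₁, h₂, -⟩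
  · exact h₁
  · exact absurd (Finset.mem_range.2 h₁) h₂

/-- Without its distractions, Odd sets its bits again one by one. -/
theorem Ready.remaining_step (hrun : IsRun (twoCounters N) v keep cs b) (hx : x + 1 < N)
    (hE : ∀ y, TCVertex.l .even y ∈ won .even) (hO : won .odd = ∅)
    (h : Ready v cs n (remaining N x) won (remainingMemo N x) 1) :
    ∃ m ≥ n, states cs b n m = [Finset.univ.filter fun y => y.1 = .even ∨ (y.2 : ℕ) < x] ∧
      Ready v cs m (remaining N (x + 1)) won (remainingMemo N (x + 1)) 1 := by
  obtain ⟨m, hnm, hm, ha⟩ := remaining_arrives hrun (by omega) h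
  have hA : (remaining N x).Valid N :=
    valid_recovering (by omega) (by omega) (by simp) (by omega) (by omega) (by simp) (by simp)
  have hq := above_range_odd N (4 * N + 4) x
  have hP := recovering_recover (N := N) (v := v) (t := 4 * N + 4) (J := Finset.range x)
    (x := x) (k := N - 1) (T' := .settled) (won := won) (by omega) (by omega) (by simp) (by omega)
    (by omega) (.inr ⟨rfl, by omega⟩) (.inl le_rfl)
    fun _ => ⟨le_rfl, by omega, fun m hm => Finset.mem_range.2 hm⟩
  rw [hq, ← Finset.range_add_one] at hP
  have F := recovering_last_facts (N := N) (4 * N + 4) x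
  have F' := recovering_last_facts (N := N) (4 * N + 4) (x + 1)
  have hlow : lowPr N .odd x = 2 * (N - 1 - x) + 4 := rfl
  have hpar : ofPriority (lowPr N .odd x) = .even := ofPriority_lowPr .odd x
  have key := ha.promotes (f' := 1) (A' := remaining N (x + 1)) (Y' := remainingMemo N (x + 1))
    hrun hA (by omega) hP (.inl (recovering_pos (by omega) (by omega) (by omega)))
    (fun d hd => ?_) (fun _ _ _ hd => hd.elim) (fun d hd => hd.elim) (fun _ _ => trivial)
    (fun _ d hd => ?_)
  · refine ⟨m + 1, by omega, ?_, key.2.1⟩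
    rw [states_of_nil hnm hm, key.1,
      bits_remaining (by omega) hE hO ha]
  · obtain ⟨hv, rfl⟩ := hd
    -- the strategy to choose the distraction, which now leads to the higher region
    have hreg : (remaining N x).reg (.a .odd ⟨x + 1, hx⟩ ⟨x, by simp⟩ : TCVertex N) =
        lowPr N .odd x := by
      obtain ⟨-, -, -, -, -, -, -, h₁⟩ := F (x + 1) hx (x + 1)
      obtain ⟨-, -, -, -, h₂, -⟩ := F x (by omega) 0
      show comb .even ((remaining N x).c .odd (x + 1) (x + 1)) ((remaining N x).l .odd x) = _
      simp only [remaining, h₁, h₂, lt_irrefl, if_false, show ¬ x + 1 < x by omega,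
        show x + 1 ≠ x by omega, comb, hpar, if_true, max_self]
    have hreg' : (remaining N (x + 1)).reg (.a .odd ⟨x + 1, hx⟩ ⟨x, by simp⟩ : TCVertex N) = 1 := by
      obtain ⟨-, -, -, -, -, -, -, h₁⟩ := F' (x + 1) hx (x + 1)
      obtain ⟨-, -, -, -, h₂, -⟩ := F' x (by omega) 0
      show comb .even ((remaining N (x + 1)).c .odd (x + 1) (x + 1))
        ((remaining N (x + 1)).l .odd x) = _
      simp only [remaining, h₁, h₂, lt_irrefl, if_false, show x < x + 1 by omega, if_true,
        comb_even]
      split_ifs <;> omega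
    refine ⟨by omega, hv, .a .odd ⟨x + 1, hx⟩ ⟨x, by simp⟩, by omega, by omega, hreg, ?_, by omega,
      .l .odd ⟨x, by omega⟩, ha.strat_a_odd hv rfl rfl, ?_⟩
    · rw [hpar]
      rfl
    · obtain ⟨-, -, -, -, h₂, -⟩ := F' x (by omega) 0
      rw [if_pos (by omega)] at h₂
      show _ < (remaining N (x + 1)).l .odd x
      simp only [remaining, h₂]
      omega
  · obtain ⟨h₁, rfl⟩ := hd
    have hlow' : lowPr N .odd (x + 1) = 2 * (N - 1 - (x + 1)) + 4 := rfl
    refine ⟨by omega, by omega, fun u hu he => ?_⟩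
    rcases reg_eq_label (remaining N x) u with ⟨α, y, hy, h₂⟩ | ⟨α, y, -, h₂, -⟩
    · have f := F y hy 0
      rw [he] at h₂
      cases α <;> simp only [remaining, f] at h₂
      · omega
      · split_ifs at h₂ <;> omega
    · have := le_highPr (N := N) α y
      omega

/-- When Odd has set its last bit, it wins everything that remains. -/
theorem Ready.remaining_solve (hrun : IsRun (twoCounters N) v keep cs b) (hN : 1 ≤ N)
    (hE : ∀ y, TCVertex.l .even y ∈ won .even) (hO : won .odd = ∅)
    (h : Ready v cs n (remaining N (N - 1)) won (remainingMemo N (N - 1)) 1) :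
    ∃ m ≥ n, states cs b n m = [Finset.univ.filter fun y => y.1 = .even ∨ (y.2 : ℕ) < N - 1] ∧
      (cs m).alive = ∅ ∧ bits (cs m) = Finset.univ := by
  obtain ⟨m, hnm, hm, ha⟩ := remaining_arrives hrun (by omega) h
  have hA : (remaining N (N - 1)).Valid N :=
    valid_recovering (by omega) (by omega) (by simp) (by omega) (by omega) (by simp) (by simp)
  have hA' : (solved N).Valid N := valid_counting (by omega) (by omega) _
  have hP := recovering_complete (N := N) (v := v) (t := 4 * N + 4) (J := Finset.range (N - 1))
    (k := N - 1) (won := won) (by omega) (by omega) (by simp) (by omega) (.inl le_rfl)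
  rw [above_range_odd, ← Finset.range_add_one, show N - 1 + 1 = N by omega] at hP
  have hP' : IsPromotion (twoCounters N) v ((remaining N (N - 1)).layout N won)
      ((solved N).layout N won) 1 (4 * N + 3) fun _ => False := by
    refine IsPromotion.of_lt hP fun u _ hb => ?_
    have h₁ : (remaining N (N - 1)).reg u = lowPr N .odd (N - 1) := hb.2
    have h₂ : lowPr N .odd (N - 1) = 4 := by simp only [lowPr]; omega
    show (remaining N (N - 1)).reg u < (solved N).reg u
    by_cases h₃ : (solved N).reg u < 4 * N + 4
    · have := solved_reg u h₃
      omega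
    · omega
  obtain ⟨hs, -, hF, hp⟩ := ha.promotes (f' := 1) (A' := solved N)
    (Y' := ⟨fun _ _ => False, fun _ => False, fun _ => False, fun _ => True⟩) hrun hA (by omega) hP'
    (.inl (recovering_pos (by omega) (by omega) (by omega)))
    (fun d hd => hd.elim) (fun _ _ _ hd => hd.elim) (fun d hd => hd.elim) (fun _ _ => trivial)
    (fun _ d hd => hd.elim)
  obtain ⟨σ, hσ, hstep⟩ := hrun.2 (m + 1)
  have hD := solved_isDominion (won := won) hN
  rw [← hp] at hD
  rw [hF.step_dominion (hA'.isDecomposition won) (fun h => h) hD] at hstep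
  obtain ⟨hc, hb⟩ := Prod.mk.inj hstep
  set X := (solved N).layout N won with hX
  have hreg : ∀ u ∈ X.alive, X.reg u = (cs (m + 1)).p := fun u hu => by
    rw [hp]
    exact solved_reg u (mem_alive.1 hu)
  have hpar : ofPriority (cs (m + 1)).p = .odd := by rw [hp, ofPriority_eq_odd]; omega
  have halive : (cs (m + 1 + 1)).alive = X.alive \ X.region (cs (m + 1)).p := by
    rw [← hc, ← hF.alive]
    simp [Config.removeDominion, Config.recorded, Config.assign]
  have hwon : ∀ α, (cs (m + 1 + 1)).won α =
      if α = .odd then won α ∪ X.region (cs (m + 1)).p else won α := by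
    intro α
    rw [← hc, show won = X.won from rfl, ← hF.won, ← hpar]
    simp [Config.removeDominion, Config.recorded, Config.assign, Config.player]
  refine ⟨m + 1 + 1, by omega, ?_, ?_, ?_⟩
  · rw [← states_append (by omega : n ≤ m) (by omega : m ≤ m + 1 + 1),
      ← states_append (by omega : m ≤ m + 1) (by omega : m + 1 ≤ m + 1 + 1), hm, hs,
      states_eq_nil (n := m + 1) fun i h₁ h₂ => by
        obtain rfl : i = m + 1 := by omega
        exact hb.symm, bits_remaining (by omega) hE hO ha]
    rfl
  · rw [halive, Finset.sdiff_eq_empty_iff_subset]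
    exact fun u hu => Layout.mem_region.2 ⟨hu, hreg u hu⟩
  · rw [Finset.eq_univ_iff_forall]
    rintro ⟨α, y⟩
    refine mem_bits.2 (.inl ?_)
    rw [hwon]
    cases α
    · simpa using hE y
    · rw [if_pos rfl]
      have hu : TCVertex.l .odd y ∈ X.alive := by
        rw [mem_alive]
        show (solved N).l .odd y < _
        rw [(solved_facts .odd y.isLt 0).1]
        simp
      exact Finset.mem_union_right _ (Layout.mem_region.2 ⟨hu, hreg _ hu⟩)

/-- From the removal of the dominion of Even to the end of the run. -/
theorem Ready.remaining_run (hrun : IsRun (twoCounters N) v keep cs b) (hx : x < N)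
    (hE : ∀ y, TCVertex.l .even y ∈ won .even) (hO : won .odd = ∅)
    (h : Ready v cs n (remaining N x) won (remainingMemo N x) 1) :
    ∃ m ≥ n, (cs m).alive = ∅ ∧ bits (cs m) = Finset.univ ∧ ∃ L,
      states cs b n m = L ++ [oddState N (Finset.range (N - 1)) (N - 1)] ∧
      (∀ S ∈ L, S ⊆ oddState N (Finset.range (N - 1)) (N - 1) ∧
        (.even, ⟨N - 1, by omega⟩) ∈ S) ∧ (x = N - 1 → L = []) := by
  have hodd : oddState N (Finset.range (N - 1)) (N - 1) =
      Finset.univ.filter fun y => y.1 = .even ∨ (y.2 : ℕ) < N - 1 := by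
    ext ⟨α, y⟩
    have := y.isLt
    simp only [oddState, Finset.mem_filter, Finset.mem_univ, true_and, Finset.mem_range]
    constructor
    · rintro (h | h)
      · exact .inr h.1
      · exact .inl h.1
    · rintro (h | h)
      · rcases lt_or_ge (y : ℕ) (N - 1) with h' | h'
        · exact .inl ⟨h', h'⟩
        · exact .inr ⟨h, h'⟩
      · exact .inl ⟨h, h⟩
  rw [hodd]
  induction hd : N - 1 - x generalizing x n with
  | zero =>
    obtain rfl : x = N - 1 := by omega
    obtain ⟨m, hnm, hm, h₁, h₂⟩ := h.remaining_solve hrun (by omega) hE hO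
    exact ⟨m, hnm, h₁, h₂, [], hm, by simp, fun _ => rfl⟩
  | succ d ih =>
    obtain ⟨m, hnm, hm, h₁⟩ := h.remaining_step hrun (by omega) hE hO
    obtain ⟨m', hm', h₂, h₃, L, h₄, h₅, -⟩ := ih (by omega) h₁ (by omega)
    refine ⟨m', by omega, h₂, h₃,
      (Finset.univ.filter fun y => y.1 = .even ∨ (y.2 : ℕ) < x) :: L, ?_, ?_, by omega⟩
    · rw [← states_append hnm hm', hm, h₄]
      rfl
    · intro S hS
      rcases List.mem_cons.1 hS with rfl | hS
      · refine ⟨fun y hy => ?_, by simp⟩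
        simp only [Finset.mem_filter, Finset.mem_univ, true_and] at hy ⊢
        exact hy.imp_right fun h => by omega
      · exact h₅ S hS

end Steps

/-! ### Binary counting -/

section Binary

variable {N j k i m : ℕ}

/-- The bits that are set in the binary representation of `j`, bit `0` being the highest. -/
def binaryBits (N j : ℕ) : Finset ℕ := (Finset.range N).filter fun y => j.testBit (N - 1 - y)

theorem mem_binaryBits {y : ℕ} : y ∈ binaryBits N j ↔ y < N ∧ j.testBit (N - 1 - y) = true := by
  simp [binaryBits]

theorem binaryBits_zero (N : ℕ) : binaryBits N 0 = ∅ := by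
  simp [binaryBits]

theorem binaryBits_pred_last (hN : 1 ≤ N) : binaryBits N (2 ^ N - 2) = Finset.range (N - 1) := by
  obtain ⟨N, rfl⟩ := Nat.exists_eq_add_of_le' hN
  have h : 2 ^ (N + 1) - 2 = 2 * (2 ^ N - 1) := by
    rw [pow_succ]
    omega
  ext y
  rw [mem_binaryBits, h, Finset.mem_range]
  constructor
  · rintro ⟨h₁, h₂⟩
    by_contra hy
    have : N + 1 - 1 - y = 0 := by omega
    rw [this] at h₂
    simp at h₂
  · intro hy
    refine ⟨by omega, ?_⟩
    obtain ⟨m, hm⟩ : ∃ m, N + 1 - 1 - y = m + 1 := ⟨N - 1 - y, by omega⟩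
    rw [hm, Nat.testBit_succ, Nat.mul_div_cancel_left _ (by omega), Nat.testBit_two_pow_sub_one]
    simp only [decide_eq_true_eq]
    omega

/-- Adding one sets the lowest bit that is not set and clears the bits below it. -/
theorem testBit_add_one (h : j + 1 < 2 ^ N) : ∃ i < N, j.testBit i = false ∧
    (∀ m < i, j.testBit m = true) ∧ (j + 1).testBit i = true ∧
    (∀ m < i, (j + 1).testBit m = false) ∧ ∀ m, i < m → (j + 1).testBit m = j.testBit m := by
  induction N generalizing j with
  | zero => simp at h
  | succ N ih =>
    rcases Nat.even_or_odd' j with ⟨a, rfl | rfl⟩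
    · refine ⟨0, by omega, by simp, by omega, by simp, by omega, fun m hm => ?_⟩
      obtain ⟨m, rfl⟩ := Nat.exists_eq_add_of_le' (show 1 ≤ m from hm)
      rw [Nat.testBit_succ, Nat.testBit_succ]
      congr 1
      omega
    · have hd : (2 * a + 1) / 2 = a := by omega
      have hd' : (2 * a + 1 + 1) / 2 = a + 1 := by omega
      rw [pow_succ] at h
      obtain ⟨i, hi, h₁, h₂, h₃, h₄, h₅⟩ := ih (j := a) (by omega)
      refine ⟨i + 1, by omega, ?_, fun m hm => ?_, ?_, fun m hm => ?_, fun m hm => ?_⟩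
      · rw [Nat.testBit_succ, hd, h₁]
      · cases m with
        | zero => simp
        | succ m => rw [Nat.testBit_succ, hd, h₂ m (by omega)]
      · rw [Nat.testBit_succ, hd', h₃]
      · cases m with
        | zero => simp only [Nat.testBit_zero]; simp; omega
        | succ m => rw [Nat.testBit_succ, hd', h₄ m (by omega)]
      · obtain ⟨m, rfl⟩ := Nat.exists_eq_add_of_le' (show 1 ≤ m by omega)
        rw [Nat.testBit_succ, Nat.testBit_succ, hd, hd', h₅ m (by omega)]

theorem binaryBits_add_one (h : j + 1 < 2 ^ N) : ∃ k < N, k ∉ binaryBits N j ∧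
    (∀ m, k < m → m < N → m ∈ binaryBits N j) ∧
    binaryBits N (j + 1) = insert k ((binaryBits N j).filter (· < k)) := by
  obtain ⟨i, hi, h₁, h₂, h₃, h₄, h₅⟩ := testBit_add_one h
  refine ⟨N - 1 - i, by omega, ?_, fun m hm hmN => ?_, ?_⟩
  · rw [mem_binaryBits, show N - 1 - (N - 1 - i) = i by omega, h₁]
    simp
  · exact mem_binaryBits.2 ⟨hmN, h₂ _ (by omega)⟩
  · ext y
    rw [Finset.mem_insert, Finset.mem_filter, mem_binaryBits, mem_binaryBits]
    rcases lt_trichotomy y (N - 1 - i) with hy | rfl | hy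
    · rw [h₅ _ (by omega)]
      simp only [hy, and_true, hy.ne, false_or]
    · rw [show N - 1 - (N - 1 - i) = i by omega, h₃]
      simp only [true_or, iff_true, and_true]
      omega
    · by_cases hyN : y < N
      · rw [h₄ _ (by omega)]
        simp only [Bool.false_eq_true, and_false, false_iff]
        omega
      · omega

theorem progression_even (N j : ℕ) : progression N (2 * j) = evenState N (binaryBits N j) := by
  ext y
  simp [progression, evenState, binBit, mem_binaryBits]

theorem progression_odd (hkJ : k ∉ binaryBits N j)
    (hlow : ∀ m, k < m → m < N → m ∈ binaryBits N j)
    (h : binaryBits N (j + 1) = insert k ((binaryBits N j).filter (· < k))) :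
    progression N (2 * j + 1) = oddState N (binaryBits N j) k := by
  ext ⟨α, y⟩
  have hb : ∀ j, binBit N j y = true ↔ (y : ℕ) ∈ binaryBits N j := fun j => by
    simp [binBit, mem_binaryBits]
  have h₁ : (2 * j + 1) % 2 = 1 := by omega
  have h₂ : (2 * j + 1) / 2 = j := by omega
  have h₃ := hlow y
  have hy := y.isLt
  simp only [progression, oddState, Finset.mem_filter, Finset.mem_univ, true_and, h₁, h₂, hb, h,
    Finset.mem_insert, one_ne_zero, if_false]
  cases α <;> simp only [if_true, reduceCtorEq, if_false] <;> grind

theorem oddState_sdiff {J : Finset ℕ} (hk : k < N) (hlow : ∀ m, k < m → m < N → m ∈ J) :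
    oddState N J k \ evenState N J ⊆ {(Player.even, ⟨k, hk⟩)} := by
  rintro ⟨α, y⟩ hy
  have hyN := y.isLt
  have := hlow y
  simp only [oddState, evenState, Finset.mem_sdiff, Finset.mem_filter, Finset.mem_univ,
    true_and] at hy
  simp only [Finset.mem_singleton, Prod.mk.injEq, Fin.ext_iff]
  grind

theorem evenState_sdiff {J : Finset ℕ} (hk : k < N) :
    evenState N (insert k (J.filter (· < k))) \ oddState N J k ⊆ {(Player.odd, ⟨k, hk⟩)} := by
  rintro ⟨α, y⟩ hy
  simp only [oddState, evenState, Finset.mem_sdiff, Finset.mem_filter, Finset.mem_univ,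
    true_and, Finset.mem_insert] at hy
  simp only [Finset.mem_singleton, Prod.mk.injEq, Fin.ext_iff]
  cases α <;> grind

theorem progression_last (N : ℕ) :
    progression N (progressionLength N) = Finset.univ := by
  rw [progressionLength, progression_even, Finset.eq_univ_iff_forall]
  intro y
  have := y.2.isLt
  simp only [evenState, Finset.mem_filter, Finset.mem_univ, true_and, mem_binaryBits,
    Nat.testBit_two_pow_sub_one, decide_eq_true_eq]
  omega

/-! ### Traces that follow the progression -/

/-- The trace `L` splits into blocks that follow the first `m` states of the progression, where the
blocks with `strict` consist of one state only. -/
def Splits (N : ℕ) (strict : ℕ → Prop) (m : ℕ) (L : List (Finset (Player × Fin N))) : Prop :=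
  ∃ B : ℕ → List (Finset (Player × Fin N)), L = (List.range m).flatMap B ∧
    ∀ i < m, (B i).getLast? = some (progression N i) ∧
      (∀ S ∈ B i, S ⊆ progression N i ∧ progression N i \ progression N (i - 1) ⊆ S) ∧
      (strict i → B i = [progression N i])

variable {strict : ℕ → Prop} {L L' : List (Finset (Player × Fin N))}

theorem Splits.append (h : Splits N strict m L)
    (hL : ∀ S ∈ L', S ⊆ progression N m ∧ progression N m \ progression N (m - 1) ⊆ S)
    (hs : strict m → L' = []) : Splits N strict (m + 1) (L ++ (L' ++ [progression N m])) := by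
  obtain ⟨B, rfl, hB⟩ := h
  refine ⟨Function.update B m (L' ++ [progression N m]), ?_, fun i hi => ?_⟩
  · rw [List.range_succ, List.flatMap_append, List.flatMap_singleton, Function.update_self]
    congr 1
    refine List.flatMap_congr fun i hi => ?_
    rw [Function.update_of_ne (List.mem_range.1 hi).ne]
  · by_cases him : i = m
    · subst him
      rw [Function.update_self]
      refine ⟨by simp, fun S hS => ?_, fun h => by simp [hs h]⟩
      rcases List.mem_append.1 hS with hS | hS
      · exact hL S hS
      · rw [List.mem_singleton.1 hS]
        exact ⟨subset_rfl, Finset.sdiff_subset⟩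
    · rw [Function.update_of_ne him]
      exact hB i (by omega)

theorem Splits.le_length (h : Splits N strict m L) : m ≤ L.length := by
  obtain ⟨B, rfl, hB⟩ := h
  induction m with
  | zero => simp
  | succ m ih =>
    have h₁ := ih fun i hi => hB i (by omega)
    have h₂ : B m ≠ [] := fun h => by
      have := (hB m (by omega)).1
      simp [h] at this
    have h₃ := List.length_pos_iff.2 h₂
    rw [List.range_succ, List.flatMap_append, List.flatMap_singleton, List.length_append]
    omega

theorem Splits.length_eq (h : Splits N strict m L) (hs : ∀ i < m, strict i) : L.length = m := by
  obtain ⟨B, rfl, hB⟩ := h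
  induction m with
  | zero => simp
  | succ m ih =>
    have h₁ := ih (fun i hi => hs i (by omega)) fun i hi => hB i (by omega)
    rw [List.range_succ, List.flatMap_append, List.flatMap_singleton, List.length_append, h₁,
      (hB m (by omega)).2.2 (hs m (by omega))]
    rfl

end Binary

section Traces

open Player Labelling

variable {N j n : ℕ} {v : Variant} {keep : Bool} {cs : ℕ → Config (TCVertex N)} {b : ℕ → Bool}

/-- The run up to the point where both counters show `j`.  The states in `R` belong to the block that
the next promotion completes. -/
theorem exists_ready_counting (hrun : IsRun (twoCounters N) v keep cs b) (hN : 1 ≤ N)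
    (hj : j ≤ 2 ^ N - 2) : ∃ n o L R,
      Ready v cs n (counting N (4 * N + 2) (binaryBits N j)) (fun _ => ∅)
        (countingMemo N (binaryBits N j) o) 2 ∧
      states cs b 0 n = L ++ R ∧ Splits N (fun _ => v.Recovers) (2 * j) L ∧
      (∀ S ∈ R, S ⊆ progression N (2 * j) ∧
        progression N (2 * j) \ progression N (2 * j - 1) ⊆ S) ∧ (v.Recovers → R = []) := by
  induction j with
  | zero =>
    rw [binaryBits_zero]
    exact ⟨0, 0, [], [], Ready.initial hrun hN, by simp [states], ⟨fun _ => [], by simp, by simp⟩,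
      by simp, by simp⟩
  | succ j ih =>
    obtain ⟨n, o, L, R, h, hn, hL, hR, hR'⟩ := ih (by omega)
    have hj₁ : j + 1 < 2 ^ N := by omega
    obtain ⟨k, hk, hkJ, hlow, hJ⟩ := binaryBits_add_one hj₁
    have hi : k + 1 < N ∨ ∃ i < k, i ∉ binaryBits N j := by
      by_contra hi
      push Not at hi
      -- all bits of `j + 1` are set
      have : j + 1 = 2 ^ N - 1 := by
        refine Nat.eq_of_testBit_eq fun i => ?_
        rw [Nat.testBit_two_pow_sub_one]
        by_cases hiN : i < N
        · have h₁ : N - 1 - i ∈ binaryBits N (j + 1) := by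
            rw [hJ, Finset.mem_insert, Finset.mem_filter]
            rcases (show N - 1 - i ≤ k by omega).eq_or_lt with h₁ | h₁
            · exact .inl h₁
            · exact .inr ⟨hi.2 _ h₁, h₁⟩
          have h₂ := (mem_binaryBits.1 h₁).2
          rw [show N - 1 - (N - 1 - i) = i by omega] at h₂
          simp [h₂, hiN]
        · rw [Nat.testBit_eq_false_of_lt (hj₁.trans_le (Nat.pow_le_pow_right (by omega) (by omega)))]
          simp [hiN]
      omega
    obtain ⟨m, hm, L₁, L₂, o', hs, h₁, h₂, h₃, h'⟩ := h.count hrun hk hkJ hlow hi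
    have he := progression_even N j
    have ho := progression_odd hkJ hlow hJ
    have he' := progression_even N (j + 1)
    rw [← hJ] at h' h₂
    rw [← he, ← ho] at hs
    rw [← ho] at h₁
    rw [← he'] at h₂
    have d₁ : progression N (2 * j + 1) \ progression N (2 * j) ⊆ {(Player.even, ⟨k, hk⟩)} := by
      rw [he, ho]
      exact oddState_sdiff hk hlow
    have d₂ : progression N (2 * (j + 1)) \ progression N (2 * j + 1) ⊆
        {(Player.odd, ⟨k, hk⟩)} := by
      rw [he', ho, hJ]
      exact evenState_sdiff hk
    have key := (hL.append hR hR').append (L' := L₁)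
      (fun S hS => ⟨(h₁ S hS).1, d₁.trans (Finset.singleton_subset_iff.2 (h₁ S hS).2)⟩)
      (fun hv => (h₃ hv).1)
    refine ⟨m, o', _, L₂, h', ?_, key, fun S hS => ⟨(h₂ S hS).1, ?_⟩, fun hv => (h₃ hv).2⟩
    · rw [← states_append (Nat.zero_le n) hm, hn, hs]
      simp
    · exact d₂.trans (Finset.singleton_subset_iff.2 (h₂ S hS).2)

/-- Up to `2 ^ N - 2` the counters count as long as both players are there.  The
last two promotions that set a new bit complete the dominions of Even and of Odd. -/
theorem exists_splits (hrun : IsRun (twoCounters N) v keep cs b) (hN : 1 ≤ N) :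
    ∃ T, (cs T).alive = ∅ ∧ Splits N
      (fun i => v.Recovers ∧ (keep = true ∨ i + 1 ≠ progressionLength N))
      (progressionLength N + 1) (counterTrace cs b T) := by
  have hpow : 2 ≤ 2 ^ N := by
    calc 2 = 2 ^ 1 := rfl
      _ ≤ 2 ^ N := Nat.pow_le_pow_right (by omega) hN
  obtain ⟨n, o, L, R, h, hn, ⟨B, hB, hL⟩, hR, hR'⟩ := exists_ready_counting hrun hN le_rfl
  have hM : progressionLength N = 2 * (2 ^ N - 2) + 1 + 1 := by
    rw [progressionLength]
    omega
  have hL' : Splits N (fun i => v.Recovers ∧ (keep = true ∨ i + 1 ≠ progressionLength N))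
      (2 * (2 ^ N - 2)) L :=
    ⟨B, hB, fun i hi => ⟨(hL i hi).1, (hL i hi).2.1, fun h => (hL i hi).2.2 h.1⟩⟩
  rw [binaryBits_pred_last hN] at h
  obtain ⟨x, hx⟩ : ∃ x, (v.Recovers ∧ keep = true) ∧ x = N - 1 ∨
      ¬ (v.Recovers ∧ keep = true) ∧ x = 0 := by
    by_cases hv : v.Recovers ∧ keep = true
    · exact ⟨_, .inl ⟨hv, rfl⟩⟩
    · exact ⟨_, .inr ⟨hv, rfl⟩⟩
  obtain ⟨m, hm, hs, won, hE, hO, h⟩ := h.remove_even hrun hN hx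
  obtain ⟨T, hT, hal, hbits, L₁, hs₁, h₁, h₂⟩ := h.remaining_run hrun (by omega) hE hO
  have he := progression_even N (2 ^ N - 2)
  rw [binaryBits_pred_last hN] at he
  have hlow : ∀ m, N - 1 < m → m < N → m ∈ Finset.range (N - 1) := by omega
  have ho : progression N (2 * (2 ^ N - 2) + 1) = oddState N (Finset.range (N - 1)) (N - 1) := by
    rw [← binaryBits_pred_last hN]
    refine progression_odd (by simp [binaryBits_pred_last hN]) (by omega) ?_
    rw [binaryBits_pred_last hN, Finset.filter_true_of_mem fun y hy => Finset.mem_range.1 hy,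
      ← Finset.range_add_one, show 2 ^ N - 2 + 1 = 2 ^ N - 1 by omega]
    ext y
    simp only [mem_binaryBits, Nat.testBit_two_pow_sub_one, decide_eq_true_eq, Finset.mem_range]
    omega
  have hlast := progression_last N
  rw [hM] at hlast
  have key := ((hL'.append hR fun hv => hR' hv.1).append (L' := L₁)
    (fun S hS => ⟨ho ▸ (h₁ S hS).1, ?_⟩) ?_).append (L' := []) (by simp) (by simp)
  · refine ⟨T, hal, ?_⟩
    rw [hM] at key ⊢
    convert key using 1
    rw [counterTrace_eq, ← states_append (Nat.zero_le n) (hm.trans hT), hn, ← states_append hm hT,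
      hs, hs₁, hbits, he, ho, hlast]
    simp
  · rw [Nat.add_sub_cancel, he, ho]
    exact (oddState_sdiff (by omega) hlow).trans (Finset.singleton_subset_iff.2 (h₁ S hS).2)
  · rintro ⟨hv, hk | hk⟩
    · exact h₂ ((hx.resolve_right fun h => h.1 ⟨hv, hk⟩).2)
    · exact absurd hM.symm hk

end Traces

/-- All variants of priority promotion follow the progression of a binary counter when they solve
the Two Counters games. -/
theorem lemma2 (N : ℕ) (hN : 1 ≤ N) (v : Variant) (keep : Bool) :
    (∃ c b, IsRun (twoCounters N) v keep c b) ∧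
    ∀ (c : ℕ → Config (TCVertex N)) (b : ℕ → Bool), IsRun (twoCounters N) v keep c b →
      ∃ T, (c T).alive = ∅ ∧
        -- the trace splits into blocks, one for each state of the progression
        (∃ B : ℕ → List (Finset (Player × Fin N)),
          counterTrace c b T = (List.range (progressionLength N + 1)).flatMap B ∧
          (∀ i ≤ progressionLength N,
            (B i).getLast? = some (progression N i) ∧
            ∀ S ∈ B i, S ⊆ progression N i ∧ progression N i \ progression N (i - 1) ⊆ S) ∧
          (v.Recovers → ∀ i ≤ progressionLength N,
            keep = true ∨ i + 1 ≠ progressionLength N → B i = [progression N i])) ∧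
        -- exponentially many promotions
        progressionLength N ≤ promotions b T ∧
        (v.Recovers → keep = true → promotions b T = progressionLength N) := by
  refine ⟨exists_isRun _ v keep, fun c b hrun => ?_⟩
  obtain ⟨T, hal, hS⟩ := exists_splits hrun hN
  have hlen : (counterTrace c b T).length = promotions b T + 1 := by
    rw [counterTrace_eq, promotions_eq (cs := c), List.length_append, List.length_singleton]
  refine ⟨T, hal, ?_, ?_, fun hv hk => ?_⟩
  · obtain ⟨B, hB, h⟩ := hS
    exact ⟨B, hB, fun i hi => ⟨(h i (by omega)).1, (h i (by omega)).2.1⟩,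
      fun hv i hi hk => (h i (by omega)).2.2 ⟨hv, hk⟩⟩
  · have := hS.le_length
    omega
  · have := hS.length_eq fun i _ => ⟨hv, .inl hk⟩
    omega
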